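/- Consider the asynchronous push-pull protocol on a finite graph $G$ with node set $[n]$: at time $0$ one fixed node $s$ knows a rumor; every node $v$ has an independent Poisson clock of rate $1$, and whenever it rings, $v$ contacts a uniformly random neighbour. If exactly one of the two nodes knows the rumor, the other one learns it (push or pull). Let $T(G)$ be the time until all nodes are informed. In the variant with success probability $q\in(0,1]$ every contact is dropped, before any information is exchanged, with probability $1-q$, independently of everything else; let $T_q(G)$ be the time until all nodes are informed. $\mathbb E[T(G)]$ denotes the expectation over the protocol with $G$ fixed; so $\mathbb E[T(G_{n,p})]$ is a random variable that depends on the random graph $G_{n,p}$, in which each edge is present independently with probability $p$. Probabilities for $T_q(G_{n,p})$ are over the graph and the protocol; $s$ is chosen before the graph is sampled, and all bounds are uniform in $s$. With high probability (w.h.p.) means with probability $1-o(1)$ as $n\to\infty$. Let $0<q\le 1$. (1) For every connected graph $G$ on $[n]$ and every initially informed node, $T$ and $T_q$ are random variables, $\mathbb E[T(G)]<\infty$ and $$\mathbb E[T_q(G)]=\frac1q\,\mathbb E[T(G)].$$ (2) Let $p=\alpha(n)\ln(n)/n\in[0,1]$ for all large $n$, where $\alpha(n)\to\infty$. Then $$T_q(G_{n,p})=\frac1q\,\mathbb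 E[T(G_{n,p})]+O\big(\alpha(n)^{-1/2}\ln n\big)+O(1),$$ where the first $O$-term has a fixed constant and the term $O(1)$ is bounded in probability: there is a constant $K$ such that for every $\varepsilon>0$ there is a constant $C$ such that for all sufficiently large $n$, with probability at least $1-\varepsilon$, both $T_q(G_{n,p})$ and $\mathbb E[T(G_{n,p})]$ are finite and $$\Big|T_q(G_{n,p})-\frac1q\,\mathbb E[T(G_{n,p})]\Big|\le K\alpha(n)^{-1/2}\ln n+C.$$ In particular, if $\alpha(n)^{-1/2}\ln n\to\infty$, then there is a constant $C$ such that w.h.p. both quantities are finite and this difference is at most $C(\alpha(n)^{-1/2}\ln n+1)$. (3) Let $p=c\ln(n)/n$ for all large $n$, where $c>1$ is a constant. Then there is a constant $C$ such that w.h.p. $T_q(G_{n,p})$ and $\mathbb E[T(G_{n,p})]$ are finite and $$\Big|T_q(G_{n,p})-\frac1q\,\mathbb E[T(G_{n,p})]\Big|\le C\ln^{3/4}n.$$ -/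

import Mathlib

open MeasureTheory ProbabilityTheory Filter Topology
open scoped ENNReal unitInterval

noncomputable section

namespace Rumor

/-- The randomness of the protocol on the node set `Fin n`. For the `k`-th ring of the clock of
node `v`, the entry `ω (v, k)` holds the waiting time since the previous ring of that clock, the node
that `v` contacts, and whether the connection succeeds (`true`) or is dropped (`false`). -/
abbrev Outcome (n : ℕ) : Type := Fin n × ℕ → ℝ × Fin n × Bool

/-- The law of the node contacted by `v`: uniform on the neighbours of `v`. A node without
neighbours contacts itself, which has no effect. -/
def contactLaw {n : ℕ} (G : SimpleGraph (Fin n)) (v : Fin n) : Measure (Fin n) :=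
  open Classical in
  if (G.neighborSet v).Nonempty then uniformOn (G.neighborSet v) else Measure.dirac v

instance {n : ℕ} (G : SimpleGraph (Fin n)) (v : Fin n) :
    IsProbabilityMeasure (contactLaw G v) := by
  unfold contactLaw
  split_ifs with h
  · exact isProbabilityMeasure_uniformOn (Set.toFinite _) h
  · infer_instance

instance isProbabilityMeasure_exp_one : IsProbabilityMeasure (expMeasure 1) :=
  isProbabilityMeasure_expMeasure one_pos

/-- The law of the protocol on `G` with success probability `q`: all waiting times, contacted nodes
and success indicators are independent; the waiting times are exponential with rate `1`, so that
the clocks of the nodes are independent Poisson processes of rate `1`. -/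
def law {n : ℕ} (q : I) (G : SimpleGraph (Fin n)) : Measure (Outcome n) :=
  Measure.infinitePi fun i : Fin n × ℕ =>
    (expMeasure 1).prod ((contactLaw G i.1).prod (bernoulliMeasure true false q))

instance {n : ℕ} (q : I) (G : SimpleGraph (Fin n)) : IsProbabilityMeasure (law q G) := by
  unfold law
  infer_instance

/-- The time of the `k`-th ring (counted from `0`) of the clock of `v`. -/
def ringTime {n : ℕ} (ω : Outcome n) (v : Fin n) (k : ℕ) : ℝ :=
  ∑ i ∈ Finset.range (k + 1), (ω (v, i)).1

/-- At time `a`, the node `u` successfully contacts the node `w`. -/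
def Contacts {n : ℕ} (ω : Outcome n) (a : ℝ) (u w : Fin n) : Prop :=
  ∃ k, ringTime ω u k = a ∧ (ω (u, k)).2.1 = w ∧ (ω (u, k)).2.2 = true

/-- `Informed s ω v t`: if the node `s` knows the rumor at time `0`, then `v` knows it at time `t`.
A node `w` learns the rumor at time `a` from a node `u` that knew it before, if `u` contacts `w`
(push) or `w` contacts `u` (pull) successfully at time `a`. -/
inductive Informed {n : ℕ} (s : Fin n) (ω : Outcome n) : Fin n → ℝ → Prop
  | source {t : ℝ} (ht : 0 ≤ t) : Informed s ω s t
  | push {u w : Fin n} {r a t : ℝ} (hu : Informed s ω u r) (hr : r < a) (ht : a ≤ t)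
      (h : Contacts ω a u w) : Informed s ω w t
  | pull {u w : Fin n} {r a t : ℝ} (hu : Informed s ω u r) (hr : r < a) (ht : a ≤ t)
      (h : Contacts ω a w u) : Informed s ω w t

/-- The time until all nodes are informed, when `s` is informed at time `0`
(`⊤` if this never happens). -/
def spreadTime {n : ℕ} (s : Fin n) (ω : Outcome n) : ℝ≥0∞ :=
  ⨅ (t : ℝ) (_ : ∀ v, Informed s ω v t), ENNReal.ofReal t

/-- The expected spreading time on the fixed graph `G` with success probability `q`;
`q = 1` is the protocol without failures. -/
def meanTime {n : ℕ} (q : I) (G : SimpleGraph (Fin n)) (s : Fin n) : ℝ≥0∞ :=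
  ∫⁻ ω, spreadTime s ω ∂(law q G)

instance {n : ℕ} : MeasurableSingletonClass (SimpleGraph (Fin n)) where
  measurableSet_singleton G := by
    have h : ({G} : Set (SimpleGraph (Fin n))) = SimpleGraph.edgeSet ⁻¹' {G.edgeSet} := by
      ext H
      simp
    rw [h]
    exact SimpleGraph.measurable_edgeSet (measurableSet_singleton _)

/-- The law of the protocol as a function of the graph. -/
def lawKernel (n : ℕ) (q : I) : Kernel (SimpleGraph (Fin n)) (Outcome n) :=
  Kernel.ofFunOfCountable fun G => law q G

instance (n : ℕ) (q : I) : IsMarkovKernel (lawKernel n q) :=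
  ⟨fun G => inferInstanceAs (IsProbabilityMeasure (law q G))⟩

/-- The joint law of the binomial random graph `G_{n,p}` and of the protocol with success
probability `q` run on it. -/
def jointLaw (n : ℕ) (p q : I) : Measure (SimpleGraph (Fin n) × Outcome n) :=
  (SimpleGraph.binomialRandom (Fin n) p).compProd (lawKernel n q)

/-- `T_q(G)` and `E[T(G)]` are finite and `|T_q(G) - E[T(G)] / q| ≤ b`, where the expectation is
taken over the protocol only, with the graph `G` fixed. -/
def Close {n : ℕ} (q : I) (s : Fin n) (b : ℝ) (G : SimpleGraph (Fin n)) (ω : Outcome n) : Prop :=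
  spreadTime s ω ≠ ⊤ ∧ meanTime 1 G s ≠ ⊤ ∧
    |(spreadTime s ω).toReal - (meanTime 1 G s).toReal / q| ≤ b

/-- The probability that `T_q(G_{n,p})` is not within `b` of `E[T(G_{n,p})] / q`, for the worst
choice, made before the graph is sampled, of the initially informed node. -/
def failProb (n : ℕ) (p q : I) (b : ℝ) : ℝ≥0∞ :=
  ⨆ s : Fin n, jointLaw n p q {x | ¬ Close q s b x.1 x.2}

end Rumor

end

/-! By memorylessness the rings of all clocks together come at rate `n`, and the informed set
observed at these rings is a Markov chain on sets of nodes. Its one-step operator is `chainOp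
(contactWeight q G)`, and `(chainOp (contactWeight q G))^[j] uninformed S` is the probability that
`j` rings, started from `S`, leave somebody uninformed. Decomposing the law of the protocol at its
first ring (`firstRingLaw_eq_law`, `lintegral_spreadFrom`) gives first-step equations for the mean.
It also transfers tails of the number of steps to tails of the spreading time, through Chernoff
bounds for sums of exponential waiting times (`law_lt_spreadFrom_le`, `law_spreadFrom_le_le`,
`law_not_close_le`). After that only the chain matters.

Scaling of the mean: every contact weight carries the factor `q`, so `q` times the mean with
failures solves the same first-step equations as the mean without failures. Induction on the number
of uninformed nodes shows that these equations determine the mean (`mul_meanReal`).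

Dense graphs: a union bound over all sets shows that all cuts, in particular all degrees, are within
a factor `1 ± δ` of their expectations, with `δ` of order `α ^ (-1/2)`. Hence the informed set grows
from `k` to `k + 1` nodes with the probability of the complete graph up to a factor `1 ± O(δ)`,
whatever the set is. Comparison with sums of independent geometric waiting times puts the mean and
the number of steps within relative error `O(δ)` of `growthTime`, which is `O(log n)`. The
fluctuations are `O(1)` because the squares of the mean waiting times are summable
(`law_not_close_le_of_uniformRates`).

Sparse graphs: degrees are no longer concentrated, and the end of the process depends on nodes that
are rarely contacted. The number of steps is located near `n log n / (2 q) + touchTime`, the time of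
exponential growth plus the time after which on average one node has taken part in no contact.

For the upper bound, after a short start the informed nodes of typical degree grow at rate nearly `2
q / n` each, and then all but a tiny fraction of the nodes are informed. This is shown for a slower
chain that ignores a node `w` and does not see its edges. Those edges are therefore independent of
the set left over, and `w` has few uninformed neighbours (`graphExp_leftOut_le`). From then on
nearly every contact of `w` informs it (`GoodGraph.iterate_uninformed_le`).

For the lower bound, a first moment bound (`GoodGraph.sum_iterate_growOp_le`) shows that a little
less than `n log n / (2 q)` steps from a typical start inform only a small share of the nodes that
the remaining contacts will miss, and a second moment bound (`GoodGraph.le_iterate_uninformed`)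
shows that some node is missed. The start `s` is typical because the law of the graph is invariant
under relabelling (`binomialRandom_typical_node`).

With `z = (log n) ^ (1/4)` and relative errors `1 / z`, all errors in time are `O(z ^ 3)`. The mean
lies in the same window, since the tail probabilities `O(1 / z)` are multiplied only by times `O(z ^
4)` (`GoodGraph.law_not_close_le`). -/

noncomputable section

namespace Rumor

variable {n : ℕ}

/-! ### Spreading from a set of informed nodes -/

/-- `InformedFrom S ω v t`: if the nodes of `S` know the rumor at time `0`, then `v` knows it at
time `t`. -/
inductive InformedFrom (S : Finset (Fin n)) (ω : Outcome n) : Fin n → ℝ → Prop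
  | source {v : Fin n} {t : ℝ} (hv : v ∈ S) (ht : 0 ≤ t) : InformedFrom S ω v t
  | push {u w : Fin n} {r a t : ℝ} (hu : InformedFrom S ω u r) (hr : r < a) (ht : a ≤ t)
      (h : Contacts ω a u w) : InformedFrom S ω w t
  | pull {u w : Fin n} {r a t : ℝ} (hu : InformedFrom S ω u r) (hr : r < a) (ht : a ≤ t)
      (h : Contacts ω a w u) : InformedFrom S ω w t

/-- The time until all nodes are informed, when the nodes of `S` are informed at time `0`. -/
def spreadFrom (S : Finset (Fin n)) (ω : Outcome n) : ℝ≥0∞ :=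
  ⨅ (t : ℝ) (_ : ∀ v, InformedFrom S ω v t), ENNReal.ofReal t

theorem informed_iff {s : Fin n} {ω : Outcome n} {v : Fin n} {t : ℝ} :
    Informed s ω v t ↔ InformedFrom {s} ω v t := by
  constructor
  · intro h
    induction h with
    | source ht => exact .source (by simp) ht
    | push _ hr ht hc ih => exact .push ih hr ht hc
    | pull _ hr ht hc ih => exact .pull ih hr ht hc
  · intro h
    induction h with
    | source hv ht =>
      obtain rfl := Finset.mem_singleton.1 hv
      exact .source ht
    | push _ hr ht hc ih => exact .push ih hr ht hc
    | pull _ hr ht hc ih => exact .pull ih hr ht hc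

theorem spreadTime_eq_spreadFrom (s : Fin n) : spreadTime s = spreadFrom {s} := by
  funext ω
  simp only [spreadTime, spreadFrom, informed_iff]

theorem InformedFrom.mono {S : Finset (Fin n)} {ω : Outcome n} {v : Fin n} {t t' : ℝ}
    (h : InformedFrom S ω v t) (htt : t ≤ t') : InformedFrom S ω v t' := by
  cases h with
  | source hv ht => exact .source hv (ht.trans htt)
  | push hu hr ht hc => exact .push hu hr (ht.trans htt) hc
  | pull hu hr ht hc => exact .pull hu hr (ht.trans htt) hc

theorem InformedFrom.nonneg {S : Finset (Fin n)} {ω : Outcome n} {v : Fin n} {t : ℝ}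
    (h : InformedFrom S ω v t) : 0 ≤ t := by
  induction h with
  | source hv ht => exact ht
  | push _ hr ht _ ih => linarith
  | pull _ hr ht _ ih => linarith

/-! ### Measurability of the spreading time -/

/-- `InformedIn S ω m v t`: node `v` is informed by time `t` through at most `m` contacts. -/
def InformedIn (S : Finset (Fin n)) (ω : Outcome n) : ℕ → Fin n → ℝ → Prop
  | 0, v, t => v ∈ S ∧ 0 ≤ t
  | m + 1, w, t => (w ∈ S ∧ 0 ≤ t) ∨
      (∃ (u : Fin n) (k : ℕ) (r : ℚ), InformedIn S ω m u r ∧ (r : ℝ) < ringTime ω u k ∧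
        ringTime ω u k ≤ t ∧ (ω (u, k)).2.1 = w ∧ (ω (u, k)).2.2 = true) ∨
      ∃ (u : Fin n) (k : ℕ) (r : ℚ), InformedIn S ω m u r ∧ (r : ℝ) < ringTime ω w k ∧
        ringTime ω w k ≤ t ∧ (ω (w, k)).2.1 = u ∧ (ω (w, k)).2.2 = true

theorem InformedIn.informedFrom {S : Finset (Fin n)} {ω : Outcome n} {m : ℕ} {v : Fin n} {t : ℝ}
    (h : InformedIn S ω m v t) : InformedFrom S ω v t := by
  induction m generalizing v t with
  | zero => exact .source h.1 h.2
  | succ m ih =>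
    rcases h with h | ⟨u, k, r, hu, hr, ht, hw, hb⟩ | ⟨u, k, r, hu, hr, ht, hw, hb⟩
    · exact .source h.1 h.2
    · exact .push (ih hu) hr ht ⟨k, rfl, hw, hb⟩
    · exact .pull (ih hu) hr ht ⟨k, rfl, hw, hb⟩

theorem InformedIn.mono {S : Finset (Fin n)} {ω : Outcome n} {m : ℕ} {v : Fin n} {t t' : ℝ}
    (h : InformedIn S ω m v t) (htt : t ≤ t') : InformedIn S ω m v t' := by
  cases m with
  | zero => exact ⟨h.1, h.2.trans htt⟩
  | succ m =>
    rcases h with h | ⟨u, k, r, hu, hr, ht, hw, hb⟩ | ⟨u, k, r, hu, hr, ht, hw, hb⟩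
    · exact .inl ⟨h.1, h.2.trans htt⟩
    · exact .inr (.inl ⟨u, k, r, hu, hr, ht.trans htt, hw, hb⟩)
    · exact .inr (.inr ⟨u, k, r, hu, hr, ht.trans htt, hw, hb⟩)

/-- A rational time fits between the moment at which a node is informed and its later contact. This
turns the inductive definition into a countable recursion, which is what makes the events
measurable. -/
theorem informedFrom_iff_exists {S : Finset (Fin n)} {ω : Outcome n} {v : Fin n} {t : ℝ} :
    InformedFrom S ω v t ↔ ∃ m, InformedIn S ω m v t := by
  constructor
  · intro h
    induction h with
    | source hv ht => exact ⟨0, hv, ht⟩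
    | @push u w r a t _ hr ht hc ih =>
      obtain ⟨m, hm⟩ := ih
      obtain ⟨k, rfl, hw, hb⟩ := hc
      obtain ⟨r', h1, h2⟩ := exists_rat_btwn hr
      exact ⟨m + 1, .inr (.inl ⟨u, k, r', hm.mono h1.le, h2, ht, hw, hb⟩)⟩
    | @pull u w r a t _ hr ht hc ih =>
      obtain ⟨m, hm⟩ := ih
      obtain ⟨k, rfl, hw, hb⟩ := hc
      obtain ⟨r', h1, h2⟩ := exists_rat_btwn hr
      exact ⟨m + 1, .inr (.inr ⟨u, k, r', hm.mono h1.le, h2, ht, hw, hb⟩)⟩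
  · rintro ⟨m, hm⟩
    exact hm.informedFrom

theorem measurable_ringTime (u : Fin n) (k : ℕ) :
    Measurable fun ω : Outcome n => ringTime ω u k := by
  unfold ringTime
  fun_prop

theorem measurableSet_informedIn (S : Finset (Fin n)) (m : ℕ) (v : Fin n) (t : ℝ) :
    MeasurableSet {ω : Outcome n | InformedIn S ω m v t} := by
  induction m generalizing v t with
  | zero => exact MeasurableSet.const _
  | succ m ih =>
    have hc : ∀ (x y z : Fin n) (k : ℕ) (r : ℚ), MeasurableSet {ω : Outcome n |
        InformedIn S ω m z r ∧ (r : ℝ) < ringTime ω x k ∧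
        ringTime ω x k ≤ t ∧ (ω (x, k)).2.1 = y ∧ (ω (x, k)).2.2 = true} := by
      intro x y z k r
      have h1 : Measurable fun ω : Outcome n => (ω (x, k)).2.1 := by fun_prop
      have h2 : Measurable fun ω : Outcome n => (ω (x, k)).2.2 := by fun_prop
      exact (ih z r).inter ((measurableSet_lt measurable_const (measurable_ringTime x k)).inter
        ((measurableSet_le (measurable_ringTime x k) measurable_const).inter
        ((h1 (measurableSet_singleton y)).inter (h2 (measurableSet_singleton true)))))
    have h : {ω : Outcome n | InformedIn S ω (m + 1) v t} =
        {ω : Outcome n | v ∈ S ∧ 0 ≤ t} ∪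
        ((⋃ (u : Fin n) (k : ℕ) (r : ℚ), {ω : Outcome n |
          InformedIn S ω m u r ∧ (r : ℝ) < ringTime ω u k ∧
          ringTime ω u k ≤ t ∧ (ω (u, k)).2.1 = v ∧ (ω (u, k)).2.2 = true}) ∪
        ⋃ (u : Fin n) (k : ℕ) (r : ℚ), {ω : Outcome n |
          InformedIn S ω m u r ∧ (r : ℝ) < ringTime ω v k ∧
          ringTime ω v k ≤ t ∧ (ω (v, k)).2.1 = u ∧ (ω (v, k)).2.2 = true}) := by
      ext ω
      simp only [InformedIn, Set.mem_ofPred_eq, Set.mem_union, Set.mem_iUnion]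
    rw [h]
    refine (MeasurableSet.const _).union (.union ?_ ?_)
    · exact .iUnion fun u => .iUnion fun k => .iUnion fun r => hc u v u k r
    · exact .iUnion fun u => .iUnion fun k => .iUnion fun r => hc v u u k r

theorem measurableSet_forall_informedFrom (S : Finset (Fin n)) (t : ℝ) :
    MeasurableSet {ω : Outcome n | ∀ v, InformedFrom S ω v t} := by
  simp only [informedFrom_iff_exists, Set.ofPred_forall, Set.ofPred_exists]
  exact .iInter fun v => .iUnion fun m => measurableSet_informedIn S m v t

theorem measurable_spreadFrom (S : Finset (Fin n)) : Measurable (spreadFrom S) := by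
  refine measurable_of_Iio fun x => ?_
  have h : spreadFrom S ⁻¹' Set.Iio x = ⋃ (t : ℚ) (_ : ENNReal.ofReal t < x),
      {ω : Outcome n | ∀ v, InformedFrom S ω v t} := by
    ext ω
    simp only [spreadFrom, Set.mem_preimage, Set.mem_Iio, iInf_lt_iff, Set.mem_iUnion,
      Set.mem_ofPred_eq, exists_prop]
    constructor
    · rintro ⟨t, ht, hx⟩
      -- The strict inequality leaves room to the right of `t`, and being informed persists, so a
      -- rational time slightly larger than `t` serves as well.
      have : ∀ᶠ y in 𝓝[>] t, ENNReal.ofReal y < x :=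
        (ENNReal.continuous_ofReal.continuousAt.tendsto.mono_left nhdsWithin_le_nhds).eventually
          (gt_mem_nhds hx)
      obtain ⟨y, hy, hty⟩ := (this.and self_mem_nhdsWithin).exists
      obtain ⟨r, h1, h2⟩ := exists_rat_btwn (show t < y from hty)
      exact ⟨r, (ENNReal.ofReal_le_ofReal h2.le).trans_lt hy, fun v => (ht v).mono h1.le⟩
    · rintro ⟨t, hx, ht⟩
      exact ⟨t, ht, hx⟩
  rw [h]
  exact .iUnion fun t => .iUnion fun _ => measurableSet_forall_informedFrom S t

/-! ### The first ring -/

/-- The set of informed nodes after a successful contact between the two given nodes. -/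
def stepSet {V : Type*} [DecidableEq V] (S : Finset V) (e : V × V) : Finset V :=
  if e.1 ∈ S ∨ e.2 ∈ S then insert e.1 (insert e.2 S) else S

theorem subset_stepSet {V : Type*} [DecidableEq V] (S : Finset V) (e : V × V) :
    S ⊆ stepSet S e := by
  unfold stepSet
  split_ifs
  · intro x hx
    simp [hx]
  · rfl

/-- The set of informed nodes after a contact that succeeds if the indicator is `true`. -/
def stepMark (S : Finset (Fin n)) (v w : Fin n) (b : Bool) : Finset (Fin n) :=
  if b then stepSet S (v, w) else S

/-- The outcome in which `v` is the first node whose clock rings, with the entry `x`, and in which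
the protocol continues as in `ω`. -/
def prepend (v : Fin n) (x : ℝ × Fin n × Bool) (ω : Outcome n) : Outcome n := fun i =>
  if i.1 = v then (if i.2 = 0 then x else ω (i.1, i.2 - 1))
  else if i.2 = 0 then ((ω i).1 + x.1, (ω i).2) else ω i

theorem measurable_prepend (v : Fin n) :
    Measurable fun y : (ℝ × Fin n × Bool) × Outcome n => prepend v y.1 y.2 := by
  refine measurable_pi_lambda _ fun i => ?_
  unfold prepend
  split_ifs <;> fun_prop

theorem ringTime_prepend_self_zero (v : Fin n) (x : ℝ × Fin n × Bool) (ω : Outcome n) :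
    ringTime (prepend v x ω) v 0 = x.1 := by
  simp [ringTime, prepend]

theorem ringTime_prepend_self_succ (v : Fin n) (x : ℝ × Fin n × Bool) (ω : Outcome n) (k : ℕ) :
    ringTime (prepend v x ω) v (k + 1) = x.1 + ringTime ω v k := by
  unfold ringTime
  rw [Finset.sum_range_succ']
  simp [prepend, add_comm]

/-- Only the first waiting time of this clock is lengthened, but it is a summand of every ring time,
so the whole clock is delayed by `x.1`. -/
theorem ringTime_prepend_of_ne {u v : Fin n} (h : u ≠ v) (x : ℝ × Fin n × Bool) (ω : Outcome n)
    (k : ℕ) : ringTime (prepend v x ω) u k = x.1 + ringTime ω u k := by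
  unfold ringTime
  rw [Finset.sum_range_succ', Finset.sum_range_succ' _ k]
  simp [prepend, h]
  ring

/-- All waiting times are positive. -/
def PosWaits (ω : Outcome n) : Prop := ∀ i, 0 < (ω i).1

theorem PosWaits.ringTime_pos {ω : Outcome n} (h : PosWaits ω) (u : Fin n) (k : ℕ) :
    0 < ringTime ω u k :=
  Finset.sum_pos (fun _ _ => h _) (by simp)

theorem contacts_prepend {v : Fin n} {x : ℝ × Fin n × Bool} {ω : Outcome n} {a : ℝ}
    {u w : Fin n} : Contacts (prepend v x ω) a u w ↔
      (u = v ∧ a = x.1 ∧ x.2.1 = w ∧ x.2.2 = true) ∨ Contacts ω (a - x.1) u w := by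
  unfold Contacts
  constructor
  · rintro ⟨k, hk, hw, hb⟩
    by_cases huv : u = v
    · subst huv
      cases k with
      | zero =>
        rw [ringTime_prepend_self_zero] at hk
        left
        simp only [prepend, if_true] at hw hb
        exact ⟨rfl, hk.symm, hw, hb⟩
      | succ k =>
        rw [ringTime_prepend_self_succ] at hk
        right
        simp only [prepend, if_true, Nat.succ_ne_zero, if_false, Nat.add_sub_cancel] at hw hb
        exact ⟨k, by linarith, hw, hb⟩
    · rw [ringTime_prepend_of_ne huv] at hk
      right
      refine ⟨k, by linarith, ?_, ?_⟩
      · simp only [prepend, huv, if_false] at hw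
        split_ifs at hw <;> exact hw
      · simp only [prepend, huv, if_false] at hb
        split_ifs at hb <;> exact hb
  · rintro (⟨rfl, rfl, hw, hb⟩ | ⟨k, hk, hw, hb⟩)
    · exact ⟨0, ringTime_prepend_self_zero _ _ _, by simpa [prepend] using hw,
        by simpa [prepend] using hb⟩
    · by_cases huv : u = v
      · subst huv
        refine ⟨k + 1, ?_, by simpa [prepend] using hw, by simpa [prepend] using hb⟩
        rw [ringTime_prepend_self_succ]
        linarith
      · refine ⟨k, ?_, ?_, ?_⟩
        · rw [ringTime_prepend_of_ne huv]
          linarith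
        · simp only [prepend, huv, if_false]
          split_ifs <;> exact hw
        · simp only [prepend, huv, if_false]
          split_ifs <;> exact hb

theorem mem_stepMark_of_left {S : Finset (Fin n)} {v w : Fin n} (h : v ∈ S ∨ w ∈ S) :
    v ∈ stepMark S v w true ∧ w ∈ stepMark S v w true := by
  simp [stepMark, stepSet, h]

theorem subset_stepMark (S : Finset (Fin n)) (v w : Fin n) (b : Bool) :
    S ⊆ stepMark S v w b := by
  cases b
  · exact subset_rfl
  · exact subset_stepSet S (v, w)

/-- Positive waiting times put every other contact strictly after `x.1`. So nothing is learned
before the first ring, and at that ring only the contact between `v` and `x.2.1` can pass the rumor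
on. -/
theorem informedFrom_of_prepend {S : Finset (Fin n)} {v : Fin n} {x : ℝ × Fin n × Bool}
    {ω : Outcome n} (hω : PosWaits ω) {z : Fin n} {t : ℝ}
    (h : InformedFrom S (prepend v x ω) z t) :
    (t < x.1 → z ∈ S) ∧
      (x.1 ≤ t → InformedFrom (stepMark S v x.2.1 x.2.2) ω z (t - x.1)) := by
  induction h with
  | source hv ht => exact ⟨fun _ => hv, fun h => .source (subset_stepMark _ _ _ _ hv) (by linarith)⟩
  | @push u w r a t hu hr ht hc ih =>
    rcases contacts_prepend.1 hc with ⟨rfl, rfl, rfl, hb⟩ | hc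
    · refine ⟨fun h => absurd h (by linarith), fun h => .source ?_ (by linarith)⟩
      rw [hb]
      exact (mem_stepMark_of_left (.inl (ih.1 hr))).2
    · have ha : x.1 < a := by
        obtain ⟨k, hk, -⟩ := hc
        have := hω.ringTime_pos u k
        linarith
      refine ⟨fun h => absurd h (by linarith), fun h => ?_⟩
      rcases lt_or_ge r x.1 with h1 | h1
      · exact .push (.source (subset_stepMark _ _ _ _ (ih.1 h1)) le_rfl) (by linarith)
          (by linarith) hc
      · exact .push (ih.2 h1) (by linarith) (by linarith) hc
  | @pull u w r a t hu hr ht hc ih =>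
    rcases contacts_prepend.1 hc with ⟨rfl, rfl, rfl, hb⟩ | hc
    · refine ⟨fun h => absurd h (by linarith), fun h => .source ?_ (by linarith)⟩
      rw [hb]
      exact (mem_stepMark_of_left (.inr (ih.1 hr))).1
    · have ha : x.1 < a := by
        obtain ⟨k, hk, -⟩ := hc
        have := hω.ringTime_pos w k
        linarith
      refine ⟨fun h => absurd h (by linarith), fun h => ?_⟩
      rcases lt_or_ge r x.1 with h1 | h1
      · exact .pull (.source (subset_stepMark _ _ _ _ (ih.1 h1)) le_rfl) (by linarith)
          (by linarith) hc
      · exact .pull (ih.2 h1) (by linarith) (by linarith) hc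

theorem informedFrom_prepend {S : Finset (Fin n)} {v : Fin n} {x : ℝ × Fin n × Bool}
    (hx : 0 < x.1) {ω : Outcome n} {z : Fin n} {t : ℝ}
    (h : InformedFrom (stepMark S v x.2.1 x.2.2) ω z t) :
    InformedFrom S (prepend v x ω) z (t + x.1) := by
  induction h with
  | @source z t hv ht =>
    by_cases hz : z ∈ S
    · exact .source hz (by linarith)
    · have hb : x.2.2 = true := by
        by_contra hb
        simp [stepMark, hb, hz] at hv
      simp only [stepMark, hb, if_true, stepSet] at hv
      split_ifs at hv with hvw
      · simp only [Finset.mem_insert, hz, or_false] at hv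
        have hc : Contacts (prepend v x ω) x.1 v x.2.1 :=
          contacts_prepend.2 (.inl ⟨rfl, rfl, rfl, hb⟩)
        rcases hv with rfl | rfl
        · exact .pull (.source (hvw.resolve_left hz) le_rfl) hx (by linarith) hc
        · exact .push (.source (hvw.resolve_right hz) le_rfl) hx (by linarith) hc
      · exact absurd hv hz
  | @push u w r a t hu hr ht hc ih =>
    exact .push ih (a := a + x.1) (by linarith) (by linarith)
      (contacts_prepend.2 (.inr (by simpa using hc)))
  | @pull u w r a t hu hr ht hc ih =>
    exact .pull ih (a := a + x.1) (by linarith) (by linarith)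
      (contacts_prepend.2 (.inr (by simpa using hc)))

/-- An uninformed node has to wait at least for the first ring, after which the process restarts
from the enlarged set. For `S = univ` the left side would be zero. -/
theorem spreadFrom_prepend {S : Finset (Fin n)} (hS : S ≠ Finset.univ) (v : Fin n)
    {x : ℝ × Fin n × Bool} (hx : 0 < x.1) {ω : Outcome n} (hω : PosWaits ω) :
    spreadFrom S (prepend v x ω) =
      ENNReal.ofReal x.1 + spreadFrom (stepMark S v x.2.1 x.2.2) ω := by
  apply le_antisymm
  · rw [spreadFrom.eq_1 (stepMark S v x.2.1 x.2.2), ENNReal.add_iInf]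
    refine le_iInf fun t => ?_
    rcases em (∀ z, InformedFrom (stepMark S v x.2.1 x.2.2) ω z t) with h | h
    · simp only [h, implies_true, iInf_pos]
      obtain ⟨z, -⟩ : ∃ z, z ∉ S := by
        by_contra! h'
        exact hS (Finset.eq_univ_iff_forall.2 h')
      refine (iInf₂_le (t + x.1) fun z => informedFrom_prepend hx (h z)).trans_eq ?_
      rw [ENNReal.ofReal_add (h z).nonneg hx.le, add_comm]
    · simp [h]
  · refine le_iInf₂ fun t ht => ?_
    obtain ⟨z, hz⟩ : ∃ z, z ∉ S := by
      by_contra! h'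
      exact hS (Finset.eq_univ_iff_forall.2 h')
    have htx : x.1 ≤ t := by
      by_contra! h
      exact hz ((informedFrom_of_prepend hω (ht z)).1 h)
    refine (add_le_add le_rfl
      (iInf₂_le (t - x.1) fun z => (informedFrom_of_prepend hω (ht z)).2 htx)).trans_eq ?_
    rw [← ENNReal.ofReal_add hx.le (by linarith)]
    congr 1
    ring

theorem spreadFrom_univ (ω : Outcome n) : spreadFrom Finset.univ ω = 0 := by
  refine le_antisymm ((iInf₂_le 0 fun v => ?_).trans_eq ENNReal.ofReal_zero) zero_le
  exact .source (Finset.mem_univ v) le_rfl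

end Rumor

end

noncomputable section

namespace Rumor

variable {n : ℕ}

/-! ### Decomposition of the law of the protocol at the first ring -/

theorem lintegral_expMeasure {r : ℝ} {f : ℝ → ℝ≥0∞} (hf : Measurable f) :
    ∫⁻ x, f x ∂(expMeasure r) =
      ∫⁻ x in Set.Ioi 0, ENNReal.ofReal (r * Real.exp (-(r * x))) * f x := by
  have h1 : Measurable (exponentialPDF r) :=
    (measurable_exponentialPDFReal r).ennreal_ofReal
  have : expMeasure r = volume.withDensity (exponentialPDF r) := rfl
  rw [this, lintegral_withDensity_eq_lintegral_mul _ h1 hf, ← lintegral_indicator measurableSet_Ioi]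
  refine lintegral_congr_ae ?_
  have h0 : ∀ᵐ x : ℝ, x ≠ 0 := by simp [ae_iff, measure_singleton]
  filter_upwards [h0] with x hx
  rcases lt_or_gt_of_ne hx with h | h
  · simp [Pi.mul_apply, exponentialPDF_of_neg h, h.le]
  · simp [Pi.mul_apply, exponentialPDF_of_nonneg h.le, h]

/-- Memorylessness of the exponential law in integrated form: `exp (-t)` is the probability of
exceeding `t`, and the excess has the same law again. -/
theorem exp_mul_lintegral_expMeasure_one {t : ℝ} (ht : 0 ≤ t) {f : ℝ → ℝ≥0∞} (hf : Measurable f) :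
    ENNReal.ofReal (Real.exp (-t)) * ∫⁻ x, f (x + t) ∂(expMeasure 1) =
      ∫⁻ x, (Set.Ioi t).indicator f x ∂(expMeasure 1) := by
  rw [lintegral_expMeasure (by fun_prop), lintegral_expMeasure (hf.indicator measurableSet_Ioi),
    ← lintegral_const_mul _ (by fun_prop), ← lintegral_indicator measurableSet_Ioi,
    ← lintegral_indicator measurableSet_Ioi,
    ← lintegral_add_right_eq_self (fun x => Set.indicator (Set.Ioi (0 : ℝ)) (fun x =>
      ENNReal.ofReal (1 * Real.exp (-(1 * x))) * (Set.Ioi t).indicator f x) x) t]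
  refine lintegral_congr fun x => ?_
  by_cases hx : 0 < x
  · have h1 : x + t ∈ Set.Ioi (0 : ℝ) := by simp; linarith
    have h2 : x + t ∈ Set.Ioi t := by simp [hx]
    rw [Set.indicator_of_mem (show x ∈ Set.Ioi (0 : ℝ) from hx), Set.indicator_of_mem h1,
      Set.indicator_of_mem h2, ← mul_assoc, ← ENNReal.ofReal_mul (Real.exp_nonneg _), one_mul,
      one_mul, one_mul, ← Real.exp_add]
    congr 3
    ring_nf
  · have h2 : x + t ∉ Set.Ioi t := by simp; linarith
    rw [Set.indicator_of_notMem (show x ∉ Set.Ioi (0 : ℝ) from hx)]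
    by_cases h1 : x + t ∈ Set.Ioi (0 : ℝ)
    · rw [Set.indicator_of_mem h1, Set.indicator_of_notMem h2, mul_zero]
    · rw [Set.indicator_of_notMem h1]

/-- The law of an entry of the outcome that belongs to the clock of `v`. -/
def entryLaw (q : I) (G : SimpleGraph (Fin n)) (v : Fin n) : Measure (ℝ × Fin n × Bool) :=
  (expMeasure 1).prod ((contactLaw G v).prod (bernoulliMeasure true false q))

instance (q : I) (G : SimpleGraph (Fin n)) (v : Fin n) :
    IsProbabilityMeasure (entryLaw q G v) := by
  unfold entryLaw
  infer_instance

theorem law_eq (q : I) (G : SimpleGraph (Fin n)) :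
    law q G = Measure.infinitePi fun i : Fin n × ℕ => entryLaw q G i.1 := rfl

theorem exp_mul_entryLaw (q : I) (G : SimpleGraph (Fin n)) (v : Fin n) {t : ℝ} (ht : 0 ≤ t)
    {A : Set (ℝ × Fin n × Bool)} (hA : MeasurableSet A) :
    ENNReal.ofReal (Real.exp (-t)) * entryLaw q G v {x | (x.1 + t, x.2) ∈ A} =
      entryLaw q G v (A ∩ {x | t < x.1}) := by
  have h1 : MeasurableSet {x : ℝ × Fin n × Bool | (x.1 + t, x.2) ∈ A} :=
    (by fun_prop : Measurable fun x : ℝ × Fin n × Bool => (x.1 + t, x.2)) hA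
  have h2 : MeasurableSet {x : ℝ × Fin n × Bool | t < x.1} :=
    measurableSet_lt measurable_const measurable_fst
  unfold entryLaw
  rw [Measure.prod_apply h1, Measure.prod_apply (hA.inter h2)]
  refine (exp_mul_lintegral_expMeasure_one ht (measurable_measure_prodMk_left hA)).trans ?_
  refine lintegral_congr fun x => ?_
  by_cases hx : t < x
  · rw [Set.indicator_of_mem (show x ∈ Set.Ioi t from hx)]
    congr 1
    ext y
    simp [hx]
  · rw [Set.indicator_of_notMem (show x ∉ Set.Ioi t from hx)]
    symm
    convert measure_empty (μ := (contactLaw G v).prod (bernoulliMeasure true false q))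
    ext y
    simp [hx]

theorem entryLaw_fst_eq (q : I) (G : SimpleGraph (Fin n)) (v : Fin n) (t : ℝ) :
    entryLaw q G v {x | x.1 = t} = 0 := by
  have h : {x : ℝ × Fin n × Bool | x.1 = t} = {t} ×ˢ Set.univ := by
    ext x
    simp
  have h0 : expMeasure 1 {t} = 0 := by
    have : expMeasure 1 = volume.withDensity (exponentialPDF 1) := rfl
    rw [this]
    exact withDensity_absolutelyContinuous _ _ (measure_singleton t)
  rw [h, entryLaw, Measure.prod_prod, h0, zero_mul]

theorem ae_expMeasure_pos (r : ℝ) : ∀ᵐ x ∂(expMeasure r), 0 < x := by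
  have h2 : MeasurableSet {x : ℝ | ¬ 0 < x} := measurableSet_Ioi.compl
  rw [ae_iff, ← lintegral_indicator_one h2,
    lintegral_expMeasure (measurable_one.indicator h2)]
  refine (setLIntegral_congr_fun (g := fun _ => 0) measurableSet_Ioi fun x hx => ?_).trans
    (by simp)
  have : (0 : ℝ) < x := hx
  simp [this]

theorem ae_entryLaw_pos (q : I) (G : SimpleGraph (Fin n)) (v : Fin n) :
    ∀ᵐ x ∂(entryLaw q G v), 0 < x.1 :=
  Measure.quasiMeasurePreserving_fst.ae (ae_expMeasure_pos 1)

theorem ae_law_posWaits (q : I) (G : SimpleGraph (Fin n)) :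
    ∀ᵐ ω ∂(law q G), PosWaits ω := by
  unfold PosWaits
  rw [ae_all_iff]
  intro i
  have := (measurePreserving_eval_infinitePi
    (fun i : Fin n × ℕ => entryLaw q G i.1) i).quasiMeasurePreserving.ae (ae_entryLaw_pos q G i.1)
  exact this

/-- Splitting a product of probability measures according to the coordinate whose first component
is smallest. -/
theorem pi_measure_eq_sum_argmin {m : ℕ} {Y : Type*} [MeasurableSpace Y]
    (μ : Fin (m + 1) → Measure (ℝ × Y)) [∀ u, IsProbabilityMeasure (μ u)]
    (hμ : ∀ u t, μ u {x | x.1 = t} = 0) (A : Fin (m + 1) → Set (ℝ × Y))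
    (hA : ∀ u, MeasurableSet (A u)) :
    ∏ u, μ u (A u) = ∑ v, ∫⁻ x in A v,
      ∏ j, μ (v.succAbove j) (A (v.succAbove j) ∩ {y | x.1 < y.1}) ∂(μ v) := by
  classical
  have hlt : ∀ t : ℝ, MeasurableSet {y : ℝ × Y | t < y.1} := fun t =>
    measurableSet_lt measurable_const measurable_fst
  have hle : ∀ t : ℝ, MeasurableSet {y : ℝ × Y | t ≤ y.1} := fun t =>
    measurableSet_le measurable_const measurable_fst
  -- The event that `v` attains the minimum, with ties resolved in favour of the smallest index. The
  -- strict inequality on one side and the weak one on the other make these events disjoint and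
  -- exhaustive.
  let D : Fin (m + 1) → Set (Fin (m + 1) → ℝ × Y) := fun v =>
    {y | (∀ u, y u ∈ A u) ∧ ∀ u, (u < v → (y v).1 < (y u).1) ∧ (v < u → (y v).1 ≤ (y u).1)}
  have hD : ∀ v, MeasurableSet (D v) := by
    intro v
    have : D v = (⋂ u, (fun y : Fin (m + 1) → ℝ × Y => y u) ⁻¹' A u) ∩
        ⋂ u, ({y : Fin (m + 1) → ℝ × Y | u < v → (y v).1 < (y u).1} ∩
          {y : Fin (m + 1) → ℝ × Y | v < u → (y v).1 ≤ (y u).1}) := by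
      ext y
      simp [D]
    rw [this]
    refine (MeasurableSet.iInter fun u => measurable_pi_apply u (hA u)).inter
      (MeasurableSet.iInter fun u => .inter ?_ ?_)
    · by_cases h : u < v
      · simp only [h, true_imp_iff]
        exact measurableSet_lt (by fun_prop) (by fun_prop)
      · simp [h]
    · by_cases h : v < u
      · simp only [h, true_imp_iff]
        exact measurableSet_le (by fun_prop) (by fun_prop)
      · simp [h]
  have hpart : Set.univ.pi A = ⋃ v, D v := by
    ext y
    simp only [Set.mem_univ_pi, Set.mem_iUnion]
    constructor
    · intro hy
      obtain ⟨v, -, hv⟩ := Finset.exists_min_image Finset.univ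
        (fun u => toLex ((y u).1, u)) Finset.univ_nonempty
      refine ⟨v, hy, fun u => ⟨fun huv => ?_, fun huv => ?_⟩⟩
      · have := hv u (Finset.mem_univ u)
        rw [Prod.Lex.toLex_le_toLex] at this
        rcases this with h | h
        · exact h
        · exact absurd h.2 (not_le.2 huv)
      · have := hv u (Finset.mem_univ u)
        rw [Prod.Lex.toLex_le_toLex] at this
        rcases this with h | h
        · exact h.le
        · exact h.1.le
    · rintro ⟨v, hy⟩
      exact hy.1
  have hdisj : Pairwise (Function.onFun Disjoint D) := by
    intro v w hvw
    rw [Function.onFun, Set.disjoint_left]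
    intro y hv hw
    rcases lt_or_gt_of_ne hvw with h | h
    · exact absurd ((hv.2 w).2 h) (not_le.2 ((hw.2 v).1 h))
    · exact absurd ((hw.2 v).2 h) (not_le.2 ((hv.2 w).1 h))
  rw [← Measure.pi_pi, hpart, measure_iUnion hdisj hD, tsum_fintype]
  refine Finset.sum_congr rfl fun v _ => ?_
  have hmp := (measurePreserving_piFinSuccAbove μ v).symm
  rw [← hmp.measure_preimage (hD v).nullMeasurableSet,
    Measure.prod_apply ((MeasurableEquiv.measurable _) (hD v)), ← lintegral_indicator (hA v)]
  refine lintegral_congr fun x => ?_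
  by_cases hx : x ∈ A v
  · rw [Set.indicator_of_mem hx]
    have hset : Prod.mk x ⁻¹' ((MeasurableEquiv.piFinSuccAbove (fun _ => ℝ × Y) v).symm ⁻¹' D v) =
        Set.univ.pi fun j => if v.succAbove j < v then
          A (v.succAbove j) ∩ {y | x.1 < y.1} else A (v.succAbove j) ∩ {y | x.1 ≤ y.1} := by
      ext y
      simp only [Set.mem_preimage, MeasurableEquiv.piFinSuccAbove_symm_apply, Set.mem_univ_pi, D,
        Set.mem_ofPred_eq, Fin.insertNthEquiv_apply]
      constructor
      · rintro ⟨h1, h2⟩ j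
        have h1 := h1 (v.succAbove j)
        have h2 := h2 (v.succAbove j)
        simp only [Fin.insertNth_apply_succAbove, Fin.insertNth_apply_same] at h1 h2
        split_ifs with h
        · exact ⟨h1, h2.1 h⟩
        · exact ⟨h1, h2.2 (lt_of_le_of_ne (not_lt.1 h) (Fin.succAbove_ne v j).symm)⟩
      · intro h
        constructor
        · intro u
          rcases Fin.eq_self_or_eq_succAbove v u with rfl | ⟨j, rfl⟩
          · simpa using hx
          · have := h j
            simp only [Fin.insertNth_apply_succAbove]
            split_ifs at this <;> exact this.1
        · intro u
          rcases Fin.eq_self_or_eq_succAbove v u with rfl | ⟨j, rfl⟩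
          · simp
          · have := h j
            simp only [Fin.insertNth_apply_succAbove, Fin.insertNth_apply_same]
            split_ifs at this with h'
            · exact ⟨fun _ => this.2, fun h'' => absurd h'' (not_lt.2 h'.le)⟩
            · exact ⟨fun h'' => absurd h'' h', fun _ => this.2⟩
    rw [hset, Measure.pi_pi]
    refine Finset.prod_congr rfl fun j _ => ?_
    split_ifs with h
    · rfl
    -- Strict and weak inequality differ by the event of a tie, which is null by `hμ`.
    · refine le_antisymm ?_ (measure_mono (Set.inter_subset_inter_right _
        fun y (hy : x.1 < y.1) => hy.le))
      refine (measure_mono (t := (A (v.succAbove j) ∩ {y | x.1 < y.1}) ∪ {y | y.1 = x.1})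
        fun y hy => ?_).trans ((measure_union_le _ _).trans_eq (by rw [hμ, add_zero]))
      rcases (show x.1 ≤ y.1 from hy.2).lt_or_eq with h | h
      · exact .inl ⟨hy.1, h⟩
      · exact .inr h.symm
  · rw [Set.indicator_of_notMem hx]
    convert measure_empty (μ := Measure.pi fun j => μ (v.succAbove j))
    ext y
    simp only [Set.mem_preimage, MeasurableEquiv.piFinSuccAbove_symm_apply, D, Set.mem_ofPred_eq,
      Set.mem_empty_iff_false, iff_false, not_and, Fin.insertNthEquiv_apply]
    intro h
    exact absurd (by simpa using h v) hx

end Rumor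

end

/-! ### The law of the protocol rebuilt from its first ring. -/

noncomputable section

namespace Rumor

variable {n : ℕ}

/-- The law of the outcome, assembled from the first ring and the protocol after it. -/
def firstRingLaw (q : I) (G : SimpleGraph (Fin n)) : Measure (Outcome n) :=
  ∑ v, (((entryLaw q G v).withDensity fun x =>
    ENNReal.ofReal (Real.exp (-x.1)) ^ (n - 1)).prod (law q G)).map fun y => prepend v y.1 y.2

/-- The preimage of a box is a box again: for `v` the conditions move down by one index, for the
other nodes only the condition on the first entry is shifted by `x.1`. Moving down would bring in
index `K + 1`, which `hK` leaves free. -/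
theorem law_preimage_prepend (q : I) (G : SimpleGraph (Fin n)) (v : Fin n) (K : ℕ)
    (A : Fin n × ℕ → Set (ℝ × Fin n × Bool)) (hA : ∀ i, MeasurableSet (A i))
    (hK : ∀ u, A (u, K + 1) = Set.univ) (x : ℝ × Fin n × Bool) (hx : x ∈ A (v, 0)) :
    law q G {ω | prepend v x ω ∈
      Set.pi (Finset.univ ×ˢ Finset.range (K + 1) : Finset (Fin n × ℕ)) A} =
    (∏ u, if u = v then 1 else entryLaw q G u {y | (y.1 + x.1, y.2) ∈ A (u, 0)}) *
      ∏ u, ∏ k ∈ Finset.range K, entryLaw q G u (A (u, k + 1)) := by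
  have hset : {ω | prepend v x ω ∈
      Set.pi (Finset.univ ×ˢ Finset.range (K + 1) : Finset (Fin n × ℕ)) A} =
      Set.pi (Finset.univ ×ˢ Finset.range (K + 1) : Finset (Fin n × ℕ)) fun i =>
        if i.1 = v then A (v, i.2 + 1) else
          if i.2 = 0 then {y | (y.1 + x.1, y.2) ∈ A (i.1, 0)} else A i := by
    ext ω
    simp only [Set.mem_ofPred_eq, Set.mem_pi, Finset.coe_product, Finset.coe_univ,
      Finset.coe_range, Set.mem_prod, Set.mem_univ, true_and, Set.mem_Iio, Prod.forall]
    constructor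
    · intro h u k hk
      by_cases huv : u = v
      · subst huv
        simp only [if_true]
        rcases Nat.lt_succ_iff_lt_or_eq.1 hk with hk' | rfl
        · have := h u (k + 1) (by omega)
          simpa [prepend] using this
        · simp [hK]
      · have := h u k hk
        simp only [huv, if_false]
        by_cases hk0 : k = 0
        · subst hk0
          simpa [prepend, huv] using this
        · simpa [prepend, huv, hk0] using this
    · intro h u k hk
      by_cases huv : u = v
      · subst huv
        cases k with
        | zero => simpa [prepend] using hx
        | succ k =>
          have := h u k (by omega)
          simpa [prepend] using this
      · have := h u k hk
        simp only [huv, if_false] at this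
        by_cases hk0 : k = 0
        · subst hk0
          simpa [prepend, huv] using this
        · simpa [prepend, huv, hk0] using this
  rw [hset, law_eq, Measure.infinitePi_pi, Finset.prod_product, ← Finset.prod_mul_distrib]
  · refine Finset.prod_congr rfl fun u _ => ?_
    by_cases huv : u = v
    · subst huv
      simp only [if_true, one_mul]
      rw [Finset.prod_range_succ, hK, measure_univ, mul_one]
    · simp only [huv, if_false]
      rw [Finset.prod_range_succ', mul_comm]
      simp
  · rintro ⟨u, k⟩ -
    dsimp only
    split_ifs
    · exact hA _
    · exact (by fun_prop : Measurable fun y : ℝ × Fin n × Bool => (y.1 + x.1, y.2)) (hA _)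
    · exact hA _

theorem firstRingLaw_pi (q : I) (G : SimpleGraph (Fin n)) (hn : 0 < n) (K : ℕ)
    (A : Fin n × ℕ → Set (ℝ × Fin n × Bool)) (hA : ∀ i, MeasurableSet (A i))
    (hK : ∀ u, A (u, K + 1) = Set.univ) :
    firstRingLaw q G (Set.pi (Finset.univ ×ˢ Finset.range (K + 1) : Finset (Fin n × ℕ)) A) =
      ∏ u, ∏ k ∈ Finset.range (K + 1), entryLaw q G u (A (u, k)) := by
  obtain ⟨m, rfl⟩ : ∃ m, n = m + 1 := ⟨n - 1, by omega⟩
  have hB : MeasurableSet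
      (Set.pi (Finset.univ ×ˢ Finset.range (K + 1) : Finset (Fin (m + 1) × ℕ)) A) :=
    MeasurableSet.pi (Finset.countable_toSet _) fun i _ => hA i
  have hmeas : Measurable fun x : ℝ × Fin (m + 1) × Bool =>
      ENNReal.ofReal (Real.exp (-x.1)) ^ (m + 1 - 1) := by fun_prop
  simp only [firstRingLaw, Measure.finsetSum_apply]
  have hterm : ∀ v, (((entryLaw q G v).withDensity fun x =>
      ENNReal.ofReal (Real.exp (-x.1)) ^ (m + 1 - 1)).prod (law q G)).map
        (fun y => prepend v y.1 y.2)
        (Set.pi (Finset.univ ×ˢ Finset.range (K + 1) : Finset (Fin (m + 1) × ℕ)) A) =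
      (∫⁻ x in A (v, 0), ∏ j, entryLaw q G (v.succAbove j)
        (A (v.succAbove j, 0) ∩ {y | x.1 < y.1}) ∂(entryLaw q G v)) *
        ∏ u, ∏ k ∈ Finset.range K, entryLaw q G u (A (u, k + 1)) := by
    intro v
    have hfin : ∏ u, ∏ k ∈ Finset.range K, entryLaw q G u (A (u, k + 1)) ≠ ⊤ :=
      ENNReal.prod_ne_top fun u _ => ENNReal.prod_ne_top fun k _ => measure_ne_top _ _
    have : SFinite ((entryLaw q G v).withDensity fun x =>
      ENNReal.ofReal (Real.exp (-x.1)) ^ (m + 1 - 1)) := inferInstance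
    rw [Measure.map_apply (measurable_prepend v) hB,
      Measure.prod_apply ((measurable_prepend v) hB),
      lintegral_withDensity_eq_lintegral_mul _ hmeas
        (measurable_measure_prodMk_left ((measurable_prepend v) hB)),
      ← lintegral_mul_const' _ _ hfin, ← lintegral_indicator (hA _)]
    refine lintegral_congr_ae ?_
    filter_upwards [ae_entryLaw_pos q G v] with x hx
    by_cases hxA : x ∈ A (v, 0)
    · rw [Set.indicator_of_mem hxA, Pi.mul_apply]
      have := law_preimage_prepend q G v K A hA hK x hxA
      rw [show Prod.mk x ⁻¹' ((fun y : (ℝ × Fin (m + 1) × Bool) × Outcome (m + 1) =>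
        prepend v y.1 y.2) ⁻¹' (Set.pi
          (Finset.univ ×ˢ Finset.range (K + 1) : Finset (Fin (m + 1) × ℕ)) A)) =
        {ω | prepend v x ω ∈
          Set.pi (Finset.univ ×ˢ Finset.range (K + 1) : Finset (Fin (m + 1) × ℕ)) A} from rfl,
        this, ← mul_assoc]
      congr 1
      rw [Fin.prod_univ_succAbove _ v]
      simp only [if_true, one_mul, Fin.succAbove_ne, if_false]
      -- The `m` other clocks each absorb one factor `exp (-x.1)`, which by memorylessness restricts
      -- their first ring to times after `x.1`.
      rw [Nat.add_sub_cancel, ← Fin.prod_const, ← Finset.prod_mul_distrib]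
      exact Finset.prod_congr rfl fun j _ => exp_mul_entryLaw q G _ hx.le (hA _)
    · rw [Set.indicator_of_notMem hxA, Pi.mul_apply]
      convert mul_zero _
      convert measure_empty (μ := law q G)
      ext ω
      simp only [Set.mem_preimage, Set.mem_empty_iff_false, iff_false]
      intro h
      have := h (v, 0) (by simp)
      simp [prepend] at this
      exact hxA this
  simp only [hterm]
  rw [← Finset.sum_mul, ← pi_measure_eq_sum_argmin _ (fun u t => entryLaw_fst_eq q G u t)
    (fun u => A (u, 0)) fun u => hA _, ← Finset.prod_mul_distrib]
  refine Finset.prod_congr rfl fun u _ => ?_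
  rw [Finset.prod_range_succ' _ K, mul_comm]

/-- A product measure is determined by its values on finite boxes. On a box, the density in
`firstRingLaw` is the probability that the other `n - 1` clocks are silent until the first ring, and
summing over `v` is the case distinction on which clock rings first (`pi_measure_eq_sum_argmin`). -/
theorem firstRingLaw_eq_law (q : I) (G : SimpleGraph (Fin n)) (hn : 0 < n) :
    firstRingLaw q G = law q G := by
  classical
  refine Measure.eq_infinitePi _ fun s t ht => ?_
  obtain ⟨K, hK⟩ : ∃ K, ∀ i ∈ s, i.2 < K := by
    obtain ⟨K, hK⟩ := (s.image Prod.snd).exists_nat_subset_range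
    exact ⟨K, fun i hi => Finset.mem_range.1 (hK (Finset.mem_image_of_mem _ hi))⟩
  let A : Fin n × ℕ → Set (ℝ × Fin n × Bool) := fun i => if i ∈ s then t i else Set.univ
  have hset : Set.pi s t =
      Set.pi (Finset.univ ×ˢ Finset.range (K + 1) : Finset (Fin n × ℕ)) A := by
    ext ω
    simp only [Set.mem_pi, Finset.mem_coe, Finset.mem_product, Finset.mem_univ, true_and,
      Finset.mem_range, A]
    constructor
    · intro h i _
      split_ifs with hi
      · exact h i hi
      · trivial
    · intro h i hi
      have := h i ((hK i hi).trans (by omega))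
      rwa [if_pos hi] at this
  have hA : ∀ i, MeasurableSet (A i) := fun i => by
    simp only [A]
    split_ifs
    · exact ht i
    · exact .univ
  rw [hset, firstRingLaw_pi q G hn K A hA, ← Finset.prod_product']
  · have hsub : s ⊆ Finset.univ ×ˢ Finset.range (K + 1) := fun i hi => by
      simpa using Nat.lt_succ_of_lt (hK i hi)
    refine (Finset.prod_subset hsub fun i _ hi => ?_).symm.trans
      (Finset.prod_congr rfl fun i hi => ?_)
    · simp [A, hi]
    · simp only [A, Prod.mk.eta, hi, if_true]
      rfl
  · intro u
    have : (u, K + 1) ∉ s := fun h => by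
      have := hK _ h
      simp only at this
      omega
    simp [A, this]

/-- The expectation of a functional of the protocol, decomposed at the first ring. -/
theorem lintegral_law (q : I) (G : SimpleGraph (Fin n)) (hn : 0 < n) {F : Outcome n → ℝ≥0∞}
    (hF : Measurable F) :
    ∫⁻ ω, F ω ∂(law q G) = ∑ v, ∫⁻ x, ENNReal.ofReal (Real.exp (-x.1)) ^ (n - 1) *
      ∫⁻ ω, F (prepend v x ω) ∂(law q G) ∂(entryLaw q G v) := by
  have hmeas : Measurable fun x : ℝ × Fin n × Bool =>
      ENNReal.ofReal (Real.exp (-x.1)) ^ (n - 1) := by fun_prop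
  have hp : ∀ v : Fin n, Measurable fun y : (ℝ × Fin n × Bool) × Outcome n =>
      F (prepend v y.1 y.2) := fun v => hF.comp (measurable_prepend v)
  conv_lhs => rw [← firstRingLaw_eq_law q G hn]
  rw [firstRingLaw, lintegral_finsetSum_measure]
  refine Finset.sum_congr rfl fun v _ => ?_
  rw [lintegral_map hF (measurable_prepend v), lintegral_prod _ (hp v).aemeasurable,
    lintegral_withDensity_eq_lintegral_mul _ hmeas (hp v).lintegral_prod_right']
  rfl

end Rumor

end

noncomputable section

namespace Rumor

variable {n : ℕ}

/-! ### The embedded Markov chain -/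

/-- The transition operator of the chain that applies the step `st · e` with probability `b e`. -/
def markovOp {V : Type*} [Fintype V] (st : Finset V → V × V → Finset V) (b : V × V → ℝ)
    (f : Finset V → ℝ) (S : Finset V) : ℝ :=
  f S + ∑ e, b e * (f (st S e) - f S)

/-- The transition operator of the chain of informed sets. -/
abbrev chainOp {V : Type*} [Fintype V] [DecidableEq V] (b : V × V → ℝ) :
    (Finset V → ℝ) → Finset V → ℝ :=
  markovOp stepSet b

/-- The probability that a ring is one of `e.1`, which successfully contacts `e.2`. -/
def contactWeight (q : I) (G : SimpleGraph (Fin n)) (e : Fin n × Fin n) : ℝ :=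
  q / n * (contactLaw G e.1).real {e.2}

theorem contactWeight_nonneg (q : I) (G : SimpleGraph (Fin n)) (e : Fin n × Fin n) :
    0 ≤ contactWeight q G e := by
  unfold contactWeight
  have := q.2.1
  positivity

theorem sum_contactLaw (G : SimpleGraph (Fin n)) (v : Fin n) :
    ∑ w, (contactLaw G v).real {w} = 1 := by
  have := sum_measureReal_singleton (μ := contactLaw G v) Finset.univ
  rw [this]
  simp

theorem sum_contactWeight (q : I) (G : SimpleGraph (Fin n)) (hn : 0 < n) :
    ∑ e, contactWeight q G e = q := by
  have : (n : ℝ) ≠ 0 := by positivity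
  rw [Fintype.sum_prod_type]
  simp only [contactWeight, ← Finset.mul_sum, sum_contactLaw]
  simp
  field_simp

/-- Indicator of the sets that are not everything. -/
def uninformed {V : Type*} [Fintype V] [DecidableEq V] (S : Finset V) : ℝ :=
  if S = Finset.univ then 0 else 1

theorem lintegral_exp_expMeasure {r l : ℝ} (hr : 0 < r) (hl : l < r) :
    ∫⁻ t, ENNReal.ofReal (Real.exp (l * t)) ∂(expMeasure r) = ENNReal.ofReal (r / (r - l)) := by
  rw [lintegral_expMeasure (by fun_prop)]
  have h : ∀ x : ℝ, ENNReal.ofReal (r * Real.exp (-(r * x))) * ENNReal.ofReal (Real.exp (l * x)) =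
      ENNReal.ofReal (r * Real.exp ((l - r) * x)) := fun x => by
    rw [← ENNReal.ofReal_mul (by positivity), mul_assoc, ← Real.exp_add]
    ring_nf
  simp only [h]
  rw [← ofReal_integral_eq_lintegral_ofReal]
  · rw [integral_const_mul, integral_exp_mul_Ioi (by linarith)]
    congr 1
    have : l - r ≠ 0 := by linarith
    have : r - l ≠ 0 := by linarith
    simp
    field_simp
    ring
  · exact (integrableOn_exp_mul_Ioi (by linarith) 0).const_mul r
  · exact ae_of_all _ fun x => by positivity

theorem lintegral_id_expMeasure {r : ℝ} (hr : 0 < r) :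
    ∫⁻ t, ENNReal.ofReal t ∂(expMeasure r) = ENNReal.ofReal (1 / r) := by
  rw [lintegral_expMeasure (by fun_prop)]
  have h : ∀ x ∈ Set.Ioi (0 : ℝ), ENNReal.ofReal (r * Real.exp (-(r * x))) * ENNReal.ofReal x =
      ENNReal.ofReal (r * (x ^ ((2 : ℝ) - 1) * Real.exp (-(r * x)))) := fun x hx => by
    rw [← ENNReal.ofReal_mul (by positivity)]
    congr 1
    norm_num
    ring
  rw [setLIntegral_congr_fun measurableSet_Ioi h, ← ofReal_integral_eq_lintegral_ofReal]
  · rw [integral_const_mul, Real.integral_rpow_mul_exp_neg_mul_Ioi (by norm_num) hr]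
    rw [Real.Gamma_two]
    congr 1
    rw [show (2 : ℝ) = ((2 : ℕ) : ℝ) by norm_num, Real.rpow_natCast]
    field_simp
  · have := integrableOn_rpow_mul_exp_neg_mul_rpow (p := 1) (s := 2 - 1) (by norm_num) one_pos hr
    simp only [Real.rpow_one, neg_mul] at this
    exact this.const_mul r
  · refine (ae_restrict_iff' measurableSet_Ioi).2 (ae_of_all _ fun x hx => ?_)
    have : (0 : ℝ) < x := hx
    positivity

/-- The minimum of `n` independent exponential times of rate `1` has rate `n`, and it is attained by
a given clock with probability `1 / n`, independently of its value. -/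
theorem lintegral_expMeasure_one_mul_exp (hn : 0 < n) {f : ℝ → ℝ≥0∞} (hf : Measurable f) :
    ∫⁻ t, ENNReal.ofReal (Real.exp (-t)) ^ (n - 1) * f t ∂(expMeasure 1) =
      ENNReal.ofReal (1 / n) * ∫⁻ t, f t ∂(expMeasure n) := by
  have hn' : (0 : ℝ) < n := by positivity
  rw [lintegral_expMeasure (by fun_prop), lintegral_expMeasure hf,
    ← lintegral_const_mul _ (by fun_prop)]
  refine lintegral_congr fun x => ?_
  rw [← mul_assoc, ← mul_assoc, ← ENNReal.ofReal_pow (Real.exp_nonneg _),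
    ← ENNReal.ofReal_mul (by positivity), ← ENNReal.ofReal_mul (by positivity), ← Real.exp_nat_mul,
    one_mul, ← Real.exp_add, ← mul_assoc, one_div, inv_mul_cancel₀ hn'.ne', one_mul, one_mul]
  congr 3
  rw [Nat.cast_sub hn]
  push_cast
  ring

theorem lintegral_mark (q : I) (G : SimpleGraph (Fin n)) (v : Fin n)
    (g : Fin n × Bool → ℝ≥0∞) :
    ∫⁻ y, g y ∂((contactLaw G v).prod (bernoulliMeasure true false q)) =
      ∑ w, (ENNReal.ofReal (q * (contactLaw G v).real {w}) * g (w, true) +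
        ENNReal.ofReal ((1 - q) * (contactLaw G v).real {w}) * g (w, false)) := by
  have hq0 := q.2.1
  have hq1 : (0 : ℝ) ≤ 1 - q := by linarith [q.2.2]
  have hs : ∀ w b, ((contactLaw G v).prod (bernoulliMeasure true false q)) {(w, b)} =
      contactLaw G v {w} * bernoulliMeasure true false q {b} := fun w b => by
    rw [← Set.singleton_prod_singleton, Measure.prod_prod]
  have ht : bernoulliMeasure true false q {true} = ENNReal.ofReal q := by
    rw [bernoulliMeasure_apply q (measurableSet_singleton _)]
    simp
    rw [ENNReal.ofReal, Real.toNNReal_of_nonneg hq0]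
    rfl
  have hf : bernoulliMeasure true false q {false} = ENNReal.ofReal (1 - q) := by
    rw [bernoulliMeasure_apply q (measurableSet_singleton _)]
    simp
    rw [ENNReal.ofReal, Real.toNNReal_of_nonneg hq1]
    rfl
  have hc : ∀ w, contactLaw G v {w} = ENNReal.ofReal ((contactLaw G v).real {w}) := fun w => by
    simp
  rw [lintegral_fintype, Fintype.sum_prod_type]
  refine Finset.sum_congr rfl fun w _ => ?_
  rw [Fintype.sum_bool, hs, hs, ht, hf, hc, ENNReal.ofReal_mul hq0, ENNReal.ofReal_mul hq1]
  ring

end Rumor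

end

/-! ### Tails of the spreading time in terms of the embedded chain. -/

noncomputable section

namespace Rumor

variable {n : ℕ}

/-- The law of the spreading time, decomposed at the first ring. -/
theorem lintegral_spreadFrom (q : I) (G : SimpleGraph (Fin n)) (hn : 0 < n)
    {S : Finset (Fin n)} (hS : S ≠ Finset.univ) {φ : ℝ≥0∞ → ℝ≥0∞} (hφ : Measurable φ) :
    ∫⁻ ω, φ (spreadFrom S ω) ∂(law q G) =
      ∫⁻ t, (∑ e, ENNReal.ofReal (contactWeight q G e) *
          ∫⁻ ω, φ (ENNReal.ofReal t + spreadFrom (stepSet S e) ω) ∂(law q G)) +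
        ENNReal.ofReal (1 - q) * ∫⁻ ω, φ (ENNReal.ofReal t + spreadFrom S ω) ∂(law q G)
        ∂(expMeasure n) := by
  have hn' : (0 : ℝ) < n := by positivity
  have hq0 := q.2.1
  have hq1 : (0 : ℝ) ≤ 1 - q := by linarith [q.2.2]
  obtain ⟨g, hg⟩ : ∃ g : ℝ → Finset (Fin n) → ℝ≥0∞, ∀ t S', g t S' =
    ∫⁻ ω, φ (ENNReal.ofReal t + spreadFrom S' ω) ∂(law q G) := ⟨_, fun _ _ => rfl⟩
  have hgm : ∀ S', Measurable fun t => g t S' := fun S' => by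
    simp only [hg]
    refine Measurable.lintegral_prod_right'
      (f := fun y : ℝ × Outcome n => φ (ENNReal.ofReal y.1 + spreadFrom S' y.2)) ?_
    exact hφ.comp ((ENNReal.measurable_ofReal.comp measurable_fst).add
      ((measurable_spreadFrom S').comp measurable_snd))
  refine (lintegral_law q G hn (hφ.comp (measurable_spreadFrom S))).trans ?_
  have hterm : ∀ v, ∫⁻ x, ENNReal.ofReal (Real.exp (-x.1)) ^ (n - 1) *
      ∫⁻ ω, (φ ∘ spreadFrom S) (prepend v x ω) ∂(law q G) ∂(entryLaw q G v) =
      ∫⁻ t, ENNReal.ofReal (1 / n) * ∑ w,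
        (ENNReal.ofReal (q * (contactLaw G v).real {w}) * g t (stepSet S (v, w)) +
        ENNReal.ofReal ((1 - q) * (contactLaw G v).real {w}) * g t S) ∂(expMeasure n) := by
    intro v
    have h1 : ∫⁻ x, ENNReal.ofReal (Real.exp (-x.1)) ^ (n - 1) *
        ∫⁻ ω, (φ ∘ spreadFrom S) (prepend v x ω) ∂(law q G) ∂(entryLaw q G v) =
        ∫⁻ x, ENNReal.ofReal (Real.exp (-x.1)) ^ (n - 1) *
          g x.1 (stepMark S v x.2.1 x.2.2) ∂(entryLaw q G v) := by
      refine lintegral_congr_ae ?_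
      filter_upwards [ae_entryLaw_pos q G v] with x hx
      rw [hg]
      congr 1
      refine lintegral_congr_ae ?_
      filter_upwards [ae_law_posWaits q G] with ω hω
      simp only [Function.comp_apply, spreadFrom_prepend hS v hx hω]
    have h2 : Measurable fun x : ℝ × Fin n × Bool =>
        ENNReal.ofReal (Real.exp (-x.1)) ^ (n - 1) * g x.1 (stepMark S v x.2.1 x.2.2) := by
      refine Measurable.mul (by fun_prop) ?_
      exact measurable_from_prod_countable_left fun y => hgm (stepMark S v y.1 y.2)
    rw [h1, entryLaw, lintegral_prod _ h2.aemeasurable]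
    have h3 : ∀ t, ∫⁻ y, ENNReal.ofReal (Real.exp (-t)) ^ (n - 1) * g t (stepMark S v y.1 y.2)
        ∂((contactLaw G v).prod (bernoulliMeasure true false q)) =
        ENNReal.ofReal (Real.exp (-t)) ^ (n - 1) * ∑ w,
        (ENNReal.ofReal (q * (contactLaw G v).real {w}) * g t (stepSet S (v, w)) +
        ENNReal.ofReal ((1 - q) * (contactLaw G v).real {w}) * g t S) := fun t => by
      rw [lintegral_const_mul _ (measurable_of_countable _), lintegral_mark]
      simp [stepMark]
    simp only [h3]
    have h4 : Measurable fun t => ∑ w,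
        (ENNReal.ofReal (q * (contactLaw G v).real {w}) * g t (stepSet S (v, w)) +
        ENNReal.ofReal ((1 - q) * (contactLaw G v).real {w}) * g t S) :=
      Finset.measurable_fun_sum _ fun w _ => ((hgm _).const_mul _).add ((hgm _).const_mul _)
    rw [lintegral_expMeasure_one_mul_exp hn h4, lintegral_const_mul _ h4]
  simp only [hterm, ← hg]
  rw [← lintegral_finsetSum]
  · refine lintegral_congr fun t => ?_
    rw [Fintype.sum_prod_type]
    -- The dropped contacts of all nodes leave `S` unchanged; they are gathered into a single term
    -- of total weight `1 - q`.
    have h5 : ENNReal.ofReal (1 - q) * g t S = ∑ v, ∑ w, ENNReal.ofReal (1 / n) *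
        (ENNReal.ofReal ((1 - q) * (contactLaw G v).real {w}) * g t S) := by
      have h6 : ∀ v, ∑ w, ENNReal.ofReal (1 / n) *
          (ENNReal.ofReal ((1 - q) * (contactLaw G v).real {w}) * g t S) =
          ENNReal.ofReal (1 / n) * (ENNReal.ofReal (1 - q) * g t S) := fun v => by
        rw [← Finset.mul_sum, ← Finset.sum_mul, ← ENNReal.ofReal_sum_of_nonneg
          (fun w _ => by positivity), ← Finset.mul_sum, sum_contactLaw, mul_one]
      simp only [h6, Finset.sum_const, Finset.card_univ, Fintype.card_fin, nsmul_eq_mul]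
      rw [← mul_assoc, ← ENNReal.ofReal_natCast, ← ENNReal.ofReal_mul hn'.le]
      rw [mul_one_div_cancel hn'.ne', ENNReal.ofReal_one, one_mul]
    rw [h5, ← Finset.sum_add_distrib]
    refine Finset.sum_congr rfl fun v _ => ?_
    rw [← Finset.sum_add_distrib, Finset.mul_sum]
    refine Finset.sum_congr rfl fun w _ => ?_
    rw [mul_add, ← mul_assoc, ← ENNReal.ofReal_mul (by positivity)]
    congr 3
    simp only [contactWeight]
    ring
  · intro v _
    exact (Finset.measurable_fun_sum _ fun w _ =>
      ((hgm _).const_mul _).add ((hgm _).const_mul _)).const_mul _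

theorem ofReal_chainOp (q : I) (G : SimpleGraph (Fin n)) (hn : 0 < n) {f : Finset (Fin n) → ℝ}
    {S : Finset (Fin n)} (hf : ∀ S', S ⊆ S' → 0 ≤ f S') :
    (∑ e, ENNReal.ofReal (contactWeight q G e) * ENNReal.ofReal (f (stepSet S e))) +
      ENNReal.ofReal (1 - q) * ENNReal.ofReal (f S) =
    ENNReal.ofReal (chainOp (contactWeight q G) f S) := by
  have hq1 : (0 : ℝ) ≤ 1 - q := by linarith [q.2.2]
  have h1 : ∀ e, ENNReal.ofReal (contactWeight q G e) * ENNReal.ofReal (f (stepSet S e)) =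
      ENNReal.ofReal (contactWeight q G e * f (stepSet S e)) := fun e =>
    (ENNReal.ofReal_mul (contactWeight_nonneg q G e)).symm
  have h0 : ∀ e ∈ Finset.univ, 0 ≤ contactWeight q G e * f (stepSet S e) := fun e _ =>
    mul_nonneg (contactWeight_nonneg q G e) (hf _ (subset_stepSet S e))
  simp only [h1]
  rw [← ENNReal.ofReal_sum_of_nonneg h0, ← ENNReal.ofReal_mul hq1,
    ← ENNReal.ofReal_add (Finset.sum_nonneg h0) (mul_nonneg hq1 (hf S subset_rfl))]
  congr 1
  simp only [markovOp, mul_sub, Finset.sum_sub_distrib, ← Finset.sum_mul]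
  rw [sum_contactWeight q G hn]
  ring

theorem chainOp_univ {V : Type*} [Fintype V] [DecidableEq V] (b : V × V → ℝ)
    (f : Finset V → ℝ) : chainOp b f Finset.univ = f Finset.univ := by
  have : ∀ e : V × V, stepSet Finset.univ e = Finset.univ := fun e =>
    Finset.univ_subset_iff.1 (subset_stepSet _ e)
  simp [markovOp, this]

/-- The operator is an average over the steps `e`, in which the missing mass `1 - ∑ e, b e` stands
for a step that does nothing. -/
theorem markovOp_mono {V : Type*} [Fintype V] {st : Finset V → V × V → Finset V}
    {b : V × V → ℝ} (hb0 : ∀ e, 0 ≤ b e) (hb1 : ∑ e, b e ≤ 1) {f g : Finset V → ℝ} {S : Finset V}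
    (hS : f S ≤ g S) (h : ∀ e, f (st S e) ≤ g (st S e)) :
    markovOp st b f S ≤ markovOp st b g S := by
  have h1 : ∀ k : Finset V → ℝ, markovOp st b k S =
      ∑ e, b e * k (st S e) + (1 - ∑ e, b e) * k S := fun k => by
    simp only [markovOp, mul_sub, Finset.sum_sub_distrib, ← Finset.sum_mul]
    ring
  rw [h1, h1]
  exact add_le_add (Finset.sum_le_sum fun e _ => mul_le_mul_of_nonneg_left (h e) (hb0 e))
    (mul_le_mul_of_nonneg_left hS (by linarith))

theorem markovOp_const {V : Type*} [Fintype V] (st : Finset V → V × V → Finset V)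
    (b : V × V → ℝ) (c : ℝ) : markovOp st b (fun _ => c) = fun _ => c := by
  funext S
  simp [markovOp]

theorem markovOp_add {V : Type*} [Fintype V] (st : Finset V → V × V → Finset V)
    (b : V × V → ℝ) (f g : Finset V → ℝ) :
    markovOp st b (fun S => f S + g S) = fun S => markovOp st b f S + markovOp st b g S := by
  funext S
  simp only [markovOp]
  rw [add_add_add_comm, ← Finset.sum_add_distrib]
  congr 1
  exact Finset.sum_congr rfl fun e _ => by ring

theorem markovOp_const_mul {V : Type*} [Fintype V] (st : Finset V → V × V → Finset V)
    (b : V × V → ℝ) (c : ℝ) (f : Finset V → ℝ) :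
    markovOp st b (fun S => c * f S) = fun S => c * markovOp st b f S := by
  funext S
  simp only [markovOp, mul_add, Finset.mul_sum]
  congr 1
  exact Finset.sum_congr rfl fun e _ => by ring

theorem markovOp_nonneg {V : Type*} [Fintype V] {st : Finset V → V × V → Finset V}
    {b : V × V → ℝ} (hb0 : ∀ e, 0 ≤ b e) (hb1 : ∑ e, b e ≤ 1) {f : Finset V → ℝ}
    (hf : ∀ S, 0 ≤ f S) (S : Finset V) : 0 ≤ markovOp st b f S := by
  have := markovOp_mono (st := st) hb0 hb1 (f := fun _ => 0) (g := f) (S := S) (hf S)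
    fun e => hf _
  rwa [markovOp_const] at this

theorem iterate_markovOp_nonneg {V : Type*} [Fintype V] {st : Finset V → V × V → Finset V}
    {b : V × V → ℝ} (hb0 : ∀ e, 0 ≤ b e) (hb1 : ∑ e, b e ≤ 1) {f : Finset V → ℝ}
    (hf : ∀ S, 0 ≤ f S) (j : ℕ) (S : Finset V) : 0 ≤ (markovOp st b)^[j] f S := by
  induction j generalizing S with
  | zero => exact hf S
  | succ j ih =>
    rw [Function.iterate_succ_apply']
    exact markovOp_nonneg hb0 hb1 ih S

theorem uninformed_nonneg {V : Type*} [Fintype V] [DecidableEq V] (S : Finset V) :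
    0 ≤ uninformed S := by
  unfold uninformed
  split_ifs <;> norm_num

theorem uninformed_le_one {V : Type*} [Fintype V] [DecidableEq V] (S : Finset V) :
    uninformed S ≤ 1 := by
  unfold uninformed
  split_ifs <;> norm_num

theorem sum_contactWeight_le_one (q : I) (G : SimpleGraph (Fin n)) (hn : 0 < n) :
    ∑ e, contactWeight q G e ≤ 1 :=
  (sum_contactWeight q G hn).trans_le q.2.2

theorem iterate_chainOp_univ {V : Type*} [Fintype V] [DecidableEq V] (b : V × V → ℝ)
    (f : Finset V → ℝ) (j : ℕ) : (chainOp b)^[j] f Finset.univ = f Finset.univ := by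
  induction j with
  | zero => rfl
  | succ j ih => rw [Function.iterate_succ_apply', chainOp_univ, ih]

/-- One step of the induction for the tails of the spreading time. -/
theorem lintegral_expMeasure_chainOp (q : I) (G : SimpleGraph (Fin n)) (hn : 0 < n) {l c : ℝ}
    (hln : l < n) (hc : 0 ≤ c) {f : Finset (Fin n) → ℝ} (hf : ∀ S, 0 ≤ f S)
    (S : Finset (Fin n)) {J : ℝ → Finset (Fin n) → ℝ≥0∞}
    (hJ : ∀ t S', 0 < t → J t S' ≤ ENNReal.ofReal (f S' + c * Real.exp (l * t))) :
    ∫⁻ t, (∑ e, ENNReal.ofReal (contactWeight q G e) * J t (stepSet S e)) +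
        ENNReal.ofReal (1 - q) * J t S ∂(expMeasure n) ≤
      ENNReal.ofReal (chainOp (contactWeight q G) f S + c * (n / (n - l))) := by
  have hn' : (0 : ℝ) < n := by positivity
  have hnl : (0 : ℝ) < n - l := by linarith
  have hcf : 0 ≤ chainOp (contactWeight q G) f S :=
    markovOp_nonneg (contactWeight_nonneg q G) (sum_contactWeight_le_one q G hn) hf S
  have : IsProbabilityMeasure (expMeasure n) := isProbabilityMeasure_expMeasure hn'
  calc _ ≤ ∫⁻ t, ENNReal.ofReal (chainOp (contactWeight q G) f S) +
        ENNReal.ofReal c * ENNReal.ofReal (Real.exp (l * t)) ∂(expMeasure n) := by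
        refine lintegral_mono_ae ?_
        filter_upwards [ae_expMeasure_pos (n : ℝ)] with t ht
        have h0 : ∀ S', 0 ≤ f S' + c * Real.exp (l * t) := fun S' => by
          have := hf S'
          positivity
        rw [← ENNReal.ofReal_mul hc, ← ENNReal.ofReal_add hcf (by positivity)]
        have := ofReal_chainOp q G hn (S := S) (f := fun S' => f S' + c * Real.exp (l * t))
          fun S' _ => h0 S'
        rw [chainOp, markovOp_add, markovOp_const] at this
        rw [← this]
        gcongr with e _
        · exact hJ t _ ht
        · exact hJ t _ ht
    _ = _ := by
        rw [lintegral_add_left measurable_const, lintegral_const_mul _ (by fun_prop),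
          lintegral_exp_expMeasure hn' hln, lintegral_const, measure_univ, mul_one,
          ← ENNReal.ofReal_mul hc, ← ENNReal.ofReal_add hcf (by positivity)]

theorem lintegral_indicator_spreadFrom (q : I) (G : SimpleGraph (Fin n)) {s : Set ℝ≥0∞}
    (hs : MeasurableSet s) (S : Finset (Fin n)) :
    ∫⁻ ω, s.indicator 1 (spreadFrom S ω) ∂(law q G) = law q G {ω | spreadFrom S ω ∈ s} := by
  have : MeasurableSet {ω : Outcome n | spreadFrom S ω ∈ s} := measurable_spreadFrom S hs
  rw [← lintegral_indicator_one this]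
  rfl

/-- An upper bound for the upper tail of the spreading time. -/
theorem law_lt_spreadFrom_le (q : I) (G : SimpleGraph (Fin n)) (hn : 0 < n) {l : ℝ} (hl : 0 < l)
    (hln : l < n) (j : ℕ) (S : Finset (Fin n)) (x : ℝ) :
    law q G {ω | ENNReal.ofReal x < spreadFrom S ω} ≤
      ENNReal.ofReal ((chainOp (contactWeight q G))^[j] uninformed S +
        Real.exp (-(l * x)) * (n / (n - l)) ^ j) := by
  have hn' : (0 : ℝ) < n := by positivity
  have hnl : (0 : ℝ) < n - l := by linarith
  have hr : (1 : ℝ) ≤ n / (n - l) := by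
    rw [one_le_div hnl]
    linarith
  have hnn : ∀ j S, 0 ≤ (chainOp (contactWeight q G))^[j] uninformed S := fun j S =>
    iterate_markovOp_nonneg (contactWeight_nonneg q G) (sum_contactWeight_le_one q G hn)
      uninformed_nonneg j S
  have huniv : ∀ (j : ℕ) (x : ℝ), law q G {ω | ENNReal.ofReal x < spreadFrom Finset.univ ω} ≤
      ENNReal.ofReal ((chainOp (contactWeight q G))^[j] uninformed Finset.univ +
        Real.exp (-(l * x)) * (n / (n - l)) ^ j) := by
    intro j x
    simp [spreadFrom_univ]
  -- If the spreading takes longer than `x`, then either `j` rings do not suffice or the first `j`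
  -- rings take longer than `x`. The second term is the Chernoff bound for the latter: each waiting
  -- time of rate `n` has exponential moment `n / (n - l)`.
  induction j generalizing S x with
  | zero =>
    by_cases hS : S = Finset.univ
    · exact hS ▸ huniv 0 x
    · refine prob_le_one.trans ?_
      rw [← ENNReal.ofReal_one]
      refine ENNReal.ofReal_le_ofReal ?_
      simp only [Function.iterate_zero, id, uninformed, hS, if_false]
      have := Real.exp_nonneg (-(l * x))
      simp [this]
  | succ j ih =>
    by_cases hS : S = Finset.univ
    · exact hS ▸ huniv (j + 1) x
    rw [show {ω | ENNReal.ofReal x < spreadFrom S ω} =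
      {ω | spreadFrom S ω ∈ Set.Ioi (ENNReal.ofReal x)} from rfl,
      ← lintegral_indicator_spreadFrom q G measurableSet_Ioi S,
      lintegral_spreadFrom q G hn hS (measurable_one.indicator measurableSet_Ioi),
      Function.iterate_succ_apply']
    rw [pow_succ, ← mul_assoc]
    refine lintegral_expMeasure_chainOp q G hn hln
      (c := Real.exp (-(l * x)) * (n / (n - l)) ^ j) (by positivity) (hnn j) S
      (J := fun t S' => ∫⁻ ω, (Set.Ioi (ENNReal.ofReal x)).indicator 1
        (ENNReal.ofReal t + spreadFrom S' ω) ∂(law q G)) fun t S' ht => ?_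
    have he : Real.exp (-(l * x)) * (n / (n - l)) ^ j * Real.exp (l * t) =
        Real.exp (-(l * (x - t))) * (n / (n - l)) ^ j := by
      rw [mul_right_comm, ← Real.exp_add]
      ring_nf
    rw [he]
    -- When the first ring comes after time `x`, the exponential term is at least `1`, so the bound
    -- is trivial.
    rcases le_or_gt x t with hxt | hxt
    · have h1 : 1 ≤ Real.exp (-(l * (x - t))) := Real.one_le_exp (by nlinarith)
      have h2 : (1 : ℝ) ≤ (n / (n - l)) ^ j := one_le_pow₀ hr
      have h3 : (1 : ℝ) ≤ (chainOp (contactWeight q G))^[j] uninformed S' +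
          Real.exp (-(l * (x - t))) * (n / (n - l)) ^ j := by nlinarith [hnn j S']
      have h4 : ∫⁻ ω, (Set.Ioi (ENNReal.ofReal x)).indicator 1
          (ENNReal.ofReal t + spreadFrom S' ω) ∂(law q G) ≤ ∫⁻ _, 1 ∂(law q G) :=
        lintegral_mono fun ω => by
          rw [Set.indicator_apply]
          split_ifs <;> simp
      refine h4.trans (le_trans (le_of_eq ?_) (ENNReal.ofReal_le_ofReal h3))
      simp
    · refine le_trans (le_of_eq ?_) (ih S' (x - t))
      rw [show {ω | ENNReal.ofReal (x - t) < spreadFrom S' ω} =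
        {ω | spreadFrom S' ω ∈ Set.Ioi (ENNReal.ofReal (x - t))} from rfl,
        ← lintegral_indicator_spreadFrom q G measurableSet_Ioi S']
      refine lintegral_congr fun ω => ?_
      have h1 : ENNReal.ofReal x = ENNReal.ofReal t + ENNReal.ofReal (x - t) := by
        rw [← ENNReal.ofReal_add ht.le (by linarith)]
        ring_nf
      simp only [Set.indicator_apply, Set.mem_Ioi, h1,
        ENNReal.add_lt_add_iff_left ENNReal.ofReal_ne_top, Pi.one_apply]

/-- An upper bound for the lower tail of the spreading time. -/
theorem law_spreadFrom_le_le (q : I) (G : SimpleGraph (Fin n)) (hn : 0 < n) {l : ℝ} (hl : 0 < l)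
    (j : ℕ) (S : Finset (Fin n)) {x : ℝ} (hx : 0 ≤ x) :
    law q G {ω | spreadFrom S ω ≤ ENNReal.ofReal x} ≤
      ENNReal.ofReal (1 - (chainOp (contactWeight q G))^[j] uninformed S +
        Real.exp (l * x) * (n / (n + l)) ^ j) := by
  have hn' : (0 : ℝ) < n := by positivity
  have hle : ∀ j S, (chainOp (contactWeight q G))^[j] uninformed S ≤ 1 := by
    intro j
    induction j with
    | zero => exact uninformed_le_one
    | succ j ih =>
      intro S
      rw [Function.iterate_succ_apply']
      have := markovOp_mono (st := stepSet) (contactWeight_nonneg q G)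
        (sum_contactWeight_le_one q G hn) (g := fun _ => 1) (ih S) fun e => ih (stepSet S e)
      rwa [markovOp_const] at this
  have huniv : ∀ (j : ℕ) (x : ℝ), law q G {ω | spreadFrom Finset.univ ω ≤ ENNReal.ofReal x} ≤
      ENNReal.ofReal (1 - (chainOp (contactWeight q G))^[j] uninformed Finset.univ +
        Real.exp (l * x) * (n / (n + l)) ^ j) := by
    intro j x
    refine prob_le_one.trans ?_
    rw [← ENNReal.ofReal_one]
    refine ENNReal.ofReal_le_ofReal ?_
    rw [iterate_chainOp_univ]
    simp only [uninformed, if_true]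
    have : 0 ≤ Real.exp (l * x) * (n / (n + l)) ^ j := by positivity
    linarith
  induction j generalizing S x with
  | zero =>
    by_cases hS : S = Finset.univ
    · exact hS ▸ huniv 0 x
    · refine prob_le_one.trans ?_
      rw [← ENNReal.ofReal_one]
      refine ENNReal.ofReal_le_ofReal ?_
      simp only [Function.iterate_zero, id, uninformed, hS, if_false]
      have := Real.one_le_exp (mul_nonneg hl.le hx)
      simpa using this
  | succ j ih =>
    by_cases hS : S = Finset.univ
    · exact hS ▸ huniv (j + 1) x
    rw [show {ω | spreadFrom S ω ≤ ENNReal.ofReal x} =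
      {ω | spreadFrom S ω ∈ Set.Iic (ENNReal.ofReal x)} from rfl,
      ← lintegral_indicator_spreadFrom q G measurableSet_Iic S,
      lintegral_spreadFrom q G hn hS (measurable_one.indicator measurableSet_Iic),
      Function.iterate_succ_apply']
    rw [pow_succ, ← mul_assoc]
    -- The lower tail is the same one-step estimate, applied to the probability of being finished
    -- and with `-l` in place of `l`.
    have hsub : 1 - chainOp (contactWeight q G)
        ((chainOp (contactWeight q G))^[j] uninformed) S = chainOp (contactWeight q G)
        (fun S => 1 + (-1) * (chainOp (contactWeight q G))^[j] uninformed S) S := by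
      rw [chainOp, markovOp_add, markovOp_const, markovOp_const_mul]
      ring
    rw [hsub, show (n : ℝ) / (n + l) = n / (n - -l) by ring_nf]
    refine lintegral_expMeasure_chainOp q G hn (l := -l) (by linarith)
      (c := Real.exp (l * x) * (n / (n - -l)) ^ j)
      (by rw [sub_neg_eq_add]; positivity)
      (f := fun S => 1 + -1 * (chainOp (contactWeight q G))^[j] uninformed S)
      (fun S => by linarith [hle j S]) S
      (J := fun t S' => ∫⁻ ω, (Set.Iic (ENNReal.ofReal x)).indicator 1
        (ENNReal.ofReal t + spreadFrom S' ω) ∂(law q G)) fun t S' ht => ?_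
    have he : Real.exp (l * x) * (n / (n - -l)) ^ j * Real.exp (-l * t) =
        Real.exp (l * (x - t)) * (n / (n + l)) ^ j := by
      rw [mul_right_comm, ← Real.exp_add, sub_neg_eq_add]
      ring_nf
    rw [he]
    rcases lt_or_ge x t with hxt | hxt
    · refine le_trans (le_of_eq ?_) zero_le
      rw [← lintegral_zero (μ := law q G)]
      refine lintegral_congr fun ω => ?_
      refine Set.indicator_of_notMem ?_ _
      rw [Set.mem_Iic, not_le]
      exact ((ENNReal.ofReal_lt_ofReal_iff ht).2 hxt).trans_le le_self_add
    · rw [show 1 + -1 * (chainOp (contactWeight q G))^[j] uninformed S' =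
        1 - (chainOp (contactWeight q G))^[j] uninformed S' by ring]
      refine le_trans (le_of_eq ?_) (ih S' (x := x - t) (by linarith))
      rw [show {ω | spreadFrom S' ω ≤ ENNReal.ofReal (x - t)} =
        {ω | spreadFrom S' ω ∈ Set.Iic (ENNReal.ofReal (x - t))} from rfl,
        ← lintegral_indicator_spreadFrom q G measurableSet_Iic S']
      refine lintegral_congr fun ω => ?_
      have h1 : ENNReal.ofReal x = ENNReal.ofReal t + ENNReal.ofReal (x - t) := by
        rw [← ENNReal.ofReal_add ht.le (by linarith)]
        ring_nf
      simp only [Set.indicator_apply, Set.mem_Iic, h1,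
        ENNReal.add_le_add_iff_left ENNReal.ofReal_ne_top, Pi.one_apply]

end Rumor

end

noncomputable section

namespace Rumor

variable {n : ℕ}

/-! ### The expected spreading time -/

theorem InformedFrom.mono_set {S S' : Finset (Fin n)} (hS : S ⊆ S') {ω : Outcome n} {v : Fin n}
    {t : ℝ} (h : InformedFrom S ω v t) : InformedFrom S' ω v t := by
  induction h with
  | source hv ht => exact .source (hS hv) ht
  | push _ hr ht hc ih => exact .push ih hr ht hc
  | pull _ hr ht hc ih => exact .pull ih hr ht hc

theorem spreadFrom_anti {S S' : Finset (Fin n)} (hS : S ⊆ S') (ω : Outcome n) :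
    spreadFrom S' ω ≤ spreadFrom S ω :=
  le_iInf₂ fun t ht => iInf₂_le t fun v => (ht v).mono_set hS

/-- The expected spreading time from a set of informed nodes. -/
def meanFrom (q : I) (G : SimpleGraph (Fin n)) (S : Finset (Fin n)) : ℝ≥0∞ :=
  ∫⁻ ω, spreadFrom S ω ∂(law q G)

theorem meanTime_eq_meanFrom (q : I) (G : SimpleGraph (Fin n)) (s : Fin n) :
    meanTime q G s = meanFrom q G {s} := by
  rw [meanTime, meanFrom, spreadTime_eq_spreadFrom]

theorem sum_ofReal_contactWeight (q : I) (G : SimpleGraph (Fin n)) (hn : 0 < n) :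
    ∑ e, ENNReal.ofReal (contactWeight q G e) + ENNReal.ofReal (1 - q) = 1 := by
  rw [← ENNReal.ofReal_sum_of_nonneg fun e _ => contactWeight_nonneg q G e,
    sum_contactWeight q G hn, ← ENNReal.ofReal_add q.2.1 (by linarith [q.2.2])]
  simp

theorem lintegral_expMeasure_add (q : I) (G : SimpleGraph (Fin n)) (hn : 0 < n)
    (J : Finset (Fin n) → ℝ≥0∞) (S : Finset (Fin n)) :
    ∫⁻ t, (∑ e, ENNReal.ofReal (contactWeight q G e) * (ENNReal.ofReal t + J (stepSet S e))) +
        ENNReal.ofReal (1 - q) * (ENNReal.ofReal t + J S) ∂(expMeasure n) =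
      ENNReal.ofReal (1 / n) + ((∑ e, ENNReal.ofReal (contactWeight q G e) * J (stepSet S e)) +
        ENNReal.ofReal (1 - q) * J S) := by
  have hn' : (0 : ℝ) < n := by positivity
  have : IsProbabilityMeasure (expMeasure n) := isProbabilityMeasure_expMeasure hn'
  rw [← lintegral_id_expMeasure hn']
  have h : ∀ t : ℝ, (∑ e, ENNReal.ofReal (contactWeight q G e) *
      (ENNReal.ofReal t + J (stepSet S e))) + ENNReal.ofReal (1 - q) * (ENNReal.ofReal t + J S) =
      ENNReal.ofReal t + ((∑ e, ENNReal.ofReal (contactWeight q G e) * J (stepSet S e)) +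
        ENNReal.ofReal (1 - q) * J S) := fun t => by
    simp only [mul_add, Finset.sum_add_distrib, ← Finset.sum_mul]
    rw [add_add_add_comm, ← add_mul, sum_ofReal_contactWeight q G hn, one_mul]
  simp only [h]
  rw [lintegral_add_right _ measurable_const, lintegral_const, measure_univ, mul_one]

theorem meanFrom_eq (q : I) (G : SimpleGraph (Fin n)) (hn : 0 < n) {S : Finset (Fin n)}
    (hS : S ≠ Finset.univ) :
    meanFrom q G S = ENNReal.ofReal (1 / n) +
      ((∑ e, ENNReal.ofReal (contactWeight q G e) * meanFrom q G (stepSet S e)) +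
        ENNReal.ofReal (1 - q) * meanFrom q G S) := by
  rw [← lintegral_expMeasure_add q G hn (meanFrom q G) S]
  conv_lhs => rw [meanFrom, lintegral_spreadFrom q G hn hS (φ := fun x => x) measurable_id]
  have h : ∀ (t : ℝ) (S' : Finset (Fin n)),
      ∫⁻ ω, ENNReal.ofReal t + spreadFrom S' ω ∂(law q G) =
        ENNReal.ofReal t + meanFrom q G S' := fun t S' => by
    rw [lintegral_add_left measurable_const, lintegral_const, measure_univ, mul_one, meanFrom]
  simp only [h]

/-- The expected spreading time truncated at `N`. -/
def truncMean (q : I) (G : SimpleGraph (Fin n)) (N : ℕ) (S : Finset (Fin n)) : ℝ≥0∞ :=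
  ∫⁻ ω, min (spreadFrom S ω) N ∂(law q G)

theorem truncMean_ne_top (q : I) (G : SimpleGraph (Fin n)) (N : ℕ) (S : Finset (Fin n)) :
    truncMean q G N S ≠ ⊤ := by
  refine ne_top_of_le_ne_top (b := N) (by simp) ?_
  refine (lintegral_mono (g := fun _ => (N : ℝ≥0∞)) fun ω => min_le_right _ _).trans_eq ?_
  simp

theorem truncMean_anti (q : I) (G : SimpleGraph (Fin n)) (N : ℕ) {S S' : Finset (Fin n)}
    (h : S ⊆ S') : truncMean q G N S' ≤ truncMean q G N S :=
  lintegral_mono fun ω => min_le_min_right _ (spreadFrom_anti h ω)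

/-- Truncation turns the first-step equation into an inequality, but makes all terms finite, so that
they can be moved from one side to the other before the mean is known to be finite. -/
theorem truncMean_le (q : I) (G : SimpleGraph (Fin n)) (hn : 0 < n) (N : ℕ) {S : Finset (Fin n)}
    (hS : S ≠ Finset.univ) :
    truncMean q G N S ≤ ENNReal.ofReal (1 / n) +
      ((∑ e, ENNReal.ofReal (contactWeight q G e) * truncMean q G N (stepSet S e)) +
        ENNReal.ofReal (1 - q) * truncMean q G N S) := by
  rw [← lintegral_expMeasure_add q G hn (truncMean q G N) S]
  conv_lhs => rw [truncMean, lintegral_spreadFrom q G hn hS (φ := fun x => min x N)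
    (measurable_id.min measurable_const)]
  have h : ∀ (t : ℝ) (S' : Finset (Fin n)),
      ∫⁻ ω, min (ENNReal.ofReal t + spreadFrom S' ω) N ∂(law q G) ≤
        ENNReal.ofReal t + truncMean q G N S' := fun t S' => by
    have h1 : ENNReal.ofReal t + truncMean q G N S' =
        ∫⁻ ω, ENNReal.ofReal t + min (spreadFrom S' ω) N ∂(law q G) := by
      rw [lintegral_add_left measurable_const, lintegral_const, measure_univ, mul_one, truncMean]
    rw [h1]
    refine lintegral_mono fun ω => ?_
    rw [← min_add_add_left]
    exact min_le_min_left _ le_add_self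
  refine lintegral_mono fun t => ?_
  gcongr
  · exact h t _
  · exact h t _

theorem toReal_markov (q : I) (G : SimpleGraph (Fin n)) (hn : 0 < n)
    {J : Finset (Fin n) → ℝ≥0∞} {S : Finset (Fin n)} (hJ : ∀ S', S ⊆ S' → J S' ≠ ⊤) :
    ENNReal.ofReal (1 / n) +
      ((∑ e, ENNReal.ofReal (contactWeight q G e) * J (stepSet S e)) +
        ENNReal.ofReal (1 - q) * J S) =
      ENNReal.ofReal (1 / n + chainOp (contactWeight q G) (fun S => (J S).toReal) S) := by
  have h3 := ofReal_chainOp q G hn (f := fun S => (J S).toReal) (S := S)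
    fun S' _ => ENNReal.toReal_nonneg
  rw [ENNReal.ofReal_add (by positivity) (markovOp_nonneg (contactWeight_nonneg q G)
    (sum_contactWeight_le_one q G hn) (fun S => ENNReal.toReal_nonneg) S), ← h3]
  congr 2
  · refine Finset.sum_congr rfl fun e _ => ?_
    rw [ENNReal.ofReal_toReal (hJ _ (subset_stepSet S e))]
  · rw [ENNReal.ofReal_toReal (hJ _ subset_rfl)]

/-- The neighbours of a node. -/
def nbr (G : SimpleGraph (Fin n)) (u : Fin n) : Finset (Fin n) :=
  open Classical in Finset.univ.filter (G.Adj u)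

@[simp]
theorem mem_nbr {G : SimpleGraph (Fin n)} {u v : Fin n} : v ∈ nbr G u ↔ G.Adj u v := by
  simp [nbr]

/-- The degree of a node, as a real number. -/
def dg (G : SimpleGraph (Fin n)) (u : Fin n) : ℝ := (nbr G u).card

theorem dg_pos_of_adj {G : SimpleGraph (Fin n)} {u v : Fin n} (h : G.Adj u v) : 0 < dg G u := by
  unfold dg
  exact_mod_cast Finset.card_pos.2 ⟨v, mem_nbr.2 h⟩

theorem contactWeight_of_adj (q : I) {G : SimpleGraph (Fin n)} {u v : Fin n}
    (h : G.Adj u v) : contactWeight q G (u, v) = q / n * (1 / dg G u) := by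
  classical
  have hne : (G.neighborSet u).Nonempty := ⟨v, h⟩
  have h1 : G.neighborSet u = ↑(nbr G u) := by
    ext w
    simp
  rw [contactWeight, contactLaw, if_pos hne, measureReal_def, h1, ← Finset.coe_singleton,
    uniformOn_apply_finset, Finset.inter_singleton_of_mem (mem_nbr.2 h)]
  simp [dg]

theorem contactWeight_of_not_adj (q : I) {G : SimpleGraph (Fin n)} {u v : Fin n}
    (h : ¬ G.Adj u v) (huv : u ≠ v) : contactWeight q G (u, v) = 0 := by
  classical
  by_cases hne : (G.neighborSet u).Nonempty
  · have h1 : G.neighborSet u = ↑(nbr G u) := by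
      ext w
      simp
    rw [contactWeight, contactLaw, if_pos hne, measureReal_def, h1, ← Finset.coe_singleton,
      uniformOn_apply_finset, Finset.inter_singleton_of_notMem (by simpa using h)]
    simp
  · rw [contactWeight, contactLaw, if_neg hne, measureReal_def,
      Measure.dirac_apply' _ (measurableSet_singleton v)]
    simp [huv]

theorem contactWeight_eq_mul (q : I) (G : SimpleGraph (Fin n)) (e : Fin n × Fin n) :
    contactWeight q G e = q * contactWeight 1 G e := by
  simp only [contactWeight, Set.Icc.coe_one]
  ring

theorem stepSet_of_mem {V : Type*} [DecidableEq V] {S : Finset V} {u v : V}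
    (hu : u ∈ S) : stepSet S (u, v) = insert v S := by
  simp [stepSet, hu]

theorem exists_contactWeight_pos {q : I} (hq : 0 < q) {G : SimpleGraph (Fin n)}
    (hG : G.Connected) {S : Finset (Fin n)} (hne : S.Nonempty) (hS : S ≠ Finset.univ) :
    ∃ e, 0 < contactWeight q G e ∧ stepSet S e ≠ S := by
  obtain ⟨u, hu⟩ := hne
  obtain ⟨v, hv⟩ : ∃ v, v ∉ S := by
    by_contra! h'
    exact hS (Finset.eq_univ_iff_forall.2 h')
  obtain ⟨w⟩ := hG.preconnected u v
  obtain ⟨d, -, hd1, hd2⟩ := w.exists_boundary_dart (S : Set (Fin n)) hu hv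
  refine ⟨(d.fst, d.snd), ?_, ?_⟩
  · rw [contactWeight_of_adj q d.adj]
    have hq' : (0 : ℝ) < q := hq
    have hn : (0 : ℝ) < n := by exact_mod_cast u.pos
    have := dg_pos_of_adj d.adj
    positivity
  · rw [stepSet_of_mem hd1]
    intro h
    exact hd2 (h ▸ Finset.mem_insert_self _ _)

theorem sum_contactWeight_mul_sub_le {q : I} {G : SimpleGraph (Fin n)} {f : Finset (Fin n) → ℝ}
    {S : Finset (Fin n)} (h : f S ≤ 1 / n + chainOp (contactWeight q G) f S) :
    ∑ e, contactWeight q G e * (f S - f (stepSet S e)) ≤ 1 / n := by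
  have h1 : ∑ e, contactWeight q G e * (f S - f (stepSet S e)) =
      f S - chainOp (contactWeight q G) f S := by
    simp only [markovOp, mul_sub, Finset.sum_sub_distrib]
    ring
  linarith

theorem stepSet_card_lt {V : Type*} [DecidableEq V] {S : Finset V} {e : V × V}
    (h : stepSet S e ≠ S) : S.card < (stepSet S e).card :=
  Finset.card_lt_card ((subset_stepSet S e).ssubset_of_ne h.symm)

/-- On a connected graph some contact of positive weight enlarges `S`. All terms of the first-step
inequality are nonnegative, so keeping only this one bounds the value at `S` by the value at a
larger set plus a constant independent of `N`. Induction on the number of uninformed nodes finishes.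
-/
theorem exists_truncMean_le {q : I} (hq : 0 < q) {G : SimpleGraph (Fin n)} (hG : G.Connected)
    {S : Finset (Fin n)} (hne : S.Nonempty) :
    ∃ C : ℝ, ∀ N, (truncMean q G N S).toReal ≤ C := by
  obtain ⟨k, hk⟩ : ∃ k, k = n - S.card := ⟨_, rfl⟩
  induction k using Nat.strong_induction_on generalizing S with
  | _ k ih =>
  by_cases hS : S = Finset.univ
  · subst hS
    exact ⟨0, fun N => by simp [truncMean, spreadFrom_univ]⟩
  obtain ⟨e, he, hne'⟩ := exists_contactWeight_pos hq hG hne hS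
  have hlt := stepSet_card_lt hne'
  have hle : (stepSet S e).card ≤ n := by
    simpa using Finset.card_le_univ (stepSet S e)
  have hn : 0 < n := by omega
  obtain ⟨C, hC⟩ := ih _ (by omega) (hne.mono (subset_stepSet S e)) rfl
  refine ⟨C + 1 / n / contactWeight q G e, fun N => ?_⟩
  have h1 := truncMean_le q G hn N hS
  rw [toReal_markov q G hn fun S' _ => truncMean_ne_top q G N S'] at h1
  have h2 := ENNReal.toReal_mono ENNReal.ofReal_ne_top h1
  rw [ENNReal.toReal_ofReal (add_nonneg (by positivity) (markovOp_nonneg (contactWeight_nonneg q G)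
    (sum_contactWeight_le_one q G hn) (fun S => ENNReal.toReal_nonneg) S))] at h2
  have h3 := sum_contactWeight_mul_sub_le (f := fun S => (truncMean q G N S).toReal) h2
  have h4 := Finset.single_le_sum (f := fun e => contactWeight q G e *
    ((truncMean q G N S).toReal - (truncMean q G N (stepSet S e)).toReal)) (fun e _ => ?_)
    (Finset.mem_univ e)
  · have h5 := h4.trans h3
    have h6 : (truncMean q G N S).toReal - (truncMean q G N (stepSet S e)).toReal ≤
        1 / n / contactWeight q G e := by
      rw [le_div_iff₀ he]
      linarith
    linarith [hC N]
  · refine mul_nonneg (contactWeight_nonneg q G e) (sub_nonneg.2 ?_)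
    exact ENNReal.toReal_mono (truncMean_ne_top _ _ _ _)
      (truncMean_anti q G N (subset_stepSet S e))

theorem meanFrom_ne_top {q : I} (hq : 0 < q) {G : SimpleGraph (Fin n)} (hG : G.Connected)
    {S : Finset (Fin n)} (hne : S.Nonempty) : meanFrom q G S ≠ ⊤ := by
  obtain ⟨C, hC⟩ := exists_truncMean_le hq hG hne
  refine ne_top_of_le_ne_top (b := ENNReal.ofReal C) ENNReal.ofReal_ne_top ?_
  have h1 : meanFrom q G S = ⨆ N : ℕ, truncMean q G N S := by
    unfold meanFrom truncMean
    rw [← lintegral_iSup fun N => (measurable_spreadFrom S).min measurable_const]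
    · refine lintegral_congr fun ω => ?_
      rw [← inf_iSup_eq, ENNReal.iSup_natCast, inf_top_eq]
    · intro N M hNM ω
      exact min_le_min_left _ (by exact_mod_cast hNM)
  rw [h1]
  refine iSup_le fun N => ?_
  rw [← ENNReal.ofReal_toReal (truncMean_ne_top q G N S)]
  exact ENNReal.ofReal_le_ofReal (hC N)

/-- The expected spreading time as a real number. -/
def meanReal (q : I) (G : SimpleGraph (Fin n)) (S : Finset (Fin n)) : ℝ := (meanFrom q G S).toReal

theorem meanReal_univ (q : I) (G : SimpleGraph (Fin n)) : meanReal q G Finset.univ = 0 := by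
  simp [meanReal, meanFrom, spreadFrom_univ]

theorem meanReal_nonneg (q : I) (G : SimpleGraph (Fin n)) (S : Finset (Fin n)) :
    0 ≤ meanReal q G S := ENNReal.toReal_nonneg

theorem meanReal_eq {q : I} (hq : 0 < q) {G : SimpleGraph (Fin n)} (hG : G.Connected)
    {S : Finset (Fin n)} (hne : S.Nonempty) (hS : S ≠ Finset.univ) :
    meanReal q G S = 1 / n + chainOp (contactWeight q G) (meanReal q G) S := by
  have hn : 0 < n := by
    obtain ⟨u, -⟩ := hne
    exact u.pos
  have h1 := meanFrom_eq q G hn hS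
  rw [toReal_markov q G hn fun S' h => meanFrom_ne_top hq hG (hne.mono h)] at h1
  have h2 := congrArg ENNReal.toReal h1
  rw [ENNReal.toReal_ofReal (add_nonneg (by positivity) (markovOp_nonneg (contactWeight_nonneg q G)
    (sum_contactWeight_le_one q G hn) (fun S => ENNReal.toReal_nonneg) S))] at h2
  exact h2

theorem sum_contactWeight_meanReal {q : I} (hq : 0 < q) {G : SimpleGraph (Fin n)}
    (hG : G.Connected) {S : Finset (Fin n)} (hne : S.Nonempty) (hS : S ≠ Finset.univ) :
    ∑ e, contactWeight q G e * (meanReal q G S - meanReal q G (stepSet S e)) = 1 / n := by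
  have h := meanReal_eq hq hG hne hS
  simp only [markovOp, mul_sub, Finset.sum_sub_distrib] at h ⊢
  linarith

/-- Weights for success probability `q` are `q` times those for `1`, so both sides satisfy the same
first-step equation. In the difference of the two equations the contacts that leave `S` unchanged
contribute nothing, and the induction hypothesis lets the larger sets cancel. What remains is the
difference at `S` times a positive weight. -/
theorem mul_meanReal {q : I} (hq : 0 < q) {G : SimpleGraph (Fin n)} (hG : G.Connected)
    {S : Finset (Fin n)} (hne : S.Nonempty) : q * meanReal q G S = meanReal 1 G S := by
  obtain ⟨k, hk⟩ : ∃ k, k = n - S.card := ⟨_, rfl⟩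
  induction k using Nat.strong_induction_on generalizing S with
  | _ k ih =>
  by_cases hS : S = Finset.univ
  · subst hS
    simp [meanReal_univ]
  have h1 := sum_contactWeight_meanReal hq hG hne hS
  have h2 := sum_contactWeight_meanReal (q := 1) one_pos hG hne hS
  have h3 : ∑ e, contactWeight 1 G e * ((q * meanReal q G S - meanReal 1 G S) *
      if stepSet S e = S then 0 else 1) = 0 := by
    refine Eq.trans ?_ (sub_eq_zero.2 (h1.trans h2.symm))
    rw [← Finset.sum_sub_distrib]
    refine Finset.sum_congr rfl fun e _ => ?_
    rw [contactWeight_eq_mul q]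
    split_ifs with he
    · rw [he]
      ring
    · have hlt := stepSet_card_lt he
      have hle : (stepSet S e).card ≤ n := by
        simpa using Finset.card_le_univ (stepSet S e)
      have := ih _ (by omega) (hne.mono (subset_stepSet S e)) rfl
      linear_combination (contactWeight 1 G e) * this
  obtain ⟨e, he, hne'⟩ := exists_contactWeight_pos (q := 1) one_pos hG hne hS
  have h4 : (q * meanReal q G S - meanReal 1 G S) *
      ∑ e, contactWeight 1 G e * (if stepSet S e = S then 0 else 1) = 0 := by
    refine Eq.trans ?_ h3
    rw [Finset.mul_sum]
    exact Finset.sum_congr rfl fun e _ => by ring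
  have h5 : 0 < ∑ e, contactWeight 1 G e * (if stepSet S e = S then (0 : ℝ) else 1) := by
    refine Finset.sum_pos' (fun e _ => mul_nonneg (contactWeight_nonneg _ _ _) ?_)
      ⟨e, Finset.mem_univ e, ?_⟩
    · split_ifs <;> norm_num
    · simpa [hne'] using he
  rcases mul_eq_zero.1 h4 with h | h
  · linarith
  · exact absurd h h5.ne'

theorem meanFrom_eq_div {q : I} (hq : 0 < q) {G : SimpleGraph (Fin n)} (hG : G.Connected)
    {S : Finset (Fin n)} (hne : S.Nonempty) :
    meanFrom q G S = meanFrom 1 G S / ENNReal.ofReal q := by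
  have hq' : (0 : ℝ) < q := hq
  have h := mul_meanReal hq hG hne
  rw [← ENNReal.ofReal_toReal (meanFrom_ne_top hq hG hne),
    ← ENNReal.ofReal_toReal (meanFrom_ne_top (q := 1) one_pos hG hne),
    ← ENNReal.ofReal_div_of_pos hq']
  congr 1
  rw [eq_div_iff hq'.ne', mul_comm]
  exact h

end Rumor

end

noncomputable section

namespace Rumor

/-! ### Comparison lemmas for the chain of informed sets -/

section Chain

set_option linter.unusedSectionVars false

variable {V : Type*} [Fintype V] [DecidableEq V] {b : V × V → ℝ}

/-- The comparison is needed only on a set of states `R` that steps of nonzero weight do not leave,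
such as nonempty sets or sets that avoid a node. -/
theorem iterate_markovOp_mono_on {st : Finset V → V × V → Finset V} (hb0 : ∀ e, 0 ≤ b e)
    (hb1 : ∑ e, b e ≤ 1) {R : Finset V → Prop} (hR : ∀ S e, R S → b e ≠ 0 → R (st S e))
    {f g : Finset V → ℝ} (h : ∀ S, R S → f S ≤ g S) (j : ℕ) {S : Finset V} (hS : R S) :
    (markovOp st b)^[j] f S ≤ (markovOp st b)^[j] g S := by
  induction j generalizing S with
  | zero => exact h S hS
  | succ j ih =>
    rw [Function.iterate_succ_apply', Function.iterate_succ_apply']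
    have key : ∀ k : Finset V → ℝ, markovOp st b k S =
        ∑ e, b e * k (st S e) + (1 - ∑ e, b e) * k S := fun k => by
      simp only [markovOp, mul_sub, Finset.sum_sub_distrib, ← Finset.sum_mul]
      ring
    rw [key, key]
    refine add_le_add (Finset.sum_le_sum fun e _ => ?_)
      (mul_le_mul_of_nonneg_left (ih hS) (by linarith))
    by_cases he : b e = 0
    · simp [he]
    · exact mul_le_mul_of_nonneg_left (ih (hR S e hS he)) (hb0 e)

theorem iterate_markovOp_mono {st : Finset V → V × V → Finset V} (hb0 : ∀ e, 0 ≤ b e)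
    (hb1 : ∑ e, b e ≤ 1) {f g : Finset V → ℝ} (h : ∀ S, f S ≤ g S) (j : ℕ) (S : Finset V) :
    (markovOp st b)^[j] f S ≤ (markovOp st b)^[j] g S :=
  iterate_markovOp_mono_on hb0 hb1 (R := fun _ => True) (fun _ _ _ _ => trivial)
    (fun S _ => h S) j trivial

theorem iterate_markovOp_const (st : Finset V → V × V → Finset V) (b : V × V → ℝ) (c : ℝ) (j : ℕ) :
    (markovOp st b)^[j] (fun _ => c) = fun _ => c := by
  induction j with
  | zero => rfl
  | succ j ih => rw [Function.iterate_succ_apply', ih, markovOp_const]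

theorem iterate_markovOp_add (st : Finset V → V × V → Finset V) (b : V × V → ℝ)
    (f g : Finset V → ℝ) (j : ℕ) : (markovOp st b)^[j] (fun S => f S + g S) =
      fun S => (markovOp st b)^[j] f S + (markovOp st b)^[j] g S := by
  induction j generalizing f g with
  | zero => rfl
  | succ j ih =>
    simp only [Function.iterate_succ_apply]
    rw [markovOp_add, ih]

theorem iterate_markovOp_const_mul (st : Finset V → V × V → Finset V) (b : V × V → ℝ) (c : ℝ)
    (f : Finset V → ℝ) (j : ℕ) : (markovOp st b)^[j] (fun S => c * f S) =
      fun S => c * (markovOp st b)^[j] f S := by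
  induction j generalizing f with
  | zero => rfl
  | succ j ih =>
    simp only [Function.iterate_succ_apply]
    rw [markovOp_const_mul, ih]

theorem iterate_markovOp_sum {ι : Type*} (s : Finset ι) (st : Finset V → V × V → Finset V)
    (b : V × V → ℝ) (f : ι → Finset V → ℝ) (j : ℕ) :
    (markovOp st b)^[j] (fun S => ∑ i ∈ s, f i S) =
      fun S => ∑ i ∈ s, (markovOp st b)^[j] (f i) S := by
  classical
  induction s using Finset.induction_on with
  | empty => simp [iterate_markovOp_const]
  | insert i s hi ih =>
    simp only [Finset.sum_insert hi]
    rw [iterate_markovOp_add, ih]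

/-- Splitting the run of a chain into two phases. -/
theorem iterate_markovOp_two_phase {st : Finset V → V × V → Finset V} (hb0 : ∀ e, 0 ≤ b e)
    (hb1 : ∑ e, b e ≤ 1) {R : Finset V → Prop} (hR : ∀ S e, R S → b e ≠ 0 → R (st S e))
    {f : Finset V → ℝ} (hf1 : ∀ S, f S ≤ 1) {Bad : Finset V → ℝ} (hBad : ∀ S, 0 ≤ Bad S)
    {j k : ℕ} {ε ε' : ℝ} (hε : 0 ≤ ε)
    (h : ∀ S, R S → Bad S < 1 → (markovOp st b)^[k] f S ≤ ε)
    {S : Finset V} (hS : R S) (hj : (markovOp st b)^[j] Bad S ≤ ε') :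
    (markovOp st b)^[j + k] f S ≤ ε' + ε := by
  rw [Function.iterate_add_apply]
  -- `Bad` need not be an indicator: it has to be at least `1` where the second phase may fail. A
  -- sum of indicators is allowed, which builds in a union bound.
  have h1 : ∀ S, R S → (markovOp st b)^[k] f S ≤ Bad S + ε := by
    intro S hS
    by_cases hB : Bad S < 1
    · linarith [h S hS hB, hBad S]
    · have := iterate_markovOp_mono (st := st) hb0 hb1 (g := fun _ => 1) hf1 k S
      rw [iterate_markovOp_const] at this
      linarith
  refine (iterate_markovOp_mono_on hb0 hb1 hR h1 j hS).trans ?_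
  rw [iterate_markovOp_add, iterate_markovOp_const]
  linarith

theorem markovOp_antitone {st : Finset V → V × V → Finset V}
    (hst : ∀ S S' e, S ⊆ S' → st S e ⊆ st S' e) (hb0 : ∀ e, 0 ≤ b e) (hb1 : ∑ e, b e ≤ 1)
    {f : Finset V → ℝ} (hf : Antitone f) : Antitone (markovOp st b f) := by
  intro S S' h
  have key : ∀ S, markovOp st b f S =
      ∑ e, b e * f (st S e) + (1 - ∑ e, b e) * f S := fun S => by
    simp only [markovOp, mul_sub, Finset.sum_sub_distrib, ← Finset.sum_mul]
    ring
  rw [key, key]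
  exact add_le_add (Finset.sum_le_sum fun e _ =>
    mul_le_mul_of_nonneg_left (hf (hst S S' e h)) (hb0 e))
    (mul_le_mul_of_nonneg_left (hf h) (by linarith))

theorem iterate_markovOp_antitone {st : Finset V → V × V → Finset V}
    (hst : ∀ S S' e, S ⊆ S' → st S e ⊆ st S' e) (hb0 : ∀ e, 0 ≤ b e) (hb1 : ∑ e, b e ≤ 1)
    {f : Finset V → ℝ} (hf : Antitone f) (j : ℕ) : Antitone ((markovOp st b)^[j] f) := by
  induction j with
  | zero => exact hf
  | succ j ih =>
    rw [Function.iterate_succ_apply']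
    exact markovOp_antitone hst hb0 hb1 ih

theorem stepSet_mono (S S' : Finset V) (e : V × V) (h : S ⊆ S') :
    stepSet S e ⊆ stepSet S' e := by
  unfold stepSet
  split_ifs with h1 h2
  · exact Finset.insert_subset_insert _ (Finset.insert_subset_insert _ h)
  · exact absurd (h1.imp (fun x => h x) fun x => h x) h2
  · exact h.trans ((Finset.subset_insert _ _).trans (Finset.subset_insert _ _))
  · exact h

/-- The set of touched nodes after a contact. -/
def touchSet (S : Finset V) (e : V × V) : Finset V := insert e.1 (insert e.2 S)

theorem touchSet_mono (S S' : Finset V) (e : V × V) (h : S ⊆ S') :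
    touchSet S e ⊆ touchSet S' e :=
  Finset.insert_subset_insert _ (Finset.insert_subset_insert _ h)

theorem stepSet_subset_touchSet (S : Finset V) (e : V × V) : stepSet S e ⊆ touchSet S e := by
  unfold stepSet touchSet
  split_ifs
  · rfl
  · exact (Finset.subset_insert _ _).trans (Finset.subset_insert _ _)

/-- Nodes that are informed have been touched. -/
theorem iterate_touch_le_iterate_chainOp (hb0 : ∀ e, 0 ≤ b e) (hb1 : ∑ e, b e ≤ 1)
    {f : Finset V → ℝ} (hf : Antitone f) (j : ℕ) (S : Finset V) :
    (markovOp touchSet b)^[j] f S ≤ (chainOp b)^[j] f S := by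
  induction j generalizing S with
  | zero => exact le_rfl
  | succ j ih =>
    rw [Function.iterate_succ_apply', Function.iterate_succ_apply']
    -- Both chains are run with the same contacts. A step of the touched chain leads to a larger
    -- set, on which the antitone functional is smaller.
    refine le_trans ?_ (markovOp_mono hb0 hb1 (ih S) fun e => ih _)
    have := iterate_markovOp_antitone (b := b) touchSet_mono hb0 hb1 hf j
    unfold markovOp
    gcongr with e _
    · exact hb0 e
    · exact this (stepSet_subset_touchSet S e)

/-- Contacts with smaller probabilities inform fewer nodes. -/
theorem iterate_chainOp_le_of_le {b' : V × V → ℝ} (hb0 : ∀ e, 0 ≤ b e) (hb1 : ∑ e, b e ≤ 1)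
    (hb'0 : ∀ e, 0 ≤ b' e) (hle : ∀ e, b' e ≤ b e) {f : Finset V → ℝ} (hf : Antitone f) (j : ℕ)
    (S : Finset V) : (chainOp b)^[j] f S ≤ (chainOp b')^[j] f S := by
  have hb'1 : ∑ e, b' e ≤ 1 := (Finset.sum_le_sum fun e _ => hle e).trans hb1
  induction j generalizing S with
  | zero => exact le_rfl
  | succ j ih =>
    rw [Function.iterate_succ_apply', Function.iterate_succ_apply']
    refine le_trans ?_ (markovOp_mono hb'0 hb'1 (ih S) fun e => ih _)
    have := iterate_markovOp_antitone (b := b) stepSet_mono hb0 hb1 hf j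
    unfold chainOp markovOp
    refine add_le_add le_rfl (Finset.sum_le_sum fun e _ => ?_)
    exact mul_le_mul_of_nonpos_right (hle e) (sub_nonpos.2 (this (subset_stepSet S e)))

/-- Sums over contacts, in terms of the edges that leave `S`. -/
theorem sum_stepSet (b : V × V → ℝ) (f : Finset V → ℝ) (S : Finset V) :
    ∑ e, b e * (f (stepSet S e) - f S) =
      ∑ u ∈ S, ∑ v ∈ Sᶜ, (b (u, v) + b (v, u)) * (f (insert v S) - f S) := by
  rw [Fintype.sum_prod_type, ← Finset.sum_add_sum_compl S]
  have h1 : ∀ u ∈ S, ∑ v, b (u, v) * (f (stepSet S (u, v)) - f S) =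
      ∑ v ∈ Sᶜ, b (u, v) * (f (insert v S) - f S) := by
    intro u hu
    rw [← Finset.sum_add_sum_compl S]
    have : ∑ v ∈ S, b (u, v) * (f (stepSet S (u, v)) - f S) = 0 :=
      Finset.sum_eq_zero fun v hv => by simp [stepSet, hu, hv]
    rw [this, zero_add]
    exact Finset.sum_congr rfl fun v _ => by rw [stepSet_of_mem hu]
  have h2 : ∀ u ∈ Sᶜ, ∑ v, b (u, v) * (f (stepSet S (u, v)) - f S) =
      ∑ v ∈ S, b (u, v) * (f (insert u S) - f S) := by
    intro u hu
    rw [← Finset.sum_add_sum_compl S]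
    have : ∑ v ∈ Sᶜ, b (u, v) * (f (stepSet S (u, v)) - f S) = 0 :=
      Finset.sum_eq_zero fun v hv => by
        rw [Finset.mem_compl] at hu hv
        simp [stepSet, hu, hv]
    rw [this, add_zero]
    refine Finset.sum_congr rfl fun v hv => ?_
    simp [stepSet, hv]
  rw [Finset.sum_congr rfl h1, Finset.sum_congr rfl h2, Finset.sum_comm (s := Sᶜ),
    ← Finset.sum_add_distrib]
  refine Finset.sum_congr rfl fun u _ => ?_
  rw [← Finset.sum_add_distrib]
  exact Finset.sum_congr rfl fun v _ => by ring

theorem stepSet_card_le (S : Finset V) (e : V × V) : (stepSet S e).card ≤ S.card + 1 := by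
  unfold stepSet
  split_ifs with h
  · rcases h with h | h
    · rw [Finset.insert_eq_of_mem (Finset.mem_insert_of_mem h)]
      exact Finset.card_insert_le _ _
    · rw [Finset.insert_eq_of_mem h]
      exact Finset.card_insert_le _ _
  · omega

/-- An exponential bound for the probability that a statistic of the informed set that grows in
steps of size at most `1` has not reached `K` after `j` steps. -/
theorem iterate_chainOp_lt_le (hb0 : ∀ e, 0 ≤ b e) (hb1 : ∑ e, b e ≤ 1)
    {R : Finset V → Prop} (hR : ∀ S e, R S → b e ≠ 0 → R (stepSet S e))
    {g : Finset V → ℕ} (hg : ∀ S e, g S ≤ g (stepSet S e)) (hg1 : ∀ S e, g (stepSet S e) ≤ g S + 1)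
    {K : ℕ} {a : ℕ → ℝ} {s : ℝ} (hs : 0 ≤ s) (hs1 : s ≤ 1) (ha : ∀ i < K, s < a i)
    (hrate : ∀ S, R S → g S < K → a (g S) ≤ ∑ e, b e * ((g (stepSet S e) : ℝ) - g S))
    (j : ℕ) {S : Finset V} (hS : R S) :
    (chainOp b)^[j] (fun S => if g S < K then 1 else 0) S ≤
      (1 - s) ^ j * ∏ i ∈ Finset.Ico (g S) K, (1 + s / (a i - s)) := by
  have hfac : ∀ i < K, (1 : ℝ) ≤ 1 + s / (a i - s) := fun i hi => by
    have := div_nonneg hs (sub_nonneg.2 (ha i hi).le)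
    linarith
  have hprod : ∀ m, 1 ≤ ∏ i ∈ Finset.Ico m K, (1 + s / (a i - s)) := fun m => by
    have : ∏ i ∈ Finset.Ico m K, (1 : ℝ) ≤ ∏ i ∈ Finset.Ico m K, (1 + s / (a i - s)) :=
      Finset.prod_le_prod (fun _ _ => zero_le_one) fun i hi => hfac i (Finset.mem_Ico.1 hi).2
    simpa using this
  induction j generalizing S with
  | zero =>
    simp only [Function.iterate_zero, id, pow_zero, one_mul]
    split_ifs
    · exact hprod _
    · exact zero_le_one.trans (hprod _)
  | succ j ih =>
    have h1s : 0 ≤ (1 - s) ^ j := pow_nonneg (by linarith) j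
    rw [Function.iterate_succ_apply']
    by_cases hK : g S < K
    · have h1 : chainOp b ((chainOp b)^[j] fun S => if g S < K then 1 else 0) S ≤
          chainOp b (fun S => (1 - s) ^ j * ∏ i ∈ Finset.Ico (g S) K, (1 + s / (a i - s))) S := by
        have := iterate_markovOp_mono_on (st := stepSet) hb0 hb1 hR (fun S hS => ih hS) 1 hS
        simpa using this
      refine h1.trans ?_
      rw [chainOp, markovOp_const_mul]
      -- The factor `1 + s / (a i - s)` equals `a i / (a i - s)`, the mean of `(1 - s) ^ (-τ)` for a
      -- geometric waiting time `τ` with success probability `a i`. So this is the Chernoff bound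
      -- for a sum of independent geometric times. The identity `a m * (F m - F (m + 1)) = s * F m`
      -- makes `(1 - s) ^ (-j) * F (g S_j)` a supermartingale.
      set F : ℕ → ℝ := fun m => ∏ i ∈ Finset.Ico m K, (1 + s / (a i - s)) with hF
      have hFS : F (g S) = (1 + s / (a (g S) - s)) * F (g S + 1) := by
        simp only [hF]
        rw [Finset.prod_eq_prod_Ico_succ_bot hK]
      have hpos := sub_pos.2 (ha _ hK)
      have h2 : markovOp stepSet b (fun S => F (g S)) S = F (g S) -
          (∑ e, b e * ((g (stepSet S e) : ℝ) - g S)) * (s / (a (g S) - s) * F (g S + 1)) := by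
        unfold markovOp
        rw [sub_eq_add_neg, ← neg_mul, ← Finset.sum_neg_distrib, Finset.sum_mul]
        congr 1
        refine Finset.sum_congr rfl fun e _ => ?_
        beta_reduce
        rcases (hg S e).lt_or_eq with h | h
        · have : g (stepSet S e) = g S + 1 := le_antisymm (hg1 S e) h
          rw [this, hFS]
          push_cast
          ring
        · rw [← h]
          ring
      have h3 := hrate S hS hK
      have hF1 : 1 ≤ F (g S + 1) := hprod _
      have h4 : a (g S) * (s / (a (g S) - s) * F (g S + 1)) = s * F (g S) := by
        rw [hFS]
        field_simp
        ring
      have h5 : s * F (g S) ≤ (∑ e, b e * ((g (stepSet S e) : ℝ) - g S)) *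
          (s / (a (g S) - s) * F (g S + 1)) := by
        rw [← h4]
        exact mul_le_mul_of_nonneg_right h3
          (mul_nonneg (div_nonneg hs hpos.le) (zero_le_one.trans hF1))
      change (1 - s) ^ j * markovOp stepSet b (fun S => F (g S)) S ≤ (1 - s) ^ (j + 1) * F (g S)
      rw [h2, pow_succ, mul_assoc]
      exact mul_le_mul_of_nonneg_left (by linarith) h1s
    · have hz : ∀ (i : ℕ) (S : Finset V), ¬ g S < K →
          (chainOp b)^[i] (fun S => if g S < K then (1 : ℝ) else 0) S = 0 := by
        intro i
        induction i with
        | zero =>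
          intro S hS
          simp [hS]
        | succ i ih =>
          intro S hS
          rw [Function.iterate_succ_apply']
          simp only [markovOp]
          rw [ih S hS, Finset.sum_eq_zero fun e _ => ?_, add_zero]
          rw [ih _ (by have := hg S e; omega)]
          simp
      have := hz (j + 1) S hK
      rw [Function.iterate_succ_apply'] at this
      rw [this]
      exact mul_nonneg (pow_nonneg (by linarith) _) (zero_le_one.trans (hprod _))

/-- An exponential bound for the probability that everything is informed after `j` steps. -/
theorem one_sub_iterate_chainOp_le (hb0 : ∀ e, 0 ≤ b e) (hb1 : ∑ e, b e ≤ 1)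
    {a : ℕ → ℝ} {s : ℝ} (hs : 0 ≤ s) (ha : ∀ i < Fintype.card V, 0 < i → 0 < a i)
    (hrate : ∀ S : Finset V, S.Nonempty → S ≠ Finset.univ →
      ∑ e, b e * (((stepSet S e).card : ℝ) - S.card) ≤ a S.card)
    (j : ℕ) {S : Finset V} (hS : S.Nonempty) :
    1 - (chainOp b)^[j] uninformed S ≤
      (1 + s) ^ j * ∏ i ∈ Finset.Ico S.card (Fintype.card V), (1 + s / a i)⁻¹ := by
  -- Here `(1 + s / a i)⁻¹` is the mean of `(1 + s) ^ (-τ)` for a geometric waiting time `τ` with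
  -- success probability `a i`, so the estimate is the Chernoff bound for the lower tail of their
  -- sum.
  set F : ℕ → ℝ := fun m => ∏ i ∈ Finset.Ico m (Fintype.card V), (1 + s / a i)⁻¹ with hF
  have hF0 : ∀ m, 0 < m → 0 ≤ F m := fun m hm => Finset.prod_nonneg fun i hi => by
    have hi := Finset.mem_Ico.1 hi
    have := div_nonneg hs (ha i hi.2 (by omega)).le
    positivity
  suffices h : ∀ j (S : Finset V), S.Nonempty →
      (chainOp b)^[j] (fun S => 1 - uninformed S) S ≤ (1 + s) ^ j * F S.card by
    have h1 : (fun S : Finset V => 1 - uninformed S) = fun S => 1 + (-1) * uninformed S := by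
      funext S
      ring
    have h2 := h j S hS
    rw [h1, iterate_markovOp_add, iterate_markovOp_const, iterate_markovOp_const_mul] at h2
    linarith
  intro j
  induction j with
  | zero =>
    intro S hS
    simp only [Function.iterate_zero, id, pow_zero, one_mul, uninformed]
    split_ifs with h
    · subst h
      simp [hF, Finset.card_univ]
    · simpa using hF0 _ hS.card_pos
  | succ j ih =>
    intro S hS
    rw [Function.iterate_succ_apply']
    by_cases hu : S = Finset.univ
    · subst hu
      rw [chainOp_univ, iterate_chainOp_univ]
      simp only [uninformed, if_true, hF, Finset.card_univ, Finset.Ico_self, Finset.prod_empty]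
      simpa using one_le_pow₀ (by linarith : (1 : ℝ) ≤ 1 + s)
    have hlt : S.card < Fintype.card V := by
      rw [← Finset.card_univ]
      exact Finset.card_lt_card (Finset.ssubset_univ_iff.2 hu)
    have h1 : chainOp b ((chainOp b)^[j] fun S => 1 - uninformed S) S ≤
        chainOp b (fun S => (1 + s) ^ j * F S.card) S :=
      markovOp_mono hb0 hb1 (ih S hS) fun e => ih _ (hS.mono (subset_stepSet S e))
    refine h1.trans ?_
    rw [chainOp, markovOp_const_mul, pow_succ, mul_assoc]
    refine mul_le_mul_of_nonneg_left ?_ (by positivity)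
    have hpos := ha _ hlt hS.card_pos
    have hFS : F (S.card + 1) = (1 + s / a S.card) * F S.card := by
      simp only [hF]
      rw [Finset.prod_eq_prod_Ico_succ_bot hlt, ← mul_assoc, mul_inv_cancel₀, one_mul]
      positivity
    have h2 : markovOp stepSet b (fun S => F S.card) S = F S.card +
        (∑ e, b e * (((stepSet S e).card : ℝ) - S.card)) * (s / a S.card * F S.card) := by
      unfold markovOp
      rw [Finset.sum_mul]
      congr 1
      refine Finset.sum_congr rfl fun e _ => ?_
      beta_reduce
      rcases (Finset.card_le_card (subset_stepSet S e)).lt_or_eq with h | h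
      · have : (stepSet S e).card = S.card + 1 := le_antisymm (stepSet_card_le S e) h
        rw [this, hFS]
        push_cast
        ring
      · rw [← h]
        ring
    rw [h2]
    have h3 := hrate S hS hu
    have h4 : a S.card * (s / a S.card * F S.card) = s * F S.card := by
      field_simp
    have h5 := mul_le_mul_of_nonneg_right h3
      (mul_nonneg (div_nonneg hs hpos.le) (hF0 _ hS.card_pos))
    rw [h4] at h5
    linarith

/-- An upper bound for a hitting time functional. -/
theorem hitting_le_sum (hb0 : ∀ e, 0 ≤ b e) {m : Finset V → ℝ} {τ : ℝ} (hτ : 0 ≤ τ)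
    (hm0 : m Finset.univ = 0)
    (hm : ∀ S : Finset V, S.Nonempty → S ≠ Finset.univ →
      ∑ e, b e * (m S - m (stepSet S e)) = τ)
    {a : ℕ → ℝ} (ha : ∀ i < Fintype.card V, 0 < i → 0 < a i)
    (hrate : ∀ S : Finset V, S.Nonempty → S ≠ Finset.univ →
      a S.card ≤ ∑ e, b e * (((stepSet S e).card : ℝ) - S.card))
    {S : Finset V} (hS : S.Nonempty) :
    m S ≤ ∑ i ∈ Finset.Ico S.card (Fintype.card V), τ / a i := by
  obtain ⟨k, hk⟩ : ∃ k, k = Fintype.card V - S.card := ⟨_, rfl⟩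
  induction k using Nat.strong_induction_on generalizing S with
  | _ k ih =>
  by_cases hu : S = Finset.univ
  · subst hu
    simp [hm0, Finset.card_univ]
  have hlt : S.card < Fintype.card V := by
    rw [← Finset.card_univ]
    exact Finset.card_lt_card (Finset.ssubset_univ_iff.2 hu)
  have hpos := ha _ hlt hS.card_pos
  have h3 := hrate S hS hu
  set r := ∑ e, b e * (((stepSet S e).card : ℝ) - S.card) with hr
  set H := ∑ i ∈ Finset.Ico (S.card + 1) (Fintype.card V), τ / a i with hH
  -- Every contact that changes `S` adds exactly one node, and from there the induction hypothesis
  -- bounds the remaining time by `H`. The equation for `m S` then bounds its excess over `H`.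
  have h1 : r * (m S - H) ≤ τ := by
    rw [← hm S hS hu, hr, Finset.sum_mul]
    refine Finset.sum_le_sum fun e _ => ?_
    rcases (Finset.card_le_card (subset_stepSet S e)).lt_or_eq with h | h
    · have hc : (stepSet S e).card = S.card + 1 := le_antisymm (stepSet_card_le S e) h
      have h2 := ih _ (by omega) (hS.mono (subset_stepSet S e)) rfl
      rw [hc, ← hH] at h2
      rw [hc]
      push_cast
      rw [mul_assoc]
      exact mul_le_mul_of_nonneg_left (by linarith) (hb0 e)
    · have : stepSet S e = S := (Finset.eq_of_subset_of_card_le (subset_stepSet S e) h.ge).symm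
      rw [this]
      simp
  rw [Finset.sum_eq_sum_Ico_succ_bot hlt, ← hH]
  rcases le_or_gt (m S) H with h | h
  · have : 0 ≤ τ / a S.card := by positivity
    linarith
  · have h2 : a S.card * (m S - H) ≤ τ :=
      (mul_le_mul_of_nonneg_right h3 (by linarith)).trans h1
    have : m S - H ≤ τ / a S.card := by
      rw [le_div_iff₀ hpos]
      linarith
    linarith

/-- A lower bound for a hitting time functional. -/
theorem sum_le_hitting (hb0 : ∀ e, 0 ≤ b e) {m : Finset V → ℝ} {τ : ℝ} (hτ : 0 < τ)
    (hm0 : m Finset.univ = 0)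
    (hm : ∀ S : Finset V, S.Nonempty → S ≠ Finset.univ →
      ∑ e, b e * (m S - m (stepSet S e)) = τ)
    {a : ℕ → ℝ} (ha : ∀ i < Fintype.card V, 0 < i → 0 < a i)
    (hrate : ∀ S : Finset V, S.Nonempty → S ≠ Finset.univ →
      ∑ e, b e * (((stepSet S e).card : ℝ) - S.card) ≤ a S.card)
    {S : Finset V} (hS : S.Nonempty) :
    ∑ i ∈ Finset.Ico S.card (Fintype.card V), τ / a i ≤ m S := by
  obtain ⟨k, hk⟩ : ∃ k, k = Fintype.card V - S.card := ⟨_, rfl⟩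
  induction k using Nat.strong_induction_on generalizing S with
  | _ k ih =>
  by_cases hu : S = Finset.univ
  · subst hu
    simp [hm0, Finset.card_univ]
  have hlt : S.card < Fintype.card V := by
    rw [← Finset.card_univ]
    exact Finset.card_lt_card (Finset.ssubset_univ_iff.2 hu)
  have hpos := ha _ hlt hS.card_pos
  have h3 := hrate S hS hu
  set r := ∑ e, b e * (((stepSet S e).card : ℝ) - S.card) with hr
  set H := ∑ i ∈ Finset.Ico (S.card + 1) (Fintype.card V), τ / a i with hH
  have hr0 : 0 ≤ r := Finset.sum_nonneg fun e _ => mul_nonneg (hb0 e) (sub_nonneg.2 (by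
    exact_mod_cast Finset.card_le_card (subset_stepSet S e)))
  have h1 : τ ≤ r * (m S - H) := by
    rw [← hm S hS hu, hr, Finset.sum_mul]
    refine Finset.sum_le_sum fun e _ => ?_
    rcases (Finset.card_le_card (subset_stepSet S e)).lt_or_eq with h | h
    · have hc : (stepSet S e).card = S.card + 1 := le_antisymm (stepSet_card_le S e) h
      have h2 := ih _ (by omega) (hS.mono (subset_stepSet S e)) rfl
      rw [hc, ← hH] at h2
      rw [hc]
      push_cast
      rw [mul_assoc]
      exact mul_le_mul_of_nonneg_left (by linarith) (hb0 e)
    · have : stepSet S e = S := (Finset.eq_of_subset_of_card_le (subset_stepSet S e) h.ge).symm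
      rw [this]
      simp
  rw [Finset.sum_eq_sum_Ico_succ_bot hlt, ← hH]
  -- Since `τ` is strictly positive, `h1` excludes `m S ≤ H`; only then may `r` be replaced by its
  -- upper bound.
  have h4 : 0 < m S - H := by
    by_contra! h
    nlinarith
  have h2 : τ ≤ a S.card * (m S - H) := h1.trans (mul_le_mul_of_nonneg_right h3 h4.le)
  have : τ / a S.card ≤ m S - H := by
    rw [div_le_iff₀ hpos]
    linarith
  linarith

theorem uninformed_antitone : Antitone (uninformed : Finset V → ℝ) := by
  intro S S' h
  unfold uninformed
  split_ifs with h1 h2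
  · exact le_rfl
  · exact zero_le_one
  · subst_vars
    exact absurd (Finset.univ_subset_iff.1 h) h1
  · exact le_rfl

theorem iterate_chainOp_uninformed_le (hb0 : ∀ e, 0 ≤ b e) (hb1 : ∑ e, b e ≤ 1) (j : ℕ)
    (S : Finset V) : (chainOp b)^[j] uninformed S ≤ uninformed S := by
  by_cases h : S = Finset.univ
  · rw [h, iterate_chainOp_univ]
  · have := iterate_markovOp_mono (st := stepSet) hb0 hb1 (g := fun _ => 1)
      uninformed_le_one j S
    rw [iterate_markovOp_const] at this
    simpa [uninformed, h] using this

end Chain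

variable {n : ℕ}

/-- The first `j` rings cost `1 / n` each on average, and if they do not suffice, the remaining mean
is at most `C` from whatever set has been reached. -/
theorem meanReal_le_add {q : I} (hq : 0 < q) {G : SimpleGraph (Fin n)} (hG : G.Connected) {C : ℝ}
    (hC : ∀ S : Finset (Fin n), S.Nonempty → meanReal q G S ≤ C) (j : ℕ) {S : Finset (Fin n)}
    (hS : S.Nonempty) :
    meanReal q G S ≤ j / n + C * (chainOp (contactWeight q G))^[j] uninformed S := by
  have hn : 0 < n := hS.choose.pos
  have hb0 := contactWeight_nonneg q G
  have hb1 := sum_contactWeight_le_one q G hn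
  have hn' : (0 : ℝ) < n := by positivity
  induction j generalizing S with
  | zero =>
    by_cases hu : S = Finset.univ
    · subst hu
      simp [meanReal_univ, uninformed]
    · simpa [uninformed, hu] using hC S hS
  | succ j ih =>
    by_cases hu : S = Finset.univ
    · subst hu
      rw [meanReal_univ, iterate_chainOp_univ]
      simp only [uninformed, if_true, mul_zero, add_zero]
      positivity
    · rw [meanReal_eq hq hG hS hu, Function.iterate_succ_apply']
      have h1 : chainOp (contactWeight q G) (meanReal q G) S ≤ chainOp (contactWeight q G)
          (fun S => (j : ℝ) / n + C * (chainOp (contactWeight q G))^[j] uninformed S) S :=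
        markovOp_mono hb0 hb1 (ih hS) fun e => ih (hS.mono (subset_stepSet S e))
      rw [chainOp, markovOp_add, markovOp_const, markovOp_const_mul] at h1
      push_cast
      rw [add_div]
      linarith

/-- Markov's inequality for the number of rings: if `j` rings do not suffice, all of them are
needed, at mean cost `1 / n` each. -/
theorem mul_le_meanReal {q : I} (hq : 0 < q) {G : SimpleGraph (Fin n)} (hG : G.Connected) (j : ℕ)
    {S : Finset (Fin n)} (hS : S.Nonempty) :
    j / n * (chainOp (contactWeight q G))^[j] uninformed S ≤ meanReal q G S := by
  have hn : 0 < n := hS.choose.pos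
  have hb0 := contactWeight_nonneg q G
  have hb1 := sum_contactWeight_le_one q G hn
  have hn' : (0 : ℝ) < n := by positivity
  induction j generalizing S with
  | zero => simpa using meanReal_nonneg q G S
  | succ j ih =>
    by_cases hu : S = Finset.univ
    · subst hu
      rw [meanReal_univ, iterate_chainOp_univ]
      simp [uninformed]
    · have h0 := iterate_chainOp_uninformed_le hb0 hb1 (j + 1) S
      rw [meanReal_eq hq hG hS hu]
      rw [Function.iterate_succ_apply'] at h0 ⊢
      have h1 : chainOp (contactWeight q G)
          (fun S => (j : ℝ) / n * (chainOp (contactWeight q G))^[j] uninformed S) S ≤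
          chainOp (contactWeight q G) (meanReal q G) S :=
        markovOp_mono hb0 hb1 (ih hS) fun e => ih (hS.mono (subset_stepSet S e))
      rw [chainOp, markovOp_const_mul] at h1
      simp only [uninformed, hu, if_false] at h0
      push_cast
      rw [add_div, add_mul]
      have h2 := mul_le_mul_of_nonneg_left h0 (by positivity : (0 : ℝ) ≤ 1 / n)
      linarith

end Rumor

end

noncomputable section

namespace Rumor

/-! ### Expectations over random sets and random graphs -/

section EdgeExp

set_option linter.unusedSectionVars false

variable {E : Type*} [DecidableEq E]

/-- The expectation of `F A`, where `A` contains each element of `P` independently with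
probability `p`. -/
def edgeExp (p : ℝ) (P : Finset E) (F : Finset E → ℝ) : ℝ :=
  ∑ A ∈ P.powerset, p ^ A.card * (1 - p) ^ (P.card - A.card) * F A

theorem edgeExp_empty (p : ℝ) (F : Finset E → ℝ) : edgeExp p ∅ F = F ∅ := by
  simp [edgeExp]

theorem edgeExp_insert (p : ℝ) {P : Finset E} {e : E} (he : e ∉ P) (F : Finset E → ℝ) :
    edgeExp p (insert e P) F =
      (1 - p) * edgeExp p P F + p * edgeExp p P (fun A => F (insert e A)) := by
  unfold edgeExp
  rw [Finset.sum_powerset_insert he, Finset.mul_sum, Finset.mul_sum]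
  congr 1
  · refine Finset.sum_congr rfl fun A hA => ?_
    have := Finset.card_le_card (Finset.mem_powerset.1 hA)
    rw [Finset.card_insert_of_notMem he, Nat.sub_add_comm this]
    ring
  · refine Finset.sum_congr rfl fun A hA => ?_
    have hA' := Finset.mem_powerset.1 hA
    rw [Finset.card_insert_of_notMem he, Finset.card_insert_of_notMem fun h => he (hA' h),
      Nat.add_sub_add_right]
    ring

theorem edgeExp_congr (p : ℝ) {P : Finset E} {F F' : Finset E → ℝ} (h : ∀ A ⊆ P, F A = F' A) :
    edgeExp p P F = edgeExp p P F' :=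
  Finset.sum_congr rfl fun A hA => by rw [h A (Finset.mem_powerset.1 hA)]

theorem edgeExp_mono {p : ℝ} (hp0 : 0 ≤ p) (hp1 : p ≤ 1) {P : Finset E} {F F' : Finset E → ℝ}
    (h : ∀ A ⊆ P, F A ≤ F' A) : edgeExp p P F ≤ edgeExp p P F' := by
  refine Finset.sum_le_sum fun A hA => mul_le_mul_of_nonneg_left (h A (Finset.mem_powerset.1 hA)) ?_
  have : 0 ≤ 1 - p := by linarith
  positivity

theorem edgeExp_const (p : ℝ) (P : Finset E) (c : ℝ) : edgeExp p P (fun _ => c) = c := by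
  unfold edgeExp
  rw [← Finset.sum_mul, Finset.sum_pow_mul_eq_add_pow]
  simp

theorem edgeExp_prod (p : ℝ) (P : Finset E) (h k : E → ℝ) :
    edgeExp p P (fun A => ∏ e ∈ P, if e ∈ A then h e else k e) =
      ∏ e ∈ P, (p * h e + (1 - p) * k e) := by
  rw [Finset.prod_add]
  refine Finset.sum_congr rfl fun A hA => ?_
  have hA := Finset.mem_powerset.1 hA
  beta_reduce
  rw [Finset.prod_mul_distrib, Finset.prod_mul_distrib, Finset.prod_const, Finset.prod_const,
    Finset.card_sdiff_of_subset hA, ← Finset.prod_sdiff hA]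
  rw [Finset.prod_congr rfl fun e he => if_neg (Finset.mem_sdiff.1 he).2,
    Finset.prod_congr rfl fun e he => if_pos he]
  ring

theorem edgeExp_union (p : ℝ) {P Q : Finset E} (h : Disjoint P Q) (F : Finset E → ℝ) :
    edgeExp p (P ∪ Q) F = edgeExp p P fun A => edgeExp p Q fun B => F (A ∪ B) := by
  induction P using Finset.induction_on generalizing F with
  | empty => simp [edgeExp_empty]
  | insert e P he ih =>
    rw [Finset.disjoint_insert_left] at h
    rw [Finset.insert_union, edgeExp_insert p (by simp [he, h.1]), edgeExp_insert p he, ih h.2,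
      ih h.2]
    simp only [Finset.insert_union]

/-- The joint moment generating function of the number of elements in `Q`, on the event that all
elements of `R` are present. -/
theorem edgeExp_indicator_mul_exp_le {p : ℝ} (hp0 : 0 ≤ p) (hp1 : p ≤ 1) {P Q R : Finset E}
    (hQ : Q ⊆ P) (hR : R ⊆ P) (hQR : Disjoint Q R) (l : ℝ) :
    edgeExp p P (fun A => (if R ⊆ A then 1 else 0) * Real.exp (l * (A ∩ Q).card)) ≤
      p ^ R.card * Real.exp (Q.card * p * (Real.exp l - 1)) := by
  -- The integrand is a product over pairs, so the expectation factorises, with factor `p` on `R`,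
  -- `1 + p * (exp l - 1)` on `Q` and `1` elsewhere.
  have h1 : ∀ A ⊆ P, (if R ⊆ A then (1 : ℝ) else 0) * Real.exp (l * (A ∩ Q).card) =
      ∏ e ∈ P, if e ∈ A then (if e ∈ Q then Real.exp l else 1) else (if e ∈ R then 0 else 1) := by
    intro A hA
    have ha : ∏ e ∈ P, (if e ∈ A then (if e ∈ Q then Real.exp l else 1) else
        (if e ∈ R then (0 : ℝ) else 1)) = (∏ e ∈ P, if e ∈ A ∩ Q then Real.exp l else 1) *
          ∏ e ∈ P, if e ∈ R \ A then (0 : ℝ) else 1 := by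
      rw [← Finset.prod_mul_distrib]
      refine Finset.prod_congr rfl fun e _ => ?_
      by_cases h : e ∈ A <;> simp [h]
    rw [ha, Finset.prod_ite_mem, Finset.prod_const, mul_comm l, Real.exp_nat_mul,
      Finset.inter_eq_right.2 (Finset.inter_subset_left.trans hA), mul_comm]
    congr 1
    split_ifs with h
    · rw [Finset.sdiff_eq_empty_iff_subset.2 h]
      simp
    · obtain ⟨e, he, hA⟩ := Finset.not_subset.1 h
      rw [Finset.prod_eq_zero (hR he)]
      simp [he, hA]
  rw [edgeExp_congr p h1, edgeExp_prod, ← Finset.prod_sdiff hR]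
  rw [mul_comm]
  have h2 : ∏ e ∈ R, (p * (if e ∈ Q then Real.exp l else 1) + (1 - p) * if e ∈ R then 0 else 1) =
      p ^ R.card := by
    rw [← Finset.prod_const]
    refine Finset.prod_congr rfl fun e he => ?_
    simp [he, Finset.disjoint_right.1 hQR he]
  have h3 : Q ⊆ P \ R := fun e he => Finset.mem_sdiff.2 ⟨hQ he, Finset.disjoint_left.1 hQR he⟩
  rw [h2, ← Finset.prod_sdiff h3]
  refine mul_le_mul_of_nonneg_left ?_ (by positivity)
  rw [Finset.prod_eq_one, one_mul]
  · calc _ = ∏ e ∈ Q, (p * (Real.exp l - 1) + 1) := by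
          refine Finset.prod_congr rfl fun e he => ?_
          rw [if_pos he, if_neg (Finset.disjoint_left.1 hQR he)]
          ring
      _ ≤ ∏ e ∈ Q, Real.exp (p * (Real.exp l - 1)) :=
        Finset.prod_le_prod (fun e _ => by nlinarith [Real.exp_pos l])
          fun e _ => Real.add_one_le_exp _
      _ = _ := by
        rw [Finset.prod_const, ← Real.exp_nat_mul, mul_assoc]
  · intro e he
    simp only [Finset.mem_sdiff] at he
    rw [if_neg he.2, if_neg he.1.2]
    ring

end EdgeExp

variable {n : ℕ}

/-- The pairs of distinct nodes. -/
def allEdges (n : ℕ) : Finset (Sym2 (Fin n)) := Finset.univ.filter fun e => ¬ e.IsDiag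

theorem mem_allEdges {u v : Fin n} : s(u, v) ∈ allEdges n ↔ u ≠ v := by
  simp [allEdges]

theorem card_allEdges : (allEdges n).card = n.choose 2 := by
  have := Sym2.card_subtype_not_diag (α := Fin n)
  rw [Fintype.card_fin, Fintype.card_subtype] at this
  rw [← this]
  rfl

/-- The expectation of a function of the random graph. -/
def graphExp (p : I) (F : SimpleGraph (Fin n) → ℝ) : ℝ :=
  ∑ G, (SimpleGraph.binomialRandom (Fin n) p).real {G} * F G

theorem binomialRandom_real_singleton (p : I) (G : SimpleGraph (Fin n)) :
    (SimpleGraph.binomialRandom (Fin n) p).real {G} =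
      p ^ G.edgeSet.ncard * (1 - p : ℝ) ^ (n.choose 2 - G.edgeSet.ncard) := by
  simp [measureReal_def]

theorem graphExp_eq_edgeExp (p : I) (F : SimpleGraph (Fin n) → ℝ) :
    graphExp p F = edgeExp p (allEdges n) fun A => F (SimpleGraph.fromEdgeSet A) := by
  classical
  unfold graphExp edgeExp
  symm
  refine Finset.sum_bij' (fun A _ => SimpleGraph.fromEdgeSet A) (fun G _ => G.edgeFinset)
    (fun _ _ => Finset.mem_univ _) ?_ ?_ ?_ ?_
  · intro G _
    rw [Finset.mem_powerset]
    intro e he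
    simpa [allEdges] using G.not_isDiag_of_mem_edgeSet (SimpleGraph.mem_edgeFinset.1 he)
  · intro A hA
    ext e
    have hA := Finset.mem_powerset.1 hA
    simp only [SimpleGraph.mem_edgeFinset, SimpleGraph.edgeSet_fromEdgeSet, Set.mem_sdiff,
      Finset.mem_coe]
    refine ⟨fun h => h.1, fun h => ⟨h, ?_⟩⟩
    simpa [allEdges] using hA h
  · intro G _
    simp
  · intro A hA
    have hA := Finset.mem_powerset.1 hA
    have h : (SimpleGraph.fromEdgeSet (A : Set (Sym2 (Fin n)))).edgeSet = A := by
      ext e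
      simp only [SimpleGraph.edgeSet_fromEdgeSet, Set.mem_sdiff, Finset.mem_coe]
      refine ⟨fun h => h.1, fun h => ⟨h, ?_⟩⟩
      simpa [allEdges] using hA h
    rw [binomialRandom_real_singleton, h, Set.ncard_coe_finset, card_allEdges]

theorem graphExp_mono (p : I) {F F' : SimpleGraph (Fin n) → ℝ} (h : ∀ G, F G ≤ F' G) :
    graphExp p F ≤ graphExp p F' :=
  Finset.sum_le_sum fun G _ => mul_le_mul_of_nonneg_left (h G) measureReal_nonneg

theorem graphExp_sum {ι : Type*} (p : I) (s : Finset ι) (F : ι → SimpleGraph (Fin n) → ℝ) :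
    graphExp p (fun G => ∑ i ∈ s, F i G) = ∑ i ∈ s, graphExp p (F i) := by
  simp only [graphExp, Finset.mul_sum]
  exact Finset.sum_comm

theorem graphExp_const (p : I) (c : ℝ) : graphExp p (fun _ : SimpleGraph (Fin n) => c) = c := by
  rw [graphExp_eq_edgeExp, edgeExp_const]

theorem graphExp_const_mul (p : I) (c : ℝ) (F : SimpleGraph (Fin n) → ℝ) :
    graphExp p (fun G => c * F G) = c * graphExp p F := by
  simp only [graphExp, Finset.mul_sum]
  exact Finset.sum_congr rfl fun G _ => by ring

open Classical in
theorem binomialRandom_real_eq (p : I) (Q : SimpleGraph (Fin n) → Prop) :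
    (SimpleGraph.binomialRandom (Fin n) p).real {G | Q G} =
      graphExp p fun G => if Q G then 1 else 0 := by
  simp only [graphExp, mul_ite, mul_one, mul_zero]
  rw [← Finset.sum_filter, sum_measureReal_singleton]
  congr
  simp

/-- Markov's inequality for random graphs. -/
theorem binomialRandom_real_le (p : I) {Q : SimpleGraph (Fin n) → Prop}
    {F : SimpleGraph (Fin n) → ℝ} (hF : ∀ G, 0 ≤ F G) (h : ∀ G, Q G → 1 ≤ F G) :
    (SimpleGraph.binomialRandom (Fin n) p).real {G | Q G} ≤ graphExp p F := by
  classical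
  rw [binomialRandom_real_eq]
  refine graphExp_mono p fun G => ?_
  split_ifs with hG
  · exact h G hG
  · exact hF G

theorem binomialRandom_real_exists_le {ι : Type*} (p : I) (s : Finset ι)
    (Q : ι → SimpleGraph (Fin n) → Prop) :
    (SimpleGraph.binomialRandom (Fin n) p).real {G | ∃ i ∈ s, Q i G} ≤
      ∑ i ∈ s, (SimpleGraph.binomialRandom (Fin n) p).real {G | Q i G} := by
  have : {G | ∃ i ∈ s, Q i G} = ⋃ i ∈ s, {G | Q i G} := by
    ext
    simp
  rw [this]
  exact measureReal_biUnion_finset_le _ _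

/-- The law of the random graph is invariant under relabelling of the nodes. -/
theorem graphExp_map (p : I) (τ : Equiv.Perm (Fin n)) (F : SimpleGraph (Fin n) → ℝ) :
    graphExp p (fun G => F (G.map τ)) = graphExp p F := by
  classical
  unfold graphExp
  refine Fintype.sum_bijective (fun G : SimpleGraph (Fin n) => G.map τ) ?_ _ _ fun G => ?_
  · refine (Fintype.bijective_iff_injective_and_card _).2 ⟨?_, rfl⟩
    exact SimpleGraph.map_injective τ.toEmbedding
  · congr 1
    rw [binomialRandom_real_singleton, binomialRandom_real_singleton]
    have := (SimpleGraph.Iso.map τ G).card_edgeFinset_eq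
    rw [Set.ncard_eq_toFinset_card', Set.ncard_eq_toFinset_card']
    simp only [SimpleGraph.edgeFinset] at this
    rw [this]

/-- The number of edges of `G` in a set of pairs. -/
def edgeCount (G : SimpleGraph (Fin n)) (Q : Finset (Sym2 (Fin n))) : ℕ := by
  classical exact (Q.filter (· ∈ G.edgeSet)).card

theorem fromEdgeSet_mem_iff {A : Finset (Sym2 (Fin n))} (hA : A ⊆ allEdges n)
    (e : Sym2 (Fin n)) :
    e ∈ (SimpleGraph.fromEdgeSet (A : Set (Sym2 (Fin n)))).edgeSet ↔ e ∈ A := by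
  simp only [SimpleGraph.edgeSet_fromEdgeSet, Set.mem_sdiff, Finset.mem_coe]
  refine ⟨fun h => h.1, fun h => ⟨h, ?_⟩⟩
  simpa [allEdges] using hA h

theorem edgeCount_fromEdgeSet {A : Finset (Sym2 (Fin n))} (hA : A ⊆ allEdges n)
    (Q : Finset (Sym2 (Fin n))) :
    edgeCount (SimpleGraph.fromEdgeSet (A : Set (Sym2 (Fin n)))) Q = (A ∩ Q).card := by
  classical
  unfold edgeCount
  congr 1
  ext e
  refine (@Finset.mem_filter _ _ (_) _ _).trans ?_
  rw [Finset.mem_inter, and_comm]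
  exact and_congr_left fun _ => fromEdgeSet_mem_iff hA e

/-- The exponential moment method for edge counts, on the event that all pairs in `R` are edges. -/
theorem binomialRandom_edgeCount_le (p : I) {Q R : Finset (Sym2 (Fin n))} (hQ : Q ⊆ allEdges n)
    (hR : R ⊆ allEdges n) (hQR : Disjoint Q R) (l x : ℝ) :
    (SimpleGraph.binomialRandom (Fin n) p).real
        {G | (R : Set (Sym2 (Fin n))) ⊆ G.edgeSet ∧ l * x ≤ l * edgeCount G Q} ≤
      (p : ℝ) ^ R.card * Real.exp (Q.card * p * (Real.exp l - 1) - l * x) := by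
  classical
  refine (binomialRandom_real_le p (F := fun G => Real.exp (-(l * x)) *
    ((if (R : Set (Sym2 (Fin n))) ⊆ G.edgeSet then 1 else 0) *
      Real.exp (l * edgeCount G Q))) (fun G => ?_) fun G hG => ?_).trans ?_
  · split_ifs <;> positivity
  · rw [if_pos hG.1, one_mul, ← Real.exp_add]
    exact Real.one_le_exp (by linarith [hG.2])
  · rw [graphExp_const_mul, graphExp_eq_edgeExp]
    have h1 : ∀ A ⊆ allEdges n, (if (R : Set (Sym2 (Fin n))) ⊆
        (SimpleGraph.fromEdgeSet (A : Set (Sym2 (Fin n)))).edgeSet then (1 : ℝ) else 0) *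
          Real.exp (l * edgeCount (SimpleGraph.fromEdgeSet (A : Set (Sym2 (Fin n)))) Q) =
        (if R ⊆ A then 1 else 0) * Real.exp (l * (A ∩ Q).card) := by
      intro A hA
      rw [edgeCount_fromEdgeSet hA]
      congr 1
      refine if_congr ?_ rfl rfl
      simp only [Set.subset_def, Finset.mem_coe, fromEdgeSet_mem_iff hA]
      rfl
    rw [edgeExp_congr _ h1]
    calc _ ≤ Real.exp (-(l * x)) *
          ((p : ℝ) ^ R.card * Real.exp (Q.card * p * (Real.exp l - 1))) :=
          mul_le_mul_of_nonneg_left (edgeExp_indicator_mul_exp_le p.2.1 p.2.2 hQ hR hQR l)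
            (Real.exp_pos _).le
      _ = _ := by
        rw [sub_eq_add_neg _ (l * x), Real.exp_add]
        ring

end Rumor

end

noncomputable section

namespace Rumor

variable {n : ℕ}

/-! ### From bounds on the chain to closeness of the spreading time and its mean -/

theorem measurableSet_not_close (q : I) (s : Fin n) (b : ℝ) (G : SimpleGraph (Fin n)) :
    MeasurableSet {ω | ¬ Close q s b G ω} := by
  have hm : Measurable (spreadTime s) := by
    rw [spreadTime_eq_spreadFrom]
    exact measurable_spreadFrom _
  change MeasurableSet {ω | Close q s b G ω}ᶜ
  refine MeasurableSet.compl ?_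
  have h1 : MeasurableSet {ω | spreadTime s ω ≠ ⊤} := (hm (measurableSet_singleton ⊤)).compl
  have h2 : MeasurableSet {ω | |(spreadTime s ω).toReal - (meanTime 1 G s).toReal / q| ≤ b} :=
    measurableSet_le (measurable_norm.comp (hm.ennreal_toReal.sub_const _)) measurable_const
  by_cases h : meanTime 1 G s = ⊤
  · have : {ω | Close q s b G ω} = ∅ := by
      ext ω
      simp [Close, h]
    rw [this]
    exact MeasurableSet.empty
  · have : {ω | Close q s b G ω} = {ω | spreadTime s ω ≠ ⊤} ∩
        {ω | |(spreadTime s ω).toReal - (meanTime 1 G s).toReal / q| ≤ b} := by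
      ext ω
      simp [Close, h]
    rw [this]
    exact h1.inter h2

/-- Either the graph is not good, or it is good and the protocol on it fails. The notion of a good
graph may depend on `s`; in the sparse case it has to, because not every node of a typical graph
need be a typical start. -/
theorem failProb_le {p q : I} {b ε ε' : ℝ} (hε : 0 ≤ ε) (hε' : 0 ≤ ε')
    (h : ∀ s : Fin n, ∃ Good : SimpleGraph (Fin n) → Prop,
      (SimpleGraph.binomialRandom (Fin n) p).real {G | ¬ Good G} ≤ ε ∧
      ∀ G, Good G → law q G {ω | ¬ Close q s b G ω} ≤ ENNReal.ofReal ε') :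
    failProb n p q b ≤ ENNReal.ofReal (ε + ε') := by
  refine iSup_le fun s => ?_
  obtain ⟨Good, h1, h2⟩ := h s
  have hms : MeasurableSet {x : SimpleGraph (Fin n) × Outcome n | ¬ Close q s b x.1 x.2} := by
    have : {x : SimpleGraph (Fin n) × Outcome n | ¬ Close q s b x.1 x.2} =
        ⋃ G, {G} ×ˢ {ω | ¬ Close q s b G ω} := by
      ext ⟨G, ω⟩
      simp
    rw [this]
    exact MeasurableSet.iUnion fun G =>
      (measurableSet_singleton G).prod (measurableSet_not_close q s b G)
  rw [jointLaw, Measure.compProd_apply hms]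
  calc ∫⁻ G, (lawKernel n q G) (Prod.mk G ⁻¹' {x | ¬ Close q s b x.1 x.2})
        ∂(SimpleGraph.binomialRandom (Fin n) p)
      ≤ ∫⁻ G, ({G | ¬ Good G}.indicator 1 G + ENNReal.ofReal ε')
        ∂(SimpleGraph.binomialRandom (Fin n) p) := by
        refine lintegral_mono fun G => ?_
        by_cases hG : Good G
        · exact (h2 G hG).trans le_add_self
        · refine prob_le_one.trans ?_
          simp [hG]
    _ = (SimpleGraph.binomialRandom (Fin n) p) {G | ¬ Good G} + ENNReal.ofReal ε' := by
        rw [lintegral_add_right _ measurable_const, lintegral_indicator_one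
          (Set.toFinite _).measurableSet, lintegral_const, measure_univ, mul_one]
    _ ≤ ENNReal.ofReal (ε + ε') := by
        rw [ENNReal.ofReal_add hε hε']
        gcongr
        rw [← ofReal_measureReal]
        exact ENNReal.ofReal_le_ofReal h1

/-- The spreading time is close to its mean, if the number of steps of the chain is concentrated
between `j₁` and `j₂`. -/
theorem law_not_close_le {q : I} (hq : 0 < q) {G : SimpleGraph (Fin n)} (hG : G.Connected)
    (hn : 2 ≤ n) (s : Fin n) {j₁ j₂ : ℕ} {y b : ℝ} (hy : 0 ≤ y) (hj₁ : (j₁ : ℝ) ≤ n * (n - 1))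
    (hj₂ : (j₂ : ℝ) ≤ n * (n - 1))
    (h₂ : j₂ / n + y - meanReal q G {s} ≤ b) (h₁ : meanReal q G {s} - (j₁ / n - y) ≤ b) :
    law q G {ω | ¬ Close q s b G ω} ≤ ENNReal.ofReal
      ((chainOp (contactWeight q G))^[j₂] uninformed {s} +
        (1 - (chainOp (contactWeight q G))^[j₁] uninformed {s}) + 2 * Real.exp (1 - y)) := by
  have hn0 : 0 < n := by omega
  have hn' : (2 : ℝ) ≤ n := by exact_mod_cast hn
  have hq' : (0 : ℝ) < q := hq
  set m := meanReal q G {s} with hm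
  have hm0 : 0 ≤ m := meanReal_nonneg _ _ _
  set u₂ := (chainOp (contactWeight q G))^[j₂] uninformed {s} with hu₂
  set u₁ := (chainOp (contactWeight q G))^[j₁] uninformed {s} with hu₁
  have hu₂0 : 0 ≤ u₂ := iterate_markovOp_nonneg (contactWeight_nonneg q G)
    (sum_contactWeight_le_one q G hn0) uninformed_nonneg _ _
  have hu₁1 : u₁ ≤ 1 := (iterate_chainOp_uninformed_le (contactWeight_nonneg q G)
    (sum_contactWeight_le_one q G hn0) _ _).trans (uninformed_le_one _)
  have htop : meanTime 1 G s ≠ ⊤ := by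
    rw [meanTime_eq_meanFrom]
    exact meanFrom_ne_top one_pos hG (Finset.singleton_nonempty s)
  have hmean : (meanTime 1 G s).toReal / q = m := by
    have : (meanTime 1 G s).toReal = meanReal 1 G {s} := by
      rw [meanTime_eq_meanFrom]
      rfl
    rw [this, ← mul_meanReal hq hG (Finset.singleton_nonempty s), mul_div_cancel_left₀ _ hq'.ne']
  set x₂ : ℝ := j₂ / n + y with hx₂
  set x₁ : ℝ := j₁ / n - y with hx₁
  have hx₂0 : 0 ≤ x₂ := by positivity
  have hup : law q G {ω | ENNReal.ofReal x₂ < spreadFrom {s} ω} ≤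
      ENNReal.ofReal (u₂ + Real.exp (1 - y)) := by
    refine (law_lt_spreadFrom_le q G hn0 one_pos (by linarith) j₂ {s} x₂).trans
      (ENNReal.ofReal_le_ofReal ?_)
    refine add_le_add le_rfl ?_
    have h1 : (n : ℝ) / (n - 1) ≤ Real.exp (1 / (n - 1)) := by
      have : (n : ℝ) / (n - 1) = 1 / (n - 1) + 1 := by
        have : (n : ℝ) - 1 ≠ 0 := by linarith
        field_simp
        ring
      rw [this]
      exact Real.add_one_le_exp _
    have h2 : ((n : ℝ) / (n - 1)) ^ j₂ ≤ Real.exp (j₂ * (1 / (n - 1))) := by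
      rw [Real.exp_nat_mul]
      exact pow_le_pow_left₀ (div_nonneg (by linarith) (by linarith)) h1 _
    calc _ ≤ Real.exp (-(1 * x₂)) * Real.exp (j₂ * (1 / (n - 1))) := by gcongr
      _ ≤ Real.exp (1 - y) := by
        rw [← Real.exp_add, Real.exp_le_exp]
        -- The exponential moment with `l = 1` yields `j / (n - 1)` in the exponent instead of `j /
        -- n`. The assumption `j ≤ n * (n - 1)` is what keeps the difference at most `1`.
        have h3 : (j₂ : ℝ) * (1 / (n - 1)) - j₂ / n = j₂ / (n * (n - 1)) := by
          have : (n : ℝ) - 1 ≠ 0 := by linarith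
          field_simp
          ring
        have h4 : (j₂ : ℝ) / (n * (n - 1)) ≤ 1 := by
          rw [div_le_one (by nlinarith)]
          exact hj₂
        linarith
  have hlo : 0 ≤ x₁ → law q G {ω | spreadFrom {s} ω ≤ ENNReal.ofReal x₁} ≤
      ENNReal.ofReal (1 - u₁ + Real.exp (1 - y)) := by
    intro hx
    refine (law_spreadFrom_le_le q G hn0 one_pos j₁ {s} hx).trans (ENNReal.ofReal_le_ofReal ?_)
    refine add_le_add le_rfl ?_
    have h1 : (n : ℝ) / (n + 1) ≤ Real.exp (-(1 / (n + 1))) := by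
      have : (n : ℝ) / (n + 1) = -(1 / (n + 1)) + 1 := by
        field_simp
        ring
      rw [this]
      exact Real.add_one_le_exp _
    have h2 : ((n : ℝ) / (n + 1)) ^ j₁ ≤ Real.exp (j₁ * -(1 / (n + 1))) := by
      rw [Real.exp_nat_mul]
      exact pow_le_pow_left₀ (by positivity) h1 _
    calc _ ≤ Real.exp (1 * x₁) * Real.exp (j₁ * -(1 / (n + 1))) := by gcongr
      _ ≤ Real.exp (1 - y) := by
        rw [← Real.exp_add, Real.exp_le_exp]
        have h3 : (j₁ : ℝ) / n - j₁ * (1 / (n + 1)) = j₁ / (n * (n + 1)) := by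
          field_simp
          ring
        have h4 : (j₁ : ℝ) / (n * (n + 1)) ≤ 1 := by
          rw [div_le_one (by positivity)]
          nlinarith
        linarith
  have hsub : {ω | ¬ Close q s b G ω} ⊆ {ω | ENNReal.ofReal x₂ < spreadFrom {s} ω} ∪
      {ω | 0 ≤ x₁ ∧ spreadFrom {s} ω ≤ ENNReal.ofReal x₁} := by
    intro ω hω
    by_contra hcon
    simp only [Set.mem_union, Set.mem_ofPred_eq, not_or, not_lt, not_and, not_le] at hcon
    refine hω ⟨?_, htop, ?_⟩
    · rw [spreadTime_eq_spreadFrom]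
      exact ne_top_of_le_ne_top ENNReal.ofReal_ne_top hcon.1
    · rw [hmean, spreadTime_eq_spreadFrom]
      have h1 : (spreadFrom {s} ω).toReal ≤ x₂ := ENNReal.toReal_le_of_le_ofReal hx₂0 hcon.1
      have h2 : x₁ ≤ (spreadFrom {s} ω).toReal := by
        rcases lt_or_ge x₁ 0 with h | h
        · exact h.le.trans ENNReal.toReal_nonneg
        · exact (ENNReal.ofReal_le_iff_le_toReal
            (ne_top_of_le_ne_top ENNReal.ofReal_ne_top hcon.1)).1 (hcon.2 h).le
      rw [abs_le]
      constructor <;> linarith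
  refine (measure_mono hsub).trans ((measure_union_le _ _).trans ?_)
  calc _ ≤ ENNReal.ofReal (u₂ + Real.exp (1 - y)) + ENNReal.ofReal (1 - u₁ + Real.exp (1 - y)) := by
        refine add_le_add hup ?_
        by_cases hx : 0 ≤ x₁
        · simpa [hx] using hlo hx
        · simp [hx]
    _ = _ := by
      rw [← ENNReal.ofReal_add (by positivity) (by linarith [Real.exp_pos (1 - y)])]
      congr 1
      ring

end Rumor

end

noncomputable section

namespace Rumor

variable {n : ℕ}

/-! ### Edges between sets of nodes -/

/-- The indicator of adjacency. -/
def ad (G : SimpleGraph (Fin n)) (u v : Fin n) : ℝ := open Classical in if G.Adj u v then 1 else 0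

theorem ad_nonneg (G : SimpleGraph (Fin n)) (u v : Fin n) : 0 ≤ ad G u v := by
  unfold ad
  split_ifs <;> norm_num

theorem ad_le_one (G : SimpleGraph (Fin n)) (u v : Fin n) : ad G u v ≤ 1 := by
  unfold ad
  split_ifs <;> norm_num

theorem ad_comm (G : SimpleGraph (Fin n)) (u v : Fin n) : ad G u v = ad G v u := by
  classical
  unfold ad
  exact if_congr (G.adj_comm u v) rfl rfl

theorem ad_self (G : SimpleGraph (Fin n)) (u : Fin n) : ad G u u = 0 := by
  simp [ad]

theorem dg_eq_sum (G : SimpleGraph (Fin n)) (u : Fin n) : dg G u = ∑ v, ad G u v := by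
  simp [dg, nbr, ad]

theorem dg_nonneg (G : SimpleGraph (Fin n)) (u : Fin n) : 0 ≤ dg G u := by
  unfold dg
  positivity

/-- The number of pairs of adjacent nodes in `S × T`. -/
def cut (G : SimpleGraph (Fin n)) (S T : Finset (Fin n)) : ℝ := ∑ u ∈ S, ∑ v ∈ T, ad G u v

theorem cut_comm (G : SimpleGraph (Fin n)) (S T : Finset (Fin n)) : cut G S T = cut G T S := by
  unfold cut
  rw [Finset.sum_comm]
  simp only [ad_comm]

theorem cut_nonneg (G : SimpleGraph (Fin n)) (S T : Finset (Fin n)) : 0 ≤ cut G S T :=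
  Finset.sum_nonneg fun _ _ => Finset.sum_nonneg fun _ _ => ad_nonneg _ _ _

theorem cut_mono (G : SimpleGraph (Fin n)) {S S' T T' : Finset (Fin n)} (hS : S ⊆ S')
    (hT : T ⊆ T') : cut G S T ≤ cut G S' T' :=
  (Finset.sum_le_sum fun _ _ => Finset.sum_le_sum_of_subset_of_nonneg hT
    fun _ _ _ => ad_nonneg _ _ _).trans (Finset.sum_le_sum_of_subset_of_nonneg hS
    fun _ _ _ => Finset.sum_nonneg fun _ _ => ad_nonneg _ _ _)

theorem cut_union_right (G : SimpleGraph (Fin n)) (S : Finset (Fin n)) {T T' : Finset (Fin n)}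
    (h : Disjoint T T') : cut G S (T ∪ T') = cut G S T + cut G S T' := by
  simp only [cut, Finset.sum_union h, Finset.sum_add_distrib]

theorem cut_univ (G : SimpleGraph (Fin n)) (S : Finset (Fin n)) :
    cut G S Finset.univ = ∑ u ∈ S, dg G u := by
  simp only [cut, dg_eq_sum]

theorem cut_singleton_left (G : SimpleGraph (Fin n)) (u : Fin n) (T : Finset (Fin n)) :
    cut G {u} T = ∑ v ∈ T, ad G u v := by
  simp [cut]

theorem cut_singleton_compl (G : SimpleGraph (Fin n)) (u : Fin n) : cut G {u} {u}ᶜ = dg G u := by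
  rw [cut_singleton_left, dg_eq_sum, ← Finset.sum_add_sum_compl {u}]
  simp [ad_self]

theorem cut_le_card_mul (G : SimpleGraph (Fin n)) (S T : Finset (Fin n)) :
    cut G S T ≤ S.card * T.card := by
  calc _ ≤ ∑ u ∈ S, ∑ v ∈ T, (1 : ℝ) :=
        Finset.sum_le_sum fun _ _ => Finset.sum_le_sum fun _ _ => ad_le_one _ _ _
    _ = _ := by simp

/-- The pairs with one node in `S` and one node in `T`. -/
def cutPairs (S T : Finset (Fin n)) : Finset (Sym2 (Fin n)) :=
  (S ×ˢ T).image fun x => s(x.1, x.2)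

theorem cutPairs_subset {S T : Finset (Fin n)} (h : Disjoint S T) : cutPairs S T ⊆ allEdges n := by
  intro e he
  obtain ⟨x, hx, rfl⟩ := Finset.mem_image.1 he
  rw [Finset.mem_product] at hx
  exact mem_allEdges.2 fun h' => Finset.disjoint_left.1 h hx.1 (h' ▸ hx.2)

theorem cutPairs_injOn {S T : Finset (Fin n)} (h : Disjoint S T) :
    Set.InjOn (fun x : Fin n × Fin n => s(x.1, x.2)) (S ×ˢ T : Finset (Fin n × Fin n)) := by
  intro x hx y hy hxy
  rw [Finset.mem_coe, Finset.mem_product] at hx hy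
  rcases Sym2.eq_iff.1 hxy with h1 | h1
  · exact Prod.ext h1.1 h1.2
  · exact absurd (h1.1 ▸ hx.1) fun h2 => Finset.disjoint_left.1 h h2 hy.2

theorem card_cutPairs {S T : Finset (Fin n)} (h : Disjoint S T) :
    (cutPairs S T).card = S.card * T.card := by
  rw [cutPairs, Finset.card_image_of_injOn (cutPairs_injOn h), Finset.card_product]

theorem edgeCount_eq_sum (G : SimpleGraph (Fin n)) (Q : Finset (Sym2 (Fin n))) :
    (edgeCount G Q : ℝ) = ∑ e ∈ Q, open Classical in if e ∈ G.edgeSet then 1 else 0 := by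
  classical
  unfold edgeCount
  rw [Finset.sum_boole]

theorem edgeCount_cutPairs (G : SimpleGraph (Fin n)) {S T : Finset (Fin n)} (h : Disjoint S T) :
    (edgeCount G (cutPairs S T) : ℝ) = cut G S T := by
  classical
  rw [edgeCount_eq_sum, cutPairs, Finset.sum_image (cutPairs_injOn h), cut, Finset.sum_product]
  exact Finset.sum_congr rfl fun u _ => Finset.sum_congr rfl fun v _ =>
    if_congr G.mem_edgeSet rfl rfl

/-- The pairs of distinct nodes in `S`. -/
def innerPairs (S : Finset (Fin n)) : Finset (Sym2 (Fin n)) :=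
  (S.offDiag.filter fun x => x.1 < x.2).image fun x => s(x.1, x.2)

theorem innerPairs_subset (S : Finset (Fin n)) : innerPairs S ⊆ allEdges n := by
  intro e he
  obtain ⟨x, hx, rfl⟩ := Finset.mem_image.1 he
  simp only [Finset.mem_filter] at hx
  exact mem_allEdges.2 hx.2.ne

theorem innerPairs_injOn (S : Finset (Fin n)) : Set.InjOn (fun x : Fin n × Fin n => s(x.1, x.2))
    (S.offDiag.filter fun x => x.1 < x.2 : Finset (Fin n × Fin n)) := by
  intro x hx y hy hxy
  simp only [Finset.coe_filter, Set.mem_ofPred_eq] at hx hy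
  rcases Sym2.eq_iff.1 hxy with h1 | h1
  · exact Prod.ext h1.1 h1.2
  · exact absurd (h1.1 ▸ h1.2 ▸ hx.2) hy.2.asymm

theorem card_innerPairs_le (S : Finset (Fin n)) : (innerPairs S).card ≤ S.card * S.card := by
  refine Finset.card_image_le.trans ((Finset.card_filter_le _ _).trans ?_)
  rw [Finset.offDiag_card]
  exact Nat.sub_le _ _

theorem cut_self_eq (G : SimpleGraph (Fin n)) (S : Finset (Fin n)) :
    cut G S S = 2 * edgeCount G (innerPairs S) := by
  classical
  rw [edgeCount_eq_sum, innerPairs, Finset.sum_image (innerPairs_injOn S), cut,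
    ← Finset.sum_product']
  have h1 : ∑ x ∈ S ×ˢ S, ad G x.1 x.2 = ∑ x ∈ S.offDiag, ad G x.1 x.2 := by
    rw [← Finset.diag_union_offDiag, Finset.sum_union (Finset.disjoint_diag_offDiag S)]
    rw [Finset.sum_eq_zero, zero_add]
    intro x hx
    rw [(Finset.mem_diag.1 hx).2, ad_self]
  rw [h1, ← Finset.sum_filter_add_sum_filter_not _ fun x : Fin n × Fin n => x.1 < x.2, two_mul]
  have h2 : ∑ x ∈ S.offDiag with ¬ x.1 < x.2, ad G x.1 x.2 =
      ∑ x ∈ S.offDiag with x.1 < x.2, ad G x.1 x.2 := by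
    refine Finset.sum_bij' (fun x _ => x.swap) (fun x _ => x.swap) ?_ ?_ ?_ ?_ ?_
    · simp only [Finset.mem_filter, Finset.mem_offDiag]
      exact fun x hx => ⟨⟨hx.1.2.1, hx.1.1, hx.1.2.2.symm⟩,
        lt_of_le_of_ne (not_lt.1 hx.2) hx.1.2.2.symm⟩
    · simp only [Finset.mem_filter, Finset.mem_offDiag]
      exact fun x hx => ⟨⟨hx.1.2.1, hx.1.1, hx.1.2.2.symm⟩, hx.2.asymm⟩
    · simp
    · simp
    · exact fun x _ => ad_comm _ _ _
  rw [h2]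
  have h3 : ∑ x ∈ S.offDiag with x.1 < x.2, ad G x.1 x.2 = ∑ x ∈ S.offDiag with x.1 < x.2,
      open Classical in if s(x.1, x.2) ∈ G.edgeSet then (1 : ℝ) else 0 :=
    Finset.sum_congr rfl fun x _ => if_congr G.mem_edgeSet.symm rfl rfl
  rw [h3]

/-- The exponential moment method with `l = δ / 2` and `exp x ≤ 1 + x + x ^ 2`: the exponent is at
most `μ * (δ / 2 + δ ^ 2 / 4) - (δ / 2) * (1 + δ) * μ`. Pairs in `R` are disjoint from `Q` and
contribute an independent factor `p` each. -/
theorem binomialRandom_edgeCount_ge (p : I) {Q R : Finset (Sym2 (Fin n))} (hQ : Q ⊆ allEdges n)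
    (hR : R ⊆ allEdges n) (hQR : Disjoint Q R) {δ μ : ℝ} (hδ0 : 0 ≤ δ) (hδ : δ ≤ 1)
    (hμ : (Q.card : ℝ) * p ≤ μ) :
    (SimpleGraph.binomialRandom (Fin n) p).real
        {G | (R : Set (Sym2 (Fin n))) ⊆ G.edgeSet ∧ (1 + δ) * μ ≤ edgeCount G Q} ≤
      (p : ℝ) ^ R.card * Real.exp (-(μ * δ ^ 2 / 4)) := by
  have h := binomialRandom_edgeCount_le p hQ hR hQR (δ / 2) ((1 + δ) * μ)
  refine (measureReal_mono fun G hG => ?_).trans (h.trans ?_)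
  · exact ⟨hG.1, mul_le_mul_of_nonneg_left hG.2 (by positivity)⟩
  · have hp : (0 : ℝ) ≤ p := p.2.1
    gcongr
    have h1 := (abs_le.1 (Real.abs_exp_sub_one_sub_id_le (x := δ / 2)
      (by rw [abs_of_nonneg (by positivity)]; linarith))).2
    have h2 : (Q.card : ℝ) * p * (Real.exp (δ / 2) - 1) ≤ μ * (δ / 2 + (δ / 2) ^ 2) := by
      have h3 : 0 ≤ Real.exp (δ / 2) - 1 := by linarith [Real.add_one_le_exp (δ / 2)]
      exact (mul_le_mul_of_nonneg_right hμ h3).trans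
        (mul_le_mul_of_nonneg_left (by linarith) ((by positivity : (0 : ℝ) ≤ Q.card * p).trans hμ))
    nlinarith

theorem binomialRandom_edgeCount_le_sub (p : I) {Q R : Finset (Sym2 (Fin n))}
    (hQ : Q ⊆ allEdges n) (hR : R ⊆ allEdges n) (hQR : Disjoint Q R) {δ μ : ℝ} (hδ0 : 0 ≤ δ)
    (hδ : δ ≤ 1) (hμ : μ ≤ (Q.card : ℝ) * p) :
    (SimpleGraph.binomialRandom (Fin n) p).real
        {G | (R : Set (Sym2 (Fin n))) ⊆ G.edgeSet ∧ edgeCount G Q ≤ (1 - δ) * μ} ≤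
      (p : ℝ) ^ R.card * Real.exp (-(μ * δ ^ 2 / 4)) := by
  have h := binomialRandom_edgeCount_le p hQ hR hQR (-(δ / 2)) ((1 - δ) * μ)
  refine (measureReal_mono fun G hG => ?_).trans (h.trans ?_)
  · exact ⟨hG.1, by nlinarith [mul_le_mul_of_nonneg_left hG.2 (by positivity : 0 ≤ δ / 2)]⟩
  · have hp : (0 : ℝ) ≤ p := p.2.1
    gcongr
    have h1 := (abs_le.1 (Real.abs_exp_sub_one_sub_id_le (x := -(δ / 2))
      (by rw [abs_neg, abs_of_nonneg (by positivity)]; linarith))).2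
    have h2 : (Q.card : ℝ) * p * (Real.exp (-(δ / 2)) - 1) ≤ μ * (-(δ / 2) + (δ / 2) ^ 2) := by
      have h3 : -(δ / 2) + (δ / 2) ^ 2 ≤ 0 := by nlinarith
      calc _ ≤ (Q.card : ℝ) * p * (-(δ / 2) + (δ / 2) ^ 2) :=
            mul_le_mul_of_nonneg_left (by linarith) (by positivity)
        _ ≤ _ := mul_le_mul_of_nonpos_right hμ h3
    nlinarith

/-! ### Rates -/

/-- The contact rate along a pair of nodes, for success probability `1`. -/
def rate (G : SimpleGraph (Fin n)) (u v : Fin n) : ℝ := ad G u v * (1 / dg G u + 1 / dg G v)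

theorem rate_nonneg (G : SimpleGraph (Fin n)) (u v : Fin n) : 0 ≤ rate G u v := by
  unfold rate
  have := ad_nonneg G u v
  have := dg_nonneg G u
  have := dg_nonneg G v
  positivity

theorem rate_comm (G : SimpleGraph (Fin n)) (u v : Fin n) : rate G u v = rate G v u := by
  unfold rate
  rw [ad_comm, add_comm]

theorem contactWeight_of_ne (q : I) (G : SimpleGraph (Fin n)) {u v : Fin n} (h : u ≠ v) :
    contactWeight q G (u, v) = q / n * (ad G u v / dg G u) := by
  unfold ad
  split_ifs with h1
  · rw [contactWeight_of_adj q h1]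
  · rw [contactWeight_of_not_adj q h1 h]
    simp

theorem contactWeight_add_swap (q : I) (G : SimpleGraph (Fin n)) {u v : Fin n} (h : u ≠ v) :
    contactWeight q G (u, v) + contactWeight q G (v, u) = q / n * rate G u v := by
  rw [contactWeight_of_ne q G h, contactWeight_of_ne q G h.symm, rate, ad_comm G v u]
  ring

theorem sum_contactWeight_stepSet (q : I) (G : SimpleGraph (Fin n)) (f : Finset (Fin n) → ℝ)
    (S : Finset (Fin n)) : ∑ e, contactWeight q G e * (f (stepSet S e) - f S) =
      q / n * ∑ u ∈ S, ∑ v ∈ Sᶜ, rate G u v * (f (insert v S) - f S) := by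
  rw [sum_stepSet, Finset.mul_sum]
  refine Finset.sum_congr rfl fun u hu => ?_
  rw [Finset.mul_sum]
  refine Finset.sum_congr rfl fun v hv => ?_
  have huv : u ≠ v := fun h => Finset.mem_compl.1 hv (h ▸ hu)
  rw [contactWeight_add_swap q G huv]
  ring

theorem sum_contactWeight_card (q : I) (G : SimpleGraph (Fin n)) (S : Finset (Fin n)) :
    ∑ e, contactWeight q G e * (((stepSet S e).card : ℝ) - S.card) =
      q / n * ∑ u ∈ S, ∑ v ∈ Sᶜ, rate G u v := by
  rw [sum_contactWeight_stepSet q G (fun S => (S.card : ℝ))]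
  congr 1
  refine Finset.sum_congr rfl fun u _ => Finset.sum_congr rfl fun v hv => ?_
  rw [Finset.card_insert_of_notMem (Finset.mem_compl.1 hv)]
  push_cast
  ring

/-- Sums of `x ^ |S|` over all nonempty sets. -/
theorem sum_pow_card_le {x : ℝ} (hx : 0 ≤ x) (hxn : n * x ≤ 1) :
    ∑ S : Finset (Fin n) with S.Nonempty, x ^ S.card ≤ 2 * (n * x) := by
  have h1 := Fintype.sum_pow_mul_eq_add_pow (Fin n) x (1 : ℝ)
  simp only [one_pow, mul_one, Fintype.card_fin] at h1
  have h2 : (x + 1) ^ n ≤ Real.exp (n * x) := by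
    rw [Real.exp_nat_mul]
    exact pow_le_pow_left₀ (by linarith) (Real.add_one_le_exp x) _
  have h3 := (abs_le.1 (Real.abs_exp_sub_one_sub_id_le (x := n * x)
    (by rw [abs_of_nonneg (by positivity)]; exact hxn))).2
  have h4 : ∑ S : Finset (Fin n), x ^ S.card =
      ∑ S : Finset (Fin n) with S.Nonempty, x ^ S.card + 1 := by
    rw [← Finset.sum_filter_add_sum_filter_not _ Finset.Nonempty]
    congr 1
    simp [Finset.not_nonempty_iff_eq_empty, Finset.sum_filter]
  have h5 : 0 ≤ n * x := by positivity
  nlinarith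

end Rumor

end

noncomputable section

namespace Rumor

variable {n : ℕ}

/-! ### Spreading when all cuts have nearly their typical size -/

theorem sum_Ico_one_div_sq_le {a b : ℕ} (ha : 0 < a) (hab : a ≤ b) :
    ∑ i ∈ Finset.Ico a b, 1 / (i : ℝ) ^ 2 ≤ 2 / (a : ℝ) := by
  have : ∑ i ∈ Finset.Ico a b, 1 / (i : ℝ) ^ 2 ≤ 2 / (a : ℝ) - 2 / (b : ℝ) := by
    induction b, hab using Nat.le_induction with
    | base => simp
    | succ b hb ih =>
      rw [Finset.sum_Ico_succ_top hb]
      have hb0 : (0 : ℝ) < b := by exact_mod_cast ha.trans_le hb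
      have hb1 : (1 : ℝ) ≤ b := by exact_mod_cast Nat.succ_le_of_lt (ha.trans_le hb)
      have h1 : 1 / (b : ℝ) ^ 2 ≤ 2 / b - 2 / ((b + 1 : ℕ) : ℝ) := by
        push_cast
        rw [div_sub_div _ _ hb0.ne' (by positivity), div_le_div_iff₀ (by positivity) (by positivity)]
        nlinarith
      linarith
  have h2 : (0 : ℝ) ≤ 2 / b := by positivity
  linarith

theorem sum_Ico_one_div_le {a b : ℕ} (ha : 0 < a) :
    ∑ i ∈ Finset.Ico a b, 1 / (i : ℝ) ≤ 1 + Real.log b := by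
  have h := harmonic_le_one_add_log b
  refine le_trans ?_ h
  rw [harmonic_eq_sum_Icc]
  push_cast
  simp only [one_div]
  refine Finset.sum_le_sum_of_subset_of_nonneg (fun i hi => ?_) fun _ _ _ => by positivity
  rw [Finset.mem_Ico] at hi
  rw [Finset.mem_Icc]
  omega

theorem sum_Ico_reflect_one (f : ℕ → ℝ) (n : ℕ) :
    ∑ i ∈ Finset.Ico 1 n, f (n - i) = ∑ i ∈ Finset.Ico 1 n, f i := by
  have := Finset.sum_Ico_reflect f 1 (Nat.le_succ n)
  simpa using this

theorem prod_one_add_le {ι : Type*} (s : Finset ι) {f : ι → ℝ} (h : ∀ i ∈ s, 0 ≤ 1 + f i) :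
    ∏ i ∈ s, (1 + f i) ≤ Real.exp (∑ i ∈ s, f i) := by
  rw [Real.exp_sum]
  exact Finset.prod_le_prod h fun i _ => by
    rw [add_comm]
    exact Real.add_one_le_exp _

theorem one_sub_pow_le {s : ℝ} (hs : s ≤ 1) (j : ℕ) : (1 - s) ^ j ≤ Real.exp (-(s * j)) := by
  have h1 : 1 - s ≤ Real.exp (-s) := by linarith [Real.add_one_le_exp (-s)]
  calc _ ≤ Real.exp (-s) ^ j := pow_le_pow_left₀ (by linarith) h1 _
    _ = _ := by
      rw [← Real.exp_nat_mul]
      ring_nf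

theorem one_add_pow_le {s : ℝ} (hs : 0 ≤ s) (j : ℕ) : (1 + s) ^ j ≤ Real.exp (s * j) := by
  calc _ ≤ Real.exp s ^ j :=
        pow_le_pow_left₀ (by linarith) (by linarith [Real.add_one_le_exp s]) _
    _ = _ := by
      rw [← Real.exp_nat_mul]
      ring_nf

/-- The factor in the exponential bound for the hitting time of a large set. -/
theorem div_sub_le {s a : ℝ} (hs : 0 ≤ s) (ha : 0 < a) (h : 2 * s ≤ a) :
    s / (a - s) ≤ s / a + 2 * (s / a) ^ 2 := by
  have h1 : 0 < a - s := by linarith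
  have h2 : s / (a - s) - s / a = s / a * (s / (a - s)) := by
    field_simp
    ring
  have h3 : s / (a - s) ≤ 2 * (s / a) := by
    rw [div_le_iff₀ h1]
    have : 2 * (s / a) * (a - s) = 2 * s - 2 * s * (s / a) := by
      field_simp
    rw [this]
    have : s / a ≤ 1 / 2 := by
      rw [div_le_iff₀ ha]
      linarith
    nlinarith
  have h4 : 0 ≤ s / a := by positivity
  nlinarith

theorem inv_one_add_le_exp {y : ℝ} (hy0 : 0 ≤ y) (hy : y ≤ 1) :
    (1 + y)⁻¹ ≤ Real.exp (-y + y ^ 2) := by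
  have h1 := (abs_le.1 (Real.abs_exp_sub_one_sub_id_le (x := y - y ^ 2)
    (by rw [abs_le]; constructor <;> nlinarith))).2
  have h2 : Real.exp (y - y ^ 2) ≤ 1 + y := by
    have h3 : (y - y ^ 2) ^ 2 ≤ y ^ 2 :=
      pow_le_pow_left₀ (by nlinarith) (by nlinarith) 2
    linarith
  rw [inv_le_comm₀ (by positivity) (Real.exp_pos _), ← Real.exp_neg]
  rwa [neg_add, neg_neg, ← sub_eq_add_neg]

/-- The typical probability that the informed set grows from `k` to `k + 1` nodes. -/
def growth (n : ℕ) (q : ℝ) (k : ℕ) : ℝ := 2 * q * (k * (n - k)) / (n * (n - 1))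

/-- The typical spreading time in a dense random graph. -/
def growthTime (n : ℕ) (q : ℝ) : ℝ := ∑ k ∈ Finset.Ico 1 n, 1 / n / growth n q k

theorem growth_pos {q : ℝ} (hq : 0 < q) {k : ℕ} (hk : 0 < k) (hkn : k < n) : 0 < growth n q k := by
  have h1 : (0 : ℝ) < k := by exact_mod_cast hk
  have h2 : (0 : ℝ) < n - k := sub_pos.2 (by exact_mod_cast hkn)
  have h3 : (0 : ℝ) < n - 1 := by
    have : (1 : ℝ) ≤ k := by exact_mod_cast hk
    linarith
  have h4 : (0 : ℝ) < n := by linarith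
  unfold growth
  positivity

/-- Partial fractions. The time spent at `k` informed nodes behaves like `1 / k` early and like `1 /
(n - k)` late, so each half of the process costs half a logarithm divided by `q`. -/
theorem one_div_growth_le {q : ℝ} (hq : 0 < q) {k : ℕ} (hk : 0 < k) (hkn : k < n) :
    1 / n / growth n q k ≤ 1 / (2 * q) * (1 / k + 1 / (n - k : ℕ)) := by
  have h1 : (1 : ℝ) ≤ k := by exact_mod_cast hk
  have h2 : (0 : ℝ) < n - k := sub_pos.2 (by exact_mod_cast hkn)
  have h4 : (0 : ℝ) < n := by linarith
  have h3 : (0 : ℝ) < n - 1 := by linarith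
  rw [Nat.cast_sub hkn.le]
  have : 1 / (2 * q) * (1 / (k : ℝ) + 1 / (n - k)) - 1 / n / growth n q k =
      1 / (2 * q) * (1 / (k * (n - k))) := by
    unfold growth
    field_simp
    ring
  have h5 : 0 ≤ 1 / (2 * q) * (1 / ((k : ℝ) * (n - k))) := by positivity
  linarith

theorem growthTime_le {q : ℝ} (hq : 0 < q) : growthTime n q ≤ 1 / q * (1 + Real.log n) := by
  calc growthTime n q ≤ ∑ k ∈ Finset.Ico 1 n, 1 / (2 * q) * (1 / (k : ℝ) + 1 / (n - k : ℕ)) :=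
        Finset.sum_le_sum fun k hk => one_div_growth_le hq (Finset.mem_Ico.1 hk).1
          (Finset.mem_Ico.1 hk).2
    _ = 1 / q * ∑ k ∈ Finset.Ico 1 n, 1 / (k : ℝ) := by
        rw [← Finset.mul_sum, Finset.sum_add_distrib,
          sum_Ico_reflect_one fun i => 1 / (i : ℝ)]
        field_simp
        ring
    _ ≤ _ := mul_le_mul_of_nonneg_left (sum_Ico_one_div_le one_pos) (by positivity)

theorem growthTime_nonneg {q : ℝ} (hq : 0 < q) : 0 ≤ growthTime n q :=
  Finset.sum_nonneg fun k hk => by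
    have := growth_pos hq (Finset.mem_Ico.1 hk).1 (Finset.mem_Ico.1 hk).2
    positivity

/-- These are the second-order terms of the exponential bounds below. That their sum is bounded is
the reason for fluctuations `O(1)` rather than a power of the logarithm. -/
theorem sum_growth_sq_le {q : ℝ} (hq : 0 < q) :
    ∑ k ∈ Finset.Ico 1 n, (q / (2 * n) / ((1 / 2) * growth n q k)) ^ 2 ≤ 4 := by
  calc _ ≤ ∑ k ∈ Finset.Ico 1 n, 1 / 2 * (1 / (k : ℝ) ^ 2 + 1 / ((n - k : ℕ) : ℝ) ^ 2) := by
        refine Finset.sum_le_sum fun k hk => ?_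
        rw [Finset.mem_Ico] at hk
        have h1 := one_div_growth_le hq hk.1 hk.2
        have h2 := growth_pos hq hk.1 hk.2
        have h3 : q / (2 * n) / ((1 / 2) * growth n q k) = q * (1 / n / growth n q k) := by
          field_simp
        have h4 : q * (1 / n / growth n q k) ≤ 1 / 2 * (1 / (k : ℝ) + 1 / (n - k : ℕ)) := by
          calc _ ≤ q * (1 / (2 * q) * (1 / (k : ℝ) + 1 / (n - k : ℕ))) := by gcongr
            _ = _ := by
              field_simp
        rw [h3]
        calc _ ≤ (1 / 2 * (1 / (k : ℝ) + 1 / (n - k : ℕ))) ^ 2 :=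
              pow_le_pow_left₀ (by positivity) h4 2
          _ ≤ _ := by
            rw [← one_div_pow, ← one_div_pow]
            nlinarith [sq_nonneg (1 / (k : ℝ) - 1 / (n - k : ℕ))]
    _ = ∑ k ∈ Finset.Ico 1 n, 1 / (k : ℝ) ^ 2 := by
        rw [← Finset.mul_sum, Finset.sum_add_distrib,
          sum_Ico_reflect_one fun i => 1 / (i : ℝ) ^ 2]
        ring
    _ ≤ 4 := by
        rcases Nat.lt_or_ge n 1 with h | h
        · simp [Finset.Ico_eq_empty_of_le h.le]
        · have := sum_Ico_one_div_sq_le one_pos h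
          norm_num at this ⊢
          linarith

section Uniform

variable {q : I} {G : SimpleGraph (Fin n)} {δ : ℝ}

/-- All cuts spread the rumor at their typical rate, up to a factor `1 ± δ`. -/
def UniformRates (q : I) (G : SimpleGraph (Fin n)) (δ : ℝ) : Prop :=
  ∀ S : Finset (Fin n), S.Nonempty → S ≠ Finset.univ →
    (1 - δ) * growth n q S.card ≤
      ∑ e, contactWeight q G e * (((stepSet S e).card : ℝ) - S.card) ∧
    ∑ e, contactWeight q G e * (((stepSet S e).card : ℝ) - S.card) ≤ (1 + δ) * growth n q S.card

theorem one_div_one_sub_le (hδ0 : 0 ≤ δ) (hδ : δ ≤ 1 / 2) : 1 / (1 - δ) ≤ 1 + 2 * δ := by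
  rw [div_le_iff₀ (by linarith)]
  nlinarith

theorem one_sub_le_one_div (hδ0 : 0 ≤ δ) : 1 - δ ≤ 1 / (1 + δ) := by
  rw [le_div_iff₀ (by linarith)]
  nlinarith

theorem meanReal_le_of_uniformRates (hq : 0 < q) (hG : G.Connected) (h : UniformRates q G δ)
    (hδ0 : 0 ≤ δ) (hδ : δ ≤ 1 / 2) (s : Fin n) :
    meanReal q G {s} ≤ (1 + 2 * δ) * growthTime n q := by
  have hq' : (0 : ℝ) < q := hq
  have h1 := hitting_le_sum (contactWeight_nonneg q G) (τ := 1 / n) (by positivity)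
    (meanReal_univ q G) (fun S hS hS' => sum_contactWeight_meanReal hq hG hS hS')
    (a := fun k => (1 - δ) * growth n q k)
    (fun i hi hi0 => mul_pos (by linarith) (growth_pos hq' hi0 (by simpa using hi)))
    (fun S hS hS' => (h S hS hS').1) (Finset.singleton_nonempty s)
  refine h1.trans ?_
  rw [Finset.card_singleton, Fintype.card_fin, growthTime, Finset.mul_sum]
  refine Finset.sum_le_sum fun k hk => ?_
  have h2 := growth_pos hq' (Finset.mem_Ico.1 hk).1 (Finset.mem_Ico.1 hk).2
  calc _ = 1 / (1 - δ) * (1 / n / growth n q k) := by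
        have : 1 - δ ≠ 0 := by linarith
        field_simp
    _ ≤ _ := mul_le_mul_of_nonneg_right (one_div_one_sub_le hδ0 hδ) (by positivity)

theorem le_meanReal_of_uniformRates (hq : 0 < q) (hG : G.Connected) (h : UniformRates q G δ)
    (hδ0 : 0 ≤ δ) (s : Fin n) : (1 - δ) * growthTime n q ≤ meanReal q G {s} := by
  have hq' : (0 : ℝ) < q := hq
  have hn : (0 : ℝ) < n := by exact_mod_cast s.pos
  have h1 := sum_le_hitting (contactWeight_nonneg q G) (τ := 1 / n) (by positivity)
    (meanReal_univ q G) (fun S hS hS' => sum_contactWeight_meanReal hq hG hS hS')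
    (a := fun k => (1 + δ) * growth n q k)
    (fun i hi hi0 => mul_pos (by linarith) (growth_pos hq' hi0 (by simpa using hi)))
    (fun S hS hS' => (h S hS hS').2) (Finset.singleton_nonempty s)
  refine le_trans ?_ h1
  rw [Finset.card_singleton, Fintype.card_fin, growthTime, Finset.mul_sum]
  refine Finset.sum_le_sum fun k hk => ?_
  have h2 := growth_pos hq' (Finset.mem_Ico.1 hk).1 (Finset.mem_Ico.1 hk).2
  calc _ ≤ 1 / (1 + δ) * (1 / n / growth n q k) :=
        mul_le_mul_of_nonneg_right (one_sub_le_one_div hδ0) (by positivity)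
    _ = _ := by
        have : 1 + δ ≠ 0 := by linarith
        field_simp

theorem le_half_growth {q : ℝ} (hq : 0 < q) {k : ℕ} (hk : 0 < k) (hkn : k < n) :
    2 * (q / (2 * n)) ≤ 1 / 2 * growth n q k := by
  have h1 : (1 : ℝ) ≤ k := by exact_mod_cast hk
  have h2 : (k : ℝ) + 1 ≤ n := by exact_mod_cast hkn
  have h4 : (0 : ℝ) < n := by linarith
  have h3 : (0 : ℝ) < n - 1 := by linarith
  have h5 : (n : ℝ) - 1 ≤ k * (n - k) := by nlinarith
  have h6 : 1 / 2 * growth n q k = q / n * (k * (n - k) / (n - 1)) := by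
    unfold growth
    field_simp
  rw [h6]
  have h7 : 1 ≤ (k : ℝ) * (n - k) / (n - 1) := by
    rw [le_div_iff₀ h3]
    linarith
  calc 2 * (q / (2 * n)) = q / n * 1 := by field_simp
    _ ≤ _ := by gcongr

/-- The bound for sums of geometric times with `s = q / (2 * n)`, which is at most half of every
rate that occurs (`le_half_growth`). First-order terms add up to `q / 2` times the upper bound for
the mean, second-order terms to at most `2 * 4 = 8`. -/
theorem iterate_uninformed_le_of_uniformRates (hq : 0 < q) (h : UniformRates q G δ)
    (hδ0 : 0 ≤ δ) (hδ : δ ≤ 1 / 2) (s : Fin n) {x : ℝ} {j : ℕ}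
    (hj : n * ((1 + 2 * δ) * growthTime n q + x) ≤ j) :
    (chainOp (contactWeight q G))^[j] uninformed {s} ≤ Real.exp (8 - q / 2 * x) := by
  have hq' : (0 : ℝ) < q := hq
  have hq1 : (q : ℝ) ≤ 1 := q.2.2
  have hn0 : 0 < n := s.pos
  have hn : (1 : ℝ) ≤ n := by exact_mod_cast hn0
  set t : ℝ := q / (2 * n) with ht
  have ht0 : 0 ≤ t := by positivity
  have ht1 : t ≤ 1 := by
    rw [ht, div_le_one (by positivity)]
    linarith
  have hlo : ∀ k : ℕ, 0 < k → k < n → 1 / 2 * growth n q k ≤ (1 - δ) * growth n q k :=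
    fun k hk hkn => mul_le_mul_of_nonneg_right (by linarith) (growth_pos hq' hk hkn).le
  -- The value at `0` is a dummy: the general bound asks for `s < a i` at all levels, but a nonempty
  -- set never has level `0`.
  have ha : ∀ i, i < n → t < (fun k => if k = 0 then t + 1 else (1 - δ) * growth n q k) i := by
    intro i hi
    by_cases h0 : i = 0
    · simp [h0]
    · have := le_half_growth hq' (Nat.pos_of_ne_zero h0) hi
      have h2 := hlo i (Nat.pos_of_ne_zero h0) hi
      have : 0 < t := by positivity
      simp only [h0, if_false]
      linarith
  have h1 := iterate_chainOp_lt_le (contactWeight_nonneg q G) (sum_contactWeight_le_one q G hn0)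
    (R := Finset.Nonempty) (fun S e hS _ => hS.mono (subset_stepSet S e)) (g := Finset.card)
    (fun S e => Finset.card_le_card (subset_stepSet S e)) stepSet_card_le (K := n) ht0 ht1
    ha (fun S hS hlt => by
      rw [if_neg hS.card_pos.ne']
      refine (h S hS fun hu => ?_).1
      rw [hu, Finset.card_univ, Fintype.card_fin] at hlt
      exact lt_irrefl _ hlt) j (Finset.singleton_nonempty s)
  have h2 : (fun S : Finset (Fin n) => if S.card < n then (1 : ℝ) else 0) = uninformed := by
    funext S
    unfold uninformed
    by_cases hu : S = Finset.univ
    · simp [hu]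
    · have : S.card < n := by
        simpa using Finset.card_lt_card (Finset.ssubset_univ_iff.2 hu)
      simp [hu, this]
  rw [h2] at h1
  refine h1.trans ?_
  rw [Finset.card_singleton]
  have h3 : ∏ i ∈ Finset.Ico 1 n, (1 + t / ((if i = 0 then t + 1 else (1 - δ) * growth n q i) - t)) ≤
      Real.exp (q / 2 * ((1 + 2 * δ) * growthTime n q) + 8) := by
    refine (prod_one_add_le _ fun i hi => ?_).trans (Real.exp_le_exp.2 ?_)
    · have := ha i (Finset.mem_Ico.1 hi).2
      have := div_nonneg ht0 (sub_nonneg.2 this.le)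
      linarith
    · have h4 : ∀ i ∈ Finset.Ico 1 n,
          t / ((if i = 0 then t + 1 else (1 - δ) * growth n q i) - t) ≤
            q / 2 * ((1 + 2 * δ) * (1 / n / growth n q i)) +
              2 * (t / ((1 / 2) * growth n q i)) ^ 2 := by
        intro i hi
        rw [Finset.mem_Ico] at hi
        have hg := growth_pos hq' hi.1 hi.2
        rw [if_neg (by omega)]
        have h5 := le_half_growth hq' hi.1 hi.2
        have h6 := hlo i hi.1 hi.2
        refine (div_sub_le ht0 ((by positivity : 0 < 1 / 2 * growth n q i).trans_le h6)
          (h5.trans h6)).trans ?_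
        refine add_le_add ?_ ?_
        · calc t / ((1 - δ) * growth n q i) = q / 2 * (1 / (1 - δ) * (1 / n / growth n q i)) := by
                have : 1 - δ ≠ 0 := by linarith
                rw [ht]
                field_simp
            _ ≤ _ := by
              gcongr
              exact one_div_one_sub_le hδ0 hδ
        · have h8 : t / ((1 - δ) * growth n q i) ≤ t / ((1 / 2) * growth n q i) := by gcongr
          have h9 : 0 ≤ t / ((1 - δ) * growth n q i) :=
            div_nonneg ht0 ((by positivity : 0 ≤ 1 / 2 * growth n q i).trans h6)
          gcongr
      refine (Finset.sum_le_sum h4).trans ?_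
      rw [Finset.sum_add_distrib, ← Finset.mul_sum, ← Finset.mul_sum, ← Finset.mul_sum]
      have := sum_growth_sq_le (n := n) hq'
      rw [growthTime]
      linarith
  calc _ ≤ Real.exp (-(t * j)) * Real.exp (q / 2 * ((1 + 2 * δ) * growthTime n q) + 8) := by
        refine mul_le_mul (one_sub_pow_le ht1 j) h3 ?_ (Real.exp_pos _).le
        refine Finset.prod_nonneg fun i hi => ?_
        have := ha i (Finset.mem_Ico.1 hi).2
        have := div_nonneg ht0 (sub_nonneg.2 this.le)
        linarith
    _ ≤ _ := by
        rw [← Real.exp_add, Real.exp_le_exp]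
        have h7 : t * (n * ((1 + 2 * δ) * growthTime n q + x)) =
            q / 2 * ((1 + 2 * δ) * growthTime n q + x) := by
          rw [ht]
          field_simp
        have := mul_le_mul_of_nonneg_left hj ht0
        linarith

theorem one_sub_iterate_uninformed_le_of_uniformRates (hq : 0 < q) (h : UniformRates q G δ)
    (hδ0 : 0 ≤ δ) (s : Fin n) {x : ℝ} {j : ℕ}
    (hj : j ≤ n * ((1 - δ) * growthTime n q - x)) :
    1 - (chainOp (contactWeight q G))^[j] uninformed {s} ≤ Real.exp (8 - q / 2 * x) := by
  have hq' : (0 : ℝ) < q := hq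
  have hn0 : 0 < n := s.pos
  have hn : (1 : ℝ) ≤ n := by exact_mod_cast hn0
  set t : ℝ := q / (2 * n) with ht
  have ht0 : 0 ≤ t := by positivity
  have h1 := one_sub_iterate_chainOp_le (contactWeight_nonneg q G)
    (sum_contactWeight_le_one q G hn0) (a := fun k => (1 + δ) * growth n q k) ht0
    (fun i hi hi0 => mul_pos (by linarith) (growth_pos hq' hi0 (by simpa using hi)))
    (fun S hS hS' => (h S hS hS').2) j (Finset.singleton_nonempty s)
  refine h1.trans ?_
  rw [Finset.card_singleton, Fintype.card_fin]
  have h3 : ∏ i ∈ Finset.Ico 1 n, (1 + t / ((1 + δ) * growth n q i))⁻¹ ≤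
      Real.exp (-(q / 2 * ((1 - δ) * growthTime n q)) + 8) := by
    have h4 : ∀ i ∈ Finset.Ico 1 n, (1 + t / ((1 + δ) * growth n q i))⁻¹ ≤
        Real.exp (-(q / 2 * ((1 - δ) * (1 / n / growth n q i))) +
          (t / ((1 / 2) * growth n q i)) ^ 2) := by
      intro i hi
      rw [Finset.mem_Ico] at hi
      have hg := growth_pos hq' hi.1 hi.2
      have h5 := le_half_growth hq' hi.1 hi.2
      have h6 : 1 / 2 * growth n q i ≤ (1 + δ) * growth n q i := by gcongr; linarith
      have hle : t / ((1 + δ) * growth n q i) ≤ t / ((1 / 2) * growth n q i) := by gcongr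
      refine (inv_one_add_le_exp (by positivity) ?_).trans (Real.exp_le_exp.2 ?_)
      · rw [div_le_one (by positivity)]
        linarith
      · refine add_le_add (neg_le_neg ?_) (pow_le_pow_left₀ (by positivity) hle 2)
        calc _ ≤ q / 2 * (1 / (1 + δ) * (1 / n / growth n q i)) := by
              gcongr
              exact one_sub_le_one_div hδ0
          _ = _ := by
            rw [ht]
            field_simp
    refine (Finset.prod_le_prod (fun i hi => ?_) h4).trans ?_
    · rw [Finset.mem_Ico] at hi
      have hg := growth_pos hq' hi.1 hi.2
      positivity
    · rw [← Real.exp_sum, Real.exp_le_exp, Finset.sum_add_distrib, Finset.sum_neg_distrib,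
        ← Finset.mul_sum, ← Finset.mul_sum]
      have := sum_growth_sq_le (n := n) hq'
      rw [growthTime]
      linarith
  calc _ ≤ Real.exp (t * j) * Real.exp (-(q / 2 * ((1 - δ) * growthTime n q)) + 8) := by
        refine mul_le_mul (one_add_pow_le ht0 j) h3 ?_ (Real.exp_pos _).le
        refine Finset.prod_nonneg fun i hi => ?_
        rw [Finset.mem_Ico] at hi
        have hg := growth_pos hq' hi.1 hi.2
        positivity
    _ ≤ _ := by
        rw [← Real.exp_add, Real.exp_le_exp]
        have h7 : t * (n * ((1 - δ) * growthTime n q - x)) =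
            q / 2 * ((1 - δ) * growthTime n q - x) := by
          rw [ht]
          field_simp
        have := mul_le_mul_of_nonneg_left hj ht0
        linarith

/-- Concentration of the spreading time under uniform rates. -/
theorem law_not_close_le_of_uniformRates (hq : 0 < q) (hG : G.Connected) (hn : 2 ≤ n)
    (h : UniformRates q G δ) (hδ0 : 0 ≤ δ) (hδ : δ ≤ 1 / 2) (s : Fin n) {x : ℝ} (hx : 0 ≤ x)
    (hxn : 2 * growthTime n q + x + 1 ≤ n - 1) :
    law q G {ω | ¬ Close q s (3 * δ * growthTime n q + 2 * x + 1) G ω} ≤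
      ENNReal.ofReal (4 * Real.exp (8 - q / 2 * x)) := by
  have hq' : (0 : ℝ) < q := hq
  have hq1 : (q : ℝ) ≤ 1 := q.2.2
  have hn' : (2 : ℝ) ≤ n := by exact_mod_cast hn
  set H := growthTime n q with hH
  have hH0 : 0 ≤ H := growthTime_nonneg hq'
  set j₂ := ⌈n * ((1 + 2 * δ) * H + x)⌉₊ with hj₂
  set j₁ := ⌊n * ((1 - δ) * H - x)⌋₊ with hj₁
  have h2a : n * ((1 + 2 * δ) * H + x) ≤ j₂ := Nat.le_ceil _
  have h2b : (j₂ : ℝ) ≤ n * ((1 + 2 * δ) * H + x) + 1 := (Nat.ceil_lt_add_one (by positivity)).le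
  have h1b : n * ((1 - δ) * H - x) - 1 ≤ j₁ := (Nat.sub_one_lt_floor _).le
  have hu₁ : 1 - (chainOp (contactWeight q G))^[j₁] uninformed {s} ≤ Real.exp (8 - q / 2 * x) := by
    -- The natural floor of a negative number is `0`, and after `0` steps a single informed node
    -- among `n ≥ 2` is not everything.
    rcases lt_or_ge (n * ((1 - δ) * H - x)) 0 with hneg | hpos
    · have : j₁ = 0 := Nat.floor_of_nonpos hneg.le
      rw [this]
      have hs : ({s} : Finset (Fin n)) ≠ Finset.univ := fun hs => by
        have := congrArg Finset.card hs
        simp at this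
        omega
      simp [uninformed, hs, Real.exp_nonneg]
    · exact one_sub_iterate_uninformed_le_of_uniformRates hq h hδ0 s (Nat.floor_le hpos)
  have hu₂ := iterate_uninformed_le_of_uniformRates hq h hδ0 hδ s h2a
  have hm₁ := meanReal_le_of_uniformRates hq hG h hδ0 hδ s
  have hm₂ := le_meanReal_of_uniformRates hq hG h hδ0 s
  have hmul : ∀ a : ℝ, n * a / n = a := fun a => by field_simp
  have hj2n : (j₂ : ℝ) / n ≤ (1 + 2 * δ) * H + x + 1 := by
    rw [div_le_iff₀ (by linarith)]
    nlinarith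
  have hj1n : (1 - δ) * H - x - 1 ≤ (j₁ : ℝ) / n := by
    rw [le_div_iff₀ (by linarith)]
    nlinarith
  have hδH : δ * H ≤ 1 / 2 * H := mul_le_mul_of_nonneg_right hδ hH0
  have hδH0 : 0 ≤ δ * H := by positivity
  have hj₂n : (j₂ : ℝ) ≤ n * (n - 1) := by
    have h5 : (j₂ : ℝ) / n ≤ n - 1 := by linarith
    rw [div_le_iff₀ (by linarith)] at h5
    linarith
  have hj₁n : (j₁ : ℝ) ≤ n * (n - 1) := by
    refine le_trans ?_ hj₂n
    have : j₁ ≤ j₂ := by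
      refine (Nat.floor_le_floor ?_).trans (Nat.floor_le_ceil _)
      refine mul_le_mul_of_nonneg_left ?_ (by positivity)
      linarith
    exact_mod_cast this
  refine (law_not_close_le hq hG hn s hx hj₁n hj₂n (b := 3 * δ * H + 2 * x + 1)
    (by linarith) (by linarith)).trans (ENNReal.ofReal_le_ofReal ?_)
  have h6 : Real.exp (1 - x) ≤ Real.exp (8 - q / 2 * x) := by
    rw [Real.exp_le_exp]
    nlinarith
  linarith

end Uniform

end Rumor

end

noncomputable section

namespace Rumor

variable {n : ℕ}

/-! ### Dense random graphs -/

/-- The set of nodes reachable from `u` has no edge to its complement. -/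
theorem connected_of_cut_pos {G : SimpleGraph (Fin n)} (hn : 0 < n)
    (h : ∀ S : Finset (Fin n), S.Nonempty → S ≠ Finset.univ → 0 < cut G S Sᶜ) : G.Connected := by
  classical
  have : Nonempty (Fin n) := ⟨⟨0, hn⟩⟩
  refine (SimpleGraph.connected_iff _).2 ⟨fun u v => ?_, inferInstance⟩
  by_contra huv
  set S : Finset (Fin n) := Finset.univ.filter fun w => G.Reachable u w with hS
  have h1 := h S ⟨u, by simp [hS]⟩ fun hu => huv (by
    have : v ∈ S := hu ▸ Finset.mem_univ v
    simpa [hS] using this)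
  obtain ⟨a, ha, ha'⟩ := Finset.exists_lt_of_sum_lt (f := fun _ => (0 : ℝ))
    (by simpa [cut] using h1)
  obtain ⟨b, hb, hb'⟩ := Finset.exists_lt_of_sum_lt (f := fun _ => (0 : ℝ)) (by simpa using ha')
  have hab : G.Adj a b := by
    by_contra hab
    simp [ad, hab] at hb'
  simp only [hS, Finset.mem_filter, Finset.mem_univ, true_and, Finset.mem_compl] at ha hb
  exact hb (ha.trans hab.reachable)

theorem card_compl_cast (S : Finset (Fin n)) : ((Sᶜ).card : ℝ) = n - S.card := by
  rw [Finset.card_compl, Fintype.card_fin, Nat.cast_sub (by simpa using S.card_le_univ)]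

/-- All cuts have nearly their expected size. -/
def TypicalCuts (p : I) (δ : ℝ) (G : SimpleGraph (Fin n)) : Prop :=
  ∀ S : Finset (Fin n), S.Nonempty → 2 * S.card ≤ n →
    (1 - δ) * (S.card * (n - S.card) * p) < cut G S Sᶜ ∧
      cut G S Sᶜ < (1 + δ) * (S.card * (n - S.card) * p)

theorem TypicalCuts.of_ne_univ {p : I} {δ : ℝ} {G : SimpleGraph (Fin n)} (h : TypicalCuts p δ G)
    {S : Finset (Fin n)} (hS : S.Nonempty) (hu : S ≠ Finset.univ) :
    (1 - δ) * (S.card * (n - S.card) * p) < cut G S Sᶜ ∧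
      cut G S Sᶜ < (1 + δ) * (S.card * (n - S.card) * p) := by
  by_cases hc : 2 * S.card ≤ n
  · exact h S hS hc
  · have h1 : Sᶜ.Nonempty := by
      rw [Finset.nonempty_iff_ne_empty]
      exact fun h => hu (by simpa using h)
    have h2 := h Sᶜ h1 (by
      rw [Finset.card_compl, Fintype.card_fin]
      omega)
    rw [card_compl_cast, compl_compl, cut_comm] at h2
    convert h2 using 3 <;> ring

/-- Since `n - |S| ≥ n / 2`, the Chernoff exponent is at least `|S| * n * p * δ ^ 2 / 8 ≥ 2 * |S| *
log n`. So a set fails with probability at most `2 * n ^ (-2 * |S|)`, which can be summed over all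
sets. -/
theorem binomialRandom_not_typicalCuts_le {p : I} {δ : ℝ} (hδ0 : 0 ≤ δ) (hδ : δ ≤ 1) (hn : 0 < n)
    (h : 16 * Real.log n ≤ δ ^ 2 * (n * p)) :
    (SimpleGraph.binomialRandom (Fin n) p).real {G | ¬ TypicalCuts p δ G} ≤ 4 / n := by
  have hn' : (0 : ℝ) < n := by exact_mod_cast hn
  have hp : (0 : ℝ) ≤ p := p.2.1
  set x : ℝ := 1 / (n : ℝ) ^ 2 with hx
  have hone : ∀ S : Finset (Fin n), 2 * S.card ≤ n →
      (SimpleGraph.binomialRandom (Fin n) p).real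
        {G | ¬ ((1 - δ) * (S.card * (n - S.card) * p) < cut G S Sᶜ ∧
          cut G S Sᶜ < (1 + δ) * (S.card * (n - S.card) * p))} ≤ 2 * x ^ S.card := by
    intro S hc
    have hdis : Disjoint S Sᶜ := disjoint_compl_right
    have hcard : ((cutPairs S Sᶜ).card : ℝ) * p = S.card * (n - S.card) * p := by
      rw [card_cutPairs hdis]
      push_cast
      rw [card_compl_cast]
    have h1 := binomialRandom_edgeCount_ge p (cutPairs_subset hdis)
      (Finset.empty_subset (allEdges n)) (Finset.disjoint_empty_right _) hδ0 hδ hcard.le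
    have h2 := binomialRandom_edgeCount_le_sub p (cutPairs_subset hdis)
      (Finset.empty_subset (allEdges n)) (Finset.disjoint_empty_right _) hδ0 hδ hcard.ge
    have h3 : Real.exp (-(S.card * (n - S.card) * p * δ ^ 2 / 4)) ≤ x ^ S.card := by
      have h4 : x ^ S.card = Real.exp (-(2 * S.card * Real.log n)) := by
        rw [hx, one_div, ← Real.exp_log (inv_pos.2 (pow_pos hn' 2)), ← Real.exp_nat_mul,
          Real.log_inv, Real.log_pow]
        push_cast
        ring_nf
      rw [h4, Real.exp_le_exp, neg_le_neg_iff]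
      have h5 : (2 : ℝ) * S.card ≤ n := by exact_mod_cast hc
      have h6 : (n : ℝ) / 2 ≤ n - S.card := by linarith
      have h7 : S.card * ((n : ℝ) / 2) * p * δ ^ 2 ≤ S.card * (n - S.card) * p * δ ^ 2 := by
        gcongr
      have h8 := mul_le_mul_of_nonneg_left h (by positivity : (0 : ℝ) ≤ (S.card : ℝ))
      nlinarith
    calc _ ≤ (SimpleGraph.binomialRandom (Fin n) p).real
          ({G | ((∅ : Finset (Sym2 (Fin n))) : Set (Sym2 (Fin n))) ⊆ G.edgeSet ∧
            (1 + δ) * (S.card * (n - S.card) * p) ≤ edgeCount G (cutPairs S Sᶜ)} ∪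
          {G | ((∅ : Finset (Sym2 (Fin n))) : Set (Sym2 (Fin n))) ⊆ G.edgeSet ∧
            edgeCount G (cutPairs S Sᶜ) ≤ (1 - δ) * (S.card * (n - S.card) * p)}) := by
          refine measureReal_mono fun G hG => ?_
          simp only [Set.mem_ofPred_eq, not_and_or, not_lt] at hG
          simp only [Set.mem_union, Set.mem_ofPred_eq, Finset.coe_empty, Set.empty_subset, true_and,
            edgeCount_cutPairs G hdis]
          exact hG.symm
      _ ≤ _ := measureReal_union_le _ _
      _ ≤ 2 * x ^ S.card := by
        simp only [Finset.card_empty, pow_zero, one_mul] at h1 h2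
        linarith
  have hsub : {G : SimpleGraph (Fin n) | ¬ TypicalCuts p δ G} ⊆
      {G | ∃ S ∈ Finset.univ.filter fun S : Finset (Fin n) => S.Nonempty,
        2 * S.card ≤ n ∧ ¬ ((1 - δ) * (S.card * (n - S.card) * p) < cut G S Sᶜ ∧
          cut G S Sᶜ < (1 + δ) * (S.card * (n - S.card) * p))} := by
    intro G hG
    simp only [TypicalCuts, Set.mem_ofPred_eq, not_forall] at hG
    obtain ⟨S, h1, h2, h3⟩ := hG
    exact ⟨S, by simpa using h1, h2, h3⟩
  refine (measureReal_mono hsub).trans ((binomialRandom_real_exists_le p _ _).trans ?_)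
  calc _ ≤ ∑ S : Finset (Fin n) with S.Nonempty, 2 * x ^ S.card := by
        refine Finset.sum_le_sum fun S _ => ?_
        by_cases hc : 2 * S.card ≤ n
        · simpa [hc] using hone S hc
        · simp only [hc, false_and, Set.ofPred_false, measureReal_empty]
          positivity
    _ ≤ 2 * (2 * (n * x)) := by
        rw [← Finset.mul_sum]
        refine mul_le_mul_of_nonneg_left (sum_pow_card_le (by positivity) ?_) two_pos.le
        rw [hx, mul_one_div, div_le_one (by positivity)]
        have : (1 : ℝ) ≤ n := by exact_mod_cast hn
        nlinarith
    _ = 4 / n := by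
        rw [hx]
        field_simp
        ring

theorem TypicalCuts.connected {p : I} {δ : ℝ} {G : SimpleGraph (Fin n)} (h : TypicalCuts p δ G)
    (hn : 0 < n) (hδ : δ ≤ 1) : G.Connected :=
  connected_of_cut_pos hn fun S hS hu => by
    have hp : (0 : ℝ) ≤ p := p.2.1
    have h1 : (S.card : ℝ) ≤ n := by exact_mod_cast (by simpa using S.card_le_univ : S.card ≤ n)
    refine lt_of_le_of_lt ?_ (h.of_ne_univ hS hu).1
    exact mul_nonneg (by linarith) (mul_nonneg (mul_nonneg (by positivity) (by linarith)) hp)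

/-- Cuts of single nodes are degrees, so each edge has contact rate about `2 / ((n - 1) * p)`, and
the number of edges leaving `S` is about `|S| * (n - |S|) * p`. The product no longer contains `p`;
the two errors combine to `(1 + δ) / (1 - δ) ≤ 1 + 3 * δ`. -/
theorem TypicalCuts.uniformRates {p q : I} {δ : ℝ} {G : SimpleGraph (Fin n)}
    (h : TypicalCuts p δ G) (hn : 2 ≤ n) (hδ0 : 0 ≤ δ) (hδ : δ ≤ 1 / 6) :
    UniformRates q G (3 * δ) := by
  intro S hS hu
  have hn' : (2 : ℝ) ≤ n := by exact_mod_cast hn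
  have hq : (0 : ℝ) ≤ q := q.2.1
  have hp : (0 : ℝ) ≤ p := p.2.1
  rw [sum_contactWeight_card]
  set k : ℝ := (S.card : ℝ) with hk
  set D : ℝ := (n - 1) * p with hD
  have hk1 : 1 ≤ k := by
    rw [hk]
    exact_mod_cast hS.card_pos
  have hkn : k + 1 ≤ n := by
    have : S.card < n := by simpa using Finset.card_lt_card (Finset.ssubset_univ_iff.2 hu)
    rw [hk]
    exact_mod_cast this
  have hdeg : ∀ u, (1 - δ) * D < dg G u ∧ dg G u < (1 + δ) * D := by
    intro u
    have h1 := h.of_ne_univ (Finset.singleton_nonempty u) fun hu => by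
      have := congrArg Finset.card hu
      simp at this
      omega
    rw [cut_singleton_compl, Finset.card_singleton, Nat.cast_one, one_mul] at h1
    exact h1
  have hD0 : 0 < D := by
    obtain ⟨u, hu⟩ := hS
    have := (hdeg u).1.trans (hdeg u).2
    nlinarith
  have hp0 : (p : ℝ) ≠ 0 := by
    rintro h0
    rw [hD, h0, mul_zero] at hD0
    exact lt_irrefl _ hD0
  obtain ⟨hc1, hc2⟩ := h.of_ne_univ hS hu
  have hX0 : 0 ≤ k * (n - k) * p := mul_nonneg (mul_nonneg (by linarith) (by linarith)) hp
  have hgr : growth n q S.card = q / n * (2 / D * (k * (n - k) * p)) := by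
    rw [growth, hD, ← hk]
    have : (n : ℝ) - 1 ≠ 0 := by linarith
    field_simp
  rw [hgr]
  have hup : ∑ u ∈ S, ∑ v ∈ Sᶜ, rate G u v ≤ cut G S Sᶜ * (2 / ((1 - δ) * D)) := by
    rw [cut, Finset.sum_mul]
    refine Finset.sum_le_sum fun u _ => ?_
    rw [Finset.sum_mul]
    refine Finset.sum_le_sum fun v _ => mul_le_mul_of_nonneg_left ?_ (ad_nonneg _ _ _)
    have hpos : 0 < (1 - δ) * D := mul_pos (by linarith) hD0
    have h1 := one_div_le_one_div_of_le hpos (hdeg u).1.le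
    have h2 := one_div_le_one_div_of_le hpos (hdeg v).1.le
    calc _ ≤ 1 / ((1 - δ) * D) + 1 / ((1 - δ) * D) := add_le_add h1 h2
      _ = _ := by ring
  have hlow : cut G S Sᶜ * (2 / ((1 + δ) * D)) ≤ ∑ u ∈ S, ∑ v ∈ Sᶜ, rate G u v := by
    rw [cut, Finset.sum_mul]
    refine Finset.sum_le_sum fun u _ => ?_
    rw [Finset.sum_mul]
    refine Finset.sum_le_sum fun v _ => mul_le_mul_of_nonneg_left ?_ (ad_nonneg _ _ _)
    have hpos : 0 < (1 - δ) * D := mul_pos (by linarith) hD0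
    have h1 := one_div_le_one_div_of_le (hpos.trans (hdeg u).1) (hdeg u).2.le
    have h2 := one_div_le_one_div_of_le (hpos.trans (hdeg v).1) (hdeg v).2.le
    calc _ = 1 / ((1 + δ) * D) + 1 / ((1 + δ) * D) := by ring
      _ ≤ _ := add_le_add h1 h2
  constructor
  · rw [mul_left_comm]
    refine mul_le_mul_of_nonneg_left (le_trans ?_ hlow) (by positivity)
    calc (1 - 3 * δ) * (2 / D * (k * (n - k) * p))
        ≤ ((1 - δ) / (1 + δ)) * (2 / D * (k * (n - k) * p)) := by
          refine mul_le_mul_of_nonneg_right ?_ (by positivity)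
          rw [le_div_iff₀ (by linarith)]
          nlinarith
      _ = ((1 - δ) * (k * (n - k) * p)) * (2 / ((1 + δ) * D)) := by
          have : 1 + δ ≠ 0 := by linarith
          field_simp
      _ ≤ _ := mul_le_mul_of_nonneg_right hc1.le (by positivity)
  · rw [mul_left_comm]
    refine mul_le_mul_of_nonneg_left (hup.trans ?_) (by positivity)
    have hpos : 0 < (1 - δ) * D := mul_pos (by linarith) hD0
    calc _ ≤ ((1 + δ) * (k * (n - k) * p)) * (2 / ((1 - δ) * D)) :=
          mul_le_mul_of_nonneg_right hc2.le (by positivity)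
      _ = ((1 + δ) / (1 - δ)) * (2 / D * (k * (n - k) * p)) := by
          have : 1 - δ ≠ 0 := by linarith
          field_simp
      _ ≤ _ := by
          refine mul_le_mul_of_nonneg_right ?_ (by positivity)
          rw [div_le_iff₀ (by linarith)]
          nlinarith

theorem failProb_antitone (p q : I) : Antitone (failProb n p q) := by
  intro b b' h
  refine iSup_mono fun s => measure_mono fun x hx => ?_
  exact fun hc => hx ⟨hc.1, hc.2.1, hc.2.2.trans h⟩

theorem eventually_log_le {c : ℝ} (hc : 0 < c) :
    ∀ᶠ n : ℕ in atTop, Real.log n ≤ c * n := by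
  have := (Real.isLittleO_log_id_atTop.def hc).and (eventually_ge_atTop 1)
  filter_upwards [tendsto_natCast_atTop_atTop.eventually this] with n hn
  have h := hn.1
  rw [Real.norm_of_nonneg (Real.log_nonneg hn.2), id, Real.norm_of_nonneg (by linarith [hn.2])] at h
  exact h

/-- The constant `36` arises as follows: cuts are typical up to `4 * β`, rates then up to `12 * β`,
and the window for the time has width `3 * (12 * β) * growthTime`, where `growthTime ≤ (1 + log n) /
q`. The tolerance `ε` enters only through the additive constant. -/
theorem failProb_dense_le {q : I} (hq : 0 < q) {α : ℕ → ℝ} {p : ℕ → I}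
    (hα : Tendsto α atTop atTop) (hp : ∀ᶠ n : ℕ in atTop, (p n : ℝ) = α n * Real.log n / n)
    {ε : ℝ} (hε : 0 < ε) : ∃ C : ℝ, ∀ᶠ n : ℕ in atTop,
      failProb n (p n) q (36 / q * (α n ^ (-(1 / 2) : ℝ) * Real.log n) + C) ≤ ENNReal.ofReal ε := by
  have hq' : (0 : ℝ) < q := hq
  obtain ⟨x, hx0, hx⟩ : ∃ x : ℝ, 0 ≤ x ∧ 4 * Real.exp (8 - q / 2 * x) ≤ ε / 2 := by
    have h1 : Tendsto (fun x : ℝ => 4 * Real.exp (8 - q / 2 * x)) atTop (𝓝 (4 * 0)) := by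
      refine (Real.tendsto_exp_atBot.comp ?_).const_mul 4
      exact tendsto_atBot_add_const_left _ _
        (tendsto_neg_atTop_atBot.comp (tendsto_id.const_mul_atTop (by positivity)))
    rw [mul_zero] at h1
    obtain ⟨x, h2, h3⟩ := ((h1.eventually_le_const (half_pos hε)).and
      (eventually_ge_atTop 0)).exists
    exact ⟨x, h3, h2⟩
  refine ⟨36 / q + 2 * x + 1, ?_⟩
  have hlarge : ∀ᶠ n : ℕ in atTop, (8 / ε ≤ n) ∧ (4 * (2 / q + x + 2) ≤ n) :=
    (tendsto_natCast_atTop_atTop.eventually_ge_atTop _).and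
      (tendsto_natCast_atTop_atTop.eventually_ge_atTop _)
  -- `576 = 24 ^ 2` gives `β ≤ 1 / 24`, hence `4 * β ≤ 1 / 6` and an error in the rates of at most
  -- `1 / 2`.
  filter_upwards [hp, hα.eventually_ge_atTop 576, eventually_ge_atTop 2, hlarge,
    eventually_log_le (c := q / 8) (by positivity)] with n hpn hαn hn hnl hlog
  have hn' : (2 : ℝ) ≤ n := by exact_mod_cast hn
  have hα0 : 0 < α n := by linarith
  set β := α n ^ (-(1 / 2) : ℝ) with hβ
  have hβ0 : 0 < β := Real.rpow_pos_of_pos hα0 _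
  have hβ2 : β ^ 2 * α n = 1 := by
    rw [hβ, ← Real.rpow_natCast, ← Real.rpow_mul hα0.le]
    norm_num
    rw [Real.rpow_neg_one, inv_mul_cancel₀ hα0.ne']
  have hβ1 : β ≤ 1 / 24 := by
    by_contra! hcon
    have : (1 / 24 : ℝ) ^ 2 < β ^ 2 := pow_lt_pow_left₀ hcon (by norm_num) two_ne_zero
    nlinarith
  have hlog0 : 0 ≤ Real.log n := Real.log_nonneg (by linarith)
  have hH := growthTime_le (n := n) hq'
  -- With `δ = 4 * β` the condition `16 * log n ≤ δ ^ 2 * (n * p)` holds with equality, because `β ^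
  -- 2 * α n = 1`.
  have h1 := binomialRandom_not_typicalCuts_le (n := n) (p := p n) (δ := 4 * β) (by positivity)
    (by linarith) (by omega) (by
      rw [hpn, mul_div_cancel₀ _ (by linarith)]
      have : (4 * β) ^ 2 * (α n * Real.log n) = 16 * (β ^ 2 * α n) * Real.log n := by ring
      rw [this, hβ2, mul_one])
  have hcl : ∀ s : Fin n, ∀ G, TypicalCuts (p n) (4 * β) G →
      law q G {ω | ¬ Close q s (36 / q * (β * Real.log n) + (36 / q + 2 * x + 1)) G ω} ≤
        ENNReal.ofReal (ε / 2) := by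
    intro s G hG
    have h2 := law_not_close_le_of_uniformRates hq (hG.connected (by omega) (by linarith)) hn
      (hG.uniformRates (q := q) hn (by positivity) (by linarith)) (by positivity) (by linarith) s
      hx0 (by
        have : 2 * growthTime n q ≤ 2 / (q : ℝ) + (n : ℝ) / 4 := by
          calc _ ≤ 2 * (1 / (q : ℝ) * (1 + q / 8 * n)) := by
                gcongr
                exact hH.trans (by gcongr)
            _ = _ := by
              field_simp
              ring
        linarith [hnl.2])
    refine (measure_mono ?_).trans (h2.trans (ENNReal.ofReal_le_ofReal hx))
    refine fun ω hω hc => hω ⟨hc.1, hc.2.1, hc.2.2.trans ?_⟩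
    have h3 : 3 * (3 * (4 * β)) * growthTime n q ≤ 36 * β * (1 / q * (1 + Real.log n)) := by
      calc _ = 36 * β * growthTime n q := by ring
        _ ≤ _ := by gcongr
    have h4 : 36 * β * (1 / q * (1 + Real.log n)) =
        36 / q * (β * Real.log n) + 36 / q * β := by
      field_simp
      ring
    have h5 : 36 / (q : ℝ) * β ≤ 36 / q * 1 := by
      gcongr
      linarith
    linarith
  refine (failProb_le (by positivity) (by positivity) fun s => ⟨_, h1, hcl s⟩).trans
    (ENNReal.ofReal_le_ofReal ?_)
  have : 4 / (n : ℝ) ≤ ε / 2 := by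
    rw [div_le_iff₀ (by linarith)]
    have := hnl.1
    rw [div_le_iff₀ hε] at this
    linarith
  linarith

/-- The factor `36 / q` is the same for every `ε`. When the main error term diverges it eventually
exceeds each additive constant, so one more unit in the factor replaces all of them. -/
theorem failProb_dense {q : I} (hq : 0 < q) {α : ℕ → ℝ} {p : ℕ → I}
    (hα : Tendsto α atTop atTop) (hp : ∀ᶠ n : ℕ in atTop, (p n : ℝ) = α n * Real.log n / n) :
    (∃ K : ℝ, ∀ ε : ℝ≥0∞, 0 < ε → ∃ C : ℝ, ∀ᶠ n : ℕ in atTop,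
      failProb n (p n) q (K * (α n ^ (-(1 / 2) : ℝ) * Real.log n) + C) ≤ ε) ∧
    (Tendsto (fun n : ℕ => α n ^ (-(1 / 2) : ℝ) * Real.log n) atTop atTop →
      ∃ C : ℝ, Tendsto (fun n : ℕ =>
        failProb n (p n) q (C * (α n ^ (-(1 / 2) : ℝ) * Real.log n + 1))) atTop (𝓝 0)) := by
  have hq' : (0 : ℝ) < q := hq
  have key : ∀ ε : ℝ≥0∞, 0 < ε → ∃ C : ℝ, ∀ᶠ n : ℕ in atTop,
      failProb n (p n) q (36 / q * (α n ^ (-(1 / 2) : ℝ) * Real.log n) + C) ≤ ε := by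
    intro ε hε
    obtain ⟨r, hr0, hr⟩ := ENNReal.lt_iff_exists_nnreal_btwn.1 hε
    obtain ⟨C, hC⟩ := failProb_dense_le hq hα hp (ε := r) (by exact_mod_cast hr0)
    refine ⟨C, hC.mono fun n hn => hn.trans ?_⟩
    rw [ENNReal.ofReal_coe_nnreal]
    exact hr.le
  refine ⟨⟨36 / q, key⟩, fun hβ => ⟨36 / q + 1, ?_⟩⟩
  rw [ENNReal.tendsto_nhds_zero]
  intro ε hε
  obtain ⟨C, hC⟩ := key ε hε
  filter_upwards [hC, hβ.eventually_ge_atTop C] with n hn hCn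
  refine (failProb_antitone _ _ ?_).trans hn
  have : 0 < 36 / (q : ℝ) := by positivity
  nlinarith

end Rumor

end

noncomputable section

namespace Rumor

variable {n : ℕ}

/-! ### Typical properties of sparse random graphs -/

/-- The nodes whose degree is not within `y` of `x`. -/
def badNodes (x y : ℝ) (G : SimpleGraph (Fin n)) : Finset (Fin n) :=
  open Classical in Finset.univ.filter fun v => y < |dg G v - x|

theorem mem_badNodes {x y : ℝ} {G : SimpleGraph (Fin n)} {v : Fin n} :
    v ∈ badNodes x y G ↔ y < |dg G v - x| := by
  simp [badNodes]

/-- The properties of typical sparse random graphs that are used: all degrees are at most `D * L`,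
all cuts are large, all nodes have few neighbours of untypical degree, and small sets span few
edges. -/
structure GoodGraph (c η D δ κ L : ℝ) (G : SimpleGraph (Fin n)) : Prop where
  dg_le : ∀ u, dg G u ≤ D * L
  le_cut : ∀ S : Finset (Fin n), S.Nonempty → 2 * S.card ≤ n → η * L * S.card ≤ cut G S Sᶜ
  cut_bad : ∀ u, cut G {u} (badNodes (c * L) (δ * (c * L)) G) ≤ δ * (c * L)
  cut_self : ∀ S : Finset (Fin n), (S.card : ℝ) ≤ κ * n → cut G S S ≤ δ * L * S.card

theorem binomialRandom_edgeCount_exp_le (p : I) {Q : Finset (Sym2 (Fin n))} (hQ : Q ⊆ allEdges n)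
    (l x : ℝ) : (SimpleGraph.binomialRandom (Fin n) p).real
        {G | l * x ≤ l * edgeCount G Q} ≤
      Real.exp (Q.card * p * (Real.exp l - 1) - l * x) := by
  have h := binomialRandom_edgeCount_le p hQ (Finset.empty_subset (allEdges n))
    (Finset.disjoint_empty_right _) l x
  simpa using h

theorem binomialRandom_cut_exp_le (p : I) {S T : Finset (Fin n)} (hST : Disjoint S T) (l x : ℝ) :
    (SimpleGraph.binomialRandom (Fin n) p).real {G | l * x ≤ l * cut G S T} ≤
      Real.exp (S.card * T.card * p * (Real.exp l - 1) - l * x) := by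
  have h := binomialRandom_edgeCount_exp_le p (cutPairs_subset hST) l x
  simp only [edgeCount_cutPairs _ hST, card_cutPairs hST] at h
  push_cast at h
  exact h

section

variable {p : I} {c : ℝ}

/-- Exponential moment with `l = 1`: since `exp 1 - 1 ≤ 2`, the exponent is at most `2 * c * log n -
(2 * c + 2) * log n`, which leaves `n ^ (-2)` for each node. -/
theorem binomialRandom_dg_gt_le (hn : 0 < n) (hc : 0 ≤ c) (hp : (p : ℝ) = c * Real.log n / n) :
    (SimpleGraph.binomialRandom (Fin n) p).real
      {G | ¬ ∀ u, dg G u ≤ (2 * c + 2) * Real.log n} ≤ 1 / n := by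
  have hn' : (1 : ℝ) ≤ n := by exact_mod_cast hn
  have hL : 0 ≤ Real.log n := Real.log_nonneg hn'
  have hone : ∀ u : Fin n, (SimpleGraph.binomialRandom (Fin n) p).real
      {G | ¬ dg G u ≤ (2 * c + 2) * Real.log n} ≤ 1 / (n : ℝ) ^ 2 := by
    intro u
    have h1 := binomialRandom_cut_exp_le p (disjoint_compl_right (a := {u})) 1
      ((2 * c + 2) * Real.log n)
    simp only [one_mul, cut_singleton_compl, card_compl_cast, Finset.card_singleton,
      Nat.cast_one] at h1
    refine (measureReal_mono fun G hG => (not_le.1 hG).le).trans (h1.trans ?_)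
    have h2 : 1 / (n : ℝ) ^ 2 = Real.exp (-(2 * Real.log n)) := by
      rw [Real.exp_neg, ← Real.log_rpow (by linarith), Real.exp_log (by positivity), one_div]
      norm_cast
    rw [h2, Real.exp_le_exp]
    have h3 : ((n : ℝ) - 1) * p ≤ c * Real.log n := by
      rw [hp, ← mul_div_assoc, div_le_iff₀ (by linarith)]
      nlinarith [mul_nonneg hc hL]
    have h4 : ((n : ℝ) - 1) * p * (Real.exp 1 - 1) ≤ c * Real.log n * 2 := by
      refine mul_le_mul h3 ?_ ?_ (by positivity)
      · linarith [Real.exp_one_lt_d9]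
      · linarith [Real.add_one_le_exp (1 : ℝ)]
    nlinarith
  have hsub : {G : SimpleGraph (Fin n) | ¬ ∀ u, dg G u ≤ (2 * c + 2) * Real.log n} ⊆
      {G | ∃ u ∈ Finset.univ, ¬ dg G u ≤ (2 * c + 2) * Real.log n} := fun G hG => by
    simpa using hG
  refine (measureReal_mono hsub).trans ((binomialRandom_real_exists_le p _ _).trans ?_)
  refine (Finset.sum_le_sum fun u _ => hone u).trans ?_
  rw [Finset.sum_const, Finset.card_univ, Fintype.card_fin, nsmul_eq_mul]
  apply le_of_eq
  field_simp

theorem exp_neg_mul_card (x : ℝ) (k : ℕ) : Real.exp (-(x * k)) = Real.exp (-x) ^ k := by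
  rw [← Real.exp_nat_mul]
  ring_nf

/-- Above the connectivity threshold all cuts are large. -/
theorem exists_binomialRandom_cut_lt_le (hc : 1 < c) : ∃ η a b : ℝ, 0 < η ∧ 0 < a ∧ 0 < b ∧
    ∀ (n : ℕ) (p : I), 0 < n → (p : ℝ) = c * Real.log n / n → 4 ≤ b * Real.log n →
      (SimpleGraph.binomialRandom (Fin n) p).real {G | ¬ ∀ S : Finset (Fin n), S.Nonempty →
        2 * S.card ≤ n → η * Real.log n * S.card ≤ cut G S Sᶜ} ≤
      2 * Real.exp (-(a * Real.log n)) + Real.exp (-(n : ℝ)) := by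
  -- The surplus `c - 1 = 4 * a` over the threshold is shared out: `a` is lost to `c * exp (-l)`,
  -- `a` to the size of the set, `a` to the threshold `η` with `η * l = a`, and the last `a` makes
  -- the union bound converge.
  set a : ℝ := (c - 1) / 4 with ha
  have ha0 : 0 < a := by
    rw [ha]
    linarith
  have hca : c = 1 + 4 * a := by
    rw [ha]
    ring
  obtain ⟨l, hl0, hl⟩ : ∃ l : ℝ, 0 < l ∧ c * Real.exp (-l) ≤ a := by
    have h1 : Tendsto (fun l : ℝ => c * Real.exp (-l)) atTop (𝓝 (c * 0)) :=
      (Real.tendsto_exp_atBot.comp tendsto_neg_atTop_atBot).const_mul c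
    rw [mul_zero] at h1
    obtain ⟨l, h2, h3⟩ := ((h1.eventually_le_const ha0).and (eventually_gt_atTop 0)).exists
    exact ⟨l, h3, h2⟩
  set b : ℝ := a / (1 + 3 * a) with hb
  have hb0 : 0 < b := by positivity
  have hexp1 : Real.exp (-l) ≤ 1 := Real.exp_le_one_iff.2 (by linarith)
  refine ⟨a / l, a, b, by positivity, ha0, hb0, fun n p hn hp hbn => ?_⟩
  have hn' : (1 : ℝ) ≤ n := by exact_mod_cast hn
  set L := Real.log n with hL
  have hL0 : 0 ≤ L := Real.log_nonneg hn'
  have hpn : (n : ℝ) * p = c * L := by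
    rw [hp]
    field_simp
  have hone : ∀ S : Finset (Fin n), 2 * S.card ≤ n →
      (SimpleGraph.binomialRandom (Fin n) p).real {G | ¬ a / l * L * S.card ≤ cut G S Sᶜ} ≤
      Real.exp (-((1 + a) * L)) ^ S.card + Real.exp (-(2 * n)) := by
    intro S hS
    have h1 := binomialRandom_cut_exp_le p (disjoint_compl_right (a := S)) (-l)
      (a / l * L * S.card)
    rw [card_compl_cast] at h1
    refine (measureReal_mono fun G hG => ?_).trans (h1.trans ?_)
    · have := mul_le_mul_of_nonneg_left (not_le.1 hG).le hl0.le
      simp only [Set.mem_ofPred_eq]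
      linarith
    set k : ℝ := (S.card : ℝ) with hk
    have hk0 : 0 ≤ k := Nat.cast_nonneg _
    have hk2 : 2 * k ≤ n := by
      rw [hk]
      exact_mod_cast hS
    have h2 : -l * (a / l * L * k) = -(a * L * k) := by field_simp
    rw [h2]
    have h3 : k * (n - k) * p * (Real.exp (-l) - 1) =
        -(k * L * ((1 - k / n) * (c * (1 - Real.exp (-l))))) := by
      rw [hp]
      field_simp
      ring
    rw [h3]
    have h4 : 1 + 3 * a ≤ c * (1 - Real.exp (-l)) := by
      rw [mul_sub, mul_one]
      linarith
    have hkn : k / n ≤ 1 / 2 := by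
      rw [div_le_iff₀ (by linarith)]
      linarith
    have h5 : (1 - k / n) * (1 + 3 * a) ≤ (1 - k / n) * (c * (1 - Real.exp (-l))) :=
      mul_le_mul_of_nonneg_left h4 (by linarith)
    have hkL : 0 ≤ k * L := mul_nonneg hk0 hL0
    have h6 := mul_le_mul_of_nonneg_left h5 hkL
    -- For small sets the probability `n ^ (-(1 + a) * k)` beats the number of sets of size `k`; for
    -- larger ones the exponent is at least `2 * n`, which beats the number `2 ^ n` of all sets.
    rcases le_or_gt (k / n) b with hkb | hkb
    · have h7 : 1 + 2 * a ≤ (1 - k / n) * (1 + 3 * a) := by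
        have : k / n * (1 + 3 * a) ≤ a := by
          rw [hb, le_div_iff₀ (by positivity)] at hkb
          exact hkb
        linarith
      have h8 := mul_le_mul_of_nonneg_left h7 hkL
      refine le_add_of_le_of_nonneg ?_ (Real.exp_pos _).le
      rw [← exp_neg_mul_card, Real.exp_le_exp]
      nlinarith
    · refine le_add_of_nonneg_of_le (by positivity) ?_
      rw [Real.exp_le_exp]
      have h7 : 1 / 2 * (1 + 3 * a) ≤ (1 - k / n) * (1 + 3 * a) :=
        mul_le_mul_of_nonneg_right (by linarith) (by positivity)
      have h8 := mul_le_mul_of_nonneg_left h7 hkL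
      have h9 : b * n ≤ k := by
        rw [lt_div_iff₀ (by linarith)] at hkb
        exact hkb.le
      have h10 : 4 * n ≤ k * L := by
        calc 4 * (n : ℝ) ≤ b * L * n := by gcongr
          _ = b * n * L := by ring
          _ ≤ k * L := by gcongr
      have h11 : 0 ≤ a * (k * L) := mul_nonneg ha0.le hkL
      nlinarith
  have hsub : {G : SimpleGraph (Fin n) | ¬ ∀ S : Finset (Fin n), S.Nonempty →
      2 * S.card ≤ n → a / l * L * S.card ≤ cut G S Sᶜ} ⊆
      {G | ∃ S ∈ Finset.univ.filter fun S : Finset (Fin n) => S.Nonempty,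
        2 * S.card ≤ n ∧ ¬ a / l * L * S.card ≤ cut G S Sᶜ} := by
    intro G hG
    simp only [Set.mem_ofPred_eq, not_forall] at hG
    obtain ⟨S, h1, h2, h3⟩ := hG
    exact ⟨S, by simpa using h1, h2, h3⟩
  refine (measureReal_mono hsub).trans ((binomialRandom_real_exists_le p _ _).trans ?_)
  have hnx : n * Real.exp (-((1 + a) * L)) = Real.exp (-(a * L)) := by
    nth_rewrite 1 [← Real.exp_log (by linarith : (0 : ℝ) < n)]
    rw [← Real.exp_add, ← hL]
    ring_nf
  calc _ ≤ ∑ S : Finset (Fin n) with S.Nonempty,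
        (Real.exp (-((1 + a) * L)) ^ S.card + Real.exp (-(2 * n))) := by
        refine Finset.sum_le_sum fun S _ => ?_
        by_cases hS : 2 * S.card ≤ n
        · simpa [hS] using hone S hS
        · simp only [hS, false_and, Set.ofPred_false, measureReal_empty]
          positivity
    _ ≤ 2 * (n * Real.exp (-((1 + a) * L))) + 2 ^ n * Real.exp (-(2 * n)) := by
        rw [Finset.sum_add_distrib]
        refine add_le_add (sum_pow_card_le (Real.exp_pos _).le ?_) ?_
        · rw [hnx, Real.exp_le_one_iff]
          have : 0 ≤ a * L := by positivity
          linarith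
        · rw [Finset.sum_const, nsmul_eq_mul]
          gcongr
          have : (Finset.univ.filter fun S : Finset (Fin n) => S.Nonempty).card ≤ 2 ^ n := by
            refine (Finset.card_filter_le _ _).trans ?_
            simp
          exact_mod_cast this
    _ ≤ _ := by
        rw [hnx]
        refine add_le_add le_rfl ?_
        have h1 : (2 : ℝ) ^ n ≤ Real.exp n := by
          rw [← Real.exp_one_pow]
          exact pow_le_pow_left₀ two_pos.le (by linarith [Real.add_one_le_exp (1 : ℝ)]) _
        calc _ ≤ Real.exp n * Real.exp (-(2 * n)) := by gcongr
          _ = _ := by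
            rw [← Real.exp_add]
            ring_nf

/-- Small sets span few edges. -/
theorem binomialRandom_cut_self_gt_le {δ κ : ℝ} (hn : 0 < n) (hc : 0 < c)
    (hp : (p : ℝ) = c * Real.log n / n) (hδ : 0 < δ) (hκ : κ = Real.exp (-(6 / δ)) / c) :
    (SimpleGraph.binomialRandom (Fin n) p).real {G | ¬ ∀ S : Finset (Fin n),
      (S.card : ℝ) ≤ κ * n → cut G S S ≤ δ * Real.log n * S.card} ≤ 2 / n := by
  have hn' : (1 : ℝ) ≤ n := by exact_mod_cast hn
  set L := Real.log n with hL
  have hL0 : 0 ≤ L := Real.log_nonneg hn'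
  have hone : ∀ S : Finset (Fin n), (S.card : ℝ) ≤ κ * n →
      (SimpleGraph.binomialRandom (Fin n) p).real {G | ¬ cut G S S ≤ δ * L * S.card} ≤
      Real.exp (-(2 * L)) ^ S.card := by
    intro S hS
    -- The exponent `l = 6 / δ` turns the threshold into `3 * L * |S|`, while `κ` is chosen so that
    -- `κ * n * p * exp l = L`. This leaves `-2 * L * |S|`, enough for the union bound.
    have h1 := binomialRandom_edgeCount_exp_le p (innerPairs_subset S) (6 / δ) (δ * L * S.card / 2)
    refine (measureReal_mono fun G hG => ?_).trans (h1.trans ?_)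
    · simp only [Set.mem_ofPred_eq, not_le, cut_self_eq] at hG ⊢
      exact mul_le_mul_of_nonneg_left (by linarith) (by positivity)
    · rw [← exp_neg_mul_card, Real.exp_le_exp]
      have h2 : 6 / δ * (δ * L * S.card / 2) = 3 * L * S.card := by
        field_simp
        ring
      have h3 : ((innerPairs S).card : ℝ) ≤ S.card * S.card := by
        exact_mod_cast card_innerPairs_le S
      have h4 : ((innerPairs S).card : ℝ) * p * (Real.exp (6 / δ) - 1) ≤ L * S.card := by
        calc _ ≤ (S.card * (κ * n)) * p * Real.exp (6 / δ) := by
              have hp0 : (0 : ℝ) ≤ p := p.2.1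
              have h5 : 0 ≤ Real.exp (6 / δ) - 1 := by
                linarith [Real.add_one_le_exp (6 / δ), (by positivity : 0 < 6 / δ)]
              refine mul_le_mul (mul_le_mul_of_nonneg_right (h3.trans (by gcongr)) hp0)
                (by linarith) h5 ?_
              have hκ0 : 0 ≤ κ := by
                rw [hκ]
                positivity
              positivity
          _ = L * S.card := by
              rw [hκ, hp, Real.exp_neg]
              field_simp
      rw [h2]
      linarith
  have hsub : {G : SimpleGraph (Fin n) | ¬ ∀ S : Finset (Fin n),
      (S.card : ℝ) ≤ κ * n → cut G S S ≤ δ * L * S.card} ⊆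
      {G | ∃ S ∈ Finset.univ.filter fun S : Finset (Fin n) => S.Nonempty,
        (S.card : ℝ) ≤ κ * n ∧ ¬ cut G S S ≤ δ * L * S.card} := by
    intro G hG
    simp only [Set.mem_ofPred_eq, not_forall] at hG
    obtain ⟨S, h2, h3⟩ := hG
    refine ⟨S, ?_, h2, h3⟩
    rw [Finset.mem_filter, Finset.nonempty_iff_ne_empty]
    refine ⟨Finset.mem_univ _, fun h => h3 ?_⟩
    simp [h, cut]
  refine (measureReal_mono hsub).trans ((binomialRandom_real_exists_le p _ _).trans ?_)
  have hx : Real.exp (-(2 * L)) = 1 / (n : ℝ) ^ 2 := by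
    rw [Real.exp_neg, hL, ← Real.log_rpow (by linarith), Real.exp_log (by positivity), one_div]
    norm_cast
  calc _ ≤ ∑ S : Finset (Fin n) with S.Nonempty, Real.exp (-(2 * L)) ^ S.card := by
        refine Finset.sum_le_sum fun S _ => ?_
        by_cases hS : (S.card : ℝ) ≤ κ * n
        · simpa [hS] using hone S hS
        · simp only [hS, false_and, Set.ofPred_false, measureReal_empty]
          positivity
    _ ≤ 2 * (n * Real.exp (-(2 * L))) := by
        refine sum_pow_card_le (Real.exp_pos _).le ?_
        rw [hx, mul_one_div, div_le_one (by positivity)]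
        nlinarith
    _ = 2 / n := by
        rw [hx]
        field_simp

end

end Rumor

end

/-! ### Nodes with many neighbours of untypical degree. -/

noncomputable section

namespace Rumor

variable {n : ℕ} {p : I} {c : ℝ}

/-- This disjointness makes the event that `u` is adjacent to all of `W` independent of the edges
that decide whether the degrees in `W` are untypical. -/
theorem disjoint_cutPairs {u : Fin n} {W : Finset (Fin n)} (hu : u ∉ W) :
    Disjoint (cutPairs W (insert u W)ᶜ) (cutPairs {u} W) := by
  rw [Finset.disjoint_left]
  intro e he he'
  obtain ⟨x, hx, rfl⟩ := Finset.mem_image.1 he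
  obtain ⟨y, hy, hxy⟩ := Finset.mem_image.1 he'
  rw [Finset.mem_product] at hx hy
  rw [Finset.mem_compl, Finset.mem_insert, not_or] at hx
  rw [Finset.mem_singleton] at hy
  rcases Sym2.eq_iff.1 hxy with h | h
  · exact hu (hy.1 ▸ h.1 ▸ hx.1)
  · exact hx.2.1 (hy.1 ▸ h.1.symm)

/-- A set of `m` neighbours of `u` that all have too large or all have too small degree. -/
theorem exists_subset_of_cut_badNodes {G : SimpleGraph (Fin n)} {x y : ℝ} {m : ℕ} {u : Fin n}
    (hm : 2 * (m : ℝ) ≤ y) (h : y < cut G {u} (badNodes x y G)) :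
    ∃ W : Finset (Fin n), u ∉ W ∧ W.card = m ∧ (∀ v ∈ W, G.Adj u v) ∧
      ((∀ v ∈ W, x + y ≤ dg G v) ∨ ∀ v ∈ W, dg G v ≤ x - y) := by
  classical
  set B := (badNodes x y G).filter fun v => G.Adj u v with hB
  have h1 : cut G {u} (badNodes x y G) = B.card := by
    rw [cut_singleton_left, hB]
    simp [ad]
  rw [h1, ← Finset.card_filter_add_card_filter_not (s := B) fun v => x < dg G v] at h
  push_cast at h
  have hadj : ∀ v ∈ B, y < |dg G v - x| ∧ G.Adj u v := fun v hv => by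
    rw [hB, Finset.mem_filter, mem_badNodes] at hv
    exact hv
  have huB : ∀ W ⊆ B, u ∉ W := fun W hW hu => G.irrefl (hadj u (hW hu)).2
  rcases le_or_gt m (B.filter fun v => x < dg G v).card with hc | hc
  · obtain ⟨W, hW, hWm⟩ := Finset.exists_subset_card_eq hc
    have hWB := hW.trans (Finset.filter_subset _ _)
    refine ⟨W, huB W hWB, hWm, fun v hv => (hadj v (hWB hv)).2, Or.inl fun v hv => ?_⟩
    have h2 := (Finset.mem_filter.1 (hW hv)).2
    have h3 := (hadj v (hWB hv)).1
    rw [abs_of_pos (by linarith)] at h3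
    linarith
  · have hc' : m ≤ (B.filter fun v => ¬ x < dg G v).card := by
      have : ((B.filter fun v => x < dg G v).card : ℝ) + 1 ≤ m := by exact_mod_cast hc
      have : (m : ℝ) ≤ (B.filter fun v => ¬ x < dg G v).card := by linarith
      exact_mod_cast this
    obtain ⟨W, hW, hWm⟩ := Finset.exists_subset_card_eq hc'
    have hWB := hW.trans (Finset.filter_subset _ _)
    refine ⟨W, huB W hWB, hWm, fun v hv => (hadj v (hWB hv)).2, Or.inr fun v hv => ?_⟩
    have h2 := (Finset.mem_filter.1 (hW hv)).2
    have h3 := (hadj v (hWB hv)).1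
    rw [abs_of_nonpos (by linarith)] at h3
    linarith

/-- All nodes have few neighbours of untypical degree. -/
theorem binomialRandom_cut_badNodes_gt_le {δ : ℝ} {m : ℕ} (hn : 1 < n) (hc : 0 < c)
    (hp : (p : ℝ) = c * Real.log n / n) (hδ0 : 0 < δ) (hδ : δ ≤ 1)
    (hm : 2 * (m + 1 : ℝ) ≤ δ * (c * Real.log n)) (hmn : 2 * (m + 1 : ℝ) ≤ δ * n)
    (hlog : Real.log (c * Real.log n) ≤ c * Real.log n * δ ^ 2 / 64) :
    (SimpleGraph.binomialRandom (Fin n) p).real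
      {G | ¬ ∀ u, cut G {u} (badNodes (c * Real.log n) (δ * (c * Real.log n)) G) ≤
        δ * (c * Real.log n)} ≤
      2 * Real.exp (Real.log n - m * (c * Real.log n * δ ^ 2 / 64)) := by
  have hn' : (1 : ℝ) < n := by exact_mod_cast hn
  have hn0 : (0 : ℝ) < n := by linarith
  have hL0 : 0 < Real.log n := Real.log_pos hn'
  set X := c * Real.log n with hX
  have hX0 : 0 < X := mul_pos hc hL0
  have hpn : (n : ℝ) * p = X := by
    rw [hp]
    field_simp
  have hp0 : (0 : ℝ) ≤ p := p.2.1
  -- If all `m` degrees in `W` deviate to the same side, so does their sum. By `hm` the at most `m *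
  -- (m + 1)` incidences inside `insert u W` use up only half of the deviation, so the number of
  -- edges leaving this set deviates by a factor `1 ± δ / 2`. Adjacency to `u` costs the independent
  -- factor `p ^ m`.
  have hone : ∀ u : Fin n, ∀ W : Finset (Fin n), W.card = m →
      (SimpleGraph.binomialRandom (Fin n) p).real {G | u ∉ W ∧ (∀ v ∈ W, G.Adj u v) ∧
        ((∀ v ∈ W, X + δ * X ≤ dg G v) ∨ ∀ v ∈ W, dg G v ≤ X - δ * X)} ≤
      2 * ((p : ℝ) ^ m * Real.exp (-(m * (X * δ ^ 2 / 32)))) := by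
    intro u W hW
    by_cases hu : u ∈ W
    · simp only [hu, not_true_eq_false, false_and, Set.ofPred_false, measureReal_empty]
      positivity
    have hdis : Disjoint W (insert u W)ᶜ :=
      Finset.disjoint_left.2 fun v hv hv' => (Finset.mem_compl.1 hv') (Finset.mem_insert_of_mem hv)
    have hdis' : Disjoint {u} W := Finset.disjoint_singleton_left.2 hu
    have hcard : ((cutPairs W (insert u W)ᶜ).card : ℝ) * p = m * (n - (m + 1)) * p := by
      rw [card_cutPairs hdis]
      push_cast
      rw [card_compl_cast, Finset.card_insert_of_notMem hu, hW]
      push_cast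
      rfl
    have hR : (cutPairs {u} W).card = m := by rw [card_cutPairs hdis', hW]; simp
    have hμ1 : ((cutPairs W (insert u W)ᶜ).card : ℝ) * p ≤ m * X := by
      rw [hcard, ← hpn]
      have : (m : ℝ) * (n - (m + 1)) * p ≤ m * n * p := by
        gcongr
        linarith [(Nat.cast_nonneg m : (0 : ℝ) ≤ m)]
      linarith
    have hhalf : (m + 1 : ℝ) ≤ δ / 2 * n := by linarith
    have hδn : δ / 2 * n ≤ 1 / 2 * n := by gcongr
    have h1 := binomialRandom_edgeCount_ge p (cutPairs_subset hdis) (cutPairs_subset hdis')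
      (disjoint_cutPairs hu) (δ := δ / 2) (by positivity) (by linarith) hμ1
    have h2 := binomialRandom_edgeCount_le_sub p (cutPairs_subset hdis) (cutPairs_subset hdis')
      (disjoint_cutPairs hu) (δ := δ / 2) (by positivity) (by linarith) hcard.ge
    rw [hR] at h1 h2
    have hmX : (m : ℝ) * X / 2 ≤ m * (n - (m + 1)) * p := by
      calc (m : ℝ) * X / 2 = m * (n / 2) * p := by
            rw [← hpn]
            ring
        _ ≤ _ := by
          gcongr
          linarith
    have hsub : {G : SimpleGraph (Fin n) | u ∉ W ∧ (∀ v ∈ W, G.Adj u v) ∧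
        ((∀ v ∈ W, X + δ * X ≤ dg G v) ∨ ∀ v ∈ W, dg G v ≤ X - δ * X)} ⊆
        {G | (cutPairs {u} W : Set (Sym2 (Fin n))) ⊆ G.edgeSet ∧
          (1 + δ / 2) * (m * X) ≤ edgeCount G (cutPairs W (insert u W)ᶜ)} ∪
        {G | (cutPairs {u} W : Set (Sym2 (Fin n))) ⊆ G.edgeSet ∧
          edgeCount G (cutPairs W (insert u W)ᶜ) ≤ (1 - δ / 2) * (m * (n - (m + 1)) * p)} := by
      rintro G ⟨-, hadj, hdeg⟩
      have hE : (cutPairs {u} W : Set (Sym2 (Fin n))) ⊆ G.edgeSet := by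
        intro e he
        obtain ⟨x, hx, rfl⟩ := Finset.mem_image.1 (Finset.mem_coe.1 he)
        rw [Finset.mem_product, Finset.mem_singleton] at hx
        rw [SimpleGraph.mem_edgeSet, hx.1]
        exact hadj _ hx.2
      have hsum : ∑ v ∈ W, dg G v = cut G W (insert u W) + cut G W (insert u W)ᶜ := by
        rw [← cut_univ, ← cut_union_right G W disjoint_compl_right, Finset.union_compl]
      have hin : cut G W (insert u W) ≤ m * (m + 1) := by
        have := cut_le_card_mul G W (insert u W)
        rw [Finset.card_insert_of_notMem hu, hW] at this
        exact_mod_cast this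
      simp only [Set.mem_union, Set.mem_ofPred_eq, edgeCount_cutPairs G hdis]
      have hm0 : (0 : ℝ) ≤ m := Nat.cast_nonneg m
      rcases hdeg with hd | hd
      · refine Or.inl ⟨hE, ?_⟩
        have h3 := Finset.card_nsmul_le_sum W _ _ hd
        rw [nsmul_eq_mul, hW, hsum] at h3
        have h4 := mul_le_mul_of_nonneg_left hm hm0
        nlinarith
      · refine Or.inr ⟨hE, ?_⟩
        have h3 := Finset.sum_le_card_nsmul W _ _ hd
        rw [nsmul_eq_mul, hW, hsum] at h3
        have h5 : cut G W (insert u W)ᶜ ≤ m * (X - δ * X) := by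
          linarith [cut_nonneg G W (insert u W)]
        refine h5.trans ?_
        have h6 : (1 - δ / 2) * (m * (n - (m + 1)) * p) =
            m * ((1 - δ / 2) * (X - (m + 1) * p)) := by
          rw [← hpn]
          ring
        rw [h6]
        refine mul_le_mul_of_nonneg_left ?_ hm0
        have h7 : (m + 1) * (p : ℝ) ≤ δ / 2 * X := by
          rw [← hpn, ← mul_assoc]
          gcongr
        have h8 : (1 - δ / 2) * ((m + 1) * (p : ℝ)) ≤ 1 * (δ / 2 * X) :=
          mul_le_mul (by linarith) h7 (by positivity) zero_le_one
        nlinarith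
    refine (measureReal_mono hsub).trans ((measureReal_union_le _ _).trans ?_)
    rw [two_mul]
    refine add_le_add (h1.trans ?_) (h2.trans ?_)
    · gcongr
      have : 0 ≤ m * X * δ ^ 2 := by positivity
      nlinarith
    · gcongr
      have := mul_le_mul_of_nonneg_right hmX (sq_nonneg δ)
      nlinarith
  have hsub : {G : SimpleGraph (Fin n) | ¬ ∀ u, cut G {u} (badNodes X (δ * X) G) ≤ δ * X} ⊆
      {G | ∃ x ∈ Finset.univ ×ˢ Finset.powersetCard m Finset.univ, x.1 ∉ x.2 ∧
        (∀ v ∈ x.2, G.Adj x.1 v) ∧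
        ((∀ v ∈ x.2, X + δ * X ≤ dg G v) ∨ ∀ v ∈ x.2, dg G v ≤ X - δ * X)} := by
    intro G hG
    simp only [Set.mem_ofPred_eq, not_forall, not_le] at hG
    obtain ⟨u, hu⟩ := hG
    obtain ⟨W, h1, h2, h3⟩ := exists_subset_of_cut_badNodes (m := m) (by linarith) hu
    exact ⟨(u, W), by simp [h2], h1, h3⟩
  refine (measureReal_mono hsub).trans ((binomialRandom_real_exists_le p _ _).trans ?_)
  -- There are at most `n * n ^ m` choices, and `n ^ m * p ^ m = X ^ m`. Assumption `hlog` lets half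
  -- of the Chernoff exponent absorb `X ^ m`; the other half has to beat the factor `n`.
  calc _ ≤ ∑ x ∈ (Finset.univ : Finset (Fin n)) ×ˢ Finset.powersetCard m Finset.univ,
        2 * ((p : ℝ) ^ m * Real.exp (-(m * (X * δ ^ 2 / 32)))) := by
        refine Finset.sum_le_sum fun x hx => hone x.1 x.2 ?_
        rw [Finset.mem_product, Finset.mem_powersetCard] at hx
        exact hx.2.2
    _ ≤ n * (n : ℝ) ^ m * (2 * ((p : ℝ) ^ m * Real.exp (-(m * (X * δ ^ 2 / 32))))) := by
        rw [Finset.sum_const, nsmul_eq_mul]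
        refine mul_le_mul_of_nonneg_right ?_ (by positivity)
        rw [Finset.card_product, Finset.card_powersetCard, Finset.card_univ, Fintype.card_fin]
        push_cast
        gcongr
        exact_mod_cast Nat.choose_le_pow n m
    _ = 2 * (n * (X ^ m * Real.exp (-(m * (X * δ ^ 2 / 32))))) := by
        rw [← hpn, mul_pow]
        ring
    _ ≤ _ := by
        have h1 : X ^ m = Real.exp (m * Real.log X) := by
          rw [Real.exp_nat_mul, Real.exp_log hX0]
        nth_rewrite 1 [← Real.exp_log hn0]
        rw [h1, ← Real.exp_add, ← Real.exp_add]
        refine mul_le_mul_of_nonneg_left (Real.exp_le_exp.2 ?_) two_pos.le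
        have := mul_le_mul_of_nonneg_left hlog (Nat.cast_nonneg m : (0 : ℝ) ≤ m)
        linarith

end Rumor

end

noncomputable section

namespace Rumor

variable {n : ℕ}

/-! ### Spreading without the help of one node -/

/-- One more than the degree of `u` in the graph without the node `w`. -/
def restDg (G : SimpleGraph (Fin n)) (w u : Fin n) : ℝ := 1 + ∑ v ∈ Finset.univ.erase w, ad G u v

/-- Probabilities of contacts that do not involve the node `w` and do not depend on its edges. -/
def restWeight (q : I) (G : SimpleGraph (Fin n)) (w : Fin n) (e : Fin n × Fin n) : ℝ :=
  if e.1 = w ∨ e.2 = w then 0 else q / n * (ad G e.1 e.2 / restDg G w e.1)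

section Rest

variable {G : SimpleGraph (Fin n)} {w : Fin n} {q : I}

theorem restDg_eq (G : SimpleGraph (Fin n)) (w u : Fin n) :
    restDg G w u = 1 + (dg G u - ad G u w) := by
  rw [restDg, dg_eq_sum, ← Finset.add_sum_erase _ _ (Finset.mem_univ w)]
  ring

/-- The additional `1` compensates for a possible edge to `w`. Thus `restDg` does not depend on the
edges of `w` and still dominates the degree, so contact probabilities built from it are lower bounds
for the true ones. -/
theorem dg_le_restDg (G : SimpleGraph (Fin n)) (w u : Fin n) : dg G u ≤ restDg G w u := by
  rw [restDg_eq]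
  linarith [ad_le_one G u w]

theorem restDg_le (G : SimpleGraph (Fin n)) (w u : Fin n) : restDg G w u ≤ dg G u + 1 := by
  rw [restDg_eq]
  linarith [ad_nonneg G u w]

theorem restDg_pos (G : SimpleGraph (Fin n)) (w u : Fin n) : 0 < restDg G w u :=
  add_pos_of_pos_of_nonneg one_pos (Finset.sum_nonneg fun _ _ => ad_nonneg _ _ _)

theorem restWeight_nonneg (e : Fin n × Fin n) : 0 ≤ restWeight q G w e := by
  unfold restWeight
  have := q.2.1
  have := ad_nonneg G e.1 e.2
  have := (restDg_pos G w e.1).le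
  split_ifs <;> positivity

theorem restWeight_le (e : Fin n × Fin n) : restWeight q G w e ≤ contactWeight q G e := by
  by_cases h : e.1 = w ∨ e.2 = w
  · rw [restWeight, if_pos h]
    exact contactWeight_nonneg q G e
  · rw [restWeight, if_neg h]
    obtain ⟨u, v⟩ := e
    by_cases huv : u = v
    · subst huv
      simpa [ad_self] using contactWeight_nonneg q G (u, u)
    · rw [contactWeight_of_ne q G huv]
      have hq : (0 : ℝ) ≤ q := q.2.1
      by_cases hadj : G.Adj u v
      · have := dg_pos_of_adj hadj
        have := ad_nonneg G u v
        gcongr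
        exact dg_le_restDg G w u
      · simp [ad, hadj]

theorem sum_restWeight_le_one : ∑ e, restWeight q G w e ≤ 1 :=
  (Finset.sum_le_sum fun e _ => restWeight_le e).trans (sum_contactWeight_le_one q G w.pos)

theorem notMem_stepSet {S : Finset (Fin n)} (hw : w ∉ S) {e : Fin n × Fin n}
    (he : restWeight q G w e ≠ 0) : w ∉ stepSet S e := by
  have h : ¬ (e.1 = w ∨ e.2 = w) := fun h => he (if_pos h)
  rw [not_or] at h
  unfold stepSet
  split_ifs
  · simp [hw, Ne.symm h.1, Ne.symm h.2]
  · exact hw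

/-- Only contacts between `A` and `T` are kept; each of them raises `g` by one and has weight at
least `2 / X` up to the factor `q / n`. -/
theorem restWeight_rate_ge {g : Finset (Fin n) → ℕ} (hg : ∀ S v, g S ≤ g (insert v S))
    {S A T : Finset (Fin n)} {X : ℝ} (hA : A ⊆ S) (hT : T ⊆ Sᶜ) (hwS : w ∉ S) (hwT : w ∉ T)
    (hgT : ∀ v ∈ T, g (insert v S) = g S + 1) (hXA : ∀ u ∈ A, restDg G w u ≤ X)
    (hXT : ∀ u ∈ T, restDg G w u ≤ X) :
    (q : ℝ) / n * (2 / X * cut G A T) ≤ ∑ e, restWeight q G w e * ((g (stepSet S e) : ℝ) - g S) := by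
  have hq : (0 : ℝ) ≤ q := q.2.1
  rw [sum_stepSet (restWeight q G w) (fun S => (g S : ℝ)), cut, Finset.mul_sum, Finset.mul_sum]
  have hnn : ∀ u v, 0 ≤ (restWeight q G w (u, v) + restWeight q G w (v, u)) *
      ((g (insert v S) : ℝ) - g S) := fun u v =>
    mul_nonneg (add_nonneg (restWeight_nonneg _) (restWeight_nonneg _))
      (sub_nonneg.2 (by exact_mod_cast hg S v))
  refine le_trans (Finset.sum_le_sum fun u hu => ?_)
    (Finset.sum_le_sum_of_subset_of_nonneg hA fun u _ _ => Finset.sum_nonneg fun v _ => hnn u v)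
  refine le_trans ?_ (Finset.sum_le_sum_of_subset_of_nonneg hT fun v _ _ => hnn u v)
  rw [Finset.mul_sum, Finset.mul_sum]
  refine Finset.sum_le_sum fun v hv => ?_
  have huw : u ≠ w := fun h => hwS (h ▸ hA hu)
  have hvw : v ≠ w := fun h => hwT (h ▸ hv)
  have h1 := one_div_le_one_div_of_le (restDg_pos G w u) (hXA u hu)
  have h2 := one_div_le_one_div_of_le (restDg_pos G w v) (hXT v hv)
  have h3 : restWeight q G w (u, v) + restWeight q G w (v, u) =
      q / n * (ad G u v * (1 / restDg G w u + 1 / restDg G w v)) := by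
    simp only [restWeight, huw, hvw, or_self, if_false, ad_comm G v u]
    ring
  rw [h3, hgT v hv]
  push_cast
  rw [add_sub_cancel_left, mul_one]
  refine mul_le_mul_of_nonneg_left ?_ (by positivity)
  rw [mul_comm]
  refine mul_le_mul_of_nonneg_left ?_ (ad_nonneg _ _ _)
  calc 2 / X = 1 / X + 1 / X := by ring
    _ ≤ _ := add_le_add h1 h2

end Rest

theorem cut_le_add (G : SimpleGraph (Fin n)) (S : Finset (Fin n)) {U T B : Finset (Fin n)}
    (h : U ⊆ T ∪ B) : cut G S U ≤ cut G S T + cut G S B := by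
  refine (cut_mono G (Finset.Subset.refl S) h).trans ?_
  rw [← Finset.union_sdiff_self_eq_union, cut_union_right G S Finset.disjoint_sdiff]
  exact add_le_add le_rfl (cut_mono G (Finset.Subset.refl S) Finset.sdiff_subset)

theorem cut_singleton_le_card (G : SimpleGraph (Fin n)) (S : Finset (Fin n)) (w : Fin n) :
    cut G S {w} ≤ S.card := by
  simpa using cut_le_card_mul G S {w}

theorem cut_eq_sum_singleton (G : SimpleGraph (Fin n)) (S T : Finset (Fin n)) :
    cut G S T = ∑ u ∈ S, cut G {u} T := by
  simp [cut]

/-- Relations between the parameters. -/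
structure Admissible (n : ℕ) (c η D δ κ κ' L : ℝ) : Prop where
  L_eq : L = Real.log n
  eight_le : 8 ≤ n
  one_le_c : 1 ≤ c
  η_pos : 0 < η
  η_le : η ≤ D
  δ_pos : 0 < δ
  δ_le : 12 * δ ≤ 1
  cδ_le : 8 * c * δ ≤ η
  le_ηL : 4 ≤ η * L
  le_δL : 1 ≤ δ * L
  κ_le : κ ≤ 1 / 8
  κ'_pos : 0 < κ'
  κ'_le : κ' ≤ κ
  L_le : 4 * L ≤ η / (2 * D) * (κ' * n)

section Good

variable {c η D δ κ κ' L : ℝ} {G : SimpleGraph (Fin n)} {w : Fin n} {q : I}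

theorem Admissible.L_pos (ha : Admissible n c η D δ κ κ' L) : 0 < L := by
  have := ha.le_ηL
  by_contra! h
  nlinarith [ha.η_pos]

theorem Admissible.D_pos (ha : Admissible n c η D δ κ κ' L) : 0 < D := ha.η_pos.trans_le ha.η_le

theorem Admissible.one_le_DL (ha : Admissible n c η D δ κ κ' L) : 1 ≤ D * L := by
  have := mul_le_mul_of_nonneg_right ha.η_le ha.L_pos.le
  linarith [ha.le_ηL]

theorem GoodGraph.le_dg (ha : Admissible n c η D δ κ κ' L) (h : GoodGraph c η D δ κ L G)
    (u : Fin n) : η * L ≤ dg G u := by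
  have := h.le_cut {u} (Finset.singleton_nonempty u) (by
    have := ha.eight_le
    simp
    omega)
  rw [cut_singleton_compl] at this
  simpa using this

theorem GoodGraph.cut_badNodes_le (h : GoodGraph c η D δ κ L G) (S : Finset (Fin n)) :
    cut G S (badNodes (c * L) (δ * (c * L)) G) ≤ δ * (c * L) * S.card := by
  rw [cut_eq_sum_singleton]
  have := Finset.sum_le_card_nsmul S _ _ fun u _ => h.cut_bad u
  rw [nsmul_eq_mul] at this
  linarith

/-- Double counting of edges into the set of bad nodes: each bad node has degree at least `η * L`,
but each node has at most `δ * c * L` bad neighbours. -/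
theorem GoodGraph.card_badNodes_le (ha : Admissible n c η D δ κ κ' L)
    (h : GoodGraph c η D δ κ L G) :
    ((badNodes (c * L) (δ * (c * L)) G).card : ℝ) ≤ n / 8 := by
  set B := badNodes (c * L) (δ * (c * L)) G with hB
  have h1 := h.cut_badNodes_le Finset.univ
  rw [cut_comm, cut_univ, Finset.card_univ, Fintype.card_fin, ← hB] at h1
  have h2 := Finset.card_nsmul_le_sum B _ _ fun u _ => h.le_dg ha u
  rw [nsmul_eq_mul] at h2
  have h3 : 8 * (δ * (c * L) * n) ≤ η * L * n := by
    have := mul_le_mul_of_nonneg_right ha.cδ_le (mul_nonneg ha.L_pos.le (Nat.cast_nonneg n))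
    linarith
  have h4 : 0 < η * L := mul_pos ha.η_pos ha.L_pos
  by_contra! hcon
  have := mul_lt_mul_of_pos_left hcon h4
  linarith

/-- The contact rates without `w` and from `A` to `T`, in terms of the number of edges. -/
theorem GoodGraph.rate_ge (ha : Admissible n c η D δ κ κ' L) (h : GoodGraph c η D δ κ L G)
    {g : Finset (Fin n) → ℕ} (hg : ∀ S v, g S ≤ g (insert v S))
    {S T : Finset (Fin n)} (hT : T ⊆ Sᶜ) (hwS : w ∉ S) (hwT : w ∉ T)
    (hgT : ∀ v ∈ T, g (insert v S) = g S + 1) {k : ℝ} (hk : η * L / 2 * k ≤ cut G S T) :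
    (q : ℝ) / n * (η / (2 * D) * k) ≤ ∑ e, restWeight q G w e * ((g (stepSet S e) : ℝ) - g S) := by
  have hq : (0 : ℝ) ≤ q := q.2.1
  have hD := ha.D_pos
  have hL := ha.L_pos
  have hX : ∀ u, restDg G w u ≤ 2 * (D * L) := fun u => by
    linarith [restDg_le G w u, h.dg_le u, ha.one_le_DL]
  refine le_trans (mul_le_mul_of_nonneg_left ?_ (by positivity))
    (restWeight_rate_ge hg (Finset.Subset.refl S) hT hwS hwT hgT (fun u _ => hX u) fun u _ => hX u)
  calc η / (2 * D) * k = 2 / (2 * (D * L)) * (η * L / 2 * k) := by field_simp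
    _ ≤ _ := mul_le_mul_of_nonneg_left hk (by positivity)

/-- The number of informed nodes of typical degree. -/
def goodCount (B S : Finset (Fin n)) : ℕ := (S \ B).card

theorem goodCount_le_insert (B S : Finset (Fin n)) (v : Fin n) :
    goodCount B S ≤ goodCount B (insert v S) :=
  Finset.card_le_card (Finset.sdiff_subset_sdiff (Finset.subset_insert v S)
    (Finset.Subset.refl B))

theorem goodCount_mono {B S S' : Finset (Fin n)} (h : S ⊆ S') : goodCount B S ≤ goodCount B S' :=
  Finset.card_le_card (Finset.sdiff_subset_sdiff h (Finset.Subset.refl B))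

theorem goodCount_insert {B S : Finset (Fin n)} {v : Fin n} (hv : v ∉ S) (hB : v ∉ B) :
    goodCount B (insert v S) = goodCount B S + 1 := by
  unfold goodCount
  rw [Finset.insert_sdiff_of_notMem _ hB, Finset.card_insert_of_notMem]
  simp [hv]

theorem goodCount_stepSet_le (B S : Finset (Fin n)) (e : Fin n × Fin n) :
    goodCount B (stepSet S e) ≤ goodCount B S + 1 := by
  have h : ∀ v, goodCount B (insert v S) ≤ goodCount B S + 1 := fun v => by
    refine (Finset.card_le_card fun x hx => ?_).trans (Finset.card_insert_le v (S \ B))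
    rw [Finset.mem_sdiff, Finset.mem_insert] at hx
    rw [Finset.mem_insert, Finset.mem_sdiff]
    exact hx.1.imp_right fun h => ⟨h, hx.2⟩
  unfold stepSet
  split_ifs with h1
  · rcases h1 with h1 | h1
    · rw [Finset.insert_eq_of_mem (Finset.mem_insert_of_mem h1)]
      exact h _
    · rw [Finset.insert_eq_of_mem h1]
      exact h _
  · omega

variable {S : Finset (Fin n)}

/-- A crude rate, for use while few informed nodes have typical degree. Of the edges leaving `S`, at
most `|S|` go to `w` and at most an eighth of the guaranteed number `η * L * |S|` to bad nodes, so
at least half of that number help. -/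
theorem GoodGraph.goodCount_rate_ge (ha : Admissible n c η D δ κ κ' L)
    (h : GoodGraph c η D δ κ L G) (hw : w ∉ S) (hS : S.Nonempty)
    (hκ : (goodCount (badNodes (c * L) (δ * (c * L)) G) S : ℝ) < κ * n) :
    (q : ℝ) / n * (η / (2 * D) * S.card) ≤ ∑ e, restWeight q G w e *
      ((goodCount (badNodes (c * L) (δ * (c * L)) G) (stepSet S e) : ℝ) -
        goodCount (badNodes (c * L) (δ * (c * L)) G) S) := by
  set B := badNodes (c * L) (δ * (c * L)) G with hB
  refine h.rate_ge ha (T := (Sᶜ \ B).erase w) (goodCount_le_insert B)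
    ((Finset.erase_subset _ _).trans Finset.sdiff_subset) hw (Finset.notMem_erase _ _)
    (fun v hv => ?_) ?_
  · rw [Finset.mem_erase, Finset.mem_sdiff, Finset.mem_compl] at hv
    exact goodCount_insert hv.2.1 hv.2.2
  · have hcard : 2 * S.card ≤ n := by
      have h1 : S.card ≤ goodCount B S + B.card := by
        rw [goodCount]
        exact Finset.card_le_card_sdiff_add_card
      have h2 := h.card_badNodes_le ha
      have h3 : (S.card : ℝ) ≤ goodCount B S + B.card := by exact_mod_cast h1
      have h4 : κ * n ≤ 1 / 8 * n := mul_le_mul_of_nonneg_right ha.κ_le (Nat.cast_nonneg n)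
      have : (2 : ℝ) * S.card ≤ n := by
        have h5 : ((badNodes (c * L) (δ * (c * L)) G).card : ℝ) = B.card := rfl
        have h6 : (0 : ℝ) ≤ n := Nat.cast_nonneg n
        linarith
      exact_mod_cast this
    have h1 := h.le_cut S hS hcard
    have h2 : cut G S Sᶜ ≤ cut G S ((Sᶜ \ B).erase w) + (cut G S {w} + cut G S B) := by
      refine (cut_le_add G S (T := (Sᶜ \ B).erase w) (B := {w} ∪ B) ?_).trans
        (add_le_add le_rfl (cut_le_add G S (Finset.Subset.refl _)))
      intro v hv
      by_cases hvw : v = w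
      · simp [hvw]
      · by_cases hvB : v ∈ B
        · simp [hvB]
        · have : v ∉ S := Finset.mem_compl.1 hv
          simp [hvw, hvB, this]
    have h3 := cut_singleton_le_card G S w
    have h4 := h.cut_badNodes_le S
    have hk : (0 : ℝ) ≤ S.card := Nat.cast_nonneg _
    have h5 : 8 * (δ * (c * L) * S.card) ≤ η * L * S.card := by
      have := mul_le_mul_of_nonneg_right ha.cδ_le (mul_nonneg ha.L_pos.le hk)
      linarith
    have h6 := mul_le_mul_of_nonneg_right ha.le_ηL hk
    linarith

/-- The sharp rate. An informed node of typical degree has about `c * L` edges, of which all but a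
small fraction lead to uninformed nodes of typical degree: `w`, bad nodes and the small informed set
each take away little. Every such edge has rate about `2 / (c * L)`. -/
theorem GoodGraph.goodCount_rate_ge' (ha : Admissible n c η D δ κ κ' L)
    (h : GoodGraph c η D δ κ L G) (hw : w ∉ S)
    (hκ : (goodCount (badNodes (c * L) (δ * (c * L)) G) S : ℝ) < κ * n) :
    (q : ℝ) / n * (2 * (1 - 6 * δ) * goodCount (badNodes (c * L) (δ * (c * L)) G) S) ≤
      ∑ e, restWeight q G w e *
      ((goodCount (badNodes (c * L) (δ * (c * L)) G) (stepSet S e) : ℝ) -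
        goodCount (badNodes (c * L) (δ * (c * L)) G) S) := by
  set B := badNodes (c * L) (δ * (c * L)) G with hB
  have hq : (0 : ℝ) ≤ q := q.2.1
  have hδ := ha.δ_pos
  have hL := ha.L_pos
  have hc := ha.one_le_c
  have hcL : 0 < c * L := by positivity
  set X := (1 + δ) * (c * L) + 1 with hX
  have hX0 : 0 < X := by positivity
  have hdg : ∀ u, u ∉ B → (1 - δ) * (c * L) ≤ dg G u ∧ dg G u ≤ (1 + δ) * (c * L) := by
    intro u hu
    rw [hB, mem_badNodes, not_lt, abs_le] at hu
    constructor <;> linarith [hu.1, hu.2]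
  have hXu : ∀ u, u ∉ B → restDg G w u ≤ X := fun u hu =>
    (restDg_le G w u).trans (by linarith [(hdg u hu).2])
  refine le_trans (mul_le_mul_of_nonneg_left ?_ (by positivity))
    (restWeight_rate_ge (T := (Sᶜ \ B).erase w) (A := S \ B) (X := X) (goodCount_le_insert B)
      Finset.sdiff_subset ((Finset.erase_subset _ _).trans Finset.sdiff_subset) hw
      (Finset.notMem_erase _ _) (fun v hv => ?_) (fun u hu => hXu u (Finset.mem_sdiff.1 hu).2)
      fun u hu => ?_)
  · have h1 := Finset.card_nsmul_le_sum (S \ B) _ _ fun u hu => (hdg u (Finset.mem_sdiff.1 hu).2).1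
    rw [nsmul_eq_mul, ← cut_univ] at h1
    have h2 : cut G (S \ B) Finset.univ ≤ cut G (S \ B) ((Sᶜ \ B).erase w) +
        (cut G (S \ B) {w} + (cut G (S \ B) B + cut G (S \ B) (S \ B))) := by
      refine (cut_le_add G _ (T := (Sᶜ \ B).erase w) (B := {w} ∪ (B ∪ (S \ B))) ?_).trans
        (add_le_add le_rfl ((cut_le_add G _ (Finset.Subset.refl _)).trans
          (add_le_add le_rfl (cut_le_add G _ (Finset.Subset.refl _)))))
      intro v _
      by_cases hvw : v = w
      · simp [hvw]
      · by_cases hvB : v ∈ B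
        · simp [hvB]
        · by_cases hvS : v ∈ S
          · simp [hvB, hvS]
          · simp [hvw, hvB, hvS]
    have h3 := cut_singleton_le_card G (S \ B) w
    have h4 := h.cut_badNodes_le (S \ B)
    have h5 := h.cut_self (S \ B) hκ.le
    change 2 * (1 - 6 * δ) * ((S \ B).card : ℝ) ≤ _
    set k : ℝ := ((S \ B).card : ℝ) with hk
    have hk0 : 0 ≤ k := Nat.cast_nonneg _
    have h6 : (1 - 6 * δ) * X * k ≤ cut G (S \ B) ((Sᶜ \ B).erase w) := by
      have h7 : (1 - 6 * δ) * X ≤ (1 - δ) * (c * L) - 1 - δ * (c * L) - δ * L := by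
        have h8 : δ * L ≤ δ * (c * L) := by
          gcongr
          nlinarith
        have h9 := ha.le_δL
        have h10 : 0 ≤ δ * (δ * (c * L)) := by positivity
        rw [hX]
        linarith
      have := mul_le_mul_of_nonneg_right h7 hk0
      linarith
    calc 2 * (1 - 6 * δ) * k = 2 / X * ((1 - 6 * δ) * X * k) := by field_simp
      _ ≤ _ := mul_le_mul_of_nonneg_left h6 (by positivity)
  · rw [Finset.mem_erase, Finset.mem_sdiff, Finset.mem_compl] at hv
    exact goodCount_insert hv.2.1 hv.2.2
  · rw [Finset.mem_erase, Finset.mem_sdiff] at hu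
    exact hXu u hu.2.2

/-- Each of `S` and the remaining nodes without `w` has a large cut by `le_cut` when it is the
smaller side. Edges to `w` cost at most one per node, a quarter of the bound at most. -/
theorem GoodGraph.card_rate_ge (ha : Admissible n c η D δ κ κ' L)
    (h : GoodGraph c η D δ κ L G) (hw : w ∉ S) (hS : S.Nonempty) :
    (q : ℝ) / n * (η / (2 * D) * min (S.card : ℝ) (n - 1 - S.card)) ≤
      ∑ e, restWeight q G w e * (((stepSet S e).card : ℝ) - S.card) := by
  refine h.rate_ge ha (T := Sᶜ.erase w) (g := Finset.card)
    (fun S v => Finset.card_le_card (Finset.subset_insert v S)) (Finset.erase_subset _ _) hw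
    (Finset.notMem_erase _ _) (fun v hv => Finset.card_insert_of_notMem
      (Finset.mem_compl.1 (Finset.mem_of_mem_erase hv))) ?_
  have hηL : 0 < η * L := mul_pos ha.η_pos ha.L_pos
  have hcov : Sᶜ ⊆ Sᶜ.erase w ∪ {w} := fun v hv => by
    by_cases hvw : v = w
    · simp [hvw]
    · simp [hvw, Finset.mem_compl.1 hv]
  by_cases hc : 2 * S.card ≤ n
  · have h1 := h.le_cut S hS hc
    have h2 := cut_le_add G S hcov
    have h3 := cut_singleton_le_card G S w
    have hk : (0 : ℝ) ≤ S.card := Nat.cast_nonneg _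
    have h6 := mul_le_mul_of_nonneg_right ha.le_ηL hk
    have h7 : η * L / 2 * min (S.card : ℝ) (n - 1 - S.card) ≤ η * L / 2 * S.card :=
      mul_le_mul_of_nonneg_left (min_le_left _ _) (by positivity)
    linarith
  · have hTcard : ((Sᶜ.erase w).card : ℝ) = n - 1 - S.card := by
      have h1 := Finset.card_erase_add_one (Finset.mem_compl.2 hw)
      have h2 := card_compl_cast S
      have h3 : ((Sᶜ.erase w).card : ℝ) + 1 = (Sᶜ).card := by exact_mod_cast h1
      linarith
    have h7 : η * L / 2 * min (S.card : ℝ) (n - 1 - S.card) ≤ η * L / 2 * (Sᶜ.erase w).card := by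
      rw [hTcard]
      exact mul_le_mul_of_nonneg_left (min_le_right _ _) (by positivity)
    refine h7.trans ?_
    rcases (Sᶜ.erase w).eq_empty_or_nonempty with he | hne
    · rw [he]
      simpa using cut_nonneg G S ∅
    · have h1 := h.le_cut _ hne (by
        have : (2 : ℝ) * (Sᶜ.erase w).card ≤ n := by
          rw [hTcard]
          have : (n : ℝ) + 1 ≤ 2 * S.card := by exact_mod_cast not_le.1 hc
          linarith
        exact_mod_cast this)
      have h2 := cut_le_add G (Sᶜ.erase w) (U := (Sᶜ.erase w)ᶜ) (T := S) (B := {w})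
        fun v hv => by
          rw [Finset.mem_compl, Finset.mem_erase, Finset.mem_compl] at hv
          by_cases hvS : v ∈ S
          · simp [hvS]
          · by_cases hvw : v = w
            · simp [hvw]
            · exact absurd ⟨hvw, hvS⟩ hv
      rw [cut_comm G _ S] at h2
      have h3 := cut_singleton_le_card G (Sᶜ.erase w) w
      have hk : (0 : ℝ) ≤ (Sᶜ.erase w).card := Nat.cast_nonneg _
      have h6 := mul_le_mul_of_nonneg_right ha.le_ηL hk
      linarith

end Good

end Rumor

end

/-! ### The growth and filling phases without one node. -/

noncomputable section

namespace Rumor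

variable {n : ℕ}

theorem sum_Ico_one_div_le_log {a b N : ℕ} (ha : 0 < a) (haN : a ≤ N) (hbN : b ≤ N + 1) :
    ∑ i ∈ Finset.Ico a b, 1 / (i : ℝ) ≤ 1 + Real.log (N / a) := by
  have h : ∑ i ∈ Finset.Ico a (N + 1), 1 / (i : ℝ) ≤ 1 + Real.log (N / a) := by
    have ha' : (0 : ℝ) < a := by exact_mod_cast ha
    clear hbN
    induction N, haN using Nat.le_induction with
    | base =>
      rw [Nat.Ico_succ_singleton, Finset.sum_singleton, div_self ha'.ne', Real.log_one, add_zero,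
        div_le_one ha']
      exact_mod_cast ha
    | succ N hN ih =>
      have hN' : (0 : ℝ) < N := by exact_mod_cast ha.trans_le hN
      rw [Finset.sum_Ico_succ_top (by omega)]
      have h1 := Real.one_sub_inv_le_log_of_pos (x := ((N + 1 : ℕ) : ℝ) / N) (by positivity)
      rw [Real.log_div (by positivity) (by positivity)] at h1
      rw [Real.log_div (by positivity) (by positivity)] at ih ⊢
      have h2 : 1 - (((N + 1 : ℕ) : ℝ) / N)⁻¹ = 1 / ((N + 1 : ℕ) : ℝ) := by
        push_cast
        field_simp
        ring
      linarith
  refine le_trans (Finset.sum_le_sum_of_subset_of_nonneg ?_ fun _ _ _ => by positivity) h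
  exact Finset.Ico_subset_Ico_right hbN

section Good

variable {c η D δ κ κ' L : ℝ} {G : SimpleGraph (Fin n)} {w : Fin n} {q : I}

/-- The exponential growth phase. -/
theorem GoodGraph.iterate_goodCount_le (ha : Admissible n c η D δ κ κ' L)
    (h : GoodGraph c η D δ κ L G) (hq : 0 < q) {M : ℕ} (hM : 0 < M) (hMn : M ≤ n)
    {S : Finset (Fin n)} (hw : w ∉ S) (hS : M ≤ S.card) {Y : ℝ} {j : ℕ}
    (hj : (n : ℝ) / q * ((1 / 2 + 6 * δ) * (1 + L) + Y) ≤ j) :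
    (chainOp (restWeight q G w))^[j] (fun S =>
        if goodCount (badNodes (c * L) (δ * (c * L)) G) S < ⌈κ * n⌉₊ then 1 else 0) S ≤
      Real.exp (2 * M - η / (4 * D) * M * Y) := by
  set B := badNodes (c * L) (δ * (c * L)) G with hB
  have hq0 : (0 : ℝ) < q := hq
  have hq1 : (q : ℝ) ≤ 1 := q.2.2
  have hn : (0 : ℝ) < n := by exact_mod_cast w.pos
  have hη := ha.η_pos
  have hδ := ha.δ_pos
  have hδ1 := ha.δ_le
  have hD := ha.D_pos
  have hM' : (0 : ℝ) < M := by exact_mod_cast hM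
  have hMn' : (M : ℝ) ≤ n := by exact_mod_cast hMn
  set c₀ := η / (2 * D) with hc₀
  have hc₀0 : 0 < c₀ := by positivity
  have hc₀1 : c₀ ≤ 1 / 2 := by
    rw [hc₀, div_le_div_iff₀ (by positivity) two_pos]
    linarith [ha.η_le]
  -- Half of the crude rate available with `M` informed nodes. Since the exponent contains `M` as a
  -- factor, a start from `M` nodes improves the failure probability accordingly.
  set s : ℝ := q / n * (c₀ * M / 2) with hs
  have hqn : 0 < (q : ℝ) / n := by positivity
  have hs0 : 0 < s := by positivity
  have hs1 : s ≤ 1 := by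
    have h1 : s = q * (c₀ / 2 * (M / n)) := by
      rw [hs]
      field_simp
    rw [h1]
    have h2 : (M : ℝ) / n ≤ 1 := by
      rw [div_le_one hn]
      exact hMn'
    have h3 : c₀ / 2 * (M / n) ≤ 1 := by
      calc _ ≤ (1 : ℝ) * 1 := mul_le_mul (by linarith) h2 (by positivity) zero_le_one
        _ = 1 := one_mul 1
    nlinarith [mul_nonneg (by positivity : 0 ≤ c₀ / 2) (by positivity : 0 ≤ (M : ℝ) / n)]
  -- Although `M` nodes are informed, fewer of them may have typical degree. On these low levels the
  -- crude rate is used; each contributes exactly `s / (a i - s) = 1`. From level `M` on the sharp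
  -- rate takes over and produces `log n / 2`.
  set a : ℕ → ℝ := fun i => if i < M then q / n * (c₀ * M) else q / n * (2 * (1 - 6 * δ) * i)
    with hadef
  have h2s : ∀ i, 2 * s ≤ a i := by
    intro i
    have h1 : 2 * s = q / n * (c₀ * M) := by
      rw [hs]
      ring
    rw [h1]
    simp only [hadef]
    split_ifs with hi
    · exact le_rfl
    · refine mul_le_mul_of_nonneg_left ?_ hqn.le
      have hi' : (M : ℝ) ≤ i := by exact_mod_cast not_lt.1 hi
      calc c₀ * M ≤ 1 * i := mul_le_mul (by linarith) hi' hM'.le zero_le_one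
        _ ≤ _ := mul_le_mul_of_nonneg_right (by linarith) (by positivity)
  have hsa : ∀ i, s < a i := fun i => by linarith [h2s i]
  have hcard : ∀ T : Finset (Fin n), goodCount B T ≤ T.card := fun T =>
    Finset.card_le_card Finset.sdiff_subset
  have h1 := iterate_chainOp_lt_le (b := restWeight q G w) restWeight_nonneg sum_restWeight_le_one
    (R := fun T => w ∉ T ∧ M ≤ T.card)
    (fun T e hT he => ⟨notMem_stepSet hT.1 he, hT.2.trans
      (Finset.card_le_card (subset_stepSet T e))⟩)
    (g := goodCount B) (fun T e => goodCount_mono (subset_stepSet T e)) (goodCount_stepSet_le B)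
    (K := ⌈κ * n⌉₊) hs0.le hs1 (a := a) (fun i _ => hsa i) (fun T hT hlt => by
      have hlt' := Nat.lt_ceil.1 hlt
      simp only [hadef]
      split_ifs with hi
      · refine le_trans ?_ (h.goodCount_rate_ge ha hT.1 (Finset.card_pos.1 (hM.trans_le hT.2)) hlt')
        have : (M : ℝ) ≤ T.card := by exact_mod_cast hT.2
        gcongr
      · exact h.goodCount_rate_ge' ha hT.1 hlt') j (S := S) ⟨hw, hS⟩
  refine h1.trans ?_
  have hterm0 : ∀ i, 0 ≤ s / (a i - s) := fun i => div_nonneg hs0.le (sub_nonneg.2 (hsa i).le)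
  have hsum : ∑ i ∈ Finset.Ico (goodCount B S) ⌈κ * n⌉₊, s / (a i - s) ≤
      2 * M + c₀ * M / 2 * ((1 / 2 + 6 * δ) * (1 + L)) := by
    have hsub : Finset.Ico (goodCount B S) ⌈κ * n⌉₊ ⊆
        Finset.range M ∪ Finset.Ico M ⌈κ * n⌉₊ := fun i hi => by
      rw [Finset.mem_Ico] at hi
      rw [Finset.mem_union, Finset.mem_range, Finset.mem_Ico]
      omega
    refine (Finset.sum_le_sum_of_subset_of_nonneg hsub fun i _ _ => hterm0 i).trans ?_
    rw [Finset.sum_union (Finset.disjoint_left.2 fun i hi hi' => by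
      rw [Finset.mem_range] at hi
      rw [Finset.mem_Ico] at hi'
      omega)]
    have h3 : ∑ i ∈ Finset.range M, s / (a i - s) = M := by
      rw [Finset.sum_congr rfl fun i hi => ?_, Finset.sum_const, Finset.card_range, nsmul_eq_mul,
        mul_one]
      have h4 : a i - s = s := by
        simp only [hadef, if_pos (Finset.mem_range.1 hi)]
        rw [hs]
        ring
      rw [h4, div_self hs0.ne']
    have h4 : ∀ i ∈ Finset.Ico M ⌈κ * n⌉₊, s / (a i - s) ≤
        c₀ * M / 2 * (1 / 2 + 6 * δ) * (1 / i) + M ^ 2 / 2 * (1 / (i : ℝ) ^ 2) := by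
      intro i hi
      have hiM := (Finset.mem_Ico.1 hi).1
      have hi0 : (0 : ℝ) < i := by exact_mod_cast hM.trans_le hiM
      have h5 : s / a i ≤ c₀ * M / 2 * (1 / 2 + 6 * δ) * (1 / i) := by
        have hpos : 0 < 1 - 6 * δ := by linarith
        have h6 : s / a i = c₀ * M / 2 * (1 / (2 * (1 - 6 * δ))) * (1 / i) := by
          simp only [hadef, if_neg (not_lt.2 hiM)]
          rw [hs]
          field_simp
        rw [h6]
        gcongr
        rw [div_le_iff₀ (by positivity)]
        nlinarith
      have h6 : s / a i ≤ M / 2 * (1 / i) := by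
        refine h5.trans (mul_le_mul_of_nonneg_right ?_ (by positivity))
        have h8 : c₀ * (1 / 2 + 6 * δ) ≤ 1 / 2 * 1 :=
          mul_le_mul hc₀1 (by linarith) (by positivity) (by norm_num)
        have h9 := mul_le_mul_of_nonneg_right h8 (by positivity : (0 : ℝ) ≤ M / 2)
        linarith
      refine (div_sub_le hs0.le (by linarith [h2s i]) (h2s i)).trans (add_le_add h5 ?_)
      have h7 : 0 ≤ s / a i := div_nonneg hs0.le (by linarith [hsa i])
      calc 2 * (s / a i) ^ 2 ≤ 2 * (M / 2 * (1 / i)) ^ 2 := by gcongr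
        _ = _ := by
          field_simp
    have hK : ⌈κ * n⌉₊ ≤ n := by
      rw [Nat.ceil_le]
      have := mul_le_mul_of_nonneg_right ha.κ_le hn.le
      linarith
    have h5 : ∑ i ∈ Finset.Ico M ⌈κ * n⌉₊, 1 / (i : ℝ) ≤ 1 + L := by
      refine le_trans (Finset.sum_le_sum_of_subset_of_nonneg
        (Finset.Ico_subset_Ico_right hK) fun _ _ _ => by positivity) ?_
      rw [ha.L_eq]
      exact sum_Ico_one_div_le hM
    have h6 : ∑ i ∈ Finset.Ico M ⌈κ * n⌉₊, 1 / (i : ℝ) ^ 2 ≤ 2 / (M : ℝ) := by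
      rcases le_total M ⌈κ * n⌉₊ with hle | hle
      · exact sum_Ico_one_div_sq_le hM hle
      · rw [Finset.Ico_eq_empty_of_le hle, Finset.sum_empty]
        positivity
    have h7 := Finset.sum_le_sum h4
    rw [Finset.sum_add_distrib, ← Finset.mul_sum, ← Finset.mul_sum] at h7
    have h8 : (M : ℝ) ^ 2 / 2 * ∑ i ∈ Finset.Ico M ⌈κ * n⌉₊, 1 / (i : ℝ) ^ 2 ≤ M := by
      calc _ ≤ (M : ℝ) ^ 2 / 2 * (2 / M) := by gcongr
        _ = M := by
          field_simp
    have h9 := mul_le_mul_of_nonneg_left h5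
      (by positivity : 0 ≤ c₀ * M / 2 * (1 / 2 + 6 * δ))
    rw [h3]
    linarith
  calc _ ≤ Real.exp (-(s * j)) *
        Real.exp (2 * M + c₀ * M / 2 * ((1 / 2 + 6 * δ) * (1 + L))) := by
        refine mul_le_mul (one_sub_pow_le hs1 j) ((prod_one_add_le _ fun i _ => ?_).trans
          (Real.exp_le_exp.2 hsum)) (Finset.prod_nonneg fun i _ => ?_) (Real.exp_pos _).le <;>
        linarith [hterm0 i]
    _ ≤ _ := by
        rw [← Real.exp_add, Real.exp_le_exp]
        have h3 := mul_le_mul_of_nonneg_left hj hs0.le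
        have h4 : s * ((n : ℝ) / q * ((1 / 2 + 6 * δ) * (1 + L) + Y)) =
            c₀ * M / 2 * ((1 / 2 + 6 * δ) * (1 + L) + Y) := by
          rw [hs]
          field_simp
        have h5 : η / (4 * D) * M * Y = c₀ * M / 2 * Y := by
          rw [hc₀]
          field_simp
          ring
        linarith

/-- The phase in which almost all nodes become informed. -/
theorem GoodGraph.iterate_card_le (ha : Admissible n c η D δ κ κ' L)
    (h : GoodGraph c η D δ κ L G) (hq : 0 < q)
    {S : Finset (Fin n)} (hw : w ∉ S) (hS : ⌈κ * n⌉₊ ≤ S.card) {Y : ℝ} {j : ℕ}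
    (hj : (n : ℝ) / q * (4 * D / η * (2 + Real.log (1 / κ) + Real.log (2 / κ')) + Y) ≤ j) :
    (chainOp (restWeight q G w))^[j] (fun S =>
        if S.card < n - ⌊κ' * n⌋₊ then 1 else 0) S ≤ Real.exp (-(L * Y)) := by
  have hq0 : (0 : ℝ) < q := hq
  have hn0 : 0 < n := w.pos
  have hn : (0 : ℝ) < n := by exact_mod_cast hn0
  have hη := ha.η_pos
  have hD := ha.D_pos
  have hL := ha.L_pos
  have hκ' := ha.κ'_pos
  have hκ : 0 < κ := hκ'.trans_le ha.κ'_le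
  set c₀ := η / (2 * D) with hc₀
  have hc₀0 : 0 < c₀ := by positivity
  have hc₀1 : c₀ ≤ 1 / 2 := by
    rw [hc₀, div_le_div_iff₀ (by positivity) two_pos]
    linarith [ha.η_le]
  -- All levels from `κ * n` up to `n - κ' * n` have rate at least `2 * s` by the assumption `L_le`.
  -- So `s` may be as large as `L * q / n`, and waiting a constant factor longer already makes the
  -- failure probability a power of `1 / n`.
  set s : ℝ := q / n * L with hs
  have hqn : 0 < (q : ℝ) / n := by positivity
  have hs0 : 0 < s := by positivity
  have hLn := ha.L_le
  have hκ'n : 8 * L ≤ κ' * n := by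
    rw [← hc₀] at hLn
    have : c₀ * (κ' * n) ≤ 1 / 2 * (κ' * n) := mul_le_mul_of_nonneg_right hc₀1 (by positivity)
    linarith
  have hL1 : 1 ≤ L := by
    have := mul_le_mul_of_nonneg_right (by linarith [ha.δ_le] : δ ≤ 1) hL.le
    linarith [ha.le_δL]
  have hκn : κ' * n ≤ κ * n := mul_le_mul_of_nonneg_right ha.κ'_le hn.le
  have hκ1 : κ * n ≤ n / 8 := by
    have := mul_le_mul_of_nonneg_right ha.κ_le hn.le
    linarith
  have hs1 : s ≤ 1 := by
    have h1 : s = q * (L / n) := by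
      rw [hs]
      ring
    have h2 : L / n ≤ 1 := by
      rw [div_le_one hn]
      linarith
    rw [h1]
    have := q.2.2
    have : 0 ≤ L / n := by positivity
    nlinarith
  set F := ⌊κ' * n⌋₊ with hF
  have hF1 : κ' * n / 2 ≤ F := by
    have := Nat.sub_one_lt_floor (κ' * n)
    rw [← hF] at this
    linarith
  have hF2 : (F : ℝ) ≤ κ' * n := Nat.floor_le (by positivity)
  have hF0 : 0 < F := by
    have : (0 : ℝ) < F := by linarith
    exact_mod_cast this
  have hFn : F ≤ n := by
    have : (F : ℝ) ≤ n := by linarith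
    exact_mod_cast this
  set K := ⌈κ * n⌉₊ with hK
  have hK1 : κ * n ≤ K := Nat.le_ceil _
  have hK0 : 0 < K := Nat.ceil_pos.2 (by positivity)
  have hKn : K ≤ n := by
    rw [hK, Nat.ceil_le]
    linarith
  -- Levels below `K` are never visited, because the chain starts above them; their value only has
  -- to satisfy the side condition.
  set a : ℕ → ℝ := fun i => if i < K then 2 * s else
    q / n * (c₀ * min (i : ℝ) (n - 1 - i)) with hadef
  have hmin : ∀ i, K ≤ i → i < n - F → κ' * n / 2 ≤ min (i : ℝ) (n - 1 - i) := by
    intro i hi hi'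
    have h1 : (K : ℝ) ≤ i := by exact_mod_cast hi
    have h2 : (i : ℝ) + F + 1 ≤ n := by
      have : i + F + 1 ≤ n := by omega
      exact_mod_cast this
    exact le_min (by linarith) (by linarith)
  have h2s : ∀ i < n - F, 2 * s ≤ a i := by
    intro i hi
    simp only [hadef]
    split_ifs with hiK
    · exact le_rfl
    · rw [hs, mul_left_comm]
      refine mul_le_mul_of_nonneg_left ?_ hqn.le
      have := mul_le_mul_of_nonneg_left (hmin i (not_lt.1 hiK) hi) hc₀0.le
      rw [← hc₀] at hLn
      linarith
  have hsa : ∀ i < n - F, s < a i := fun i hi => by linarith [h2s i hi]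
  have h1 := iterate_chainOp_lt_le (b := restWeight q G w) restWeight_nonneg sum_restWeight_le_one
    (R := fun T => w ∉ T ∧ K ≤ T.card)
    (fun T e hT he => ⟨notMem_stepSet hT.1 he, hT.2.trans
      (Finset.card_le_card (subset_stepSet T e))⟩)
    (g := Finset.card) (fun T e => Finset.card_le_card (subset_stepSet T e)) stepSet_card_le
    (K := n - F) hs0.le hs1 (a := a) hsa (fun T hT hlt => by
      simp only [hadef, if_neg (not_lt.2 hT.2)]
      exact h.card_rate_ge ha hT.1 (Finset.card_pos.1 (hK0.trans_le hT.2))) j (S := S) ⟨hw, hS⟩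
  refine h1.trans ?_
  have hterm0 : ∀ i ∈ Finset.Ico S.card (n - F), 0 ≤ s / (a i - s) := fun i hi =>
    div_nonneg hs0.le (sub_nonneg.2 (hsa i (Finset.mem_Ico.1 hi).2).le)
  have hsum : ∑ i ∈ Finset.Ico S.card (n - F), s / (a i - s) ≤
      L * (4 * D / η * (2 + Real.log (1 / κ) + Real.log (2 / κ'))) := by
    have h3 : ∀ i ∈ Finset.Ico S.card (n - F), s / (a i - s) ≤
        2 * L / c₀ * (1 / i + 1 / (n - 1 - i : ℕ)) := by
      intro i hi
      rw [Finset.mem_Ico] at hi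
      have hiK : K ≤ i := hS.trans hi.1
      have hm := hmin i hiK hi.2
      have hm0 : 0 < min (i : ℝ) (n - 1 - i) := lt_of_lt_of_le (by positivity) hm
      have hi0 : (0 : ℝ) < i := hm0.trans_le (min_le_left _ _)
      have hni0 : (0 : ℝ) < n - 1 - i := hm0.trans_le (min_le_right _ _)
      have hcast : ((n - 1 - i : ℕ) : ℝ) = n - 1 - i := by
        rw [Nat.cast_sub (by omega), Nat.cast_sub (by omega), Nat.cast_one]
      have h4 : s / (a i - s) ≤ 2 * (s / a i) := by
        have h5 := h2s i hi.2
        rw [div_le_iff₀ (by linarith), ← mul_div_assoc, div_mul_eq_mul_div,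
          le_div_iff₀ (by linarith)]
        nlinarith
      refine h4.trans ?_
      have h5 : 2 * (s / a i) = 2 * L / c₀ * (1 / min (i : ℝ) (n - 1 - i)) := by
        simp only [hadef, if_neg (not_lt.2 hiK)]
        rw [hs]
        field_simp
      rw [h5, hcast]
      refine mul_le_mul_of_nonneg_left ?_ (by positivity)
      rcases min_choice (i : ℝ) (n - 1 - i) with hc | hc <;> rw [hc]
      · exact le_add_of_nonneg_right (by positivity)
      · exact le_add_of_nonneg_left (by positivity)
    refine (Finset.sum_le_sum h3).trans ?_
    rw [← Finset.mul_sum, Finset.sum_add_distrib]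
    have hSn : S.card ≤ n := by simpa using S.card_le_univ
    have hS0 : (0 : ℝ) < S.card := by exact_mod_cast hK0.trans_le hS
    have h4 : ∑ i ∈ Finset.Ico S.card (n - F), 1 / (i : ℝ) ≤ 1 + Real.log (1 / κ) := by
      refine (sum_Ico_one_div_le_log (hK0.trans_le hS) hSn (by omega)).trans ?_
      gcongr 1 + ?_
      refine Real.log_le_log (by positivity) ?_
      rw [div_le_div_iff₀ hS0 hκ]
      have : (K : ℝ) ≤ S.card := by exact_mod_cast hS
      linarith
    have h5 : ∑ i ∈ Finset.Ico S.card (n - F), 1 / ((n - 1 - i : ℕ) : ℝ) ≤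
        1 + Real.log (2 / κ') := by
      have h6 := Finset.sum_Ico_reflect (fun i => 1 / (i : ℝ)) S.card (m := n - F) (n := n - 1)
        (by omega)
      rw [h6]
      have h7 : n - 1 + 1 - (n - F) = F := by omega
      rw [h7]
      refine (sum_Ico_one_div_le_log hF0 hFn (by omega)).trans ?_
      gcongr 1 + ?_
      have : (0 : ℝ) < F := by exact_mod_cast hF0
      refine Real.log_le_log (by positivity) ?_
      rw [div_le_div_iff₀ this hκ']
      linarith
    have h6 : 2 * L / c₀ = L * (4 * D / η) := by
      rw [hc₀]
      field_simp
      ring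
    rw [h6, mul_assoc]
    refine mul_le_mul_of_nonneg_left (mul_le_mul_of_nonneg_left ?_ (by positivity)) hL.le
    linarith
  calc _ ≤ Real.exp (-(s * j)) *
        Real.exp (L * (4 * D / η * (2 + Real.log (1 / κ) + Real.log (2 / κ')))) := by
        refine mul_le_mul (one_sub_pow_le hs1 j) ((prod_one_add_le _ fun i hi => ?_).trans
          (Real.exp_le_exp.2 hsum)) (Finset.prod_nonneg fun i hi => ?_) (Real.exp_pos _).le <;>
        linarith [hterm0 i hi]
    _ ≤ _ := by
        rw [← Real.exp_add, Real.exp_le_exp]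
        have h3 := mul_le_mul_of_nonneg_left hj hs0.le
        have h4 : s * ((n : ℝ) / q * (4 * D / η * (2 + Real.log (1 / κ) + Real.log (2 / κ')) + Y)) =
            L * (4 * D / η * (2 + Real.log (1 / κ) + Real.log (2 / κ')) + Y) := by
          rw [hs]
          field_simp
        linarith

/-- Starting from `M` nodes, all but a fraction `κ'` of the nodes become informed without the help
of `w`. -/
theorem GoodGraph.iterate_restWeight_le (ha : Admissible n c η D δ κ κ' L)
    (h : GoodGraph c η D δ κ L G) (hq : 0 < q) {M : ℕ} (hM : 0 < M) (hMn : M ≤ n)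
    {S : Finset (Fin n)} (hw : w ∉ S) (hS : M ≤ S.card) {Y Y' : ℝ} {j j' : ℕ}
    (hj : (n : ℝ) / q * ((1 / 2 + 6 * δ) * (1 + L) + Y) ≤ j)
    (hj' : (n : ℝ) / q * (4 * D / η * (2 + Real.log (1 / κ) + Real.log (2 / κ')) + Y') ≤ j') :
    (chainOp (restWeight q G w))^[j + j'] (fun S =>
        if S.card < n - ⌊κ' * n⌋₊ then 1 else 0) S ≤
      Real.exp (2 * M - η / (4 * D) * M * Y) + Real.exp (-(L * Y')) := by
  refine iterate_markovOp_two_phase restWeight_nonneg sum_restWeight_le_one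
    (R := fun T => w ∉ T) (fun T e hT he => notMem_stepSet hT he)
    (fun T => by split_ifs <;> norm_num)
    (Bad := fun S => if goodCount (badNodes (c * L) (δ * (c * L)) G) S < ⌈κ * n⌉₊ then 1 else 0)
    (fun T => by split_ifs <;> norm_num) (Real.exp_pos _).le (fun T hT hBad => ?_) hw
    (h.iterate_goodCount_le ha hq hM hMn hw hS hj)
  refine h.iterate_card_le ha hq hT (le_trans ?_ (Finset.card_le_card Finset.sdiff_subset :
    goodCount (badNodes (c * L) (δ * (c * L)) G) T ≤ T.card)) hj'
  by_contra! hlt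
  change goodCount (badNodes (c * L) (δ * (c * L)) G) T < ⌈κ * n⌉₊ at hlt
  rw [if_pos hlt] at hBad
  exact lt_irrefl _ hBad

end Good

end Rumor

end

noncomputable section

namespace Rumor

variable {n : ℕ}

/-! ### Every node has few uninformed neighbours at the end -/

open Classical in
/-- The probability that the chain without `w`, started in `S`, has at step `j` informed all but at
most `x` nodes, but that at least `y` neighbours of `w` are not informed. -/
def leftOut (q : I) (w : Fin n) (j : ℕ) (x y : ℝ) (S : Finset (Fin n))
    (G : SimpleGraph (Fin n)) : ℝ :=
  (chainOp (restWeight q G w))^[j]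
    (fun S => if (Sᶜ.card : ℝ) ≤ x ∧ y ≤ cut G {w} Sᶜ then 1 else 0) S

theorem leftOut_nonneg (q : I) (w : Fin n) (j : ℕ) (x y : ℝ) (S : Finset (Fin n))
    (G : SimpleGraph (Fin n)) : 0 ≤ leftOut q w j x y S G := by
  have h := iterate_markovOp_mono (st := stepSet) (restWeight_nonneg (q := q) (G := G) (w := w))
    sum_restWeight_le_one (f := fun _ => 0)
    (g := fun S => open Classical in if (Sᶜ.card : ℝ) ≤ x ∧ y ≤ cut G {w} Sᶜ then 1 else 0)
    (fun S => by split_ifs <;> norm_num) j S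
  rwa [iterate_markovOp_const] at h

theorem ad_fromEdgeSet_union {A B : Finset (Sym2 (Fin n))} {u v : Fin n} (hB : s(u, v) ∉ B) :
    ad (SimpleGraph.fromEdgeSet ((A ∪ B : Finset (Sym2 (Fin n))) : Set (Sym2 (Fin n)))) u v =
      ad (SimpleGraph.fromEdgeSet (A : Set (Sym2 (Fin n)))) u v := by
  have h : (SimpleGraph.fromEdgeSet
      ((A ∪ B : Finset (Sym2 (Fin n))) : Set (Sym2 (Fin n)))).Adj u v ↔
      (SimpleGraph.fromEdgeSet (A : Set (Sym2 (Fin n)))).Adj u v := by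
    simp [hB]
  unfold ad
  exact @if_congr _ _ _ (_) (_) _ _ _ _ h rfl rfl

/-- Adding edges at `w` changes neither the adjacency of other nodes nor `restDg`, so the chain
without `w` is a function of the remaining edges alone. -/
theorem restWeight_fromEdgeSet_union (q : I) {w : Fin n} {A B : Finset (Sym2 (Fin n))}
    (hB : ∀ e ∈ B, w ∈ e) :
    restWeight q
      (SimpleGraph.fromEdgeSet ((A ∪ B : Finset (Sym2 (Fin n))) : Set (Sym2 (Fin n)))) w =
      restWeight q (SimpleGraph.fromEdgeSet (A : Set (Sym2 (Fin n)))) w := by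
  funext e
  unfold restWeight
  have had : ∀ u v, u ≠ w → v ≠ w →
      ad (SimpleGraph.fromEdgeSet ((A ∪ B : Finset (Sym2 (Fin n))) : Set (Sym2 (Fin n)))) u v =
        ad (SimpleGraph.fromEdgeSet (A : Set (Sym2 (Fin n)))) u v := fun u v hu hv =>
    ad_fromEdgeSet_union fun h => by
      rcases Sym2.mem_iff.1 (hB _ h) with h1 | h1
      · exact hu h1.symm
      · exact hv h1.symm
  split_ifs with h
  · rfl
  · rw [not_or] at h
    rw [had _ _ h.1 h.2]
    congr 2
    unfold restDg
    congr 1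
    exact Finset.sum_congr rfl fun v hv => had _ _ h.1 (Finset.ne_of_mem_erase hv)

/-- The pairs that avoid `w` are fixed first. They determine the law of the chain without `w`, while
the pairs at `w` are still independent of it. For each possible outcome `T`, the number of
neighbours of `w` outside `T` is then a sum of at most `x` independent indicators, to which the
exponential moment bound applies. -/
theorem graphExp_leftOut_le (p q : I) (w : Fin n) (j : ℕ) {x y l : ℝ} (hl : 0 ≤ l)
    (S₀ : Finset (Fin n)) :
    graphExp p (leftOut q w j x y S₀) ≤ Real.exp (x * p * Real.exp l - l * y) := by
  classical
  set P := (allEdges n).filter fun e => w ∉ e with hP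
  set Q := (allEdges n).filter fun e => w ∈ e with hQ
  have hPQ : Disjoint P Q := Finset.disjoint_left.2 fun e h1 h2 =>
    (Finset.mem_filter.1 h1).2 (Finset.mem_filter.1 h2).2
  have hun : allEdges n = P ∪ Q := by
    rw [Finset.union_comm]
    exact (Finset.filter_union_filter_not_eq _ _).symm
  have hp0 : (0 : ℝ) ≤ p := p.2.1
  set X := Real.exp (x * p * Real.exp l - l * y) with hX
  rw [graphExp_eq_edgeExp, hun, edgeExp_union _ hPQ]
  have hinner : ∀ A ⊆ P, edgeExp p Q (fun B => leftOut q w j x y S₀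
      (SimpleGraph.fromEdgeSet ((A ∪ B : Finset (Sym2 (Fin n))) : Set (Sym2 (Fin n))))) ≤ X := by
    intro A hA
    set H := SimpleGraph.fromEdgeSet (A : Set (Sym2 (Fin n))) with hH
    -- The distribution of the chain after `j` steps, which depends only on the fixed pairs `A`.
    set pr : Finset (Fin n) → ℝ := fun T =>
      (chainOp (restWeight q H w))^[j] (fun S => if S = T then 1 else 0) S₀ with hpr
    have hpr0 : ∀ T, 0 ≤ pr T := fun T => by
      have h := iterate_markovOp_mono (st := stepSet) (restWeight_nonneg (q := q) (G := H) (w := w))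
        sum_restWeight_le_one (f := fun _ => 0) (g := fun S => if S = T then 1 else 0)
        (fun S => by split_ifs <;> norm_num) j S₀
      rwa [iterate_markovOp_const] at h
    have hpr1 : ∑ T, pr T = 1 := by
      have h1 := iterate_markovOp_sum Finset.univ stepSet (restWeight q H w)
        (fun (T : Finset (Fin n)) (S : Finset (Fin n)) => if S = T then (1 : ℝ) else 0) j
      have h2 := congrFun h1 S₀
      simp only [Finset.sum_ite_eq, Finset.mem_univ, if_true, iterate_markovOp_const] at h2
      exact h2.symm
    have hle : ∀ B ⊆ Q, leftOut q w j x y S₀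
        (SimpleGraph.fromEdgeSet ((A ∪ B : Finset (Sym2 (Fin n))) : Set (Sym2 (Fin n)))) ≤
        ∑ T, pr T * (if (Tᶜ.card : ℝ) ≤ x then
          Real.exp (-(l * y)) * Real.exp (l * (B ∩ cutPairs {w} (Tᶜ.erase w)).card) else 0) := by
      intro B hB
      have hBw : ∀ e ∈ B, w ∈ e := fun e he => (Finset.mem_filter.1 (hB he)).2
      have hAB : A ∪ B ⊆ allEdges n := by
        rw [hun]
        exact Finset.union_subset_union hA hB
      set G := SimpleGraph.fromEdgeSet ((A ∪ B : Finset (Sym2 (Fin n))) : Set (Sym2 (Fin n)))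
        with hG
      have hcut : ∀ T : Finset (Fin n), cut G {w} Tᶜ =
          ((B ∩ cutPairs {w} (Tᶜ.erase w)).card : ℝ) := by
        intro T
        have hdis : Disjoint ({w} : Finset (Fin n)) (Tᶜ.erase w) := by simp
        have h1 : cut G {w} Tᶜ = cut G {w} (Tᶜ.erase w) := by
          rw [cut_singleton_left, cut_singleton_left]
          by_cases hw : w ∈ Tᶜ
          · rw [← Finset.add_sum_erase _ _ hw, ad_self, zero_add]
          · rw [Finset.erase_eq_of_notMem hw]
        rw [h1, ← edgeCount_cutPairs G hdis, hG, edgeCount_fromEdgeSet hAB]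
        congr 2
        ext e
        simp only [Finset.mem_inter, Finset.mem_union]
        refine ⟨fun h => ⟨h.1.resolve_left fun hA' => ?_, h.2⟩, fun h => ⟨Or.inr h.1, h.2⟩⟩
        obtain ⟨z, hz, rfl⟩ := Finset.mem_image.1 h.2
        rw [Finset.mem_product, Finset.mem_singleton] at hz
        refine (Finset.mem_filter.1 (hA hA')).2 ?_
        rw [← hz.1]
        exact Sym2.mem_mk_left _ _
      have hf : (fun S : Finset (Fin n) => if (Sᶜ.card : ℝ) ≤ x ∧ y ≤ cut G {w} Sᶜ then (1 : ℝ)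
          else 0) = fun S => ∑ T, (if (Tᶜ.card : ℝ) ≤ x ∧ y ≤ cut G {w} Tᶜ then (1 : ℝ) else 0) *
            (if S = T then 1 else 0) := by
        funext S
        simp
      unfold leftOut
      rw [hf, restWeight_fromEdgeSet_union q hBw, chainOp, iterate_markovOp_sum]
      refine Finset.sum_le_sum fun T _ => ?_
      rw [iterate_markovOp_const_mul]
      beta_reduce
      rw [mul_comm]
      refine mul_le_mul_of_nonneg_left ?_ (hpr0 T)
      by_cases hT : (Tᶜ.card : ℝ) ≤ x
      · simp only [hT, true_and, if_true]
        split_ifs with h2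
        · rw [← Real.exp_add]
          refine Real.one_le_exp ?_
          rw [hcut T] at h2
          have := mul_le_mul_of_nonneg_left h2 hl
          linarith
        · positivity
      · simp [hT]
    refine (edgeExp_mono p.2.1 p.2.2 hle).trans ?_
    have hswap : edgeExp (p : ℝ) Q (fun B => ∑ T, pr T * (if (Tᶜ.card : ℝ) ≤ x then
          Real.exp (-(l * y)) * Real.exp (l * (B ∩ cutPairs {w} (Tᶜ.erase w)).card) else 0)) =
        ∑ T, pr T * edgeExp (p : ℝ) Q (fun B => if (Tᶜ.card : ℝ) ≤ x then
          Real.exp (-(l * y)) * Real.exp (l * (B ∩ cutPairs {w} (Tᶜ.erase w)).card) else 0) := by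
      simp only [edgeExp, Finset.mul_sum]
      rw [Finset.sum_comm]
      exact Finset.sum_congr rfl fun T _ => Finset.sum_congr rfl fun B _ => by ring
    rw [hswap]
    have hX0 : 0 < X := Real.exp_pos _
    calc _ ≤ ∑ T, pr T * X := by
          refine Finset.sum_le_sum fun T _ => mul_le_mul_of_nonneg_left ?_ (hpr0 T)
          by_cases hT : (Tᶜ.card : ℝ) ≤ x
          · simp only [hT, if_true]
            have hdis : Disjoint ({w} : Finset (Fin n)) (Tᶜ.erase w) := by simp
            have h1 := edgeExp_indicator_mul_exp_le (p := (p : ℝ)) p.2.1 p.2.2 (P := Q)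
              (Q := cutPairs {w} (Tᶜ.erase w)) (R := ∅) (fun e he => by
                refine Finset.mem_filter.2 ⟨cutPairs_subset hdis he, ?_⟩
                obtain ⟨z, hz, rfl⟩ := Finset.mem_image.1 he
                rw [Finset.mem_product, Finset.mem_singleton] at hz
                rw [← hz.1]
                exact Sym2.mem_mk_left _ _) (Finset.empty_subset _)
              (Finset.disjoint_empty_right _) l
            simp only [Finset.empty_subset, if_true, one_mul, Finset.card_empty, pow_zero,
              card_cutPairs hdis, Finset.card_singleton] at h1
            have h2 : edgeExp (p : ℝ) Q (fun B => Real.exp (-(l * y)) *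
                Real.exp (l * (B ∩ cutPairs {w} (Tᶜ.erase w)).card)) = Real.exp (-(l * y)) *
                edgeExp (p : ℝ) Q (fun B =>
                  Real.exp (l * (B ∩ cutPairs {w} (Tᶜ.erase w)).card)) := by
              simp only [edgeExp, Finset.mul_sum]
              exact Finset.sum_congr rfl fun B _ => by ring
            rw [h2]
            refine (mul_le_mul_of_nonneg_left h1 (Real.exp_pos _).le).trans ?_
            rw [← Real.exp_add, hX, Real.exp_le_exp]
            have h3 : ((Tᶜ.erase w).card : ℝ) ≤ x :=
              le_trans (by exact_mod_cast Finset.card_le_card (Finset.erase_subset _ _)) hT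
            have h4 : 0 ≤ Real.exp l - 1 := by linarith [Real.add_one_le_exp l]
            have h5 : ((Tᶜ.erase w).card : ℝ) * p * (Real.exp l - 1) ≤ x * p * Real.exp l := by
              have hx : 0 ≤ x := le_trans (Nat.cast_nonneg _) h3
              exact mul_le_mul (mul_le_mul_of_nonneg_right h3 hp0) (by linarith) h4
                (mul_nonneg hx hp0)
            linarith
          · simp only [hT, if_false]
            rw [edgeExp_const]
            exact hX0.le
      _ = X := by
          rw [← Finset.sum_mul, hpr1, one_mul]
  refine (edgeExp_mono p.2.1 p.2.2 hinner).trans ?_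
  rw [edgeExp_const]

/-- Markov's inequality and a union bound over `w` and the start `S`. Only starts of size exactly
`M` are considered, which keeps their number below `n ^ M`. -/
theorem binomialRandom_leftOut_gt_le (p q : I) (j M : ℕ) {x y l ε : ℝ} (hl : 0 ≤ l) (hε : 0 < ε) :
    (SimpleGraph.binomialRandom (Fin n) p).real
      {G | ¬ ∀ w, ∀ S : Finset (Fin n), S.card = M → leftOut q w j x y S G ≤ ε} ≤
      n * (n ^ M * (1 / ε * Real.exp (x * p * Real.exp l - l * y))) := by
  have hsub : {G : SimpleGraph (Fin n) | ¬ ∀ w, ∀ S : Finset (Fin n), S.card = M →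
      leftOut q w j x y S G ≤ ε} ⊆ {G | ∃ i ∈ (Finset.univ : Finset (Fin n)) ×ˢ
        Finset.powersetCard M (Finset.univ : Finset (Fin n)),
          ¬ leftOut q i.1 j x y i.2 G ≤ ε} := by
    intro G hG
    simp only [Set.mem_ofPred_eq, not_forall] at hG
    obtain ⟨w, S, h1, h2⟩ := hG
    exact ⟨(w, S), by simpa using h1, h2⟩
  refine (measureReal_mono hsub).trans ((binomialRandom_real_exists_le p _ _).trans ?_)
  have hone : ∀ i : Fin n × Finset (Fin n), (SimpleGraph.binomialRandom (Fin n) p).real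
      {G | ¬ leftOut q i.1 j x y i.2 G ≤ ε} ≤
      1 / ε * Real.exp (x * p * Real.exp l - l * y) := by
    intro i
    refine (binomialRandom_real_le p (F := fun G => 1 / ε * leftOut q i.1 j x y i.2 G)
      (fun G => mul_nonneg (by positivity) (leftOut_nonneg _ _ _ _ _ _ _)) fun G hG => ?_).trans ?_
    · rw [one_div_mul_eq_div, one_le_div hε]
      exact (not_le.1 hG).le
    · rw [graphExp_const_mul]
      exact mul_le_mul_of_nonneg_left (graphExp_leftOut_le p q i.1 j hl i.2) (by positivity)
  refine (Finset.sum_le_sum fun i _ => hone i).trans ?_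
  rw [Finset.sum_const, nsmul_eq_mul, Finset.card_product, Finset.card_powersetCard,
    Finset.card_univ, Fintype.card_fin, Nat.cast_mul, mul_assoc]
  refine mul_le_mul_of_nonneg_left (mul_le_mul_of_nonneg_right ?_ (by positivity))
    (Nat.cast_nonneg _)
  exact_mod_cast Nat.choose_le_pow n M

open Classical in
/-- The indicator that `w` and at least `y` of its neighbours are not informed. -/
def lonely (G : SimpleGraph (Fin n)) (y : ℝ) (w : Fin n) (S : Finset (Fin n)) : ℝ :=
  if w ∉ S ∧ y ≤ cut G {w} Sᶜ then 1 else 0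

theorem lonely_nonneg (G : SimpleGraph (Fin n)) (y : ℝ) (w : Fin n) (S : Finset (Fin n)) :
    0 ≤ lonely G y w S := by
  unfold lonely
  split_ifs <;> norm_num

theorem lonely_antitone (G : SimpleGraph (Fin n)) (y : ℝ) (w : Fin n) :
    Antitone (lonely G y w) := by
  intro S S' h
  unfold lonely
  split_ifs with h1 h2
  · exact le_rfl
  · exact absurd ⟨fun hw => h1.1 (h hw), h1.2.trans (cut_mono G (Finset.Subset.refl _)
      (Finset.compl_subset_compl.2 h))⟩ h2
  · exact zero_le_one
  · exact le_rfl

/-- By monotonicity the start may be shrunk to exactly `M` nodes and the chain slowed down to the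
one that ignores `w`. If `w` is then lonely, either the slow chain has not filled the graph or it
leaves out many neighbours of `w`. If `w` was informed from the start, it stays so. -/
theorem GoodGraph.iterate_lonely_le {c η D δ κ κ' L : ℝ} {G : SimpleGraph (Fin n)} {q : I}
    (ha : Admissible n c η D δ κ κ' L) (h : GoodGraph c η D δ κ L G) (hq : 0 < q) {M : ℕ}
    (hM : 0 < M) (hMn : M ≤ n) {y ε : ℝ} {Y Y' : ℝ} {j j' : ℕ}
    (hj : (n : ℝ) / q * ((1 / 2 + 6 * δ) * (1 + L) + Y) ≤ j)
    (hj' : (n : ℝ) / q * (4 * D / η * (2 + Real.log (1 / κ) + Real.log (2 / κ')) + Y') ≤ j')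
    (hout : ∀ w, ∀ S : Finset (Fin n), S.card = M →
      leftOut q w (j + j') (κ' * n) y S G ≤ ε) (hε : 0 ≤ ε)
    {S : Finset (Fin n)} (hS : M ≤ S.card) (w : Fin n) :
    (chainOp (contactWeight q G))^[j + j'] (lonely G y w) S ≤
      ε + (Real.exp (2 * M - η / (4 * D) * M * Y) + Real.exp (-(L * Y'))) := by
  classical
  have hb0 := contactWeight_nonneg q G
  have hb1 := sum_contactWeight_le_one q G w.pos
  by_cases hw : w ∈ S
  · have h1 := iterate_markovOp_mono_on (st := stepSet) hb0 hb1 (R := fun T => w ∈ T)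
      (fun T e hT _ => subset_stepSet T e hT) (f := lonely G y w) (g := fun _ => 0)
      (fun T hT => by simp [lonely, hT]) (j + j') hw
    rw [iterate_markovOp_const] at h1
    refine h1.trans ?_
    positivity
  · obtain ⟨S₀, hS₀, hcard⟩ := Finset.exists_subset_card_eq hS
    have hw₀ : w ∉ S₀ := fun h' => hw (hS₀ h')
    refine (iterate_markovOp_antitone stepSet_mono hb0 hb1 (lonely_antitone G y w) (j + j')
      hS₀).trans ?_
    refine (iterate_chainOp_le_of_le hb0 hb1 (restWeight_nonneg (w := w)) restWeight_le
      (lonely_antitone G y w) (j + j') S₀).trans ?_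
    refine le_trans ?_ (add_le_add (hout w S₀ hcard)
      (h.iterate_restWeight_le ha hq hM hMn hw₀ hcard.ge hj hj'))
    unfold leftOut chainOp
    have hadd := congrFun (iterate_markovOp_add stepSet (restWeight q G w)
      (fun S => if (Sᶜ.card : ℝ) ≤ κ' * n ∧ y ≤ cut G {w} Sᶜ then 1 else 0)
      (fun S => if S.card < n - ⌊κ' * n⌋₊ then 1 else 0) (j + j')) S₀
    rw [← hadd]
    refine iterate_markovOp_mono restWeight_nonneg sum_restWeight_le_one (fun T => ?_) _ _
    unfold lonely
    by_cases hc : (Tᶜ.card : ℝ) ≤ κ' * n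
    · by_cases hy : y ≤ cut G {w} Tᶜ
      · simp only [hc, hy, and_self, and_true, if_true]
        split_ifs <;> norm_num
      · simp only [hy, and_false, if_false, zero_add]
        split_ifs <;> norm_num
    · have h2 : T.card < n - ⌊κ' * n⌋₊ := by
        rw [not_le, ← Nat.floor_lt (mul_nonneg ha.κ'_pos.le (Nat.cast_nonneg n)),
          Finset.card_compl, Fintype.card_fin] at hc
        omega
      simp only [hc, h2, false_and, if_false, if_true, zero_add]
      split_ifs <;> norm_num

end Rumor

end

noncomputable section

namespace Rumor

variable {n : ℕ}

/-! ### The time at which the last nodes are contacted -/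

/-- The probability that `w` takes part in a given contact with one of its neighbours. -/
def touchRate (q : I) (G : SimpleGraph (Fin n)) (w : Fin n) : ℝ := q / n * ∑ u, rate G u w

/-- The sum over all nodes of the probability of not being contacted in `m` steps. -/
def missCount (q : I) (G : SimpleGraph (Fin n)) (m : ℕ) : ℝ := ∑ w, (1 - touchRate q G w) ^ m

/-- The number of steps after which on average at most one node has not been contacted. -/
def touchTime (q : I) (G : SimpleGraph (Fin n)) : ℕ := sInf {m | missCount q G m ≤ 1}

section Good

variable {c η D δ κ κ' L : ℝ} {G : SimpleGraph (Fin n)} {q : I}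

theorem GoodGraph.dg_pos (ha : Admissible n c η D δ κ κ' L) (h : GoodGraph c η D δ κ L G)
    (u : Fin n) : 0 < dg G u :=
  (mul_pos ha.η_pos ha.L_pos).trans_le (h.le_dg ha u)

theorem GoodGraph.le_rate (ha : Admissible n c η D δ κ κ' L) (h : GoodGraph c η D δ κ L G)
    (u v : Fin n) : 2 / (D * L) * ad G u v ≤ rate G u v := by
  have h1 := one_div_le_one_div_of_le (h.dg_pos ha u) (h.dg_le u)
  have h2 := one_div_le_one_div_of_le (h.dg_pos ha v) (h.dg_le v)
  rw [rate, mul_comm]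
  refine mul_le_mul_of_nonneg_left ?_ (ad_nonneg G u v)
  calc 2 / (D * L) = 1 / (D * L) + 1 / (D * L) := by ring
    _ ≤ _ := add_le_add h1 h2

theorem GoodGraph.rate_le (ha : Admissible n c η D δ κ κ' L) (h : GoodGraph c η D δ κ L G)
    (u v : Fin n) : rate G u v ≤ 2 / (η * L) * ad G u v := by
  have h0 := mul_pos ha.η_pos ha.L_pos
  have h1 := one_div_le_one_div_of_le h0 (h.le_dg ha u)
  have h2 := one_div_le_one_div_of_le h0 (h.le_dg ha v)
  rw [rate, mul_comm]
  refine mul_le_mul_of_nonneg_right ?_ (ad_nonneg G u v)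
  calc _ ≤ 1 / (η * L) + 1 / (η * L) := add_le_add h1 h2
    _ = _ := by ring

/-- The rings of `w` itself already contribute `q / n`; the rest comes from contacts made by its
neighbours. -/
theorem GoodGraph.le_touchRate (ha : Admissible n c η D δ κ κ' L) (h : GoodGraph c η D δ κ L G)
    (w : Fin n) : (q : ℝ) / n ≤ touchRate q G w := by
  have hq : (0 : ℝ) ≤ q := q.2.1
  refine le_mul_of_one_le_right (by positivity) ?_
  calc 1 = ∑ u, ad G u w * (1 / dg G w) := by
        rw [← Finset.sum_mul, Finset.sum_congr rfl fun u _ => ad_comm G u w, ← dg_eq_sum,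
          mul_one_div_cancel (h.dg_pos ha w).ne']
    _ ≤ _ := Finset.sum_le_sum fun u _ => mul_le_mul_of_nonneg_left
        (le_add_of_nonneg_left (one_div_nonneg.2 (dg_nonneg G u))) (ad_nonneg G u w)

theorem GoodGraph.touchRate_le (ha : Admissible n c η D δ κ κ' L) (h : GoodGraph c η D δ κ L G)
    (w : Fin n) : touchRate q G w ≤ q / n * (1 + D / η) := by
  have hq : (0 : ℝ) ≤ q := q.2.1
  have hη := ha.η_pos
  have hL := ha.L_pos
  have h0 := mul_pos ha.η_pos ha.L_pos
  refine mul_le_mul_of_nonneg_left ?_ (by positivity)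
  calc _ ≤ ∑ u, ad G w u * (1 / (η * L) + 1 / dg G w) := by
        refine Finset.sum_le_sum fun u _ => ?_
        rw [rate, ad_comm]
        refine mul_le_mul_of_nonneg_left (add_le_add ?_ le_rfl) (ad_nonneg G w u)
        exact one_div_le_one_div_of_le h0 (h.le_dg ha u)
    _ = 1 + dg G w / (η * L) := by
        rw [← Finset.sum_mul, ← dg_eq_sum, mul_add, mul_one_div_cancel (h.dg_pos ha w).ne']
        ring
    _ ≤ 1 + D * L / (η * L) := by
        gcongr
        exact h.dg_le w
    _ = _ := by
        congr 1
        field_simp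

theorem Admissible.n_pos (ha : Admissible n c η D δ κ κ' L) : (0 : ℝ) < n := by
  have := ha.eight_le
  exact_mod_cast (by omega : 0 < n)

theorem GoodGraph.touchRate_le_half (ha : Admissible n c η D δ κ κ' L)
    (h : GoodGraph c η D δ κ L G) (hR : 2 * (1 + D / η) ≤ n) (w : Fin n) :
    touchRate q G w ≤ 1 / 2 := by
  have hn := ha.n_pos
  have hq : (0 : ℝ) ≤ q := q.2.1
  have hq1 : (q : ℝ) ≤ 1 := q.2.2
  have hη := ha.η_pos
  have hD := ha.D_pos
  refine (h.touchRate_le ha w).trans ?_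
  rw [div_mul_eq_mul_div, div_le_iff₀ hn]
  have : (q : ℝ) * (1 + D / η) ≤ 1 * (1 + D / η) :=
    mul_le_mul_of_nonneg_right hq1 (by positivity)
  linarith

theorem GoodGraph.missCount_le (ha : Admissible n c η D δ κ κ' L)
    (h : GoodGraph c η D δ κ L G) (hR : 2 * (1 + D / η) ≤ n) (m : ℕ) :
    missCount q G m ≤ Real.exp (L - q / n * m) := by
  have hn := ha.n_pos
  calc missCount q G m ≤ ∑ _w : Fin n, Real.exp (-(q / n * m)) := by
        refine Finset.sum_le_sum fun w _ => ?_
        have h1 := h.le_touchRate (q := q) ha w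
        have h2 := h.touchRate_le_half (q := q) ha hR w
        exact (pow_le_pow_left₀ (by linarith) (by linarith) m).trans
          (one_sub_pow_le (by linarith) m)
    _ = _ := by
        rw [Finset.sum_const, Finset.card_univ, Fintype.card_fin, nsmul_eq_mul, sub_eq_add_neg,
          Real.exp_add, ha.L_eq, Real.exp_log hn]

theorem GoodGraph.missCount_touchTime_le (ha : Admissible n c η D δ κ κ' L)
    (h : GoodGraph c η D δ κ L G) (hq : 0 < q) (hR : 2 * (1 + D / η) ≤ n) :
    missCount q G (touchTime q G) ≤ 1 ∧ (touchTime q G : ℝ) ≤ (n : ℝ) / q * L + 1 := by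
  have hn := ha.n_pos
  have hL := ha.L_pos
  have hq0 : (0 : ℝ) < q := hq
  have hmem : ⌈(n : ℝ) / q * L⌉₊ ∈ {m | missCount q G m ≤ 1} := by
    refine (h.missCount_le ha hR _).trans (Real.exp_le_one_iff.2 ?_)
    have h1 := mul_le_mul_of_nonneg_left (Nat.le_ceil ((n : ℝ) / q * L))
      (by positivity : 0 ≤ (q : ℝ) / n)
    have h2 : (q : ℝ) / n * (n / q * L) = L := by
      field_simp
    linarith
  refine ⟨Nat.sInf_mem (s := {m | missCount q G m ≤ 1}) ⟨_, hmem⟩, ?_⟩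
  have h1 : touchTime q G ≤ ⌈(n : ℝ) / q * L⌉₊ := Nat.sInf_le hmem
  have h2 : (touchTime q G : ℝ) ≤ ⌈(n : ℝ) / q * L⌉₊ := by exact_mod_cast h1
  exact h2.trans (Nat.ceil_lt_add_one (by positivity)).le

theorem exp_neg_two_mul_le {x : ℝ} (hx0 : 0 ≤ x) (hx : x ≤ 1 / 2) :
    Real.exp (-(2 * x)) ≤ 1 - x := by
  rw [Real.exp_neg, inv_le_comm₀ (Real.exp_pos _) (by linarith)]
  have h2 := Real.add_one_le_exp (2 * x)
  have h3 : (1 - x)⁻¹ ≤ 2 * x + 1 := by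
    rw [inv_le_iff_one_le_mul₀ (by linarith)]
    nlinarith
  linarith

/-- As `touchRate` is also at most of order `q / n`, no node is touched much faster than by its own
clock, so missing at most one node on average takes order `n * log n / q` steps. -/
theorem GoodGraph.le_touchTime (ha : Admissible n c η D δ κ κ' L)
    (h : GoodGraph c η D δ κ L G) (hq : 0 < q) (hR : 2 * (1 + D / η) ≤ n) :
    (n : ℝ) / q * (L / (2 * (1 + D / η))) ≤ touchTime q G := by
  have hn := ha.n_pos
  have hq0 : (0 : ℝ) < q := hq
  have hη := ha.η_pos
  have hD := ha.D_pos
  have h1 := (h.missCount_touchTime_le ha hq hR).1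
  set m := touchTime q G with hm
  have h2 : Real.exp (L - 2 * (q / n * (1 + D / η)) * m) ≤ missCount q G m := by
    calc _ = ∑ _w : Fin n, Real.exp (-(2 * (q / n * (1 + D / η)) * m)) := by
          rw [Finset.sum_const, Finset.card_univ, Fintype.card_fin, nsmul_eq_mul, sub_eq_add_neg,
            Real.exp_add, ha.L_eq, Real.exp_log hn]
      _ ≤ _ := by
          refine Finset.sum_le_sum fun w _ => ?_
          have h3 := h.le_touchRate (q := q) ha w
          have h4 := h.touchRate_le_half (q := q) ha hR w
          have h5 := h.touchRate_le (q := q) ha w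
          have h6 : 0 ≤ (q : ℝ) / n := by positivity
          rw [exp_neg_mul_card]
          refine pow_le_pow_left₀ (Real.exp_pos _).le ?_ m
          refine le_trans ?_ (exp_neg_two_mul_le (h6.trans h3) h4)
          rw [Real.exp_le_exp]
          linarith
  have h3 : L - 2 * (q / n * (1 + D / η)) * m ≤ 0 := Real.exp_le_one_iff.1 (h2.trans h1)
  have hR0 : 0 < 1 + D / η := by positivity
  calc (n : ℝ) / q * (L / (2 * (1 + D / η)))
      ≤ n / q * ((2 * (q / n * (1 + D / η)) * m) / (2 * (1 + D / η))) := by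
        gcongr
        linarith
    _ = m := by
        generalize 1 + D / η = R at hR0
        field_simp

/-- When every uninformed node has few uninformed neighbours, then the rumor spreads to all nodes
soon after they have been contacted. -/
theorem GoodGraph.iterate_uninformed_le (ha : Admissible n c η D δ κ κ' L)
    (h : GoodGraph c η D δ κ L G) (hR : 2 * (1 + D / η) ≤ n)
    {S : Finset (Fin n)} (hS : ∀ w ∉ S, cut G {w} Sᶜ ≤ δ * L) (m b : ℕ) :
    (chainOp (contactWeight q G))^[m + b] uninformed S ≤
      Real.exp ((q : ℝ) / n * (4 * δ / η * (m + b) - b)) * missCount q G m := by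
  have hn := ha.n_pos
  have hq0 : (0 : ℝ) ≤ q := q.2.1
  have hη := ha.η_pos
  have hδ := ha.δ_pos
  have hL := ha.L_pos
  have hb0 := contactWeight_nonneg q G
  have hn0 : 0 < n := by have := ha.eight_le; omega
  have hb1 := sum_contactWeight_le_one q G hn0
  -- The part of `touchRate` that is due to uninformed neighbours: there are at most `δ * L` of
  -- them, each with rate at most `2 / (η * L)`. All other contacts of `w` inform it.
  set ε : ℝ := q / n * (2 * δ / η) with hε
  have hqn : 0 ≤ (q : ℝ) / n := by positivity
  have hε0 : 0 ≤ ε := by positivity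
  have hmiss : ∀ w (k : ℕ) (T : Finset (Fin n)), (∀ w ∉ T, cut G {w} Tᶜ ≤ δ * L) →
      (chainOp (contactWeight q G))^[k] (fun T => if w ∉ T then 1 else 0) T ≤
        (1 - touchRate q G w + ε) ^ k := by
    intro w k
    have h1 := h.le_touchRate (q := q) ha w
    have h2 := h.touchRate_le_half (q := q) ha hR w
    have hx0 : 0 ≤ 1 - touchRate q G w + ε := by linarith
    induction k with
    | zero =>
      intro T _
      simp only [Function.iterate_zero, id, pow_zero]
      split_ifs <;> norm_num
    | succ k ih =>
      intro T hT
      rw [Function.iterate_succ_apply, pow_succ]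
      have h3 : ∀ T' : Finset (Fin n), (∀ w ∉ T', cut G {w} T'ᶜ ≤ δ * L) →
          chainOp (contactWeight q G) (fun T => if w ∉ T then 1 else 0) T' ≤
          (1 - touchRate q G w + ε) * (if w ∉ T' then 1 else 0) := by
        intro T' hT'
        by_cases hw : w ∈ T'
        · simp only [chainOp, markovOp, hw, not_true, if_false, mul_zero, zero_add, sub_zero]
          refine (Finset.sum_eq_zero fun e _ => ?_).le
          simp [subset_stepSet T' e hw]
        · unfold chainOp markovOp
          rw [sum_contactWeight_stepSet q G (fun T => if w ∉ T then (1 : ℝ) else 0)]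
          have h4 : ∀ u ∈ T', ∑ v ∈ T'ᶜ, rate G u v * ((if w ∉ insert v T' then (1 : ℝ) else 0) -
              if w ∉ T' then 1 else 0) = - rate G u w := by
            intro u _
            rw [Finset.sum_eq_single_of_mem w (Finset.mem_compl.2 hw)]
            · simp [hw]
            · intro v _ hv
              simp [hw, hv.symm]
          rw [Finset.sum_congr rfl h4, Finset.sum_neg_distrib]
          simp only [hw, not_false_iff, if_true, mul_one]
          have h5 : ∑ u, rate G u w = ∑ u ∈ T', rate G u w + ∑ u ∈ T'ᶜ, rate G u w :=
            (Finset.sum_add_sum_compl T' _).symm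
          have h6 : ∑ u ∈ T'ᶜ, rate G u w ≤ 2 * δ / η := by
            calc _ ≤ ∑ u ∈ T'ᶜ, 2 / (η * L) * ad G w u :=
                  Finset.sum_le_sum fun u _ => by
                    rw [ad_comm]
                    exact h.rate_le ha u w
              _ = 2 / (η * L) * cut G {w} T'ᶜ := by
                  rw [cut_singleton_left, Finset.mul_sum]
              _ ≤ 2 / (η * L) * (δ * L) :=
                  mul_le_mul_of_nonneg_left (hT' w hw) (by positivity)
              _ = _ := by
                  field_simp
          have h7 := mul_le_mul_of_nonneg_left h6 hqn
          rw [touchRate, h5, mul_add, hε]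
          linarith
      refine (iterate_markovOp_mono_on hb0 hb1
        (R := fun T' => ∀ w ∉ T', cut G {w} T'ᶜ ≤ δ * L) (fun T' e hT' _ w hw => ?_)
        h3 k hT).trans ?_
      · exact (cut_mono G (Finset.Subset.refl _)
          (Finset.compl_subset_compl.2 (subset_stepSet T' e))).trans
          (hT' w fun hw' => hw (subset_stepSet T' e hw'))
      · rw [iterate_markovOp_const_mul]
        beta_reduce
        rw [mul_comm]
        exact mul_le_mul_of_nonneg_right (ih T hT) hx0
  have hun : ∀ T : Finset (Fin n), uninformed T ≤ ∑ w, if w ∉ T then (1 : ℝ) else 0 := by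
    intro T
    unfold uninformed
    split_ifs with hT
    · exact Finset.sum_nonneg fun w _ => by split_ifs <;> norm_num
    · obtain ⟨w, hw⟩ : ∃ w, w ∉ T := by
        by_contra! hcon
        exact hT (Finset.eq_univ_iff_forall.2 hcon)
      refine le_trans ?_ (Finset.single_le_sum (f := fun w => if w ∉ T then (1 : ℝ) else 0)
        (fun w _ => by split_ifs <;> norm_num) (Finset.mem_univ w))
      simp [hw]
  have hsum := iterate_markovOp_mono (st := stepSet) hb0 hb1 hun (m + b) S
  rw [iterate_markovOp_sum] at hsum
  refine hsum.trans ?_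
  unfold missCount
  rw [Finset.mul_sum]
  refine Finset.sum_le_sum fun w _ => (hmiss w (m + b) S hS).trans ?_
  have h1 := h.le_touchRate (q := q) ha w
  have h2 := h.touchRate_le_half (q := q) ha hR w
  set t := touchRate q G w with ht
  -- Since `1 - t ≥ 1 / 2`, the additive loss `ε` is at most a factor `exp (2 * ε)`. The `b` extra
  -- steps, each gaining `exp (-q / n)`, are there to make up for it.
  have h3 : 1 - t + ε ≤ (1 - t) * Real.exp (2 * ε) := by
    have h4 := Real.add_one_le_exp (2 * ε)
    have h5 := mul_le_mul_of_nonneg_left h4 (by linarith : 0 ≤ 1 - t)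
    nlinarith
  calc (1 - t + ε) ^ (m + b) ≤ ((1 - t) * Real.exp (2 * ε)) ^ (m + b) :=
        pow_le_pow_left₀ (by linarith) h3 _
    _ = Real.exp (2 * ε * (m + b)) * (1 - t) ^ b * (1 - t) ^ m := by
        rw [mul_pow, ← Real.exp_nat_mul, pow_add]
        push_cast
        ring_nf
    _ ≤ Real.exp (2 * ε * (m + b)) * Real.exp (-(q / n * b)) * (1 - t) ^ m := by
        have h5 : (1 - t) ^ b ≤ Real.exp (-(q / n * b)) :=
          (pow_le_pow_left₀ (by linarith) (by linarith) b).trans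
            (one_sub_pow_le (by linarith) b)
        have h6 : 0 ≤ (1 - t) ^ m := pow_nonneg (by linarith) m
        gcongr
    _ = _ := by
        rw [← Real.exp_add, hε]
        congr 2
        ring

end Good

end Rumor

end

noncomputable section

namespace Rumor

variable {n : ℕ}

/-! ### The upper tail -/

section Good

variable {c η D δ κ κ' L : ℝ} {G : SimpleGraph (Fin n)} {q : I}

theorem GoodGraph.mul_min_le_cut (ha : Admissible n c η D δ κ κ' L)
    (h : GoodGraph c η D δ κ L G) {S : Finset (Fin n)} (hS : S.Nonempty) :
    η * L * min (S.card : ℝ) (n - S.card) ≤ cut G S Sᶜ := by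
  have hηL : 0 < η * L := mul_pos ha.η_pos ha.L_pos
  by_cases hc : 2 * S.card ≤ n
  · exact (mul_le_mul_of_nonneg_left (min_le_left _ _) hηL.le).trans (h.le_cut S hS hc)
  · refine (mul_le_mul_of_nonneg_left (min_le_right _ _) hηL.le).trans ?_
    rw [← card_compl_cast]
    rcases Sᶜ.eq_empty_or_nonempty with he | hne
    · rw [he]
      simpa using cut_nonneg G S ∅
    · have h1 := h.le_cut Sᶜ hne (by
        have : (2 : ℝ) * Sᶜ.card ≤ n := by
          rw [card_compl_cast]
          have : (n : ℝ) + 1 ≤ 2 * S.card := by exact_mod_cast not_le.1 hc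
          linarith
        exact_mod_cast this)
      rwa [compl_compl, cut_comm] at h1

theorem GoodGraph.connected (ha : Admissible n c η D δ κ κ' L) (h : GoodGraph c η D δ κ L G) :
    G.Connected := by
  have hn0 : 0 < n := by have := ha.eight_le; omega
  refine connected_of_cut_pos hn0 fun S hS hS' => ?_
  refine lt_of_lt_of_le (mul_pos (mul_pos ha.η_pos ha.L_pos) (lt_min ?_ ?_))
    (h.mul_min_le_cut ha hS)
  · exact_mod_cast hS.card_pos
  · have : S.card < n := by
      simpa using Finset.card_lt_card (Finset.ssubset_univ_iff.2 hS')
    rw [sub_pos]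
    exact_mod_cast this

theorem GoodGraph.mul_min_le_sum (ha : Admissible n c η D δ κ κ' L)
    (h : GoodGraph c η D δ κ L G) {S : Finset (Fin n)} (hS : S.Nonempty) :
    (q : ℝ) / n * (2 * η / D * min (S.card : ℝ) (n - S.card)) ≤
      ∑ e, contactWeight q G e * (((stepSet S e).card : ℝ) - S.card) := by
  have hq : (0 : ℝ) ≤ q := q.2.1
  have hD := ha.D_pos
  have hL := ha.L_pos
  rw [sum_contactWeight_card]
  refine mul_le_mul_of_nonneg_left ?_ (by positivity)
  calc _ = 2 / (D * L) * (η * L * min (S.card : ℝ) (n - S.card)) := by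
        field_simp
    _ ≤ 2 / (D * L) * cut G S Sᶜ :=
        mul_le_mul_of_nonneg_left (h.mul_min_le_cut ha hS) (by positivity)
    _ ≤ _ := by
        rw [cut, Finset.mul_sum]
        refine Finset.sum_le_sum fun u _ => ?_
        rw [Finset.mul_sum]
        exact Finset.sum_le_sum fun v _ => h.le_rate ha u v

/-- A crude bound of the right order, uniform in the start. It is multiplied only by small failure
probabilities, so its constant is harmless. -/
theorem GoodGraph.meanReal_le (ha : Admissible n c η D δ κ κ' L)
    (h : GoodGraph c η D δ κ L G) (hq : 0 < q) {S : Finset (Fin n)} (hS : S.Nonempty) :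
    meanReal q G S ≤ D / (η * q) * (1 + L) := by
  have hq0 : (0 : ℝ) < q := hq
  have hn := ha.n_pos
  have hD := ha.D_pos
  have hη := ha.η_pos
  have hmin : ∀ i < n, 0 < i → 0 < min (i : ℝ) (n - i) := fun i hi hi0 => by
    have h1 : (i : ℝ) < n := by exact_mod_cast hi
    have h2 : (0 : ℝ) < i := by exact_mod_cast hi0
    exact lt_min h2 (by linarith)
  have h1 := hitting_le_sum (contactWeight_nonneg q G) (τ := 1 / n) (by positivity)
    (meanReal_univ q G) (fun S hS hS' => sum_contactWeight_meanReal hq (h.connected ha) hS hS')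
    (a := fun i => (q : ℝ) / n * (2 * η / D * min (i : ℝ) (n - i)))
    (fun i hi hi0 => by
      rw [Fintype.card_fin] at hi
      have := hmin i hi hi0
      positivity) (fun S hS _ => h.mul_min_le_sum ha hS) hS
  refine h1.trans ?_
  rw [Fintype.card_fin]
  have h2 : ∀ i ∈ Finset.Ico 1 n, 1 / (n : ℝ) / (q / n * (2 * η / D * min (i : ℝ) (n - i))) ≤
      D / (2 * η * q) * (1 / (i : ℝ) + 1 / (n - i : ℕ)) := by
    intro i hi
    rw [Finset.mem_Ico] at hi
    have hm := hmin i hi.2 hi.1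
    have h3 : 1 / (n : ℝ) / (q / n * (2 * η / D * min (i : ℝ) (n - i))) =
        D / (2 * η * q) * (1 / min (i : ℝ) (n - i)) := by
      field_simp
    rw [h3, Nat.cast_sub hi.2.le]
    refine mul_le_mul_of_nonneg_left ?_ (by positivity)
    have hi0 : (0 : ℝ) < i := hm.trans_le (min_le_left _ _)
    have hni0 : (0 : ℝ) < n - i := hm.trans_le (min_le_right _ _)
    rcases min_choice (i : ℝ) (n - i) with hc | hc <;> rw [hc]
    · exact le_add_of_nonneg_right (by positivity)
    · exact le_add_of_nonneg_left (by positivity)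
  calc _ ≤ ∑ i ∈ Finset.Ico 1 n, 1 / (n : ℝ) / (q / n * (2 * η / D * min (i : ℝ) (n - i))) := by
        refine Finset.sum_le_sum_of_subset_of_nonneg
          (Finset.Ico_subset_Ico_left hS.card_pos) fun i hi _ => ?_
        rw [Finset.mem_Ico] at hi
        have hm := hmin i hi.2 hi.1
        positivity
    _ ≤ _ := Finset.sum_le_sum h2
    _ = D / (2 * η * q) * (2 * ∑ i ∈ Finset.Ico 1 n, 1 / (i : ℝ)) := by
        rw [← Finset.mul_sum, Finset.sum_add_distrib,
          sum_Ico_reflect_one (fun i => 1 / (i : ℝ)) n, ← two_mul]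
    _ ≤ D / (2 * η * q) * (2 * (1 + L)) := by
        gcongr
        rw [ha.L_eq]
        exact sum_Ico_one_div_le one_pos
    _ = _ := by
        field_simp

/-- The start of the spreading. -/
theorem GoodGraph.iterate_card_lt_le (ha : Admissible n c η D δ κ κ' L)
    (h : GoodGraph c η D δ κ L G) (hq : 0 < q) {M : ℕ} (hMn : 2 * M ≤ n)
    {S : Finset (Fin n)} (hS : S.Nonempty) {Y : ℝ} {j : ℕ}
    (hj : (n : ℝ) / q * (D / η * (M + Y)) ≤ j) :
    (chainOp (contactWeight q G))^[j] (fun S => if S.card < M then 1 else 0) S ≤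
      Real.exp (-Y) := by
  have hq0 : (0 : ℝ) < q := hq
  have hq1 : (q : ℝ) ≤ 1 := q.2.2
  have hn := ha.n_pos
  have hn0 : 0 < n := by have := ha.eight_le; omega
  have hn1 : (1 : ℝ) ≤ n := by exact_mod_cast hn0
  have hD := ha.D_pos
  have hη := ha.η_pos
  -- Half of the rate that is available with a single informed node, used for all of the first `M`
  -- levels, which therefore contribute `s / (2 * s - s) = 1` each.
  set s : ℝ := q / n * (η / D) with hs
  have hs0 : 0 < s := by positivity
  have hs1 : s ≤ 1 := by
    have h1 : (q : ℝ) / n ≤ 1 := by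
      rw [div_le_one hn]
      linarith
    have h2 : η / D ≤ 1 := by
      rw [div_le_one hD]
      exact ha.η_le
    calc s ≤ 1 * 1 := mul_le_mul h1 h2 (by positivity) zero_le_one
      _ = 1 := one_mul 1
  have h1 := iterate_chainOp_lt_le (contactWeight_nonneg q G) (sum_contactWeight_le_one q G hn0)
    (R := fun T => T.Nonempty) (fun T e hT _ => hT.mono (subset_stepSet T e))
    (g := Finset.card) (fun T e => Finset.card_le_card (subset_stepSet T e)) stepSet_card_le
    (K := M) hs0.le hs1 (a := fun _ => 2 * s) (fun i _ => by linarith) (fun T hT hlt => by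
      refine le_trans ?_ (h.mul_min_le_sum ha hT)
      have h2 : (1 : ℝ) ≤ min (T.card : ℝ) (n - T.card) := by
        refine le_min (by exact_mod_cast hT.card_pos) ?_
        have : T.card + 1 ≤ M := hlt
        have h3 : (T.card : ℝ) + T.card + 2 ≤ n := by
          exact_mod_cast (by omega : T.card + T.card + 2 ≤ n)
        have h4 : (0 : ℝ) ≤ T.card := Nat.cast_nonneg _
        linarith
      calc 2 * s = q / n * (2 * η / D * 1) := by
            rw [hs]
            ring
        _ ≤ _ := by gcongr) j hS
  refine h1.trans ?_
  have h2 : ∏ i ∈ Finset.Ico S.card M, (1 + s / (2 * s - s)) ≤ Real.exp M := by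
    refine (prod_one_add_le _ fun i _ => ?_).trans (Real.exp_le_exp.2 ?_)
    · have : 0 ≤ s / (2 * s - s) := div_nonneg hs0.le (by linarith)
      linarith
    · have : s / (2 * s - s) = 1 := by
        rw [div_eq_one_iff_eq (by linarith)]
        ring
      rw [this, Finset.sum_const, nsmul_eq_mul, mul_one, Nat.card_Ico]
      exact_mod_cast Nat.sub_le _ _
  have h0 : 0 ≤ ∏ i ∈ Finset.Ico S.card M, (1 + s / (2 * s - s)) :=
    Finset.prod_nonneg fun i _ => add_nonneg zero_le_one (div_nonneg hs0.le (by linarith))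
  calc _ ≤ Real.exp (-(s * j)) * Real.exp M :=
        mul_le_mul (one_sub_pow_le hs1 j) h2 h0 (Real.exp_pos _).le
    _ ≤ _ := by
        rw [← Real.exp_add, Real.exp_le_exp]
        have h3 := mul_le_mul_of_nonneg_left hj hs0.le
        have h4 : s * ((n : ℝ) / q * (D / η * (M + Y))) = M + Y := by
          rw [hs]
          field_simp
        linarith

/-- The upper tail of the number of steps. -/
theorem GoodGraph.iterate_uninformed_singleton_le (ha : Admissible n c η D δ κ κ' L)
    (h : GoodGraph c η D δ κ L G) (hq : 0 < q) (hR : 2 * (1 + D / η) ≤ n) {M : ℕ} (hM : 0 < M)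
    (hMn : 2 * M ≤ n) {ε Y₀ Y Y' : ℝ} {j₀ j j' : ℕ}
    (hj₀ : (n : ℝ) / q * (D / η * (M + Y₀)) ≤ j₀)
    (hj : (n : ℝ) / q * ((1 / 2 + 6 * δ) * (1 + L) + Y) ≤ j)
    (hj' : (n : ℝ) / q * (4 * D / η * (2 + Real.log (1 / κ) + Real.log (2 / κ')) + Y') ≤ j')
    (hout : ∀ w, ∀ S : Finset (Fin n), S.card = M →
      leftOut q w (j + j') (κ' * n) (δ * L) S G ≤ ε) (hε : 0 ≤ ε) (b : ℕ) (s : Fin n) :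
    (chainOp (contactWeight q G))^[j₀ + (j + j' + (touchTime q G + b))] uninformed {s} ≤
      Real.exp (-Y₀) + (n * (ε + (Real.exp (2 * M - η / (4 * D) * M * Y) +
        Real.exp (-(L * Y')))) +
        Real.exp ((q : ℝ) / n * (4 * δ / η * (touchTime q G + b) - b))) := by
  have hb0 := contactWeight_nonneg q G
  have hn0 : 0 < n := by have := ha.eight_le; omega
  have hb1 := sum_contactWeight_le_one q G hn0
  refine iterate_markovOp_two_phase hb0 hb1 (R := fun T => T.Nonempty)
    (fun T e hT _ => hT.mono (subset_stepSet T e)) uninformed_le_one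
    (Bad := fun T => if T.card < M then 1 else 0) (fun T => by split_ifs <;> norm_num)
    (by positivity) (fun T hT hBad => ?_) (Finset.singleton_nonempty s)
    (h.iterate_card_lt_le ha hq hMn (Finset.singleton_nonempty s) hj₀)
  have hTM : M ≤ T.card := by
    by_contra! hlt
    rw [if_pos hlt] at hBad
    exact lt_irrefl _ hBad
  -- The sum of the indicators `lonely` is less than `1` only if no node is lonely. This is the
  -- union bound over `w`, each summand being estimated with its own slowed chain.
  refine iterate_markovOp_two_phase hb0 hb1 (R := fun _ => True) (fun _ _ _ _ => trivial)
    uninformed_le_one (Bad := fun T => ∑ w, lonely G (δ * L) w T)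
    (fun T => Finset.sum_nonneg fun w _ => lonely_nonneg _ _ _ _)
    (by positivity) (fun T' _ hBad' => ?_) trivial ?_
  · refine (h.iterate_uninformed_le ha hR (fun w hw => ?_) _ b).trans
      (mul_le_of_le_one_right (Real.exp_pos _).le (h.missCount_touchTime_le ha hq hR).1)
    by_contra! hlt
    have h1 := Finset.single_le_sum (f := fun w => lonely G (δ * L) w T')
      (fun w _ => lonely_nonneg _ _ _ _) (Finset.mem_univ w)
    simp only [lonely, hw, hlt.le, not_false_iff, and_self, if_true] at h1
    unfold lonely at hBad'
    linarith
  · rw [iterate_markovOp_sum]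
    refine (Finset.sum_le_sum fun w _ => h.iterate_lonely_le ha hq hM (by omega) hj hj' hout hε
      hTM w).trans ?_
    rw [Finset.sum_const, Finset.card_univ, Fintype.card_fin, nsmul_eq_mul]

end Good

end Rumor

end

noncomputable section

namespace Rumor

variable {n : ℕ}

/-! ### Nodes that have not been contacted -/

theorem contactWeight_self (q : I) {G : SimpleGraph (Fin n)} {u : Fin n} (h : 0 < dg G u) :
    contactWeight q G (u, u) = 0 := by
  classical
  have hne : (G.neighborSet u).Nonempty := by
    have h1 : 0 < (nbr G u).card := by
      unfold dg at h
      exact_mod_cast h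
    obtain ⟨v, hv⟩ := Finset.card_pos.1 h1
    exact ⟨v, mem_nbr.1 hv⟩
  have h1 : G.neighborSet u = ↑(nbr G u) := by
    ext w
    simp
  rw [contactWeight, contactLaw, if_pos hne, measureReal_def, h1, ← Finset.coe_singleton,
    uniformOn_apply_finset, Finset.inter_singleton_of_notMem (by simp)]
  simp

/-- The indicator that no node of `W` belongs to the set. -/
def avoids (W T : Finset (Fin n)) : ℝ := if Disjoint W T then 1 else 0

/-- The probability of a contact that involves a node of `W`. -/
def hitProb (b : Fin n × Fin n → ℝ) (W : Finset (Fin n)) : ℝ :=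
  ∑ e, b e * if e.1 ∈ W ∨ e.2 ∈ W then 1 else 0

/-- Whether a contact touches `W` does not depend on the current set, so avoiding `W` has exactly
geometric probability. This is why the lower bound works with touched rather than informed nodes. -/
theorem iterate_touch_avoids (b : Fin n × Fin n → ℝ) (W : Finset (Fin n)) (m : ℕ)
    (T : Finset (Fin n)) : (markovOp touchSet b)^[m] (avoids W) T =
      (1 - hitProb b W) ^ m * avoids W T := by
  have hstep : markovOp touchSet b (avoids W) = fun T => (1 - hitProb b W) * avoids W T := by
    funext T
    unfold markovOp hitProb
    rw [sub_mul, one_mul, sub_eq_add_neg, Finset.sum_mul, ← Finset.sum_neg_distrib]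
    congr 1
    refine Finset.sum_congr rfl fun e _ => ?_
    unfold avoids touchSet
    simp only [Finset.disjoint_insert_right]
    by_cases h1 : e.1 ∈ W <;> by_cases h2 : e.2 ∈ W <;> by_cases h3 : Disjoint W T <;>
      simp [h1, h2, h3]
  induction m generalizing T with
  | zero => simp
  | succ m ih =>
    rw [Function.iterate_succ_apply, hstep, iterate_markovOp_const_mul, pow_succ']
    beta_reduce
    rw [ih, mul_assoc]

section Good

variable {c η D δ κ κ' L : ℝ} {G : SimpleGraph (Fin n)} {q : I}

theorem hitProb_singleton (hdg : ∀ u, 0 < dg G u) (w : Fin n) :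
    hitProb (contactWeight q G) {w} = touchRate q G w := by
  unfold hitProb touchRate
  have h1 : ∀ e : Fin n × Fin n, contactWeight q G e *
      (if e.1 ∈ ({w} : Finset (Fin n)) ∨ e.2 ∈ ({w} : Finset (Fin n)) then (1 : ℝ) else 0) =
      (if e.1 = w then contactWeight q G e else 0) +
        (if e.2 = w then contactWeight q G e else 0) := by
    rintro ⟨u, v⟩
    by_cases hu : u = w
    · by_cases hv : v = w
      · subst hu
        subst hv
        simp [contactWeight_self q (hdg v)]
      · simp [hu, hv]
    · simp [hu]
  rw [Finset.sum_congr rfl fun e _ => h1 e, Finset.sum_add_distrib, Fintype.sum_prod_type,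
    Fintype.sum_prod_type_right]
  have h2 : ∀ u, (∑ v, if u = w then contactWeight q G (u, v) else 0) =
      if u = w then ∑ v, contactWeight q G (u, v) else 0 := fun u => by
    split_ifs <;> simp
  have h3 : ∀ v, (∑ u, if v = w then contactWeight q G (u, v) else 0) =
      if v = w then ∑ u, contactWeight q G (u, v) else 0 := fun u => by
    split_ifs <;> simp
  simp only [h2, h3, Finset.sum_ite_eq', Finset.mem_univ, if_true]
  rw [← Finset.sum_add_distrib, Finset.mul_sum]
  refine Finset.sum_congr rfl fun u _ => ?_
  by_cases hu : u = w
  · subst hu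
    simp [contactWeight_self q (hdg u), rate, ad_self]
  · rw [add_comm, contactWeight_add_swap q G hu]

/-- Inclusion and exclusion: contacts counted for both nodes are the ones between them. -/
theorem hitProb_pair_ge (hdg : ∀ u, 0 < dg G u) {w w' : Fin n} (h : w ≠ w') :
    touchRate q G w + touchRate q G w' - q / n * rate G w w' ≤
      hitProb (contactWeight q G) {w, w'} := by
  rw [← hitProb_singleton hdg, ← hitProb_singleton hdg, ← contactWeight_add_swap q G h]
  have h1 : contactWeight q G (w, w') + contactWeight q G (w', w) =
      ∑ e, contactWeight q G e * ((if e = (w, w') then 1 else 0) + if e = (w', w) then 1 else 0) := by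
    simp [mul_add, Finset.sum_add_distrib]
  rw [h1, sub_le_iff_le_add]
  unfold hitProb
  rw [← Finset.sum_add_distrib, ← Finset.sum_add_distrib]
  refine Finset.sum_le_sum fun e _ => ?_
  rw [← mul_add, ← mul_add]
  refine mul_le_mul_of_nonneg_left ?_ (contactWeight_nonneg q G e)
  obtain ⟨u, v⟩ := e
  by_cases hu : u = w
  · subst hu
    by_cases hv : v = u
    · subst hv
      simp [h]
    · by_cases hv' : v = w'
      · subst hv'
        simp [h, hv]
      · simp [h, hv, hv']
  · by_cases hu' : u = w'
    · subst hu'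
      by_cases hv : v = w
      · subst hv
        simp [h, h.symm]
      · simp [hu, hv]
    · by_cases hv : v = w
      · subst hv
        simp [h, hu, hu']
      · by_cases hv' : v = w'
        · subst hv'
          simp [hu, hu', hv]
        · simp [hu', hv', hu, hv]

/-- The second moment method for the number of nodes that have not been contacted. -/
theorem GoodGraph.le_iterate_uninformed (ha : Admissible n c η D δ κ κ' L)
    (h : GoodGraph c η D δ κ L G) (hq : 0 < q) (hR : 2 * (1 + D / η) ≤ n) {m : ℕ}
    (hm : (m : ℝ) ≤ (n : ℝ) / q * L)
    (hπ : ∀ w, D * L * (Real.exp (8 / η) * (1 - touchRate q G w) ^ m) ≤ 1)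
    (S : Finset (Fin n)) :
    1 - 2 / missCount q G m - 2 / missCount q G m * ∑ w ∈ S, (1 - touchRate q G w) ^ m ≤
      (chainOp (contactWeight q G))^[m] uninformed S := by
  have hb0 := contactWeight_nonneg q G
  have hn0 : 0 < n := by have := ha.eight_le; omega
  have hn := ha.n_pos
  have hb1 := sum_contactWeight_le_one q G hn0
  have hq0 : (0 : ℝ) < q := hq
  have hη := ha.η_pos
  have hL := ha.L_pos
  have hdg := fun u => h.dg_pos ha u
  have hqn : 0 < (q : ℝ) / n := by positivity
  set π : Fin n → ℝ := fun w => (1 - touchRate q G w) ^ m with hπdef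
  have hτ0 : ∀ w, 0 ≤ touchRate q G w := fun w => hqn.le.trans (h.le_touchRate ha w)
  have hτ1 : ∀ w, touchRate q G w ≤ 1 / 2 := fun w => h.touchRate_le_half ha hR w
  have hπ0 : ∀ w, 0 < π w := fun w => pow_pos (by linarith [hτ1 w]) m
  set N := missCount q G m with hN
  have hNsum : N = ∑ w, π w := rfl
  have hN0 : 0 < N := Finset.sum_pos (fun w _ => hπ0 w) ⟨⟨0, hn0⟩, Finset.mem_univ _⟩
  refine le_trans ?_ (iterate_touch_le_iterate_chainOp hb0 hb1 uninformed_antitone m S)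
  set X : Finset (Fin n) → ℝ := fun T => ∑ w, avoids {w} T with hX
  have hpair : ∀ (w w' : Fin n) (T : Finset (Fin n)), avoids {w} T * avoids {w'} T = avoids {w, w'} T := by
    intro w w' T
    unfold avoids
    simp only [Finset.disjoint_insert_left, Finset.disjoint_singleton_left]
    by_cases h1 : w ∈ T <;> by_cases h2 : w' ∈ T <;> simp [h1, h2]
  -- Chebyshev's inequality in pointwise form. With `X` the number of untouched nodes, `(1 - X / N)
  -- ^ 2` is nonnegative and equals `1` when `X = 0`, hence dominates the indicator that everything
  -- is touched. Its expectation needs only first and second moments.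
  have hle : ∀ T, (1 : ℝ) + ((-(2 / N)) * ∑ w, avoids {w} T +
      1 / N ^ 2 * ∑ x : Fin n × Fin n, avoids {x.1, x.2} T) ≥ 1 + (-1) * uninformed T := by
    intro T
    have h1 : ∑ x : Fin n × Fin n, avoids {x.1, x.2} T = X T ^ 2 := by
      rw [Fintype.sum_prod_type, sq, hX, Finset.sum_mul_sum]
      exact Finset.sum_congr rfl fun w _ => Finset.sum_congr rfl fun w' _ => (hpair w w' T).symm
    have h2 : (1 : ℝ) + ((-(2 / N)) * ∑ w, avoids {w} T +
        1 / N ^ 2 * ∑ x : Fin n × Fin n, avoids {x.1, x.2} T) = (1 - X T / N) ^ 2 := by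
      rw [h1]
      change 1 + (-(2 / N) * X T + 1 / N ^ 2 * X T ^ 2) = _
      ring
    rw [h2]
    by_cases hT : T = Finset.univ
    · have : X T = 0 := by
        rw [hX, hT]
        exact Finset.sum_eq_zero fun w _ => by simp [avoids]
      rw [this]
      simp [uninformed, hT]
    · simp only [uninformed, hT, if_false]
      nlinarith [sq_nonneg (1 - X T / N)]
  have hiter := iterate_markovOp_mono (st := touchSet) hb0 hb1 hle m S
  rw [iterate_markovOp_add, iterate_markovOp_add, iterate_markovOp_add, iterate_markovOp_const,
    iterate_markovOp_const_mul, iterate_markovOp_const_mul, iterate_markovOp_const_mul,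
    iterate_markovOp_sum, iterate_markovOp_sum] at hiter
  beta_reduce at hiter
  have hone : ∑ w, (markovOp touchSet (contactWeight q G))^[m] (avoids {w}) S =
      N - ∑ w ∈ S, π w := by
    have h1 : ∀ w, (markovOp touchSet (contactWeight q G))^[m] (avoids {w}) S =
        if w ∈ Sᶜ then π w else 0 := by
      intro w
      rw [iterate_touch_avoids, hitProb_singleton hdg]
      unfold avoids
      by_cases hw : w ∈ S <;> simp [hw, hπdef]
    rw [Finset.sum_congr rfl fun w _ => h1 w, Finset.sum_ite_mem, Finset.univ_inter, hNsum,
      ← Finset.sum_add_sum_compl S]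
    ring
  have hav1 : ∀ W T : Finset (Fin n), avoids W T ≤ 1 := fun W T => by
    unfold avoids
    split_ifs <;> norm_num
  have htwo : ∀ w w', (markovOp touchSet (contactWeight q G))^[m] (avoids {w, w'}) S ≤
      π w * π w' + (if w = w' then π w else 0) +
        ad G w w' * (π w * (Real.exp (8 / η) * π w')) := by
    intro w w'
    have had := ad_nonneg G w w'
    have h0 := (hπ0 w).le
    have h0' := (hπ0 w').le
    rw [iterate_touch_avoids]
    by_cases hw : w = w'
    · subst hw
      rw [if_pos rfl, ad_self, zero_mul, add_zero, Finset.pair_eq_singleton,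
        hitProb_singleton hdg]
      refine (mul_le_of_le_one_right h0 (hav1 _ _)).trans ?_
      exact le_add_of_nonneg_left (by positivity)
    · rw [if_neg hw, add_zero]
      have h1 := hitProb_pair_ge (q := q) hdg hw
      have h2 := hτ1 w
      have h3 := hτ1 w'
      set x : ℝ := q / n * rate G w w' with hx
      have hx0 : 0 ≤ x := mul_nonneg hqn.le (rate_nonneg _ _ _)
      set t := touchRate q G w with ht
      set t' := touchRate q G w' with ht'
      have ht0 : 0 ≤ t := hτ0 w
      have ht0' : 0 ≤ t' := hτ0 w'
      have hhit : hitProb (contactWeight q G) {w, w'} ≤ 1 := by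
        refine (Finset.sum_le_sum fun e _ => ?_).trans hb1
        exact mul_le_of_le_one_right (hb0 e) (by split_ifs <;> norm_num)
      -- The events of missing `w` and of missing `w'` are independent up to the term `x` for
      -- contacts between the two nodes. Because `(1 - t) * (1 - t') ≥ 1 / 4`, this term becomes a
      -- factor `1 + 4 * x`.
      have h4 : 1 - hitProb (contactWeight q G) {w, w'} ≤ (1 - t) * (1 - t') * (1 + 4 * x) := by
        have h5 : 1 / 4 ≤ (1 - t) * (1 - t') := by nlinarith
        have h6 := mul_le_mul_of_nonneg_right h5 (by linarith : 0 ≤ 4 * x)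
        have h7 : 0 ≤ t * t' := mul_nonneg ht0 ht0'
        nlinarith
      have h5 : (1 - hitProb (contactWeight q G) {w, w'}) ^ m ≤
          π w * π w' * Real.exp (4 * x * m) := by
        refine (pow_le_pow_left₀ (by linarith) h4 m).trans ?_
        rw [mul_pow, mul_pow]
        refine mul_le_mul_of_nonneg_left (one_add_pow_le (by linarith) m) ?_
        exact mul_nonneg h0 h0'
      refine (mul_le_of_le_one_right (pow_nonneg (by linarith) m) (hav1 _ _)).trans (h5.trans ?_)
      by_cases hadj : G.Adj w w'
      · have had1 : ad G w w' = 1 := by simp [ad, hadj]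
        have h6 : 4 * x * m ≤ 8 / η := by
          have h7 := h.rate_le ha w w'
          rw [had1, mul_one] at h7
          calc 4 * x * m ≤ 4 * (q / n * (2 / (η * L))) * (n / q * L) := by
                refine mul_le_mul ?_ hm (Nat.cast_nonneg m) (by positivity)
                rw [hx]
                gcongr
            _ = 8 / η := by
                field_simp
                ring
        have h7 := Real.exp_le_exp.2 h6
        rw [had1, one_mul]
        have h8 : 0 ≤ π w * π w' := mul_nonneg h0 h0'
        have h9 := mul_le_mul_of_nonneg_left h7 h8
        linarith
      · have had0 : ad G w w' = 0 := by simp [ad, hadj]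
        have hx00 : x = 0 := by
          rw [hx, rate, had0]
          ring
        rw [hx00, had0]
        simp
  have hsum : ∑ x : Fin n × Fin n,
      (markovOp touchSet (contactWeight q G))^[m] (avoids {x.1, x.2}) S ≤ N ^ 2 + 2 * N := by
    rw [Fintype.sum_prod_type]
    refine (Finset.sum_le_sum fun w _ => Finset.sum_le_sum fun w' _ => htwo w w').trans ?_
    simp only [Finset.sum_add_distrib, Finset.sum_ite_eq, Finset.mem_univ, if_true]
    have h1 : ∑ w, ∑ w', π w * π w' = N ^ 2 := by
      rw [sq, hNsum, Finset.sum_mul_sum]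
    -- Adjacent pairs are correlated by at most a factor `exp (8 / η)`. A node has at most `D * L`
    -- neighbours, and `hπ` makes their total contribution at most `π w`.
    have h2 : ∑ w, ∑ w', ad G w w' * (π w * (Real.exp (8 / η) * π w')) ≤ N := by
      rw [hNsum]
      refine Finset.sum_le_sum fun w _ => ?_
      have hDL : 0 < D * L := mul_pos ha.D_pos hL
      calc _ ≤ ∑ w', ad G w w' * (π w * (1 / (D * L))) := by
            refine Finset.sum_le_sum fun w' _ => mul_le_mul_of_nonneg_left
              (mul_le_mul_of_nonneg_left ?_ (hπ0 w).le) (ad_nonneg _ _ _)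
            rw [le_div_iff₀ hDL, mul_comm]
            exact hπ w'
        _ = π w * (dg G w / (D * L)) := by
            rw [← Finset.sum_mul, ← dg_eq_sum]
            ring
        _ ≤ π w * 1 := by
            refine mul_le_mul_of_nonneg_left ?_ (hπ0 w).le
            rw [div_le_one hDL]
            exact h.dg_le w
        _ = π w := mul_one _
    rw [h1, ← hNsum]
    linarith
  rw [hone] at hiter
  have h1 := mul_le_mul_of_nonneg_left hsum (by positivity : 0 ≤ 1 / N ^ 2)
  have h2 : 1 / N ^ 2 * (N ^ 2 + 2 * N) = 1 + 2 / N := by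
    field_simp
  have h3 : -(2 / N) * (N - ∑ w ∈ S, π w) = -2 + 2 / N * ∑ w ∈ S, π w := by
    field_simp
    ring
  rw [h3] at hiter
  rw [h2] at h1
  linarith

end Good

end Rumor

end

noncomputable section

namespace Rumor

variable {n : ℕ}

/-! ### The growth of the expected informed mass -/

/-- An upper bound for one step of the evolution of weights carried by the informed nodes. -/
def growOp (q : I) (G : SimpleGraph (Fin n)) (g : Fin n → ℝ) (u : Fin n) : ℝ :=
  g u + q / n * ∑ v, rate G u v * g v

theorem growOp_nonneg (q : I) (G : SimpleGraph (Fin n)) {g : Fin n → ℝ} (hg : ∀ u, 0 ≤ g u)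
    (u : Fin n) : 0 ≤ growOp q G g u := by
  have hq : (0 : ℝ) ≤ q := q.2.1
  exact add_nonneg (hg u) (mul_nonneg (by positivity)
    (Finset.sum_nonneg fun v _ => mul_nonneg (rate_nonneg _ _ _) (hg v)))

theorem iterate_growOp_nonneg (q : I) (G : SimpleGraph (Fin n)) {g : Fin n → ℝ}
    (hg : ∀ u, 0 ≤ g u) (k : ℕ) (u : Fin n) : 0 ≤ (growOp q G)^[k] g u := by
  induction k generalizing u with
  | zero => exact hg u
  | succ k ih =>
    rw [Function.iterate_succ_apply']
    exact growOp_nonneg q G ih u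

/-- A first moment bound: an informed node passes weight to all its neighbours, whether or not they
already know the rumor. The resulting upper bound is linear, so it acts on node weights instead of
sets. -/
theorem iterate_chainOp_sum_le (q : I) (G : SimpleGraph (Fin n)) (hn : 0 < n) {g : Fin n → ℝ}
    (hg : ∀ u, 0 ≤ g u) (k : ℕ) (S : Finset (Fin n)) :
    (chainOp (contactWeight q G))^[k] (fun S => ∑ w ∈ S, g w) S ≤
      ∑ w ∈ S, (growOp q G)^[k] g w := by
  have hq : (0 : ℝ) ≤ q := q.2.1
  induction k generalizing g S with
  | zero => exact le_rfl
  | succ k ih =>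
    rw [Function.iterate_succ_apply]
    have h1 : ∀ T : Finset (Fin n), chainOp (contactWeight q G) (fun S => ∑ w ∈ S, g w) T ≤
        ∑ w ∈ T, growOp q G g w := by
      intro T
      unfold chainOp markovOp
      rw [sum_contactWeight_stepSet q G (fun S => ∑ w ∈ S, g w)]
      simp only [growOp, Finset.sum_add_distrib]
      refine add_le_add le_rfl ?_
      rw [← Finset.mul_sum]
      refine mul_le_mul_of_nonneg_left (Finset.sum_le_sum fun u _ => ?_) (by positivity)
      refine le_trans (le_of_eq ?_) (Finset.sum_le_sum_of_subset_of_nonneg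
        (Finset.subset_univ Tᶜ) fun v _ _ => mul_nonneg (rate_nonneg _ _ _) (hg v))
      refine Finset.sum_congr rfl fun v hv => ?_
      rw [Finset.sum_insert (Finset.mem_compl.1 hv)]
      ring
    refine (iterate_markovOp_mono (contactWeight_nonneg q G) (sum_contactWeight_le_one q G hn)
      h1 k S).trans ?_
    exact ih (growOp_nonneg q G hg) S

section Good

variable {c η D δ κ κ' L : ℝ} {G : SimpleGraph (Fin n)} {q : I}

/-- For a node of typical degree, `1` comes from its own rings and about `1` from the rings of its
neighbours, most of which have about the same degree. The few bad neighbours still have degree at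
least `η * L`. -/
theorem GoodGraph.sum_rate_le (ha : Admissible n c η D δ κ κ' L) (h : GoodGraph c η D δ κ L G)
    {u : Fin n} (hu : u ∉ badNodes (c * L) (δ * (c * L)) G) :
    ∑ v, rate G u v ≤ 2 + (4 + c / η) * δ := by
  set B := badNodes (c * L) (δ * (c * L)) G with hB
  have hη := ha.η_pos
  have hL := ha.L_pos
  have hc := ha.one_le_c
  have hδ := ha.δ_pos
  have hδ1 := ha.δ_le
  have hcL : 0 < c * L := by positivity
  have hdg : ∀ v, v ∉ B → (1 - δ) * (c * L) ≤ dg G v ∧ dg G v ≤ (1 + δ) * (c * L) := by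
    intro v hv
    rw [hB, mem_badNodes, not_lt, abs_le] at hv
    constructor <;> linarith [hv.1, hv.2]
  have hx : 0 < (1 - δ) * (c * L) := mul_pos (by linarith) hcL
  have h1 : ∀ v, rate G u v ≤ ad G u v * (1 / dg G u) + ad G u v * (1 / ((1 - δ) * (c * L))) +
      if v ∈ B then ad G u v * (1 / (η * L)) else 0 := by
    intro v
    have had := ad_nonneg G u v
    rw [rate, mul_add]
    by_cases hv : v ∈ B
    · rw [if_pos hv]
      have h2 := mul_le_mul_of_nonneg_left
        (one_div_le_one_div_of_le (mul_pos hη hL) (h.le_dg ha v)) had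
      have h3 : 0 ≤ ad G u v * (1 / ((1 - δ) * (c * L))) := by positivity
      linarith
    · rw [if_neg hv, add_zero]
      have h2 := mul_le_mul_of_nonneg_left (one_div_le_one_div_of_le hx (hdg v hv).1) had
      linarith
  refine (Finset.sum_le_sum fun v _ => h1 v).trans ?_
  rw [Finset.sum_add_distrib, Finset.sum_add_distrib, ← Finset.sum_mul, ← Finset.sum_mul,
    ← dg_eq_sum, mul_one_div_cancel (h.dg_pos ha u).ne', Finset.sum_ite_mem, Finset.univ_inter,
    ← Finset.sum_mul, ← cut_singleton_left]
  have h2 : dg G u * (1 / ((1 - δ) * (c * L))) ≤ 1 + 4 * δ := by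
    rw [mul_one_div, div_le_iff₀ hx]
    refine (hdg u hu).2.trans ?_
    rw [← mul_assoc (1 + 4 * δ)]
    refine mul_le_mul_of_nonneg_right ?_ hcL.le
    nlinarith
  have h3 : cut G {u} B * (1 / (η * L)) ≤ c / η * δ := by
    rw [mul_one_div, div_le_iff₀ (mul_pos hη hL)]
    refine (h.cut_bad u).trans (le_of_eq ?_)
    field_simp
  linarith

theorem GoodGraph.sum_rate_bad_le (ha : Admissible n c η D δ κ κ' L)
    (h : GoodGraph c η D δ κ L G) (u : Fin n) :
    ∑ v ∈ badNodes (c * L) (δ * (c * L)) G, rate G u v ≤ 2 * c / η * δ := by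
  have hη := ha.η_pos
  have hL := ha.L_pos
  calc _ ≤ ∑ v ∈ badNodes (c * L) (δ * (c * L)) G, 2 / (η * L) * ad G u v :=
        Finset.sum_le_sum fun v _ => h.rate_le ha u v
    _ = 2 / (η * L) * cut G {u} (badNodes (c * L) (δ * (c * L)) G) := by
        rw [cut_singleton_left, Finset.mul_sum]
    _ ≤ 2 / (η * L) * (δ * (c * L)) :=
        mul_le_mul_of_nonneg_left (h.cut_bad u) (by positivity)
    _ = _ := by field_simp

/-- The constant that describes the influence of nodes of untypical degree. -/
def excess (c η D : ℝ) : ℝ := 4 + c / η + 2 * c / η * (1 + D / η)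

theorem GoodGraph.sum_iterate_growOp_le (ha : Admissible n c η D δ κ κ' L)
    (h : GoodGraph c η D δ κ L G) {g : Fin n → ℝ} (hg : ∀ u, 0 ≤ g u) (k : ℕ) :
    ∑ u, (growOp q G)^[k] g u ≤
      (2 + D / η) * Real.exp (q / n * (2 + excess c η D * δ) * k) * ∑ u, g u := by
  classical
  have hq : (0 : ℝ) ≤ q := q.2.1
  have hqn : 0 ≤ (q : ℝ) / n := by positivity
  have hη := ha.η_pos
  have hD := ha.D_pos
  have hc := ha.one_le_c
  have hδ := ha.δ_pos
  set B := badNodes (c * L) (δ * (c * L)) G with hB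
  set R : ℝ := 1 + D / η with hR
  have hR0 : 0 < R := by positivity
  -- A bad node may have total rate up to `R`, which would spoil the growth rate. Giving bad nodes
  -- the larger weight `1 + R` repairs this: `φ` is multiplied by at most `a`, close to `2`, since
  -- every node has few bad neighbours. The price is only the factor `1 + R` at the end.
  set φ : Fin n → ℝ := fun u => 1 + R * if u ∈ B then 1 else 0 with hφ
  have hφ1 : ∀ u, 1 ≤ φ u := fun u => by
    simp only [hφ]
    split_ifs <;> linarith
  have hφR : ∀ u, φ u ≤ 1 + R := fun u => by
    simp only [hφ]
    split_ifs <;> linarith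
  set a : ℝ := 2 + excess c η D * δ with ha'
  have hex : 0 ≤ excess c η D := by
    unfold excess
    positivity
  have ha0 : 0 ≤ a := by positivity
  have hsuper : ∀ u, ∑ v, rate G u v * φ v ≤ a * φ u := by
    intro u
    have h1 : ∑ v, rate G u v * φ v = ∑ v, rate G u v + R * ∑ v ∈ B, rate G u v := by
      simp only [hφ, mul_add, mul_one, Finset.sum_add_distrib, mul_ite, mul_zero,
        Finset.sum_ite_mem, Finset.univ_inter]
      rw [Finset.mul_sum]
      congr 1
      exact Finset.sum_congr rfl fun v _ => mul_comm _ _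
    have h2 := mul_le_mul_of_nonneg_left (h.sum_rate_bad_le ha u) hR0.le
    rw [← hB] at h2
    rw [h1]
    have hca : 2 * c / η * δ * R ≤ a - 2 - (4 + c / η) * δ := by
      rw [ha', excess]
      apply le_of_eq
      ring
    by_cases hu : u ∈ B
    · have h3 : ∑ v, rate G u v ≤ R := by
        have h4 := h.touchRate_le (q := 1) ha u
        unfold touchRate at h4
        rw [Finset.sum_congr rfl fun v _ => rate_comm G u v]
        refine le_of_mul_le_mul_left h4 ?_
        have := ha.n_pos
        simp only [Set.Icc.coe_one]
        positivity
      have h5 : φ u = 1 + R := by simp [hφ, hu]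
      rw [h5]
      have h6 : 0 ≤ (4 + c / η) * δ := by positivity
      have h7 : 2 ≤ a := by
        rw [ha']
        exact le_add_of_nonneg_right (by positivity)
      have h8 := mul_le_mul_of_nonneg_right h7 hR0.le
      linarith
    · have h3 := h.sum_rate_le ha hu
      have h5 : φ u = 1 := by simp [hφ, hu]
      rw [h5]
      linarith
  have hstep : ∀ g : Fin n → ℝ, (∀ u, 0 ≤ g u) →
      ∑ u, φ u * growOp q G g u ≤ (1 + q / n * a) * ∑ u, φ u * g u := by
    intro g hg
    have h1 : ∑ u, φ u * growOp q G g u = ∑ u, φ u * g u +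
        q / n * ∑ v, (∑ u, rate G v u * φ u) * g v := by
      simp only [growOp, mul_add, Finset.sum_add_distrib]
      congr 1
      rw [Finset.mul_sum]
      simp only [Finset.mul_sum, Finset.sum_mul]
      rw [Finset.sum_comm]
      refine Finset.sum_congr rfl fun v _ => Finset.sum_congr rfl fun u _ => ?_
      rw [rate_comm G u v]
      ring
    rw [h1, add_mul, one_mul, mul_assoc]
    refine add_le_add le_rfl (mul_le_mul_of_nonneg_left ?_ hqn)
    rw [Finset.mul_sum]
    refine Finset.sum_le_sum fun v _ => ?_
    rw [← mul_assoc]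
    exact mul_le_mul_of_nonneg_right (hsuper v) (hg v)
  have hiter : ∑ u, φ u * (growOp q G)^[k] g u ≤ (1 + q / n * a) ^ k * ∑ u, φ u * g u := by
    induction k with
    | zero => simp
    | succ k ih =>
      rw [Finset.sum_congr rfl fun u _ => by rw [Function.iterate_succ_apply'], pow_succ', mul_assoc]
      refine (hstep _ (iterate_growOp_nonneg q G hg k)).trans ?_
      exact mul_le_mul_of_nonneg_left ih (by positivity)
  calc ∑ u, (growOp q G)^[k] g u ≤ ∑ u, φ u * (growOp q G)^[k] g u :=
        Finset.sum_le_sum fun u _ =>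
          le_mul_of_one_le_left (iterate_growOp_nonneg q G hg k u) (hφ1 u)
    _ ≤ (1 + q / n * a) ^ k * ∑ u, φ u * g u := hiter
    _ ≤ Real.exp (q / n * a * k) * ((1 + R) * ∑ u, g u) := by
        refine mul_le_mul (one_add_pow_le (by positivity) k) ?_
          (Finset.sum_nonneg fun u _ => mul_nonneg (zero_le_one.trans (hφ1 u)) (hg u))
          (Real.exp_pos _).le
        rw [Finset.mul_sum]
        exact Finset.sum_le_sum fun u _ => mul_le_mul_of_nonneg_right (hφR u) (hg u)
    _ = _ := by
        rw [hR]
        ring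

end Good

/-! ### Relabelling of the nodes -/

section Relabel

variable (τ : Equiv.Perm (Fin n)) (G : SimpleGraph (Fin n)) (q : I)

theorem ad_map (u v : Fin n) : ad (G.map τ) (τ u) (τ v) = ad G u v := by
  have h : (G.map τ).Adj (τ u) (τ v) ↔ G.Adj u v := by
    have := SimpleGraph.map_adj_apply (G := G) (f := τ.toEmbedding) (a := u) (b := v)
    exact this
  unfold ad
  exact @if_congr _ _ _ (_) (_) _ _ _ _ h rfl rfl

theorem dg_map (u : Fin n) : dg (G.map τ) (τ u) = dg G u := by
  rw [dg_eq_sum, dg_eq_sum, ← Equiv.sum_comp τ]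
  simp only [ad_map]

theorem rate_map (u v : Fin n) : rate (G.map τ) (τ u) (τ v) = rate G u v := by
  simp only [rate, ad_map, dg_map]

theorem touchRate_map (w : Fin n) : touchRate q (G.map τ) (τ w) = touchRate q G w := by
  unfold touchRate
  rw [← Equiv.sum_comp τ]
  simp only [rate_map]

theorem missCount_map (m : ℕ) : missCount q (G.map τ) m = missCount q G m := by
  unfold missCount
  rw [← Equiv.sum_comp τ]
  simp only [touchRate_map]

theorem touchTime_map : touchTime q (G.map τ) = touchTime q G := by
  simp only [touchTime, missCount_map]

theorem growOp_map {g g' : Fin n → ℝ} (hg : ∀ u, g' (τ u) = g u) (u : Fin n) :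
    growOp q (G.map τ) g' (τ u) = growOp q G g u := by
  unfold growOp
  rw [hg, ← Equiv.sum_comp τ]
  simp only [rate_map, hg]

theorem iterate_growOp_map {g g' : Fin n → ℝ} (hg : ∀ u, g' (τ u) = g u) (k : ℕ) (u : Fin n) :
    (growOp q (G.map τ))^[k] g' (τ u) = (growOp q G)^[k] g u := by
  induction k generalizing u with
  | zero => exact hg u
  | succ k ih =>
    rw [Function.iterate_succ_apply', Function.iterate_succ_apply']
    exact growOp_map τ G q ih u

/-- The relative mass, with respect to the nodes that are not contacted in the last `m` steps, that
a node collects in `k` steps; here `m` is shorter by `b + 1` than the `touchTime`. -/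
def relMass (k b : ℕ) (u : Fin n) : ℝ :=
  (growOp q G)^[k] (fun w => (1 - touchRate q G w) ^ (touchTime q G - 1 - b)) u /
    missCount q G (touchTime q G - 1 - b)

theorem relMass_map (k b : ℕ) (u : Fin n) : relMass (G.map τ) q k b (τ u) = relMass G q k b u := by
  unfold relMass
  rw [touchTime_map, missCount_map]
  congr 1
  exact iterate_growOp_map τ G q (fun w => by rw [touchRate_map]) k u

end Relabel

/-- A node that is chosen before the graph is sampled is typical. -/
theorem binomialRandom_typical_node (p : I) {F : SimpleGraph (Fin n) → Fin n → ℝ}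
    (hF : ∀ (τ : Equiv.Perm (Fin n)) G u, F (G.map τ) (τ u) = F G u) {x y : ℝ} (hx : 0 < x)
    (hy : 0 ≤ y) (s : Fin n) :
    (SimpleGraph.binomialRandom (Fin n) p).real
      {G | (∀ u, 0 ≤ F G u) ∧ ∑ u, F G u ≤ n * y ∧ x ≤ F G s} ≤ y / x := by
  classical
  have hn : (0 : ℝ) < n := by exact_mod_cast s.pos
  -- Truncation to an event that is invariant under relabelling. All nodes then have the same
  -- expectation, which is at most the average `y`, and Markov's inequality applies to `s`.
  set H : Fin n → SimpleGraph (Fin n) → ℝ := fun u G =>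
    if (∀ u, 0 ≤ F G u) ∧ ∑ u, F G u ≤ n * y then F G u else 0 with hH
  have hH0 : ∀ u G, 0 ≤ H u G := fun u G => by
    simp only [hH]
    split_ifs with h
    · exact h.1 u
    · exact le_rfl
  have hmap : ∀ (τ : Equiv.Perm (Fin n)) u G, H (τ u) (G.map τ) = H u G := by
    intro τ u G
    have h1 : (∀ u, 0 ≤ F (G.map τ) u) ↔ ∀ u, 0 ≤ F G u := by
      rw [← τ.forall_congr_right]
      simp only [hF]
    have h2 : ∑ u, F (G.map τ) u = ∑ u, F G u := by
      rw [← Equiv.sum_comp τ]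
      simp only [hF]
    simp only [hH, h1, h2, hF]
  have heq : ∀ u, graphExp p (H u) = graphExp p (H s) := by
    intro u
    rw [← graphExp_map p (Equiv.swap s u) (H u)]
    congr 1
    funext G
    have := hmap (Equiv.swap s u) s G
    rwa [Equiv.swap_apply_left] at this
  have hsum : n * graphExp p (H s) ≤ n * y := by
    calc n * graphExp p (H s) = ∑ u, graphExp p (H u) := by
          rw [Finset.sum_congr rfl fun u _ => heq u, Finset.sum_const, Finset.card_univ,
            Fintype.card_fin, nsmul_eq_mul]
      _ = graphExp p fun G => ∑ u, H u G := (graphExp_sum p _ _).symm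
      _ ≤ graphExp p fun _ : SimpleGraph (Fin n) => n * y := by
          refine graphExp_mono p fun G => ?_
          simp only [hH]
          split_ifs with h
          · exact h.2
          · simpa using mul_nonneg hn.le hy
      _ = n * y := graphExp_const p _
  have hs : graphExp p (H s) ≤ y := le_of_mul_le_mul_left hsum hn
  refine (binomialRandom_real_le p (F := fun G => 1 / x * H s G)
    (fun G => mul_nonneg (by positivity) (hH0 s G)) fun G hG => ?_).trans ?_
  · simp only [hH, if_pos (And.intro hG.1 hG.2.1)]
    rw [one_div_mul_eq_div, one_le_div hx]
    exact hG.2.2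
  · rw [graphExp_const_mul, one_div_mul_eq_div]
    gcongr

end Rumor

end

noncomputable section

namespace Rumor

variable {n : ℕ}

/-! ### The lower tail -/

section Good

variable {c η D δ κ κ' L : ℝ} {G : SimpleGraph (Fin n)} {q : I}

theorem GoodGraph.one_sub_touchRate_pos (ha : Admissible n c η D δ κ κ' L)
    (h : GoodGraph c η D δ κ L G) (hR : 2 * (1 + D / η) ≤ n) (w : Fin n) :
    0 < 1 - touchRate q G w := by
  linarith [h.touchRate_le_half (q := q) ha hR w]

theorem GoodGraph.missCount_pos (ha : Admissible n c η D δ κ κ' L)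
    (h : GoodGraph c η D δ κ L G) (hR : 2 * (1 + D / η) ≤ n) (m : ℕ) : 0 < missCount q G m := by
  have hn0 : 0 < n := by have := ha.eight_le; omega
  exact Finset.sum_pos (fun w _ => pow_pos (h.one_sub_touchRate_pos ha hR w) m)
    ⟨⟨0, hn0⟩, Finset.mem_univ _⟩

/-- By minimality of `touchTime`, one step earlier still more than one node is missed on average.
Each of the `b` steps before that had reduced the count by a factor of at most `exp (-q / n)`,
because every touch rate is at least `q / n`. -/
theorem GoodGraph.exp_le_missCount (ha : Admissible n c η D δ κ κ' L)
    (h : GoodGraph c η D δ κ L G) (hR : 2 * (1 + D / η) ≤ n) {b : ℕ}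
    (hb : b + 1 ≤ touchTime q G) :
    Real.exp (q / n * b) ≤ missCount q G (touchTime q G - 1 - b) := by
  have h1 : 1 < missCount q G (touchTime q G - 1) := by
    have := Nat.notMem_of_lt_sInf (s := {m | missCount q G m ≤ 1}) (m := touchTime q G - 1)
      (show touchTime q G - 1 < touchTime q G by omega)
    exact not_le.1 this
  have h2 : missCount q G (touchTime q G - 1) ≤
      missCount q G (touchTime q G - 1 - b) * Real.exp (-(q / n * b)) := by
    unfold missCount
    rw [Finset.sum_mul]
    refine Finset.sum_le_sum fun w _ => ?_
    have h3 := h.one_sub_touchRate_pos (q := q) ha hR w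
    have h4 := h.le_touchRate (q := q) ha w
    have h5 : touchTime q G - 1 = touchTime q G - 1 - b + b := by omega
    calc _ = (1 - touchRate q G w) ^ (touchTime q G - 1 - b) * (1 - touchRate q G w) ^ b := by
          rw [← pow_add, ← h5]
      _ ≤ _ := by
          refine mul_le_mul_of_nonneg_left ?_ (pow_pos h3 _).le
          exact (pow_le_pow_left₀ h3.le (by linarith) b).trans (one_sub_pow_le (by linarith) b)
  have h3 := h1.le.trans h2
  rw [Real.exp_neg, ← div_eq_mul_inv, one_le_div (Real.exp_pos _)] at h3
  exact h3

theorem GoodGraph.relMass_nonneg (ha : Admissible n c η D δ κ κ' L)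
    (h : GoodGraph c η D δ κ L G) (hR : 2 * (1 + D / η) ≤ n) (k b : ℕ) (u : Fin n) :
    0 ≤ relMass G q k b u :=
  div_nonneg (iterate_growOp_nonneg q G
    (fun w => (pow_pos (h.one_sub_touchRate_pos ha hR w) _).le) k u) (h.missCount_pos ha hR _).le

theorem GoodGraph.sum_relMass_le (ha : Admissible n c η D δ κ κ' L)
    (h : GoodGraph c η D δ κ L G) (hR : 2 * (1 + D / η) ≤ n) (k b : ℕ) :
    ∑ u, relMass G q k b u ≤ (2 + D / η) * Real.exp (q / n * (2 + excess c η D * δ) * k) := by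
  unfold relMass
  rw [← Finset.sum_div, div_le_iff₀ (h.missCount_pos ha hR _)]
  exact h.sum_iterate_growOp_le ha
    (fun w => (pow_pos (h.one_sub_touchRate_pos ha hR w) _).le) k

/-- The lower tail of the number of steps. -/
theorem GoodGraph.le_iterate_uninformed_singleton (ha : Admissible n c η D δ κ κ' L)
    (h : GoodGraph c η D δ κ L G) (hq : 0 < q) (hR : 2 * (1 + D / η) ≤ n) {b : ℕ}
    (hb : b + 1 ≤ touchTime q G)
    (hπ : D * L * Real.exp (8 / η) ≤ Real.exp (q / n * (touchTime q G - 1 - b : ℕ)))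
    (k : ℕ) (s : Fin n) :
    1 - 2 * Real.exp (-(q / n * b)) - 2 * relMass G q k b s ≤
      (chainOp (contactWeight q G))^[k + (touchTime q G - 1 - b)] uninformed {s} := by
  have hb0 := contactWeight_nonneg q G
  have hn0 : 0 < n := by have := ha.eight_le; omega
  have hn := ha.n_pos
  have hb1 := sum_contactWeight_le_one q G hn0
  set m := touchTime q G - 1 - b with hm
  set N := missCount q G m with hN
  have hN0 : 0 < N := h.missCount_pos ha hR m
  have hNb : Real.exp (q / n * b) ≤ N := h.exp_le_missCount ha hR hb
  have hpos := fun w => h.one_sub_touchRate_pos (q := q) ha hR w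
  have h1 : ∀ S, 1 - 2 / N - 2 / N * ∑ w ∈ S, (1 - touchRate q G w) ^ m ≤
      (chainOp (contactWeight q G))^[m] uninformed S := by
    refine h.le_iterate_uninformed ha hq hR ?_ fun w => ?_
    · have h2 := (h.missCount_touchTime_le ha hq hR).2
      have h3 : (m : ℝ) + 1 ≤ touchTime q G := by
        exact_mod_cast (by omega : m + 1 ≤ touchTime q G)
      linarith
    · have h2 : (1 - touchRate q G w) ^ m ≤ Real.exp (-(q / n * m)) := by
        have h4 := h.le_touchRate (q := q) ha w
        exact (pow_le_pow_left₀ (hpos w).le (by linarith) m).trans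
          (one_sub_pow_le (by linarith [hpos w]) m)
      have hDL : 0 ≤ D * L := (mul_pos ha.D_pos ha.L_pos).le
      calc _ ≤ D * L * (Real.exp (8 / η) * Real.exp (-(q / n * m))) := by gcongr
        _ = D * L * Real.exp (8 / η) * Real.exp (-(q / n * m)) := by ring
        _ ≤ Real.exp (q / n * m) * Real.exp (-(q / n * m)) := by gcongr
        _ = 1 := by rw [← Real.exp_add, add_neg_cancel, Real.exp_zero]
  -- The bound for the last `m` steps holds for every set; it is averaged over the set reached in
  -- the first `k` steps, where only the mass of this set with respect to the untouched nodes
  -- matters.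
  rw [Function.iterate_add_apply]
  refine le_trans ?_ (iterate_markovOp_mono hb0 hb1 h1 k {s})
  have h2 : (fun S : Finset (Fin n) => 1 - 2 / N - 2 / N * ∑ w ∈ S, (1 - touchRate q G w) ^ m) =
      fun S => (1 - 2 / N) + (-(2 / N)) * ∑ w ∈ S, (1 - touchRate q G w) ^ m := by
    funext S
    ring
  rw [h2, iterate_markovOp_add, iterate_markovOp_const, iterate_markovOp_const_mul]
  beta_reduce
  have h3 := iterate_chainOp_sum_le q G hn0 (fun w => (pow_pos (hpos w) m).le) k {s}
  rw [Finset.sum_singleton] at h3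
  have h4 := mul_le_mul_of_nonneg_left h3 (by positivity : 0 ≤ 2 / N)
  have h5 : 2 / N ≤ 2 * Real.exp (-(q / n * b)) := by
    rw [Real.exp_neg, ← div_eq_mul_inv]
    gcongr
  have h6 : 2 / N * (growOp q G)^[k] (fun w => (1 - touchRate q G w) ^ m) s =
      2 * relMass G q k b s := by
    rw [relMass]
    ring
  rw [h6] at h4
  unfold chainOp at h4
  linarith

end Good

/-! ### Both tails with explicit parameters in powers of the fourth root of `log n`. -/

section Scaled

variable {c η D κ z C : ℝ} {G : SimpleGraph (Fin n)} {q : I}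

theorem exp_neg_cube_le (hz : 1 ≤ z) : Real.exp (-z ^ 3) ≤ 1 / z := by
  rw [Real.exp_neg, ← one_div]
  refine one_div_le_one_div_of_le (by linarith) ?_
  have h1 := Real.add_one_le_exp (z ^ 3)
  have h2 : z ^ 1 ≤ z ^ 3 := pow_le_pow_right₀ hz (by norm_num)
  linarith

/-- The upper tail with explicit parameters. -/
theorem GoodGraph.exists_upper (hz : 1 ≤ z)
    (ha : Admissible n c η D (1 / z) κ (Real.exp (-z ^ 3)) (z ^ 4))
    (h : GoodGraph c η D (1 / z) κ (z ^ 4) G) (hq : 0 < q) (hR : 2 * (1 + D / η) ≤ n)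
    (hMn : 2 * ⌈z⌉₊ ≤ n) {j j' : ℕ}
    (hj : (n : ℝ) / q * ((1 / 2 + 6 * (1 / z)) * (1 + z ^ 4) + 4 * D / η * (2 + 2 * z ^ 3)) ≤ j)
    (hj' : (n : ℝ) / q * (4 * D / η * (2 + Real.log (1 / κ) +
      Real.log (2 / Real.exp (-z ^ 3))) + 2) ≤ j')
    (hjj : (j + j' : ℝ) ≤ n / q * (z ^ 4 / 2 + C * z ^ 3))
    (hout : ∀ w, ∀ S : Finset (Fin n), S.card = ⌈z⌉₊ →
      leftOut q w (j + j') (Real.exp (-z ^ 3) * n) (1 / z * z ^ 4) S G ≤ Real.exp (-(2 * z ^ 4)))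
    (s : Fin n) :
    ∃ j₂ : ℕ, (j₂ : ℝ) ≤ touchTime q G +
        n / q * (z ^ 4 / 2 + (C + 3 * (D / η) + 16 / η + 4) * z ^ 3) ∧
      (chainOp (contactWeight q G))^[j₂] uninformed {s} ≤ 5 * Real.exp (-z ^ 3) := by
  have hn := ha.n_pos
  have hq0 : (0 : ℝ) < q := hq
  have hq1 : (q : ℝ) ≤ 1 := q.2.2
  have hη := ha.η_pos
  have hD := ha.D_pos
  have hz0 : 0 < z := by linarith
  have hn1 : (1 : ℝ) ≤ n := by
    have := ha.eight_le
    exact_mod_cast (by omega : 1 ≤ n)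
  have hnq : 1 ≤ (n : ℝ) / q := by
    rw [le_div_iff₀ hq0]
    linarith
  have hz3 : z ≤ z ^ 3 := by
    have := pow_le_pow_right₀ hz (by norm_num : 1 ≤ 3)
    rwa [pow_one] at this
  have hz31 : 1 ≤ z ^ 3 := hz.trans hz3
  have hz34 : z ^ 3 ≤ z ^ 4 := pow_le_pow_right₀ hz (by norm_num)
  set M := ⌈z⌉₊ with hM
  have hM1 : z ≤ M := Nat.le_ceil z
  have hM2 : (M : ℝ) ≤ z + 1 := (Nat.ceil_lt_add_one hz0.le).le
  have hM0 : 0 < M := Nat.ceil_pos.2 hz0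
  set j₀ := ⌈(n : ℝ) / q * (D / η * (M + z ^ 3))⌉₊ with hj₀
  -- Uninformed neighbours cost a factor `exp (8 / η * z ^ 3)` over the `touchTime`. Since at most
  -- half of the gain from `b` is lost in the same way, `b` is twice that exponent plus `2 * z ^ 3`.
  set b := ⌈(n : ℝ) / q * ((16 / η + 2) * z ^ 3)⌉₊ with hb
  have hj₀1 : (n : ℝ) / q * (D / η * (M + z ^ 3)) ≤ j₀ := Nat.le_ceil _
  have hj₀2 : (j₀ : ℝ) ≤ (n : ℝ) / q * (D / η * (M + z ^ 3)) + 1 :=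
    (Nat.ceil_lt_add_one (by positivity)).le
  have hb1 : (n : ℝ) / q * ((16 / η + 2) * z ^ 3) ≤ b := Nat.le_ceil _
  have hb2 : (b : ℝ) ≤ (n : ℝ) / q * ((16 / η + 2) * z ^ 3) + 1 :=
    (Nat.ceil_lt_add_one (by positivity)).le
  refine ⟨j₀ + (j + j' + (touchTime q G + b)), ?_, ?_⟩
  · push_cast
    have h1 : (n : ℝ) / q * (D / η * (M + z ^ 3)) ≤ n / q * (3 * (D / η) * z ^ 3) := by
      have h2 : (M : ℝ) + z ^ 3 ≤ 3 * z ^ 3 := by linarith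
      have h3 := mul_le_mul_of_nonneg_left h2 (by positivity : 0 ≤ D / η)
      refine mul_le_mul_of_nonneg_left ?_ (by positivity)
      linarith
    have h2 : (1 : ℝ) ≤ n / q * z ^ 3 := by
      calc (1 : ℝ) = 1 * 1 := (one_mul 1).symm
        _ ≤ _ := mul_le_mul hnq hz31 zero_le_one (by positivity)
    have h3 : (n : ℝ) / q * (z ^ 4 / 2 + (C + 3 * (D / η) + 16 / η + 4) * z ^ 3) =
        n / q * (z ^ 4 / 2 + C * z ^ 3) + n / q * (3 * (D / η) * z ^ 3) +
          n / q * ((16 / η + 2) * z ^ 3) + 2 * (n / q * z ^ 3) := by ring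
    rw [h3]
    linarith
  · have h1 := h.iterate_uninformed_singleton_le ha hq hR hM0 hMn hj₀1 hj hj' hout
      (Real.exp_pos _).le b s
    refine h1.trans ?_
    have hexpn : Real.exp (z ^ 4) = n := by rw [ha.L_eq, Real.exp_log hn]
    -- `Y` was chosen to cancel `η / (4 * D)`: the exponent becomes `-2 * M * z ^ 3` with `M ≥ z`,
    -- hence a probability `n ^ (-2)` that survives the union bound over the nodes.
    have h2 : Real.exp (2 * M - η / (4 * D) * M * (4 * D / η * (2 + 2 * z ^ 3))) ≤
        Real.exp (-(2 * z ^ 4)) := by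
      rw [Real.exp_le_exp]
      have h3 : η / (4 * D) * M * (4 * D / η * (2 + 2 * z ^ 3)) = M * (2 + 2 * z ^ 3) := by
        field_simp
      rw [h3]
      have h4 := mul_le_mul_of_nonneg_right hM1 (by positivity : 0 ≤ 2 * z ^ 3)
      have h5 : z * (2 * z ^ 3) = 2 * z ^ 4 := by ring
      linarith
    have h3 : (n : ℝ) * (Real.exp (-(2 * z ^ 4)) + (Real.exp (2 * M - η / (4 * D) * M *
        (4 * D / η * (2 + 2 * z ^ 3))) + Real.exp (-(z ^ 4 * 2)))) ≤ 3 * Real.exp (-z ^ 3) := by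
      calc _ ≤ (n : ℝ) * (3 * Real.exp (-(2 * z ^ 4))) := by
            refine mul_le_mul_of_nonneg_left ?_ hn.le
            rw [mul_comm (z ^ 4) 2]
            linarith
        _ = 3 * Real.exp (-z ^ 4) := by
            rw [← hexpn, mul_left_comm, ← Real.exp_add]
            congr 2
            ring
        _ ≤ _ := by
            gcongr
    have h4 : Real.exp ((q : ℝ) / n * (4 * (1 / z) / η * (touchTime q G + b) - b)) ≤
        Real.exp (-z ^ 3) := by
      rw [Real.exp_le_exp]
      have h5 := (h.missCount_touchTime_le ha hq hR).2
      set x : ℝ := 4 * (1 / z) / η with hx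
      have hx0 : 0 ≤ x := by positivity
      have hx1 : x ≤ 1 / 2 := by
        have h6 := ha.cδ_le
        have h7 := ha.one_le_c
        rw [hx, div_le_iff₀ hη]
        have h8 : 8 * (1 / z) ≤ 8 * c * (1 / z) := by
          have : 0 < 1 / z := by positivity
          nlinarith
        linarith
      have hqn0 : 0 < (q : ℝ) / n := by positivity
      have h6 : (q : ℝ) / n * (x * touchTime q G) ≤ 8 / η * z ^ 3 := by
        calc _ ≤ (q : ℝ) / n * (x * (n / q * (2 * z ^ 4))) := by
              refine mul_le_mul_of_nonneg_left (mul_le_mul_of_nonneg_left ?_ hx0) hqn0.le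
              have h7 : (1 : ℝ) ≤ n / q * z ^ 4 := by
                calc (1 : ℝ) = 1 * 1 := (one_mul 1).symm
                  _ ≤ _ := mul_le_mul hnq (hz31.trans hz34) zero_le_one (by positivity)
              linarith
          _ = 8 / η * z ^ 3 := by
              rw [hx]
              field_simp
              ring
      have h7 : (16 / η + 2) * z ^ 3 ≤ (q : ℝ) / n * b := by
        have h8 := mul_le_mul_of_nonneg_left hb1 hqn0.le
        have h9 : (q : ℝ) / n * (n / q * ((16 / η + 2) * z ^ 3)) = (16 / η + 2) * z ^ 3 := by
          field_simp
        linarith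
      have h8 : x * ((q : ℝ) / n * b) ≤ 1 / 2 * ((q : ℝ) / n * b) :=
        mul_le_mul_of_nonneg_right hx1 (by positivity)
      have h9 : (q : ℝ) / n * (x * (touchTime q G + b) - b) =
          (q : ℝ) / n * (x * touchTime q G) + x * ((q : ℝ) / n * b) - (q : ℝ) / n * b := by ring
      rw [h9]
      have h10 : (16 / η + 2) * z ^ 3 = 2 * (8 / η * z ^ 3) + 2 * z ^ 3 := by ring
      linarith
    linarith

/-- The lower tail with explicit parameters. -/
theorem GoodGraph.exists_lower (hz : 1 ≤ z)
    (ha : Admissible n c η D (1 / z) κ (Real.exp (-z ^ 3)) (z ^ 4))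
    (h : GoodGraph c η D (1 / z) κ (z ^ 4) G) (hq : 0 < q) (hR : 2 * (1 + D / η) ≤ n) {b k : ℕ}
    (hb : (n : ℝ) / q * z ^ 3 ≤ b) (hb' : (b : ℝ) ≤ n / q * z ^ 3 + 1)
    (hk : (n : ℝ) / q * ((z ^ 4 - z ^ 3) / (2 + excess c η D * (1 / z))) ≤ k + 1)
    (hk' : (k : ℝ) ≤ (n : ℝ) / q * ((z ^ 4 - z ^ 3) / (2 + excess c η D * (1 / z))))
    (hlarge : z ^ 3 + 2 + Real.log (D * z ^ 4 * Real.exp (8 / η)) ≤ z ^ 4 / (2 * (1 + D / η)))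
    (hDL : 1 ≤ D * z ^ 4 * Real.exp (8 / η))
    (s : Fin n) (hs : relMass G q k b s ≤ 1 / z) :
    ∃ j₁ : ℕ, touchTime q G + (n : ℝ) / q * (z ^ 4 / 2 - (excess c η D / 4 + 5) * z ^ 3) ≤ j₁ ∧
      (j₁ : ℝ) ≤ n / q * (2 * z ^ 4) ∧
      1 - (chainOp (contactWeight q G))^[j₁] uninformed {s} ≤ 4 / z := by
  have hn := ha.n_pos
  have hq0 : (0 : ℝ) < q := hq
  have hq1 : (q : ℝ) ≤ 1 := q.2.2
  have hη := ha.η_pos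
  have hD := ha.D_pos
  have hc := ha.one_le_c
  have hz0 : 0 < z := by linarith
  have hn1 : (1 : ℝ) ≤ n := by
    have := ha.eight_le
    exact_mod_cast (by omega : 1 ≤ n)
  have hnq : 1 ≤ (n : ℝ) / q := by
    rw [le_div_iff₀ hq0]
    linarith
  have hnq0 : 0 < (n : ℝ) / q := by linarith
  have hz31 : 1 ≤ z ^ 3 := one_le_pow₀ hz
  have hz34 : z ^ 3 ≤ z ^ 4 := pow_le_pow_right₀ hz (by norm_num)
  have h1 : (1 : ℝ) ≤ n / q * z ^ 3 := by
    calc (1 : ℝ) = 1 * 1 := (one_mul 1).symm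
      _ ≤ _ := mul_le_mul hnq hz31 zero_le_one (by positivity)
  have hT := h.le_touchTime ha hq hR
  have hT' := (h.missCount_touchTime_le ha hq hR).2
  have hlog0 := Real.log_nonneg hDL
  have hTlarge : (n : ℝ) / q * (z ^ 3 + 2 + Real.log (D * z ^ 4 * Real.exp (8 / η))) ≤
      touchTime q G := (mul_le_mul_of_nonneg_left hlarge hnq0.le).trans hT
  have hlog1 : 0 ≤ (n : ℝ) / q * Real.log (D * z ^ 4 * Real.exp (8 / η)) :=
    mul_nonneg hnq0.le hlog0
  have hbT : b + 1 ≤ touchTime q G := by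
    have : (b : ℝ) + 1 ≤ touchTime q G := by linarith
    exact_mod_cast this
  set m := touchTime q G - 1 - b with hm
  have hmcast : (m : ℝ) = touchTime q G - 1 - b := by
    rw [hm, Nat.cast_sub (by omega), Nat.cast_sub (by omega), Nat.cast_one]
  have hex : 0 ≤ excess c η D := by
    unfold excess
    positivity
  set E := excess c η D with hE
  refine ⟨k + m, ?_, ?_, ?_⟩
  · push_cast
    rw [hmcast]
    -- First-order expansion of the quotient in `1 / z`; the correction `E / z` of the growth rate
    -- costs time of order `z ^ 3`.
    have h2 : z ^ 4 / 2 - (E / 4 + 1) * z ^ 3 ≤ (z ^ 4 - z ^ 3) / (2 + E * (1 / z)) := by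
      rw [le_div_iff₀ (by positivity)]
      have h3 : (z ^ 4 / 2 - (E / 4 + 1) * z ^ 3) * (2 + E * (1 / z)) =
          z ^ 4 - 2 * z ^ 3 - E * z ^ 2 - E ^ 2 / 4 * z ^ 2 := by
        field_simp
        ring
      rw [h3]
      have h4 : 0 ≤ E * z ^ 2 := by positivity
      have h5 : 0 ≤ E ^ 2 / 4 * z ^ 2 := by positivity
      linarith
    have h3 := mul_le_mul_of_nonneg_left h2 hnq0.le
    have h4 : (n : ℝ) / q * (z ^ 4 / 2 - (E / 4 + 5) * z ^ 3) =
        n / q * (z ^ 4 / 2 - (E / 4 + 1) * z ^ 3) - 4 * (n / q * z ^ 3) := by ring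
    rw [h4]
    linarith
  · push_cast
    rw [hmcast]
    have h2 : (z ^ 4 - z ^ 3) / (2 + E * (1 / z)) ≤ z ^ 4 := by
      rw [div_le_iff₀ (by positivity)]
      have : 0 ≤ z ^ 4 * (E * (1 / z)) := by positivity
      linarith
    have h3 := mul_le_mul_of_nonneg_left h2 hnq0.le
    have h4 : (0 : ℝ) ≤ b := Nat.cast_nonneg b
    linarith
  · have h2 := h.le_iterate_uninformed_singleton ha hq hR hbT (by
      rw [← hm, ← Real.log_le_iff_le_exp (by linarith), hmcast]
      have h3 : (n : ℝ) / q * Real.log (D * z ^ 4 * Real.exp (8 / η)) ≤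
          touchTime q G - 1 - b := by linarith
      have h4 := mul_le_mul_of_nonneg_left h3 (by positivity : 0 ≤ (q : ℝ) / n)
      have h5 : (q : ℝ) / n * (n / q * Real.log (D * z ^ 4 * Real.exp (8 / η))) =
          Real.log (D * z ^ 4 * Real.exp (8 / η)) := by
        field_simp
      linarith) k s
    rw [← hm] at h2
    have h3 : Real.exp (-(q / n * b)) ≤ 1 / z := by
      refine le_trans (Real.exp_le_exp.2 ?_) (exp_neg_cube_le hz)
      have h4 := mul_le_mul_of_nonneg_left hb (by positivity : 0 ≤ (q : ℝ) / n)
      have h5 : (q : ℝ) / n * (n / q * z ^ 3) = z ^ 3 := by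
        field_simp
      linarith
    have h4 : 4 / z = 2 * (1 / z) + 2 * (1 / z) := by ring
    linarith

end Scaled

end Rumor

end

noncomputable section

namespace Rumor

variable {n : ℕ}

/-! ### Concentration on sparse random graphs -/

section Scaled

variable {c η D κ z C : ℝ} {G : SimpleGraph (Fin n)} {q : I}

/-- The constant in front of the error term. -/
def errorConst (q : I) (c η D C : ℝ) : ℝ :=
  (C + 13 * (D / η) + 16 / η + excess c η D / 4 + 17) / q + 1

/-- Both tails leave a window of width `O(n * z ^ 3 / q)` for the number of steps, and the mean is
in it up to `O(z ^ 3)`. Below, the failure probability `4 / z` costs a fraction of `j₁ / n ≤ 2 * z ^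
4 / q`; above, the worst mean `O(z ^ 4)` is multiplied by `5 * exp (-z ^ 3) ≤ 5 / z`. -/
theorem GoodGraph.law_not_close_le (hz : 1 ≤ z)
    (ha : Admissible n c η D (1 / z) κ (Real.exp (-z ^ 3)) (z ^ 4))
    (h : GoodGraph c η D (1 / z) κ (z ^ 4) G) (hq : 0 < q) (hR : 2 * (1 + D / η) ≤ n)
    (hC : 0 ≤ C) (hn : (C + 3 * (D / η) + 16 / η + 7) * z ^ 4 ≤ q * (n - 1)) {s : Fin n}
    (hup : ∃ j₂ : ℕ, (j₂ : ℝ) ≤ touchTime q G +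
        n / q * (z ^ 4 / 2 + (C + 3 * (D / η) + 16 / η + 4) * z ^ 3) ∧
      (chainOp (contactWeight q G))^[j₂] uninformed {s} ≤ 5 * Real.exp (-z ^ 3))
    (hlow : ∃ j₁ : ℕ, touchTime q G +
        (n : ℝ) / q * (z ^ 4 / 2 - (excess c η D / 4 + 5) * z ^ 3) ≤ j₁ ∧
      (j₁ : ℝ) ≤ n / q * (2 * z ^ 4) ∧
      1 - (chainOp (contactWeight q G))^[j₁] uninformed {s} ≤ 4 / z) :
    law q G {ω | ¬ Close q s (errorConst q c η D C * z ^ 3) G ω} ≤ ENNReal.ofReal (15 / z) := by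
  obtain ⟨j₂, hj₂, hu₂⟩ := hup
  obtain ⟨j₁, hj₁, hj₁', hu₁⟩ := hlow
  have hn0 := ha.n_pos
  have hq0 : (0 : ℝ) < q := hq
  have hq1 : (q : ℝ) ≤ 1 := q.2.2
  have hη := ha.η_pos
  have hD := ha.D_pos
  have hz0 : 0 < z := by linarith
  have hn1 : (1 : ℝ) ≤ n := by
    have := ha.eight_le
    exact_mod_cast (by omega : 1 ≤ n)
  have hnq : 1 ≤ (n : ℝ) / q := by
    rw [le_div_iff₀ hq0]
    linarith
  have hz31 : 1 ≤ z ^ 3 := one_le_pow₀ hz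
  have hz34 : z ^ 3 ≤ z ^ 4 := pow_le_pow_right₀ hz (by norm_num)
  have hz41 : 1 ≤ z ^ 4 := one_le_pow₀ hz
  have hconn := h.connected ha
  have hne := Finset.singleton_nonempty s
  set Cu := C + 3 * (D / η) + 16 / η + 4 with hCu
  set Cl := excess c η D / 4 + 5 with hCl
  have hCu0 : 0 ≤ Cu := by positivity
  set u₂ := (chainOp (contactWeight q G))^[j₂] uninformed {s} with hu₂'
  set u₁ := (chainOp (contactWeight q G))^[j₁] uninformed {s} with hu₁'
  set m := meanReal q G {s} with hm
  have hscale : ∀ x : ℝ, (n : ℝ) / q * x / n = x / q := fun x => by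
    field_simp
  have hdiff : (j₂ : ℝ) / n - j₁ / n ≤ (Cu + Cl) * z ^ 3 / q := by
    rw [← sub_div, ← hscale]
    gcongr
    have : (n : ℝ) / q * ((Cu + Cl) * z ^ 3) = n / q * (z ^ 4 / 2 + Cu * z ^ 3) -
        n / q * (z ^ 4 / 2 - Cl * z ^ 3) := by ring
    rw [this]
    linarith
  have hm_ge : (j₁ : ℝ) / n - 8 * z ^ 3 / q ≤ m := by
    have h1 := mul_le_meanReal hq hconn j₁ hne
    have h2 : (j₁ : ℝ) / n ≤ 2 * z ^ 4 / q := by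
      rw [← hscale]
      gcongr
    have h3 : (j₁ : ℝ) / n * (1 - u₁) ≤ 2 * z ^ 4 / q * (4 / z) := by
      calc _ ≤ (j₁ : ℝ) / n * (4 / z) := mul_le_mul_of_nonneg_left hu₁ (by positivity)
        _ ≤ _ := mul_le_mul_of_nonneg_right h2 (by positivity)
    have h4 : 2 * z ^ 4 / q * (4 / z) = 8 * z ^ 3 / q := by
      field_simp
      ring
    linarith
  have hm_le : m ≤ (j₂ : ℝ) / n + 10 * (D / η) * z ^ 3 / q := by
    have h1 := meanReal_le_add hq hconn (fun S hS => h.meanReal_le ha hq hS) j₂ hne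
    have h2 : D / (η * q) * (1 + z ^ 4) * u₂ ≤ D / (η * q) * (2 * z ^ 4) * (5 * (1 / z)) := by
      refine mul_le_mul (mul_le_mul_of_nonneg_left (by linarith) (by positivity))
        (hu₂.trans (mul_le_mul_of_nonneg_left (exp_neg_cube_le hz) (by norm_num))) ?_
        (by positivity)
      exact iterate_markovOp_nonneg (contactWeight_nonneg q G)
        (sum_contactWeight_le_one q G s.pos) uninformed_nonneg _ _
    have h3 : D / (η * q) * (2 * z ^ 4) * (5 * (1 / z)) = 10 * (D / η) * z ^ 3 / q := by
      field_simp
      ring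
    linarith
  have hb : errorConst q c η D C * z ^ 3 =
      (Cu + Cl) * z ^ 3 / q + 8 * z ^ 3 / q + 10 * (D / η) * z ^ 3 / q + z ^ 3 := by
    rw [errorConst, hCu, hCl]
    ring
  have h8 : 0 ≤ 8 * z ^ 3 / q := by positivity
  have h10 : 0 ≤ 10 * (D / η) * z ^ 3 / q := by positivity
  have hbig : ∀ j : ℕ, (j : ℝ) ≤ n / q * ((Cu + 3) * z ^ 4) → (j : ℝ) ≤ n * (n - 1) := by
    intro j hj
    refine hj.trans ?_
    rw [div_mul_eq_mul_div, div_le_iff₀ hq0]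
    have h1 : (Cu + 3) * z ^ 4 ≤ q * (n - 1) := by
      rw [hCu]
      linarith
    have := mul_le_mul_of_nonneg_left h1 hn0.le
    linarith
  have hnq4 : (1 : ℝ) ≤ n / q * z ^ 4 := by
    calc (1 : ℝ) = 1 * 1 := (one_mul 1).symm
      _ ≤ _ := mul_le_mul hnq hz41 zero_le_one (by positivity)
  refine (Rumor.law_not_close_le hq hconn (by have := ha.eight_le; omega) s (y := z ^ 3)
    (by positivity) (hbig j₁ ?_) (hbig j₂ ?_) (j₁ := j₁) (j₂ := j₂) (by linarith)
    (by linarith)).trans (ENNReal.ofReal_le_ofReal ?_)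
  · refine hj₁'.trans (mul_le_mul_of_nonneg_left ?_ (by positivity))
    refine mul_le_mul_of_nonneg_right ?_ (by positivity)
    linarith
  · have h1 := (h.missCount_touchTime_le ha hq hR).2
    have h2 : Cu * z ^ 3 ≤ Cu * z ^ 4 := mul_le_mul_of_nonneg_left hz34 hCu0
    have h3 := mul_le_mul_of_nonneg_left h2 (by positivity : 0 ≤ (n : ℝ) / q)
    linarith
  · have h1 := exp_neg_cube_le hz
    have h2 : Real.exp (1 - z ^ 3) ≤ 3 * (1 / z) := by
      rw [sub_eq_add_neg, Real.exp_add]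
      refine mul_le_mul ?_ h1 (Real.exp_pos _).le (by norm_num)
      linarith [Real.exp_one_lt_d9]
    have h3 : 15 / z = 15 * (1 / z) := by ring
    have h4 : 4 / z = 4 * (1 / z) := by ring
    rw [h3]
    linarith

end Scaled

/-- The length of the growth phase. -/
def growSteps (q : I) (n : ℕ) (η D z : ℝ) : ℕ :=
  ⌈(n : ℝ) / q * ((1 / 2 + 6 * (1 / z)) * (1 + z ^ 4) + 4 * D / η * (2 + 2 * z ^ 3))⌉₊

/-- The length of the phase in which almost all nodes are informed. -/
def fillSteps (q : I) (n : ℕ) (η D κ z : ℝ) : ℕ :=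
  ⌈(n : ℝ) / q * (4 * D / η * (2 + Real.log (1 / κ) + Real.log (2 / Real.exp (-z ^ 3))) + 2)⌉₊

/-- The constant in the length of the first two phases. -/
def phaseConst (c η D : ℝ) : ℝ := 17 + 4 * D / η * (14 + Real.log c)

/-- Only the growth phase contributes to the leading term `z ^ 4 / 2`. In the filling phase, `log (1
/ κ)` is of order `z` and `log (2 / κ')` of order `z ^ 3`, and the error `6 / z` in the growth rate
costs another `z ^ 3`. -/
theorem growSteps_add_fillSteps_le {q : I} (hq : 0 < q) {c η D κ z : ℝ} (hn : 0 < n) (hz : 1 ≤ z)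
    (hc : 1 ≤ c) (hη : 0 < η) (hD : 0 < D) (hκ : κ = Real.exp (-(6 * z)) / c) :
    (growSteps q n η D z + fillSteps q n η D κ z : ℝ) ≤
      n / q * (z ^ 4 / 2 + phaseConst c η D * z ^ 3) := by
  have hn1 : (1 : ℝ) ≤ n := by exact_mod_cast hn
  have hq0 : (0 : ℝ) < q := hq
  have hq1 : (q : ℝ) ≤ 1 := q.2.2
  have hz0 : 0 < z := by linarith
  have hnq : 1 ≤ (n : ℝ) / q := by
    rw [le_div_iff₀ hq0]
    linarith
  have hz31 : 1 ≤ z ^ 3 := one_le_pow₀ hz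
  have hz3 : z ≤ z ^ 3 := by
    have := pow_le_pow_right₀ hz (by norm_num : 1 ≤ 3)
    rwa [pow_one] at this
  have hnq3 : (1 : ℝ) ≤ n / q * z ^ 3 := by
    calc (1 : ℝ) = 1 * 1 := (one_mul 1).symm
      _ ≤ _ := mul_le_mul hnq hz31 zero_le_one (by positivity)
  have hlogc : 0 ≤ Real.log c := Real.log_nonneg hc
  have hlogκ : Real.log (1 / κ) = 6 * z + Real.log c := by
    rw [hκ, one_div, Real.log_inv, Real.log_div (Real.exp_pos _).ne' (by linarith), Real.log_exp]
    ring
  have hlogκ' : Real.log (2 / Real.exp (-z ^ 3)) = Real.log 2 + z ^ 3 := by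
    rw [Real.log_div two_ne_zero (Real.exp_pos _).ne', Real.log_exp]
    ring
  have hlog2 : Real.log 2 ≤ 1 := by linarith [Real.log_two_lt_d9]
  have hlog20 : 0 ≤ Real.log 2 := Real.log_nonneg one_le_two
  have hz1 : (0 : ℝ) ≤ 1 / z := by positivity
  have hz2 : 1 / z ≤ 1 := by
    rw [div_le_one hz0]
    exact hz
  have h1 : (growSteps q n η D z : ℝ) ≤
      n / q * (z ^ 4 / 2 + (13 + 16 * (D / η)) * z ^ 3) + 1 := by
    refine (Nat.ceil_lt_add_one (by positivity)).le.trans (add_le_add ?_ le_rfl)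
    refine mul_le_mul_of_nonneg_left ?_ (by positivity)
    have h2 : (1 / 2 + 6 * (1 / z)) * (1 + z ^ 4) = z ^ 4 / 2 + 1 / 2 + 6 * (1 / z) + 6 * z ^ 3 := by
      field_simp
      ring
    have h3 : 4 * D / η * (2 + 2 * z ^ 3) ≤ 16 * (D / η) * z ^ 3 := by
      have h4 : 4 * D / η * (2 + 2 * z ^ 3) = 4 * (D / η) * (2 + 2 * z ^ 3) := by ring
      rw [h4]
      have h5 := mul_le_mul_of_nonneg_left (by linarith : 2 + 2 * z ^ 3 ≤ 4 * z ^ 3)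
        (by positivity : 0 ≤ 4 * (D / η))
      linarith
    rw [h2]
    linarith
  have h2 : (fillSteps q n η D κ z : ℝ) ≤
      n / q * ((4 * D / η * (10 + Real.log c) + 2) * z ^ 3) + 1 := by
    unfold fillSteps
    rw [hlogκ, hlogκ']
    refine (Nat.ceil_lt_add_one (by positivity)).le.trans (add_le_add ?_ le_rfl)
    refine mul_le_mul_of_nonneg_left ?_ (by positivity)
    have h3 : 2 + (6 * z + Real.log c) + (Real.log 2 + z ^ 3) ≤ (10 + Real.log c) * z ^ 3 := by
      have := mul_le_mul_of_nonneg_left hz31 hlogc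
      linarith
    have h4 := mul_le_mul_of_nonneg_left h3 (by positivity : 0 ≤ 4 * D / η)
    linarith
  have h3 : (n : ℝ) / q * (z ^ 4 / 2 + phaseConst c η D * z ^ 3) =
      n / q * (z ^ 4 / 2 + (13 + 16 * (D / η)) * z ^ 3) +
      n / q * ((4 * D / η * (10 + Real.log c) + 2) * z ^ 3) + 2 * (n / q * z ^ 3) := by
    unfold phaseConst
    ring
  rw [h3]
  linarith

/-- Everything is expressed through `z`, with `n = exp (z ^ 4)`, so the conditions reduce to
comparing powers and exponentials of `z`. -/
theorem eventually_admissible {c η D : ℝ} (hc : 1 ≤ c) (hη : 0 < η) (hηD : η ≤ D) :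
    ∀ᶠ z : ℝ in atTop, ∀ n : ℕ, z ^ 4 = Real.log n →
      Admissible n c η D (1 / z) (Real.exp (-(6 * z)) / c) (Real.exp (-z ^ 3)) (z ^ 4) := by
  have hD : 0 < D := hη.trans_le hηD
  have hexp : ∀ᶠ z : ℝ in atTop, z ^ 4 * Real.exp (-z) ≤ η / (8 * D) :=
    (Real.tendsto_pow_mul_exp_neg_atTop_nhds_zero 4).eventually_le_const (by positivity)
  filter_upwards [eventually_ge_atTop 12, eventually_ge_atTop (8 * c / η),
    eventually_ge_atTop (4 / η), eventually_ge_atTop (6 + Real.log c), hexp]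
    with z hz12 hzc hzη hzlog hzexp n hL
  have hz : 1 ≤ z := by linarith
  have hz0 : 0 < z := by linarith
  have hz4 : z ≤ z ^ 4 := by
    have := pow_le_pow_right₀ hz (by norm_num : 1 ≤ 4)
    rwa [pow_one] at this
  have hz3 : z ≤ z ^ 3 := by
    have := pow_le_pow_right₀ hz (by norm_num : 1 ≤ 3)
    rwa [pow_one] at this
  have hn0 : (0 : ℝ) < n := by
    rcases Nat.eq_zero_or_pos n with h0 | h0
    · rw [h0] at hL
      simp at hL
      linarith
    · exact_mod_cast h0
  have hn : (n : ℝ) = Real.exp (z ^ 4) := by rw [hL, Real.exp_log hn0]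
  have hlogc : 0 ≤ Real.log c := Real.log_nonneg hc
  refine ⟨hL, ?_, hc, hη, hηD, by positivity, ?_, ?_, ?_, ?_, ?_, Real.exp_pos _, ?_, ?_⟩
  · have h1 := Real.add_one_le_exp (z ^ 4)
    have : (8 : ℝ) ≤ n := by linarith
    exact_mod_cast this
  · rw [mul_one_div, div_le_one hz0]
    exact hz12
  · rw [mul_one_div, div_le_iff₀ hz0]
    rw [div_le_iff₀ hη] at hzc
    linarith
  · rw [div_le_iff₀ hη] at hzη
    have := mul_le_mul_of_nonneg_left hz4 hη.le
    linarith
  · have h1 : 1 / z * z ^ 4 = z ^ 3 := by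
      field_simp
    rw [h1]
    linarith
  · rw [Real.exp_neg, div_le_iff₀ (by linarith), inv_le_comm₀ (Real.exp_pos _) (by positivity)]
    have h1 := Real.add_one_le_exp (6 * z)
    have h2 : (1 / 8 * c)⁻¹ ≤ 8 := by
      rw [inv_le_comm₀ (by positivity) (by norm_num)]
      linarith
    linarith
  · rw [le_div_iff₀ (by linarith)]
    nth_rewrite 1 [← Real.exp_log (by linarith : 0 < c)]
    rw [← Real.exp_add, Real.exp_le_exp]
    have h1 : (6 + Real.log c) * z ≤ z ^ 3 := by
      calc _ ≤ z * z := mul_le_mul_of_nonneg_right hzlog hz0.le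
        _ = z ^ 2 := by ring
        _ ≤ _ := pow_le_pow_right₀ hz (by norm_num)
    have h2 : Real.log c ≤ Real.log c * z := le_mul_of_one_le_right hlogc hz
    linarith
  · rw [hn, ← Real.exp_add]
    have h1 : Real.exp z ≤ Real.exp (-z ^ 3 + z ^ 4) := by
      rw [Real.exp_le_exp]
      have h2 : z ^ 4 = z * z ^ 3 := by ring
      have h3 := mul_le_mul_of_nonneg_right hz12 (by positivity : 0 ≤ z ^ 3)
      rw [h2]
      linarith
    have h2 : 4 * z ^ 4 ≤ η / (2 * D) * Real.exp z := by
      rw [Real.exp_neg, mul_inv_le_iff₀ (Real.exp_pos _)] at hzexp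
      have h3 : η / (2 * D) = 4 * (η / (8 * D)) := by
        field_simp
        ring
      rw [h3]
      linarith
    exact h2.trans (mul_le_mul_of_nonneg_left h1 (by positivity))

end Rumor

end

/-! ### Typicality of sparse random graphs and assembly of the sparse case. -/

noncomputable section

namespace Rumor

variable {n : ℕ}

theorem exp_neg_cube_le' {z : ℝ} (hz : 1 ≤ z) : Real.exp (-z ^ 3) ≤ 1 / z ^ 2 := by
  rw [Real.exp_neg, ← one_div]
  refine one_div_le_one_div_of_le (by positivity) ?_
  have h1 := Real.add_one_le_exp (z ^ 3)
  have h2 : z ^ 2 ≤ z ^ 3 := pow_le_pow_right₀ hz (by norm_num)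
  linarith

theorem exp_neg_four_le {z : ℝ} (hz : 1 ≤ z) : Real.exp (-z ^ 4) ≤ 1 / z := by
  refine le_trans (Real.exp_le_exp.2 (neg_le_neg ?_)) (exp_neg_cube_le hz)
  exact pow_le_pow_right₀ hz (by norm_num)

theorem measureReal_not_and_le {Ω : Type*} [MeasurableSpace Ω] (μ : Measure Ω)
    [IsFiniteMeasure μ] (P Q : Ω → Prop) :
    μ.real {x | ¬ (P x ∧ Q x)} ≤ μ.real {x | ¬ P x} + μ.real {x | P x ∧ ¬ Q x} := by
  refine (measureReal_mono fun x hx => ?_).trans (measureReal_union_le _ _)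
  by_cases hP : P x
  · exact Or.inr ⟨hP, fun hQ => hx ⟨hP, hQ⟩⟩
  · exact Or.inl hP

/-- Sparse random graphs are typical. -/
theorem eventually_binomialRandom_not_goodGraph_le {c : ℝ} (hc : 1 < c) : ∃ η : ℝ, 0 < η ∧ η ≤ 1 ∧
    ∀ᶠ z : ℝ in atTop, ∀ (n : ℕ) (p : I), z ^ 4 = Real.log n → (p : ℝ) = c * Real.log n / n →
      (SimpleGraph.binomialRandom (Fin n) p).real {G | ¬ GoodGraph c η (2 * c + 2) (1 / z)
        (Real.exp (-(6 * z)) / c) (z ^ 4) G} ≤ 8 / z := by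
  obtain ⟨η₀, a, b, hη₀, ha, hb, hcut⟩ := exists_binomialRandom_cut_lt_le hc
  refine ⟨min η₀ 1, lt_min hη₀ one_pos, min_le_right _ _, ?_⟩
  filter_upwards [eventually_ge_atTop 320, eventually_ge_atTop (1 / a),
    eventually_ge_atTop (4 / b)] with z hz320 hza hzb n p hL hp
  have hz : 1 ≤ z := by linarith
  have hz0 : 0 < z := by linarith
  have hz4 : z ≤ z ^ 4 := by
    have := pow_le_pow_right₀ hz (by norm_num : 1 ≤ 4)
    rwa [pow_one] at this
  have hz34 : z ^ 3 ≤ z ^ 4 := pow_le_pow_right₀ hz (by norm_num)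
  have hz2 : z ≤ z ^ 2 := by
    have := pow_le_pow_right₀ hz (by norm_num : 1 ≤ 2)
    rwa [pow_one] at this
  have hn0' : 0 < n := by
    rcases Nat.eq_zero_or_pos n with h0 | h0
    · rw [h0] at hL
      simp at hL
      linarith
    · exact h0
  have hn0 : (0 : ℝ) < n := by exact_mod_cast hn0'
  have hn : (n : ℝ) = Real.exp (z ^ 4) := by rw [hL, Real.exp_log hn0]
  have hnz : z ^ 4 + 1 ≤ n := by
    rw [hn]
    exact Real.add_one_le_exp _
  have hn1 : 1 < n := by
    have : (1 : ℝ) < n := by linarith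
    exact_mod_cast this
  have hinv : 1 / (n : ℝ) ≤ 1 / z := one_div_le_one_div_of_le hz0 (by linarith)
  have hc0 : 0 < c := by linarith
  have hdg := binomialRandom_dg_gt_le (p := p) hn0' hc0.le hp
  have hcut' := hcut n p hn0' hp (by
    rw [← hL]
    rw [div_le_iff₀ hb] at hzb
    have := mul_le_mul_of_nonneg_left hz4 hb.le
    linarith)
  have hself := binomialRandom_cut_self_gt_le (p := p) (δ := 1 / z)
    (κ := Real.exp (-(6 * z)) / c) hn0' hc0 hp (by positivity) (by
      congr 3
      field_simp)
  -- Large enough for `m * (c * z ^ 2 / 64) ≥ 2 * z ^ 4`, twice `log n`, and small enough for `2 *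
  -- (m + 1) ≤ z ^ 3`, which is where `z ≥ 320` is used.
  set m := ⌈128 * z ^ 2⌉₊ with hm
  have hm1 : 128 * z ^ 2 ≤ m := Nat.le_ceil _
  have hm2 : (m : ℝ) ≤ 128 * z ^ 2 + 1 := (Nat.ceil_lt_add_one (by positivity)).le
  have hz22 : 2 * ((m : ℝ) + 1) ≤ z ^ 3 := by
    have h1 : z ^ 3 = z * z ^ 2 := by ring
    have h2 := mul_le_mul_of_nonneg_right hz320 (by positivity : 0 ≤ z ^ 2)
    have h3 : 1 ≤ z ^ 2 := hz.trans hz2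
    linarith
  have hx : c * Real.log n * (1 / z) ^ 2 / 64 = c * z ^ 2 / 64 := by
    rw [← hL]
    field_simp
  have hbad := binomialRandom_cut_badNodes_gt_le (p := p) (δ := 1 / z) (m := m) hn1 hc0 hp
    (by positivity) (by
      rw [div_le_one hz0]
      exact hz) (by
      have h1 : 1 / z * (c * Real.log n) = c * z ^ 3 := by
        rw [← hL]
        field_simp
      rw [h1]
      have := le_mul_of_one_le_left (by positivity : 0 ≤ z ^ 3) hc.le
      linarith) (by
      have h1 : z ^ 3 ≤ 1 / z * n := by
        rw [one_div_mul_eq_div, le_div_iff₀ hz0]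
        have : z ^ 3 * z = z ^ 4 := by ring
        linarith
      linarith) (by
      rw [hx, ← hL, Real.log_mul (by linarith) (by positivity), Real.log_pow]
      have h1 := Real.log_le_sub_one_of_pos hc0
      have h2 := Real.log_le_sub_one_of_pos hz0
      have h3 : 320 * (c * z) ≤ c * z ^ 2 := by
        have := mul_le_mul_of_nonneg_right hz320 (by positivity : 0 ≤ c * z)
        have h4 : z * (c * z) = c * z ^ 2 := by ring
        linarith
      have h4 : z ≤ c * z := le_mul_of_one_le_left hz0.le hc.le
      have h5 : c ≤ c * z := le_mul_of_one_le_right hc0.le hz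
      push_cast
      linarith)
  rw [hx] at hbad
  rw [← hL] at hdg hcut' hself hbad
  have hbad' : 2 * Real.exp (z ^ 4 - m * (c * z ^ 2 / 64)) ≤ 2 / z := by
    have h1 : Real.exp (z ^ 4 - m * (c * z ^ 2 / 64)) ≤ Real.exp (-z ^ 4) := by
      rw [Real.exp_le_exp]
      have h2 : 2 * z ^ 4 ≤ m * (c * z ^ 2 / 64) := by
        calc 2 * z ^ 4 = 128 * z ^ 2 * (1 * z ^ 2 / 64) := by ring
          _ ≤ _ := by gcongr
      linarith
    have h2 := h1.trans (exp_neg_four_le hz)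
    have h3 : 2 / z = 2 * (1 / z) := by ring
    linarith
  have hexpn : Real.exp (-(n : ℝ)) ≤ 1 / z := by
    refine le_trans (Real.exp_le_exp.2 (neg_le_neg ?_)) (exp_neg_four_le hz)
    linarith
  have hexpa : Real.exp (-(a * z ^ 4)) ≤ 1 / z := by
    refine le_trans (Real.exp_le_exp.2 (neg_le_neg ?_)) (exp_neg_cube_le hz)
    rw [div_le_iff₀ ha] at hza
    have h1 : a * z ^ 4 = z * a * z ^ 3 := by ring
    rw [h1]
    exact le_mul_of_one_le_left (by positivity) hza
  have hsub : {G : SimpleGraph (Fin n) | ¬ GoodGraph c (min η₀ 1) (2 * c + 2) (1 / z)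
      (Real.exp (-(6 * z)) / c) (z ^ 4) G} ⊆
      (({G | ¬ ∀ u, dg G u ≤ (2 * c + 2) * z ^ 4} ∪ {G | ¬ ∀ S : Finset (Fin n), S.Nonempty →
        2 * S.card ≤ n → η₀ * z ^ 4 * S.card ≤ cut G S Sᶜ}) ∪
      {G | ¬ ∀ u, cut G {u} (badNodes (c * z ^ 4) (1 / z * (c * z ^ 4)) G) ≤
        1 / z * (c * z ^ 4)}) ∪ {G | ¬ ∀ S : Finset (Fin n),
      (S.card : ℝ) ≤ Real.exp (-(6 * z)) / c * n → cut G S S ≤ 1 / z * z ^ 4 * S.card} := by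
    intro G hG
    by_contra hcon
    have h1 := not_not.1 fun h => hcon (Or.inl (Or.inl (Or.inl h)))
    have h2 := not_not.1 fun h => hcon (Or.inl (Or.inl (Or.inr h)))
    have h3 := not_not.1 fun h => hcon (Or.inl (Or.inr h))
    have h4 := not_not.1 fun h => hcon (Or.inr h)
    exact hG ⟨h1, fun S hS hS' => le_trans (mul_le_mul_of_nonneg_right
      (mul_le_mul_of_nonneg_right (min_le_left _ _) (by positivity)) (Nat.cast_nonneg _))
      (h2 S hS hS'), h3, h4⟩
  refine (measureReal_mono hsub).trans ((measureReal_union_le _ _).trans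
    ((add_le_add ((measureReal_union_le _ _).trans (add_le_add ((measureReal_union_le _ _).trans
      (add_le_add hdg hcut')) hbad)) hself).trans ?_))
  have h2 : 2 / (n : ℝ) = 2 * (1 / n) := by ring
  have h3 : 8 / z = 8 * (1 / z) := by ring
  have h4 : 2 / z = 2 * (1 / z) := by ring
  rw [h2, h3]
  linarith

/-- A graph counts as good for `s` if it has the typical properties, leaves few neighbours of any
node uninformed, and does not give `s` an unusually large `relMass`. Each condition fails with
probability `O(1 / z)`, and so does the protocol on such a graph. -/
theorem eventually_failProb_sparse_le {q : I} (hq : 0 < q) {c : ℝ} (hc : 1 < c) :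
    ∃ C K : ℝ, 0 ≤ K ∧ ∀ᶠ z : ℝ in atTop, ∀ (n : ℕ) (p : I), z ^ 4 = Real.log n →
      (p : ℝ) = c * Real.log n / n → failProb n p q (C * z ^ 3) ≤ ENNReal.ofReal (K / z) := by
  obtain ⟨η, hη, hη1, hgood⟩ := eventually_binomialRandom_not_goodGraph_le hc
  set D : ℝ := 2 * c + 2 with hD
  have hq0 : (0 : ℝ) < q := hq
  have hD4 : 4 ≤ D := by
    rw [hD]
    linarith
  have hD0 : 0 < D := by linarith
  have hlogc : 0 ≤ Real.log c := Real.log_nonneg hc.le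
  set C := phaseConst c η D with hC
  have hC0 : 0 ≤ C := by
    rw [hC, phaseConst]
    positivity
  have hc0 : 0 < c := by linarith
  have hE0 : 0 ≤ excess c η D := by
    unfold excess
    positivity
  refine ⟨errorConst q c η D C, 8 + 1 + (2 + D / η) + 15, by positivity, ?_⟩
  filter_upwards [hgood, eventually_admissible hc.le hη (hη1.trans (by linarith : 1 ≤ D)),
    eventually_ge_atTop 2, eventually_ge_atTop (2 * (1 + D / η)), eventually_ge_atTop (6 + c),
    eventually_ge_atTop (2 * (1 + D / η) * (7 + Real.log D + 8 / η)),
    eventually_ge_atTop (2 * (C + 3 * (D / η) + 16 / η + 7) / q)]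
    with z hgood hadm hz2 hzR hzc hzlog hzn n p hL hp
  have ha := hadm n hL
  have hz : 1 ≤ z := by linarith
  have hz0 : 0 < z := by linarith
  have hz4 : z ≤ z ^ 4 := by
    have := pow_le_pow_right₀ hz (by norm_num : 1 ≤ 4)
    rwa [pow_one] at this
  have hn0 := ha.n_pos
  have hn0' : 0 < n := by exact_mod_cast hn0
  have hn : (n : ℝ) = Real.exp (z ^ 4) := by rw [hL, Real.exp_log hn0]
  have hnz : z ^ 4 + 1 ≤ n := by
    rw [hn]
    exact Real.add_one_le_exp _
  set κ := Real.exp (-(6 * z)) / c with hκ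
  set M := ⌈z⌉₊ with hM
  have hM2 : (M : ℝ) ≤ z + 1 := (Nat.ceil_lt_add_one hz0.le).le
  have hMn : 2 * M ≤ n := by
    have h1 : 8 * z ≤ z ^ 4 := by
      have h2 : (2 : ℝ) ^ 3 ≤ z ^ 3 := pow_le_pow_left₀ (by norm_num) hz2 3
      have h3 : z ^ 4 = z ^ 3 * z := by ring
      rw [h3]
      exact mul_le_mul_of_nonneg_right (by linarith) hz0.le
    have : (2 : ℝ) * M ≤ n := by linarith
    exact_mod_cast this
  have hR : 2 * (1 + D / η) ≤ n := by linarith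
  set j := growSteps q n η D z with hj
  set j' := fillSteps q n η D κ z with hj'
  set b := ⌈(n : ℝ) / q * z ^ 3⌉₊ with hb
  have hz34 : z ^ 3 ≤ z ^ 4 := pow_le_pow_right₀ hz (by norm_num)
  have hkpos : 0 ≤ (n : ℝ) / q * ((z ^ 4 - z ^ 3) / (2 + excess c η D * (1 / z))) := by
    have : 0 ≤ z ^ 4 - z ^ 3 := by linarith
    positivity
  -- Growth at rate `(q / n) * (2 + excess / z)` for this many steps multiplies the mass by at most
  -- `exp (z ^ 4 - z ^ 3)`, which is smaller than `n` by the factor `exp (-z ^ 3)`.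
  set k := ⌊(n : ℝ) / q * ((z ^ 4 - z ^ 3) / (2 + excess c η D * (1 / z)))⌋₊ with hk
  have hk1 := Nat.floor_le hkpos
  have hk2 := (Nat.lt_floor_add_one
    ((n : ℝ) / q * ((z ^ 4 - z ^ 3) / (2 + excess c η D * (1 / z))))).le
  rw [← hk] at hk1 hk2
  set Out : SimpleGraph (Fin n) → Prop := fun G => ∀ w, ∀ S : Finset (Fin n), S.card = M →
    leftOut q w (j + j') (Real.exp (-z ^ 3) * n) (1 / z * z ^ 4) S G ≤ Real.exp (-(2 * z ^ 4))
    with hOut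
  have hOutP : (SimpleGraph.binomialRandom (Fin n) p).real {G | ¬ Out G} ≤ 1 / z := by
    refine (binomialRandom_leftOut_gt_le p q (j + j') M (l := z ^ 3) (by positivity)
      (Real.exp_pos _)).trans ?_
    -- With `l = z ^ 3` the factor `exp l` cancels the fraction `exp (-z ^ 3)` of uninformed nodes,
    -- so the moment costs only `exp (c * z ^ 4)`. The gain `exp (-l * y) = exp (-z ^ 6)` beats
    -- this, the choices of `w` and of `⌈z⌉₊` starting nodes, and the required precision.
    have h1 : Real.exp (-z ^ 3) * n * p * Real.exp (z ^ 3) = c * z ^ 4 := by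
      have h2 : (n : ℝ) * p = c * z ^ 4 := by
        rw [hp, ← hL]
        field_simp
      have h3 : Real.exp (-z ^ 3) * Real.exp (z ^ 3) = 1 := by
        rw [← Real.exp_add, neg_add_cancel, Real.exp_zero]
      calc _ = (n : ℝ) * p * (Real.exp (-z ^ 3) * Real.exp (z ^ 3)) := by ring
        _ = _ := by rw [h2, h3, mul_one]
    have h2 : z ^ 3 * (1 / z * z ^ 4) = z ^ 2 * z ^ 4 := by
      field_simp
    have h3 : (n : ℝ) ^ M = Real.exp (M * z ^ 4) := by rw [hn, ← Real.exp_nat_mul]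
    have h4 : 1 / Real.exp (-(2 * z ^ 4)) = Real.exp (2 * z ^ 4) := by
      rw [Real.exp_neg, one_div, inv_inv]
    rw [h1, h2, h3, h4]
    nth_rewrite 1 [hn]
    rw [← Real.exp_add, ← Real.exp_add, ← Real.exp_add]
    refine le_trans (Real.exp_le_exp.2 ?_) (exp_neg_four_le hz)
    have h5 : 5 + z + c ≤ z ^ 2 := by
      have h6 := mul_le_mul_of_nonneg_right hzc hz0.le
      have h7 : 5 + c ≤ (5 + c) * z := le_mul_of_one_le_right (by linarith) hz
      have h8 : z * z = z ^ 2 := by ring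
      linarith
    have h6 : (4 + (M : ℝ) + c) * z ^ 4 ≤ z ^ 2 * z ^ 4 :=
      mul_le_mul_of_nonneg_right (by linarith) (by positivity)
    linarith
  refine (failProb_le (ε := 8 / z + (1 / z + (2 + D / η) / z)) (ε' := 15 / z) (by positivity)
    (by positivity) fun s => ?_).trans (ENNReal.ofReal_le_ofReal (le_of_eq (by ring)))
  refine ⟨fun G => GoodGraph c η D (1 / z) κ (z ^ 4) G ∧ (Out G ∧ relMass G q k b s < 1 / z),
    ?_, ?_⟩
  · refine (measureReal_not_and_le _ _ _).trans (add_le_add (hgood n p hL hp) ?_)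
    -- The sum of `relMass` over all nodes is at most `n * (2 + D / η) * exp (-z ^ 3)`. Hence for
    -- the prescribed `s` it reaches `1 / z` only with probability at most `(2 + D / η) * z * exp
    -- (-z ^ 3)`.
    have htyp := binomialRandom_typical_node p (F := fun G u => relMass G q k b u)
      (fun τ G u => relMass_map τ G q k b u) (x := 1 / z) (y := (2 + D / η) * Real.exp (-z ^ 3))
      (by positivity) (by positivity) s
    refine (measureReal_mono (s₂ := {G | ¬ Out G} ∪ _) fun G hG => ?_).trans
      ((measureReal_union_le _ _).trans (add_le_add hOutP (htyp.trans ?_)))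
    · by_cases hO : Out G
      · refine Or.inr ⟨fun u => hG.1.relMass_nonneg ha hR k b u, ?_, ?_⟩
        · refine (hG.1.sum_relMass_le ha hR k b).trans ?_
          rw [mul_left_comm, hn, ← Real.exp_add]
          refine mul_le_mul_of_nonneg_left (Real.exp_le_exp.2 ?_) (by positivity)
          rw [← hn]
          have h1 : 0 < 2 + excess c η D * (1 / z) := by positivity
          have h2 := mul_le_mul_of_nonneg_left hk1
            (by positivity : 0 ≤ (q : ℝ) / n * (2 + excess c η D * (1 / z)))
          have h3 : (q : ℝ) / n * (2 + excess c η D * (1 / z)) *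
              (n / q * ((z ^ 4 - z ^ 3) / (2 + excess c η D * (1 / z)))) = z ^ 4 - z ^ 3 := by
            generalize 2 + excess c η D * (1 / z) = x at h1
            field_simp
          linarith
        · by_contra! hcon
          exact hG.2 ⟨hO, hcon⟩
      · exact Or.inl hO
    · rw [div_le_div_iff₀ (by positivity) hz0]
      have h1 := exp_neg_cube_le' hz
      have h2 : (2 + D / η) * Real.exp (-z ^ 3) * z ≤ (2 + D / η) * (1 / z ^ 2) * z := by gcongr
      refine h2.trans (le_of_eq ?_)
      field_simp
  · rintro G ⟨hG, hO, hs⟩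
    refine hG.law_not_close_le hz ha hq hR hC0 ?_ ?_ ?_
    · have h1 := Real.quadratic_le_exp_of_nonneg (by positivity : 0 ≤ z ^ 4)
      rw [div_le_iff₀ hq0] at hzn
      have h2 : (C + 3 * (D / η) + 16 / η + 7) * z ^ 4 ≤ q * ((z ^ 4) ^ 2 / 2) := by
        have h3 : C + 3 * (D / η) + 16 / η + 7 ≤ q * z ^ 4 / 2 := by
          have := mul_le_mul_of_nonneg_right hz4 hq0.le
          linarith
        have h4 := mul_le_mul_of_nonneg_right h3 (by positivity : 0 ≤ z ^ 4)
        linarith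
      refine h2.trans (mul_le_mul_of_nonneg_left ?_ hq0.le)
      rw [hn]
      have : 0 ≤ z ^ 4 := by positivity
      linarith
    · exact hG.exists_upper hz ha hq hR hMn (Nat.le_ceil _) (Nat.le_ceil _)
        (growSteps_add_fillSteps_le hq hn0' hz hc.le hη hD0 hκ) hO s
    · refine hG.exists_lower hz ha hq hR (Nat.le_ceil _)
        (Nat.ceil_lt_add_one (by positivity)).le hk2 hk1 ?_ ?_ s hs.le
      · rw [Real.log_mul (by positivity) (Real.exp_pos _).ne', Real.log_exp,
          Real.log_mul hD0.ne' (by positivity), Real.log_pow]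
        have h1 := Real.log_le_sub_one_of_pos hz0
        have hz3 : z ≤ z ^ 3 := by
          have := pow_le_pow_right₀ hz (by norm_num : 1 ≤ 3)
          rwa [pow_one] at this
        have hz31 : 1 ≤ z ^ 3 := hz.trans hz3
        have hlogD : 0 ≤ Real.log D := Real.log_nonneg (by linarith)
        have h2 : Real.log D + 8 / η ≤ (Real.log D + 8 / η) * z ^ 3 :=
          le_mul_of_one_le_right (by positivity) hz31
        rw [le_div_iff₀ (by positivity)]
        have h3 := mul_le_mul_of_nonneg_right hzlog (by positivity : 0 ≤ z ^ 3)
        have h4 : z * z ^ 3 = z ^ 4 := by ring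
        rw [h4] at h3
        refine le_trans ?_ h3
        have h5 : z ^ 3 + 2 + (Real.log D + (4 : ℕ) * Real.log z + 8 / η) ≤
            (7 + Real.log D + 8 / η) * z ^ 3 := by
          push_cast
          linarith
        have h6 := mul_le_mul_of_nonneg_right h5 (by positivity : 0 ≤ 2 * (1 + D / η))
        linarith
      · have h1 : 1 ≤ z ^ 4 := one_le_pow₀ hz
        have h2 : 1 ≤ D * z ^ 4 := by
          calc (1 : ℝ) = 1 * 1 := (one_mul 1).symm
            _ ≤ _ := mul_le_mul (by linarith) h1 zero_le_one hD0.le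
        calc (1 : ℝ) = 1 * 1 := (one_mul 1).symm
          _ ≤ _ := mul_le_mul h2 (Real.one_le_exp (by positivity)) zero_le_one (by positivity)

/-- The spreading time on sparse random graphs. -/
theorem failProb_sparse {q : I} (hq : 0 < q) {c : ℝ} (hc : 1 < c) {p : ℕ → I}
    (hp : ∀ᶠ n : ℕ in atTop, (p n : ℝ) = c * Real.log n / n) :
    ∃ C : ℝ, Tendsto (fun n : ℕ => failProb n (p n) q (C * Real.log n ^ (3 / 4 : ℝ)))
      atTop (𝓝 0) := by
  obtain ⟨C, K, hK, h⟩ := eventually_failProb_sparse_le hq hc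
  refine ⟨C, ?_⟩
  have hlog : Tendsto (fun n : ℕ => Real.log n) atTop atTop :=
    Real.tendsto_log_atTop.comp tendsto_natCast_atTop_atTop
  have hz : Tendsto (fun n : ℕ => Real.log n ^ (1 / 4 : ℝ)) atTop atTop :=
    (tendsto_rpow_atTop (by norm_num)).comp hlog
  have hlim : Tendsto (fun n : ℕ => ENNReal.ofReal (K / Real.log n ^ (1 / 4 : ℝ))) atTop (𝓝 0) := by
    rw [← ENNReal.ofReal_zero]
    exact ENNReal.tendsto_ofReal (hz.const_div_atTop K)
  refine tendsto_of_tendsto_of_tendsto_of_le_of_le' tendsto_const_nhds hlim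
    (Eventually.of_forall fun n => zero_le) ?_
  filter_upwards [hp, hz.eventually h, hlog.eventually_ge_atTop 0] with n hpn hn hlogn
  have h1 : (Real.log n ^ (1 / 4 : ℝ)) ^ 4 = Real.log n := by
    rw [← Real.rpow_natCast, ← Real.rpow_mul hlogn]
    norm_num
  have h2 : (Real.log n ^ (1 / 4 : ℝ)) ^ 3 = Real.log n ^ (3 / 4 : ℝ) := by
    rw [← Real.rpow_natCast, ← Real.rpow_mul hlogn]
    norm_num
  have h3 := hn n (p n) h1 hpn
  rwa [h2] at h3

end Rumor

end

/-! ### The three statements put together. -/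

theorem proposition3 (q : I) (hq : 0 < q) :
    (∀ (n : ℕ) (G : SimpleGraph (Fin n)) (s : Fin n), G.Connected →
      Measurable (Rumor.spreadTime s) ∧ Rumor.meanTime 1 G s ≠ ⊤ ∧
      Rumor.meanTime q G s = Rumor.meanTime 1 G s / ENNReal.ofReal q) ∧
    (∀ (α : ℕ → ℝ) (p : ℕ → I), Tendsto α atTop atTop →
      (∀ᶠ n : ℕ in atTop, (p n : ℝ) = α n * Real.log n / n) →
      (∃ K : ℝ, ∀ ε : ℝ≥0∞, 0 < ε → ∃ C : ℝ, ∀ᶠ n : ℕ in atTop,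
        Rumor.failProb n (p n) q (K * (α n ^ (-(1 / 2) : ℝ) * Real.log n) + C) ≤ ε) ∧
      (Tendsto (fun n : ℕ => α n ^ (-(1 / 2) : ℝ) * Real.log n) atTop atTop →
        ∃ C : ℝ, Tendsto (fun n : ℕ =>
          Rumor.failProb n (p n) q (C * (α n ^ (-(1 / 2) : ℝ) * Real.log n + 1)))
          atTop (𝓝 0))) ∧
    (∀ (c : ℝ) (p : ℕ → I), 1 < c →
      (∀ᶠ n : ℕ in atTop, (p n : ℝ) = c * Real.log n / n) →
      ∃ C : ℝ, Tendsto (fun n : ℕ =>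
        Rumor.failProb n (p n) q (C * Real.log n ^ (3 / 4 : ℝ))) atTop (𝓝 0)) := by
  refine ⟨fun n G s hG => ?_, fun α p hα hp => Rumor.failProb_dense hq hα hp, ?_⟩
  · have hs := Finset.singleton_nonempty s
    rw [Rumor.meanTime_eq_meanFrom, Rumor.meanTime_eq_meanFrom, Rumor.spreadTime_eq_spreadFrom]
    exact ⟨Rumor.measurable_spreadFrom _, Rumor.meanFrom_ne_top one_pos hG hs,
      Rumor.meanFrom_eq_div hq hG hs⟩
  · exact fun c p hc hp => Rumor.failProb_sparse hq hc hp
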